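/- **Setting.** Let $\mathbb H$ be a real Hilbert space, $A$ a bounded self-adjoint operator on $\mathbb H$, $\mathbb H=\mathbb U\oplus\mathbb V$ an orthogonal splitting with $\dim\mathbb U<\infty$ (orthogonal projectors $P_{\mathbb U},P_{\mathbb V}$, blocks $A_{11},A_{12},A_{21},A_{22}$ of $A$), and $Q:\mathbb H\times\mathbb H\to\mathbb V$ a continuous symmetric bilinear map; put $L_aU=2Q(a,U)$ and $q(u,v)=P_{\mathbb V}Q(u+v,u+v)$ for $u\in\mathbb U$, $v\in\mathbb V$. Let $\underline U\in\mathbb H$ be an equilibrium, $Q(\underline U,\underline U)=0$, such that $\underline L=L_{\underline U}$ is self-adjoint with kernel $\mathbb U$ and $\langle\underline Lv,v\rangle\le -c\|v\|^2$ on $\mathbb V$ for some $c>0$, and suppose that there are a bounded skew-symmetric operator $K$ and $\gamma>0$ with $\mathrm{Re}(KA-\underline L)\ge\gamma\,\mathrm{Id}$. Let $u_0=P_{\mathbb U}\underline U$. Let $v_*$ be the smooth map from a neighborhood of $u_0$ in $\mathbb U$ to $\mathbb V$ given by the implicit function theorem, with $v_*(u_0)=P_{\mathbb V}\underline U$ and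 $q(u,v_*(u))=0$. Set $$h_*(u)=A_{11}u+A_{12}v_*(u),\qquad b_*(u)=-A_{12}c_*(u),$$ $$c_*(u)=\partial_vq(u,v_*(u))^{-1}\big(A_{21}+A_{22}dv_*(u)-dv_*(u)(A_{11}+A_{12}dv_*(u))\big).$$ Assume that for all $u$ in a neighborhood of $u_0$: (i) there is a symmetric positive definite $s(u)$ such that $s\,dh_*$ is symmetric and $s\,b_*$ is symmetric positive semidefinite; (ii) no eigenvector of $dh_*(u)$ lies in $\ker b_*(u)$; (iii) the left kernel of $b_*(u)$ does not depend on $u$; (iv) $\ker(\pi_*(u)\,dh_*(u))\cap\ker b_*(u)=\{0\}$, where $\pi_*(u)$ is the eigenprojection of $b_*(u)$ for the eigenvalue $0$; (v) $dh_*(u)$ has a simple real eigenvalue $\alpha(u)$ with $\alpha(u_0)=0$, $\alpha$ is differentiable at $u_0$, and $\nabla\alpha(u_0)\cdot r<0$, where $r$ is a unit vector with $dh_*(u_0)r=0$. For $\varepsilon>0$, $\delta\ge0$ and integers $s\ge 0$, $H^s_{\varepsilon,\delta}$ denotes the space of functions $f$ on $\mathbb R$ (with values in $\mathbb U$, $\mathbb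 V$ or $\mathbb H$) such that $e^{\delta\varepsilon\langle x\rangle}f\in H^s$, $\langle x\rangle=(1+x^2)^{1/2}$, with norm $$\|f\|_{H^s_{\varepsilon,\delta}}=\varepsilon^{1/2}\sum_{k\le s}\varepsilon^{-k}\|e^{\delta\varepsilon\langle x\rangle}\partial_x^kf\|_{L^2}.$$ **Proposition.** For every $\kappa>0$ there are constants $C,\varepsilon_0,\delta_0,\rho>0$ such that the following holds. Let $u_\pm\in\mathbb U$ with $|u_\pm-u_0|<\rho$, $\varepsilon:=|u_+-u_-|\in(0,\varepsilon_0]$, $|(u_+-u_-)/\varepsilon-r|\le\rho$ and $h_*(u_-)=h_*(u_+)$, and let $\bar u$ be a smooth profile with values in the ball of radius $\rho$ about $u_0$, solving $$b_*(\bar u)\bar u'=h_*(\bar u)-h_*(u_\pm),\qquad \lim_{x\to\pm\infty}\bar u(x)=u_\pm,$$ its translation being chosen so that $|\bar u(0)-u_\pm|\ge\kappa\varepsilon$. Then there is a unit vector $\ell_\varepsilon\in\mathbb U$ such that for all $\delta\in[0,\delta_0]$, $f\in H^3_{\varepsilon,\delta}(\mathbb R;\mathbb U)$ and $g\in H^2_{\varepsilon,\delta}(\mathbb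 R;\mathbb V)$, every $U\in H^2_{\varepsilon,\delta}(\mathbb R;\mathbb H)$, with $u=P_{\mathbb U}U$ and $v=P_{\mathbb V}U$, which satisfies $$A_{11}u+A_{12}v=f,\qquad A_{21}u'+A_{22}v'-P_{\mathbb V}L_{\bar u+v_*(\bar u)}U=g,\qquad \ell_\varepsilon\cdot u(0)=0,$$ obeys $$\|U\|_{H^2_{\varepsilon,\delta}}\le C\varepsilon^{-1}\big(\|f\|_{H^3_{\varepsilon,\delta}}+\|g\|_{H^2_{\varepsilon,\delta}}\big).$$ -/

import Mathlib

open Filter Topology MeasureTheory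
open scoped ContDiff InnerProductSpace

noncomputable section

/-! ## Weak derivatives and weighted, scaled Sobolev norms on the line -/

section Sobolev

variable {E : Type*} [NormedAddCommGroup E] [NormedSpace ℝ E]

/-- `g` is a weak derivative of `f : ℝ → E`. -/
def IsWeakDeriv (f g : ℝ → E) : Prop :=
  LocallyIntegrable f volume ∧ LocallyIntegrable g volume ∧
    ∀ φ : ℝ → ℝ, ContDiff ℝ ∞ φ → HasCompactSupport φ →
      ∫ x, deriv φ x • f x = -∫ x, φ x • g x

open Classical in
/-- The weak derivative of `f` (unique up to null sets), and `0` if there is none. -/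
def weakDeriv (f : ℝ → E) : ℝ → E :=
  if h : ∃ g, IsWeakDeriv f g then h.choose else 0

/-- Membership in `H^s(ℝ; E)`. -/
def MemHs : ℕ → (ℝ → E) → Prop
  | 0, f => MemLp f 2 volume
  | s + 1, f => MemLp f 2 volume ∧ ∃ g, IsWeakDeriv f g ∧ MemHs s g

/-- The weight `e^{δ ε ⟨x⟩}`, where `⟨x⟩ = (1 + x²)^{1/2}`. -/
def expWeight (ε δ x : ℝ) : ℝ := Real.exp (δ * ε * Real.sqrt (x ^ 2 + 1))

/-- Membership in `H^s_{ε,δ}`: the function `e^{δ ε ⟨x⟩} f` belongs to `H^s`. -/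
def MemWeightedHs (ε δ : ℝ) (s : ℕ) (f : ℝ → E) : Prop :=
  MemHs s (fun x => expWeight ε δ x • f x)

/-- `‖f‖_{H^s_{ε,δ}} = ε^{1/2} ∑_{k ≤ s} ε^{-k} ‖e^{δ ε ⟨x⟩} ∂_x^k f‖_{L²}`. -/
def weightedHsNorm (ε δ : ℝ) (s : ℕ) (f : ℝ → E) : ℝ :=
  Real.sqrt ε * ∑ k ∈ Finset.range (s + 1),
    (ε⁻¹) ^ k * (eLpNorm (fun x => expWeight ε δ x • (weakDeriv^[k] f) x) 2 volume).toReal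

end Sobolev

/-! ## The relaxation system `A U' = Q(U, U)` -/

/-- The standing-wave system `A U' = Q(U, U)` on a real Hilbert space `H`, with a reference
equilibrium `Uref`; `2 Q(Uref, ·)` is the differential of `U ↦ Q(U, U)` at `Uref`. -/
structure RelaxationSystem (H : Type*) [NormedAddCommGroup H] [InnerProductSpace ℝ H]
    [CompleteSpace H] where
  /-- the macroscopic subspace; the microscopic one is its orthogonal complement -/
  𝕌 : Submodule ℝ H
  finiteDimensional : FiniteDimensional ℝ 𝕌
  A : H →L[ℝ] H
  A_selfAdjoint : IsSelfAdjoint A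
  Q : H →L[ℝ] H →L[ℝ] H
  Q_symm : ∀ x y, Q x y = Q y x
  Q_mem : ∀ x y, Q x y ∈ 𝕌ᗮ
  Uref : H
  Q_Uref : Q Uref Uref = 0
  L_selfAdjoint : IsSelfAdjoint ((2 : ℝ) • Q Uref)
  L_ker : ((2 : ℝ) • Q Uref).ker = 𝕌
  L_neg : ∃ c > 0, ∀ v ∈ 𝕌ᗮ, ⟪((2 : ℝ) • Q Uref) v, v⟫_ℝ ≤ -c * ‖v‖ ^ 2
  /-- the Kawashima condition `Re (K A - L) ≥ γ Id` for a bounded skew-symmetric `K` -/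
  kawashima : ∃ K : H →L[ℝ] H, ContinuousLinearMap.adjoint K = -K ∧
    ∃ γ > 0, ∀ x, γ * ‖x‖ ^ 2 ≤ ⟪K (A x) - ((2 : ℝ) • Q Uref) x, x⟫_ℝ

namespace RelaxationSystem

variable {H : Type*} [NormedAddCommGroup H] [InnerProductSpace ℝ H] [CompleteSpace H]
  (S : RelaxationSystem H)

instance instFiniteDimensional : FiniteDimensional ℝ S.𝕌 := S.finiteDimensional

/-- The microscopic subspace. -/
abbrev 𝕍 : Submodule ℝ H := S.𝕌ᗮ

/-- Orthogonal projector on `𝕌`. -/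
def PU : H →L[ℝ] S.𝕌 := S.𝕌.orthogonalProjectionOnto

/-- Orthogonal projector on `𝕍`. -/
def PV : H →L[ℝ] S.𝕍 := S.𝕍.orthogonalProjectionOnto

/-- `L_a V = 2 Q(a, V)`, the differential of `U ↦ Q(U, U)` at `a`. -/
def L (a : H) : H →L[ℝ] H := (2 : ℝ) • S.Q a

def A11 : S.𝕌 →L[ℝ] S.𝕌 := S.PU ∘L S.A ∘L S.𝕌.subtypeL
def A12 : S.𝕍 →L[ℝ] S.𝕌 := S.PU ∘L S.A ∘L S.𝕍.subtypeL
def A21 : S.𝕌 →L[ℝ] S.𝕍 := S.PV ∘L S.A ∘L S.𝕌.subtypeL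
def A22 : S.𝕍 →L[ℝ] S.𝕍 := S.PV ∘L S.A ∘L S.𝕍.subtypeL

/-- The microscopic component `q(u, v)` of the collision operator. -/
def q (p : S.𝕌 × S.𝕍) : S.𝕍 :=
  S.PV (S.Q ((p.1 : H) + (p.2 : H)) ((p.1 : H) + (p.2 : H)))

/-- The base state: the macroscopic part of the reference equilibrium. -/
def u₀ : S.𝕌 := S.PU S.Uref

/-- The microscopic part of the reference equilibrium. -/
def vref : S.𝕍 := S.PV S.Uref

/-- The partial differential `∂_v q(u, v)`. -/
def dvq (u : S.𝕌) (v : S.𝕍) : S.𝕍 →L[ℝ] S.𝕍 :=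
  S.PV ∘L S.L ((u : H) + (v : H)) ∘L S.𝕍.subtypeL

lemma u₀_add_vref : (S.u₀ : H) + (S.vref : H) = S.Uref := by
  simp [u₀, vref, PU, PV]

/-- The map `(u, v) ↦ u + v`. -/
def addMap : S.𝕌 × S.𝕍 →L[ℝ] H := S.𝕌.subtypeL.coprod S.𝕍.subtypeL

lemma hasFDerivAt_q (p : S.𝕌 × S.𝕍) :
    HasFDerivAt S.q (S.PV ∘L S.L ((p.1 : H) + (p.2 : H)) ∘L S.addMap) p := by
  have h1 : HasFDerivAt (fun p : S.𝕌 × S.𝕍 => S.addMap p) S.addMap p := S.addMap.hasFDerivAt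
  have h2 := (S.PV.hasFDerivAt).comp p (S.Q.hasFDerivAt_of_bilinear h1 h1)
  refine h2.congr_fderiv ?_
  ext w
  · simp only [L, addMap, two_smul]
    simp [S.Q_symm w p.1, S.Q_symm w p.2]
  · simp only [L, addMap, two_smul]
    simp [S.Q_symm w p.1, S.Q_symm w p.2]

lemma contDiff_q : ContDiff ℝ ω S.q := by
  have h1 : ContDiff ℝ ω (fun p : S.𝕌 × S.𝕍 => S.addMap p) := S.addMap.contDiff
  exact S.PV.contDiff.comp ((S.Q.contDiff.comp h1).clm_apply h1)

lemma isInvertible_dvq_ref :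
    (fderiv ℝ S.q (S.u₀, S.vref) ∘L .inr ℝ S.𝕌 S.𝕍).IsInvertible := by
  have e : fderiv ℝ S.q (S.u₀, S.vref) ∘L .inr ℝ S.𝕌 S.𝕍 = S.dvq S.u₀ S.vref := by
    rw [(S.hasFDerivAt_q _).fderiv]
    ext w
    simp [dvq, addMap]
  obtain ⟨c, hc, h⟩ := S.L_neg
  rw [e]
  let B : S.𝕍 →L[ℝ] S.𝕍 →L[ℝ] ℝ := -(innerSL ℝ ∘L S.dvq S.u₀ S.vref)
  have hin : ∀ v w : S.𝕍, ⟪S.dvq S.u₀ S.vref v, w⟫_ℝ = ⟪S.L S.Uref v, (w : H)⟫_ℝ := by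
    intro v w
    simp only [dvq, S.u₀_add_vref, PV, ContinuousLinearMap.comp_apply, Submodule.subtypeL_apply]
    exact Submodule.inner_orthogonalProjectionOnto_eq_of_mem_right w _
  have hB : IsCoercive B := by
    refine ⟨c, hc, fun v => ?_⟩
    have h1 := h v v.2
    have h2 := hin v v
    have h3 : B v v = -⟪S.dvq S.u₀ S.vref v, v⟫_ℝ := rfl
    rw [h3, h2]
    have : ‖v‖ = ‖(v : H)‖ := rfl
    rw [this, L]
    nlinarith
  refine ⟨(ContinuousLinearEquiv.neg ℝ).trans hB.continuousLinearEquivOfBilin, ?_⟩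
  ext1 v
  refine ext_inner_right ℝ fun w => ?_
  have := hB.continuousLinearEquivOfBilin_apply (-v) w
  simp only [ContinuousLinearEquiv.coe_coe, ContinuousLinearEquiv.trans_apply,
    ContinuousLinearEquiv.neg_apply]
  rw [this, map_neg]
  exact neg_neg _

/-- The equilibrium map `v_*`: the implicit function solving `q(u, v_*(u)) = 0` near
the reference equilibrium. -/
def vstar : S.𝕌 → S.𝕍 :=
  (S.contDiff_q.contDiffAt (x := (S.u₀, S.vref))).implicitFunction (by simp)
    S.isInvertible_dvq_ref

/-- The equilibrium `M(u) = (u, v_*(u))`. -/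
def M (u : S.𝕌) : H := (u : H) + (S.vstar u : H)

/-- `h_*(u) = A₁₁ u + A₁₂ v_*(u)`. -/
def hstar (u : S.𝕌) : S.𝕌 := S.A11 u + S.A12 (S.vstar u)

/-- `c_*(u) = ∂_v q⁻¹(u, v_*(u)) (A₂₁ + A₂₂ dv_*(u) - dv_*(u) (A₁₁ + A₁₂ dv_*(u)))`. -/
def cstar (u : S.𝕌) : S.𝕌 →L[ℝ] S.𝕍 :=
  (S.dvq u (S.vstar u)).inverse ∘L
    (S.A21 + S.A22 ∘L fderiv ℝ S.vstar u
      - fderiv ℝ S.vstar u ∘L (S.A11 + S.A12 ∘L fderiv ℝ S.vstar u))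

/-- `b_*(u) = - A₁₂ c_*(u)`. -/
def bstar (u : S.𝕌) : S.𝕌 →L[ℝ] S.𝕌 := -(S.A12 ∘L S.cstar u)

/-- `dh_*(u)`. -/
def dhstar (u : S.𝕌) : S.𝕌 →L[ℝ] S.𝕌 := fderiv ℝ S.hstar u

end RelaxationSystem

/-- The eigenprojection of `b` for the eigenvalue `0`: the projection on the generalized kernel
of `b` along the (Fitting) complementary invariant subspace. -/
def zeroEigenprojection {E : Type*} [AddCommGroup E] [Module ℝ E] [FiniteDimensional ℝ E]
    (b : E →ₗ[ℝ] E) : E →ₗ[ℝ] E :=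
  Submodule.projection _ _ (LinearMap.isCompl_iSup_ker_pow_iInf_range_pow b)

namespace RelaxationSystem

variable {H : Type*} [NormedAddCommGroup H] [InnerProductSpace ℝ H] [CompleteSpace H]
  (S : RelaxationSystem H)

/-- Structural conditions on the reduced system `h_*(u)' = (b_*(u) u')'` near `u₀`. -/
structure GoodReduced : Prop where
  symmetrizable : ∀ᶠ u in 𝓝 S.u₀, ∃ s : S.𝕌 →L[ℝ] S.𝕌,
    (s : S.𝕌 →ₗ[ℝ] S.𝕌).IsSymmetric ∧ (∀ w, w ≠ 0 → 0 < ⟪s w, w⟫_ℝ) ∧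
    (s ∘L S.dhstar u : S.𝕌 →ₗ[ℝ] S.𝕌).IsSymmetric ∧
    (s ∘L S.bstar u : S.𝕌 →ₗ[ℝ] S.𝕌).IsSymmetric ∧ ∀ w, 0 ≤ ⟪s (S.bstar u w), w⟫_ℝ
  genuineCoupling : ∀ᶠ u in 𝓝 S.u₀, ∀ (μ : ℝ) (w : S.𝕌),
    Module.End.HasEigenvector (S.dhstar u : S.𝕌 →ₗ[ℝ] S.𝕌) μ w → S.bstar u w ≠ 0
  constantLeftKernel : ∃ N : Submodule ℝ S.𝕌, ∀ᶠ u in 𝓝 S.u₀,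
    (ContinuousLinearMap.adjoint (S.bstar u)).ker = N
  nondegenerate : ∀ᶠ u in 𝓝 S.u₀,
    (zeroEigenprojection (S.bstar u : S.𝕌 →ₗ[ℝ] S.𝕌) ∘ₗ (S.dhstar u : S.𝕌 →ₗ[ℝ] S.𝕌)).ker
      ⊓ (S.bstar u).ker = ⊥

/-- Near `u₀`, `α(u)` is a simple eigenvalue of `dh_*(u)` with `α(u₀) = 0`, `r` is a unit
eigenvector of `dh_*(u₀)` for `α(u₀)`, and the field is genuinely nonlinear, `r` being
oriented so that `∇α · r < 0` at `u₀`. -/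
structure GenuinelyNonlinear (α : S.𝕌 → ℝ) (r : S.𝕌) : Prop where
  eigenvalue : ∀ᶠ u in 𝓝 S.u₀,
    Module.End.HasEigenvalue (S.dhstar u : S.𝕌 →ₗ[ℝ] S.𝕌) (α u) ∧
    Module.finrank ℝ
      (Module.End.maxGenEigenspace (S.dhstar u : S.𝕌 →ₗ[ℝ] S.𝕌) (α u)) = 1
  zero : α S.u₀ = 0
  eigenvector : S.dhstar S.u₀ r = 0
  norm_r : ‖r‖ = 1
  differentiableAt : DifferentiableAt ℝ α S.u₀
  nonlinear : fderiv ℝ α S.u₀ r < 0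

/-- `ubar` is a zero-speed viscous (Navier--Stokes) shock profile joining `um` to `up`:
`b_*(ubar) ubar' = h_*(ubar) - h_*(u_±)`. -/
structure IsNSProfile (um up : S.𝕌) (ubar : ℝ → S.𝕌) : Prop where
  rankineHugoniot : S.hstar um = S.hstar up
  smooth : ContDiff ℝ ∞ ubar
  ode : ∀ x, S.bstar (ubar x) (deriv ubar x) = S.hstar (ubar x) - S.hstar um
  tendsto_atBot : Tendsto ubar atBot (𝓝 um)
  tendsto_atTop : Tendsto ubar atTop (𝓝 up)

/-- `U` solves the integrated linearized profile equation around `(ubar, v_*(ubar))`: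
`A₁₁ u + A₁₂ v = f` and `A₂₁ u' + A₂₂ v' - dq(ubar, v_*(ubar)) U = g`, with
`u = P_𝕌 U`, `v = P_𝕍 U`. -/
def SolvesLinearized (ubar : ℝ → S.𝕌) (U : ℝ → H) (f : ℝ → S.𝕌) (g : ℝ → S.𝕍) : Prop :=
  (∀ᵐ x, S.A11 (S.PU (U x)) + S.A12 (S.PV (U x)) = f x) ∧
  ∀ᵐ x, S.A21 (S.PU (weakDeriv U x)) + S.A22 (S.PV (weakDeriv U x))
    - S.PV (S.L (S.M (ubar x)) (U x)) = g x

end RelaxationSystem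

end

/-! Let `w` be the fluctuation `P_𝕍 U - dv_*(ubar) P_𝕌 U` of `U`, and `w'` that of `U'`. The
linearized collision operator at an equilibrium kills the tangent space of the equilibrium manifold,
so the microscopic equation sees only `w`. Solving it for `w` and inserting the result in the
macroscopic equation gives, for `u = P_𝕌 U`, the reduced equation `b_*(ubar) u' - dh_*(ubar) u =
O(f, f', g, w')` (`chapmanEnskog`). Two estimates are then needed: one for `w'`, one for the reduced
equation.

Estimate for `w'` (`exists_fluctuation_estimate`). By the equations `A U' = f' + L U + g`, so `(A
U')'` is square integrable even if `A` is singular and `U'` is not differentiable. For symmetric `A`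
the integral of `⟪(A U')', U'⟫` vanishes; this is proved by translations
(`integral_inner_deriv_eq_zero`). Since `L` is dissipative on fluctuations and `dv_*(u₀) = 0`, one
gets `‖w'‖ ≤ ν ‖u'‖ + B (‖f''‖ + ‖g'‖ + ε² ‖U‖)` with `ν` as small as desired close to `u₀`.

Geometry of the reduced system. At `u₀` both `dh_* = A₁₁` and `b_* = -A₁₂ (∂_v q)⁻¹ A₂₁` are
symmetric, and `N = ker b_* = ker A₂₁`. The range of `b_*` is orthogonal to `N` at every state, so
the `N`-component of the equation is an algebraic constraint. Nondegeneracy makes `b_*(u₀)` coercive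
on the constraint space `T`, and `A₁₁` vanishes only along `r`, which is split off by means of the
covector `ℓ = b_*(u₀) r`.

Structure of the profile. Energy estimates in the weight `e^{-2η|x-a|}` become pointwise bounds at
`a` (`peak_estimate`). They show that `ubar'` stays in a thin cone around `r` (`cone`), hence `ubar'
= A k` with `k` normalized and `A > 0`; applied once more they give `k' = O(A)`, and genuine
nonlinearity gives `m' = -l A` with `l` between positive constants, where `m = A'/A`
(`NormalizedProfile.bounds`). The amplitude thus obeys a Burgers-like ODE, and comparison arguments
show that `k₀ A / ε` compensates the growing part of `m` on each half-line
(`ScalarProfile.multiplier`).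

Reduced estimate (`ShockLayer.linear_estimate`). Write `u = lift f + y k + z`, where `lift f`
carries the constraint and `z` is transversal to `ℓ`. The part `z` is controlled by a symmetric
energy estimate without loss. The amplitude solves `y' = m y + e`, with `e` controlled by pairing
the equation with `r`. The normalization gives `y 0 = 0`, and an exponential multiplier yields `‖y‖
≤ C ε⁻¹ ‖e‖`: this is where the power of `ε` is lost. The weight `e^{δε⟨x⟩}` has logarithmic
derivative at most `δ ε`, below all these rates.

Conclusion. The two estimates feed each other and are closed by taking first `ν`, then `ε`, small
(`exists_closed_estimate`). For second derivatives, `U'` solves the same system up to `O(ε²)`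
commutators. It satisfies no condition at `0`, but the bound of `U''` by `ε U'` and the data needs
none. -/

noncomputable section

/-! ## Locally absolutely continuous functions as primitives -/

section Primitive

variable {E F G : Type*} [NormedAddCommGroup E] [NormedSpace ℝ E]
  [NormedAddCommGroup F] [NormedSpace ℝ F] [NormedAddCommGroup G] [NormedSpace ℝ G]

/-- `f` is locally integrable and `F` is a primitive of `f`. -/
structure IsPrimitive (F f : ℝ → E) : Prop where
  locallyIntegrable : LocallyIntegrable f volume
  integral_eq : ∀ a b, ∫ x in a..b, f x = F b - F a

omit [NormedSpace ℝ E] in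
lemma _root_.MeasureTheory.LocallyIntegrable.intervalIntegrable' {f : ℝ → E}
    (h : LocallyIntegrable f volume) (a b : ℝ) : IntervalIntegrable f volume a b :=
  (h.integrableOn_isCompact isCompact_uIcc).intervalIntegrable

/-- A squeeze on the sums defining absolute continuity. The three codomains may differ, which
carries the real-valued theory over to vector-valued primitives and to bilinear products. -/
lemma absolutelyContinuousOnInterval_of_dist_le {X Y Z : Type*} [PseudoMetricSpace X]
    [PseudoMetricSpace Y] [PseudoMetricSpace Z] {P : ℝ → X} {u : ℝ → Y} {v : ℝ → Z} {a b : ℝ}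
    (hu : AbsolutelyContinuousOnInterval u a b) (hv : AbsolutelyContinuousOnInterval v a b)
    (C₁ C₂ : ℝ) (h : ∀ x ∈ Set.uIcc a b, ∀ y ∈ Set.uIcc a b,
      dist (P x) (P y) ≤ C₁ * dist (u x) (u y) + C₂ * dist (v x) (v y)) :
    AbsolutelyContinuousOnInterval P a b := by
  unfold AbsolutelyContinuousOnInterval at *
  refine squeeze_zero' (g := fun E => C₁ * (∑ i ∈ Finset.range E.1, dist (u (E.2 i).1) (u (E.2 i).2))
    + C₂ * (∑ i ∈ Finset.range E.1, dist (v (E.2 i).1) (v (E.2 i).2)))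
    (Eventually.of_forall fun t => Finset.sum_nonneg fun i _ => dist_nonneg) ?_ ?_
  · rw [eventually_inf_principal]
    filter_upwards with ⟨n, I⟩ hnI
    simp only
    rw [Finset.mul_sum, Finset.mul_sum, ← Finset.sum_add_distrib]
    exact Finset.sum_le_sum fun i hi => h _ (hnI.1 i hi).1 _ (hnI.1 i hi).2
  · have := (hu.const_mul C₁).add (hv.const_mul C₂)
    simpa using this

/-- The increments are dominated by those of the primitive of `‖f‖`, for which the scalar result
applies. -/
lemma _root_.IntervalIntegrable.absolutelyContinuousOnInterval_integral {f : ℝ → E} {a b c : ℝ}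
    (h : IntervalIntegrable f volume a b) (hc : c ∈ Set.uIcc a b) :
    AbsolutelyContinuousOnInterval (fun x => ∫ t in c..x, f t) a b := by
  have h1 := h.norm.absolutelyContinuousOnInterval_intervalIntegral hc
  refine absolutelyContinuousOnInterval_of_dist_le h1 h1 1 0 fun x hx y hy => ?_
  have i1 : ∀ z ∈ Set.uIcc a b, IntervalIntegrable f volume c z := fun z hz =>
    h.mono_set (Set.uIcc_subset_uIcc hc hz)
  rw [dist_eq_norm, dist_eq_norm, intervalIntegral.integral_interval_sub_left (i1 x hx) (i1 y hy),
    intervalIntegral.integral_interval_sub_left (i1 x hx).norm (i1 y hy).norm, one_mul, zero_mul,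
    add_zero]
  exact intervalIntegral.norm_integral_le_abs_integral_norm

namespace IsPrimitive

lemma intervalIntegrable {F f : ℝ → E} (h : IsPrimitive F f) (a b : ℝ) :
    IntervalIntegrable f volume a b :=
  h.locallyIntegrable.intervalIntegrable' a b

lemma eq_add {F f : ℝ → E} (h : IsPrimitive F f) (a : ℝ) :
    F = fun x => F a + ∫ t in a..x, f t := by
  funext x
  rw [h.integral_eq a x]
  abel

lemma absCont [CompleteSpace E] {F f : ℝ → E} (h : IsPrimitive F f) (a b : ℝ) :
    AbsolutelyContinuousOnInterval F a b := by
  have h1 := (h.intervalIntegrable a b).absolutelyContinuousOnInterval_integral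
    (c := a) Set.left_mem_uIcc
  have h2 : AbsolutelyContinuousOnInterval (fun _ : ℝ => F a) a b := by
    have : ContDiffOn ℝ 1 (fun _ : ℝ => F a) (Set.uIcc a b) := contDiffOn_const
    exact this.absolutelyContinuousOnInterval
  rw [h.eq_add a]
  exact h2.add h1

lemma continuous [CompleteSpace E] {F f : ℝ → E} (h : IsPrimitive F f) : Continuous F := by
  rw [h.eq_add 0]
  exact continuous_const.add (intervalIntegral.continuous_primitive (fun a b => h.intervalIntegrable a b) 0)

lemma ae_hasDerivAt [CompleteSpace E] {F f : ℝ → E} (h : IsPrimitive F f) :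
    ∀ᵐ x, HasDerivAt F (f x) x := by
  have h1 : ∀ n : ℕ, ∀ᵐ x, x ∈ Set.uIcc (-(n : ℝ)) n → HasDerivAt F (f x) x := by
    intro n
    filter_upwards [(h.intervalIntegrable (-(n : ℝ)) n).ae_hasDerivAt_integral] with x hx hx'
    have := hx hx' (-(n : ℝ)) (by simp)
    rw [h.eq_add (-(n : ℝ))]
    exact this.const_add _
  filter_upwards [ae_all_iff.2 h1] with x hx
  obtain ⟨n, hn⟩ := exists_nat_ge |x|
  refine hx n ?_
  rw [Set.uIcc_of_le (by have := abs_nonneg x; linarith)]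
  exact abs_le.1 hn

/-- A locally absolutely continuous function with almost everywhere derivative `f` is a primitive
of `f`. -/
lemma of_ae_hasDerivAt [CompleteSpace E] {F f : ℝ → E}
    (hF : ∀ a b, AbsolutelyContinuousOnInterval F a b) (hf : LocallyIntegrable f volume)
    (h : ∀ᵐ x, HasDerivAt F (f x) x) : IsPrimitive F f := by
  refine ⟨hf, fun a b => ?_⟩
  have hi : IntervalIntegrable f volume a b := hf.intervalIntegrable' a b
  have h1 := (hF a b).sub
    (hi.absolutelyContinuousOnInterval_integral (c := a) Set.left_mem_uIcc)
  obtain ⟨C, hC⟩ := h1.const_of_ae_hasDerivAt_zero (by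
    filter_upwards [h, hi.ae_hasDerivAt_integral] with x hx hx2 hx3
    have := hx.sub (hx2 hx3 a (by simp))
    simpa using this)
  have ha := hC a (by simp)
  have hb := hC b (by simp)
  simp only [Pi.sub_apply, intervalIntegral.integral_same, sub_zero] at ha hb
  rw [← ha] at hb
  rw [← hb]; abel

lemma of_hasDerivAt [CompleteSpace E] {F f : ℝ → E} (h : ∀ x, HasDerivAt F (f x) x)
    (hf : Continuous f) : IsPrimitive F f :=
  ⟨hf.locallyIntegrable, fun _ _ =>
    intervalIntegral.integral_eq_sub_of_hasDerivAt (fun x _ => h x) (hf.intervalIntegrable _ _)⟩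

lemma congr_deriv {F f g : ℝ → E} (h : IsPrimitive F f) (hfg : f =ᵐ[volume] g) :
    IsPrimitive F g := by
  refine ⟨h.locallyIntegrable.congr hfg, fun a b => ?_⟩
  rw [← h.integral_eq a b]
  exact intervalIntegral.integral_congr_ae (hfg.symm.mono fun x hx _ => hx)

lemma add {F f F' f' : ℝ → E} (h : IsPrimitive F f) (h' : IsPrimitive F' f') :
    IsPrimitive (fun x => F x + F' x) (fun x => f x + f' x) := by
  refine ⟨h.locallyIntegrable.add h'.locallyIntegrable, fun a b => ?_⟩
  rw [intervalIntegral.integral_add (h.intervalIntegrable a b) (h'.intervalIntegrable a b),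
    h.integral_eq, h'.integral_eq]
  abel

lemma neg {F f : ℝ → E} (h : IsPrimitive F f) :
    IsPrimitive (fun x => -F x) (fun x => -f x) := by
  refine ⟨h.locallyIntegrable.neg, fun a b => ?_⟩
  rw [intervalIntegral.integral_neg, h.integral_eq]
  abel

lemma sub {F f F' f' : ℝ → E} (h : IsPrimitive F f) (h' : IsPrimitive F' f') :
    IsPrimitive (fun x => F x - F' x) (fun x => f x - f' x) := by
  simpa only [sub_eq_add_neg] using h.add h'.neg

lemma clm [CompleteSpace E] [CompleteSpace F] {u v : ℝ → E} (h : IsPrimitive u v) (T : E →L[ℝ] F) :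
    IsPrimitive (fun x => T (u x)) (fun x => T (v x)) := by
  refine ⟨?_, fun a b => ?_⟩
  · intro x
    obtain ⟨s, hs, hi⟩ := h.locallyIntegrable x
    exact ⟨s, hs, T.integrable_comp hi⟩
  · rw [T.intervalIntegral_comp_comm (h.intervalIntegrable a b), h.integral_eq, map_sub]

end IsPrimitive

lemma _root_.MeasureTheory.LocallyIntegrable.bilin_continuous_left (B : E →L[ℝ] F →L[ℝ] G)
    {u : ℝ → E} {v : ℝ → F} (hu : Continuous u) (hv : LocallyIntegrable v volume) :
    LocallyIntegrable (fun x => B (u x) (v x)) volume := by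
  rw [locallyIntegrable_iff]
  intro k hk
  have hvk := hv.integrableOn_isCompact hk
  obtain ⟨C, hC⟩ := hk.exists_bound_of_continuousOn (f := fun x => B (u x))
    (B.continuous.comp hu).continuousOn
  have hm : AEStronglyMeasurable (fun x => B (u x) (v x)) (volume.restrict k) := by
    exact (isBoundedBilinearMap_apply.continuous.comp_aestronglyMeasurable
      (((B.continuous.comp hu).aestronglyMeasurable).prodMk hvk.aestronglyMeasurable))
  refine (hvk.norm.const_mul C).mono' hm ?_
  filter_upwards [ae_restrict_mem hk.measurableSet] with x hx
  exact (B (u x)).le_of_opNorm_le (hC x hx) _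

/-- The product rule for continuous bilinear maps. -/
lemma IsPrimitive.bilin [CompleteSpace E] [CompleteSpace F] [CompleteSpace G]
    (B : E →L[ℝ] F →L[ℝ] G) {u u' : ℝ → E} {v v' : ℝ → F} (hu : IsPrimitive u u')
    (hv : IsPrimitive v v') :
    IsPrimitive (fun x => B (u x) (v x)) (fun x => B (u x) (v' x) + B (u' x) (v x)) := by
  refine IsPrimitive.of_ae_hasDerivAt (fun a b => ?_) ?_ ?_
  · obtain ⟨C1, hC1⟩ := (hu.absCont a b).exists_bound
    obtain ⟨C2, hC2⟩ := (hv.absCont a b).exists_bound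
    refine absolutelyContinuousOnInterval_of_dist_le (hv.absCont a b) (hu.absCont a b)
      (‖B‖ * |C1|) (‖B‖ * |C2|) fun x hx y hy => ?_
    have h1 := (hC1 _ hx).trans (le_abs_self _)
    have h2 := (hC2 _ hy).trans (le_abs_self _)
    rw [dist_eq_norm, dist_eq_norm, dist_eq_norm]
    have e : B (u x) (v x) - B (u y) (v y) = B (u x) (v x - v y) + B (u x - u y) (v y) := by
      rw [map_sub, map_sub, sub_apply]
      abel
    rw [e]
    refine (norm_add_le _ _).trans (add_le_add ?_ ?_)
    · refine (B.le_opNorm₂ _ _).trans ?_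
      gcongr
    · refine (B.le_opNorm₂ _ _).trans ?_
      rw [mul_right_comm]
      gcongr
  · exact (LocallyIntegrable.bilin_continuous_left B hu.continuous hv.locallyIntegrable).add
      (LocallyIntegrable.bilin_continuous_left B.flip hv.continuous hu.locallyIntegrable)
  · filter_upwards [hu.ae_hasDerivAt, hv.ae_hasDerivAt] with x h1 h2
    exact B.hasDerivAt_of_bilinear (fun _ => h1) (fun _ => h2)

lemma IsPrimitive.smul [CompleteSpace E] {c c' : ℝ → ℝ} {u u' : ℝ → E} (hc : IsPrimitive c c')
    (hu : IsPrimitive u u') :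
    IsPrimitive (fun x => c x • u x) (fun x => c x • u' x + c' x • u x) :=
  IsPrimitive.bilin (ContinuousLinearMap.lsmul ℝ ℝ) hc hu

lemma IsPrimitive.mul {c c' u u' : ℝ → ℝ} (hc : IsPrimitive c c') (hu : IsPrimitive u u') :
    IsPrimitive (fun x => c x * u x) (fun x => c x * u' x + c' x * u x) :=
  IsPrimitive.bilin (ContinuousLinearMap.mul ℝ ℝ) hc hu

lemma IsPrimitive.inner {E : Type*} [NormedAddCommGroup E] [InnerProductSpace ℝ E] [CompleteSpace E]
    {u u' v v' : ℝ → E} (hu : IsPrimitive u u') (hv : IsPrimitive v v') :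
    IsPrimitive (fun x => ⟪u x, v x⟫_ℝ) (fun x => ⟪u x, v' x⟫_ℝ + ⟪u' x, v x⟫_ℝ) :=
  IsPrimitive.bilin (innerSL ℝ) hu hv

/-- An integrable primitive of an integrable function tends to zero at infinity. -/
lemma IsPrimitive.tendsto_zero [CompleteSpace E] {F f : ℝ → E} (h : IsPrimitive F f)
    (hF : Integrable F) (hf : Integrable f) :
    Tendsto F atTop (𝓝 0) ∧ Tendsto F atBot (𝓝 0) := by
  -- A nonzero limit would keep `‖F‖` above a positive constant on a set of infinite measure,
  -- against integrability.
  have key : ∀ (l : Filter ℝ) (L : E), Tendsto F l (𝓝 L) →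
      (∀ s ∈ l, volume s = ⊤) → L = 0 := by
    intro l L hL hl
    by_contra hne
    have hpos : 0 < ‖L‖ := norm_pos_iff.2 hne
    have h1 : ∀ᶠ x in l, ‖L‖ / 2 < ‖F x‖ := hL.norm.eventually (lt_mem_nhds (by linarith))
    have h2 := hF.norm.measure_gt_lt_top (ε := ‖L‖ / 2) (by linarith)
    rw [hl _ h1] at h2
    exact lt_irrefl _ h2
  have t1 : Tendsto F atTop (𝓝 (F 0 + ∫ x in Set.Ioi 0, f x)) := by
    have := intervalIntegral_tendsto_integral_Ioi 0 hf.integrableOn tendsto_id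
    rw [h.eq_add 0]
    simpa using this.const_add (F 0)
  have t2 : Tendsto F atBot (𝓝 (F 0 - ∫ x in Set.Iic 0, f x)) := by
    have := intervalIntegral_tendsto_integral_Iic 0 hf.integrableOn tendsto_id
    refine (this.const_sub (F 0)).congr fun x => ?_
    simp only [id]
    rw [h.integral_eq]; abel
  refine ⟨?_, ?_⟩
  · rwa [key _ _ t1 (fun s hs => ?_)] at t1
    obtain ⟨a, ha⟩ := mem_atTop_sets.1 hs
    exact measure_mono_top (fun x hx => ha x hx) (Real.volume_Ici (a := a))
  · rwa [key _ _ t2 (fun s hs => ?_)] at t2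
    obtain ⟨a, ha⟩ := mem_atBot_sets.1 hs
    exact measure_mono_top (fun x hx => ha x hx) (Real.volume_Iic (a := a))

lemma IsPrimitive.integral_Ioi [CompleteSpace E] {F f : ℝ → E} (h : IsPrimitive F f)
    (hF : Integrable F) (hf : Integrable f) (a : ℝ) : ∫ x in Set.Ioi a, f x = -F a := by
  have := intervalIntegral_tendsto_integral_Ioi a hf.integrableOn tendsto_id
  refine tendsto_nhds_unique this ?_
  have := (h.tendsto_zero hF hf).1.sub_const (F a)
  simpa only [h.integral_eq, zero_sub, id] using this

lemma IsPrimitive.integral_Iic [CompleteSpace E] {F f : ℝ → E} (h : IsPrimitive F f)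
    (hF : Integrable F) (hf : Integrable f) (a : ℝ) : ∫ x in Set.Iic a, f x = F a := by
  have := intervalIntegral_tendsto_integral_Iic a hf.integrableOn tendsto_id
  refine tendsto_nhds_unique this ?_
  have := (h.tendsto_zero hF hf).2.const_sub (F a)
  simpa only [h.integral_eq, sub_zero, id] using this

lemma IsPrimitive.integral_eq_zero [CompleteSpace E] {F f : ℝ → E} (h : IsPrimitive F f)
    (hF : Integrable F) (hf : Integrable f) : ∫ x, f x = 0 := by
  rw [← intervalIntegral.integral_Iic_add_Ioi (b := 0) hf.integrableOn hf.integrableOn, h.integral_Ioi hF hf,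
    h.integral_Iic hF hf, add_neg_cancel]

end Primitive

/-! ## Weak derivatives and primitives -/

section WeakDeriv

variable {E : Type*} [NormedAddCommGroup E] [NormedSpace ℝ E]

lemma IsWeakDeriv.congr {f f₂ g g₂ : ℝ → E} (h : IsWeakDeriv f g) (hf : f =ᵐ[volume] f₂)
    (hg : g =ᵐ[volume] g₂) : IsWeakDeriv f₂ g₂ := by
  refine ⟨h.1.congr hf, h.2.1.congr hg, fun φ hφ hc => ?_⟩
  have e1 : ∫ x, deriv φ x • f x = ∫ x, deriv φ x • f₂ x :=
    integral_congr_ae (hf.mono fun x hx => by simp only [hx])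
  have e2 : ∫ x, φ x • g x = ∫ x, φ x • g₂ x :=
    integral_congr_ae (hg.mono fun x hx => by simp only [hx])
  rw [← e1, ← e2]
  exact h.2.2 φ hφ hc

lemma IsWeakDeriv.unique [CompleteSpace E] {f g g₂ : ℝ → E} (h : IsWeakDeriv f g)
    (h₂ : IsWeakDeriv f g₂) : g =ᵐ[volume] g₂ := by
  refine ae_eq_of_integral_contDiff_smul_eq h.2.1 h₂.2.1 fun φ hφ hc => ?_
  rw [← neg_inj, ← h.2.2 φ hφ hc, ← h₂.2.2 φ hφ hc]

lemma IsWeakDeriv.weakDeriv_ae [CompleteSpace E] {f g : ℝ → E} (h : IsWeakDeriv f g) :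
    weakDeriv f =ᵐ[volume] g := by
  have : ∃ g, IsWeakDeriv f g := ⟨g, h⟩
  rw [weakDeriv, dif_pos this]
  exact this.choose_spec.unique h

lemma IsWeakDeriv.isWeakDeriv_weakDeriv [CompleteSpace E] {f g : ℝ → E} (h : IsWeakDeriv f g) :
    IsWeakDeriv f (weakDeriv f) := h.congr .rfl h.weakDeriv_ae.symm

lemma integrable_smul_of_hasCompactSupport {φ : ℝ → ℝ} {f : ℝ → E} (hf : LocallyIntegrable f volume)
    (hφ : Continuous φ) (hc : HasCompactSupport φ) : Integrable (fun x => φ x • f x) :=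
  hf.integrable_smul_left_of_hasCompactSupport hφ hc

lemma IsPrimitive.isWeakDeriv [CompleteSpace E] {F f : ℝ → E} (h : IsPrimitive F f) :
    IsWeakDeriv F f := by
  refine ⟨h.continuous.locallyIntegrable, h.locallyIntegrable, fun φ hφ hc => ?_⟩
  have h1 : IsPrimitive φ (deriv φ) := IsPrimitive.of_hasDerivAt
    (fun x => (hφ.differentiable (by simp) x).hasDerivAt) (hφ.continuous_deriv (by simp))
  have i1 := integrable_smul_of_hasCompactSupport h.locallyIntegrable hφ.continuous hc
  have i2 := integrable_smul_of_hasCompactSupport h.continuous.locallyIntegrable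
    (hφ.continuous_deriv (by simp)) hc.deriv
  have i3 := integrable_smul_of_hasCompactSupport h.continuous.locallyIntegrable hφ.continuous hc
  have := (h1.smul h).integral_eq_zero i3 (i1.add i2)
  rw [integral_add i1 i2] at this
  exact eq_neg_of_add_eq_zero_right this

/-- A function with vanishing weak derivative is almost everywhere constant. -/
lemma IsWeakDeriv.ae_const [CompleteSpace E] {f : ℝ → E} (h : IsWeakDeriv f 0) :
    ∃ c, f =ᵐ[volume] fun _ => c := by
  let ψ₀ : ContDiffBump (0 : ℝ) := default
  let ψ : ℝ → ℝ := ψ₀.normed volume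
  have ψs : ContDiff ℝ ∞ ψ := ψ₀.contDiff_normed
  have ψc : HasCompactSupport ψ := ψ₀.hasCompactSupport_normed
  have ψi : ∫ x, ψ x = 1 := ψ₀.integral_normed
  refine ⟨∫ x, ψ x • f x, ae_eq_of_integral_contDiff_smul_eq h.1
    (continuous_const.locallyIntegrable) fun φ hφ hc => ?_⟩
  set I := ∫ x, φ x with hI
  -- Du Bois-Reymond: subtracting `(∫ φ) ψ` makes the test function of mean zero, so its primitive
  -- `Φ` is again a test function; testing with `Φ` identifies `f` with the constant `∫ ψ f`.
  let χ : ℝ → ℝ := fun x => φ x - I * ψ x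
  have χs : ContDiff ℝ ∞ χ := hφ.sub (contDiff_const.mul ψs)
  have χc : HasCompactSupport χ := hc.sub ψc.mul_left
  have iφ : Integrable φ := hφ.continuous.integrable_of_hasCompactSupport hc
  have iψ : Integrable ψ := ψs.continuous.integrable_of_hasCompactSupport ψc
  have iχ : Integrable χ := iφ.sub (iψ.const_mul I)
  have χ0 : ∫ x, χ x = 0 := by
    simp only [χ]
    rw [integral_sub iφ (iψ.const_mul I), integral_const_mul, ψi, mul_one, sub_self]
  let Φ : ℝ → ℝ := fun x => ∫ t in Set.Iic x, χ t
  have hΦ : ∀ x, HasDerivAt Φ (χ x) x := by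
    intro x
    have e : Φ = fun x => Φ 0 + ∫ t in (0:ℝ)..x, χ t := by
      funext y
      simp only [Φ]
      rw [← intervalIntegral.integral_Iic_sub_Iic iχ.integrableOn iχ.integrableOn]
      ring
    rw [e]
    exact (intervalIntegral.integral_hasDerivAt_right (χs.continuous.intervalIntegrable _ _)
      (χs.continuous.stronglyMeasurableAtFilter _ _) χs.continuous.continuousAt).const_add _
  have dΦ : deriv Φ = χ := funext fun x => (hΦ x).deriv
  have Φs : ContDiff ℝ ∞ Φ := by
    rw [contDiff_infty_iff_deriv]
    exact ⟨fun x => (hΦ x).differentiableAt, by rw [dΦ]; exact χs⟩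
  have Φc : HasCompactSupport Φ := by
    obtain ⟨R, hR⟩ := χc.isCompact.isBounded.subset_closedBall 0
    refine HasCompactSupport.intro (isCompact_closedBall (0:ℝ) R) fun x hx => ?_
    have hz : ∀ t, R < |t| → χ t = 0 := by
      intro t ht
      by_contra hne
      have := hR (subset_tsupport _ hne)
      rw [Metric.mem_closedBall, dist_zero_right, Real.norm_eq_abs] at this
      linarith
    rw [Metric.mem_closedBall, dist_zero_right, Real.norm_eq_abs, not_le] at hx
    simp only [Φ]
    rcases le_total 0 x with h0 | h0
    · have : ∫ t in Set.Ioi x, χ t = 0 := by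
        refine setIntegral_eq_zero_of_forall_eq_zero fun t ht => hz t ?_
        rw [abs_of_nonneg h0] at hx
        rw [abs_of_nonneg (h0.trans (le_of_lt ht))]
        exact hx.trans ht
      have h2 := intervalIntegral.integral_Iic_add_Ioi (b := x) iχ.integrableOn iχ.integrableOn
      rw [this, χ0, add_zero] at h2
      exact h2
    · refine setIntegral_eq_zero_of_forall_eq_zero fun t ht => hz t ?_
      rw [abs_of_nonpos h0] at hx
      rw [abs_of_nonpos (le_trans ht h0)]
      have : t ≤ x := ht
      linarith
  have h3 := h.2.2 Φ Φs Φc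
  rw [dΦ] at h3
  simp only [Pi.zero_apply, smul_zero, integral_zero, neg_zero, χ, sub_smul, mul_smul] at h3
  have i2 : Integrable fun x => I • ψ x • f x :=
    (integrable_smul_of_hasCompactSupport h.1 ψs.continuous ψc).smul I
  rw [integral_sub (integrable_smul_of_hasCompactSupport h.1 hφ.continuous hc) i2, integral_smul,
    sub_eq_zero] at h3
  rw [h3, integral_smul_const]

/-- A weakly differentiable function agrees almost everywhere with a primitive. -/
lemma IsWeakDeriv.exists_isPrimitive [CompleteSpace E] {f g : ℝ → E} (h : IsWeakDeriv f g) :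
    ∃ F, IsPrimitive F g ∧ f =ᵐ[volume] F := by
  let G : ℝ → E := fun x => ∫ t in (0:ℝ)..x, g t
  have hi := h.2.1.intervalIntegrable'
  have hG : IsPrimitive G g := ⟨h.2.1, fun a b => by
    simp only [G]
    rw [intervalIntegral.integral_interval_sub_left (hi _ _) (hi _ _)]⟩
  have hG' := hG.isWeakDeriv
  have h0 : IsWeakDeriv (fun x => f x - G x) 0 := by
    refine ⟨h.1.sub hG'.1, locallyIntegrable_zero, fun φ hφ hc => ?_⟩
    have c1 := (hφ.continuous_deriv (by simp))
    simp only [smul_sub, Pi.zero_apply, smul_zero, integral_zero, neg_zero]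
    rw [integral_sub (integrable_smul_of_hasCompactSupport h.1 c1 hc.deriv)
      (integrable_smul_of_hasCompactSupport hG'.1 c1 hc.deriv), h.2.2 φ hφ hc, hG'.2.2 φ hφ hc,
      sub_self]
  obtain ⟨c, hc⟩ := h0.ae_const
  refine ⟨fun x => G x + c, ⟨h.2.1, fun a b => by rw [hG.integral_eq]; abel⟩, ?_⟩
  filter_upwards [hc] with x hx
  rw [← hx]; abel

lemma IsWeakDeriv.smul [CompleteSpace E] {f g : ℝ → E} {c c' : ℝ → ℝ} (h : IsWeakDeriv f g)
    (hc : IsPrimitive c c') :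
    IsWeakDeriv (fun x => c x • f x) (fun x => c x • g x + c' x • f x) := by
  obtain ⟨F, hF, hfF⟩ := h.exists_isPrimitive
  refine (hc.smul hF).isWeakDeriv.congr ?_ ?_ <;>
  · filter_upwards [hfF] with x hx
    rw [hx]

lemma IsWeakDeriv.sub [CompleteSpace E] {f g f₂ g₂ : ℝ → E} (h : IsWeakDeriv f g)
    (h₂ : IsWeakDeriv f₂ g₂) :
    IsWeakDeriv (fun x => f x - f₂ x) (fun x => g x - g₂ x) := by
  obtain ⟨F, hF, hfF⟩ := h.exists_isPrimitive
  obtain ⟨F₂, hF₂, hfF₂⟩ := h₂.exists_isPrimitive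
  refine (hF.sub hF₂).isWeakDeriv.congr ?_ .rfl
  filter_upwards [hfF, hfF₂] with x hx hx2
  rw [hx, hx2]

lemma MemHs.memLp {s : ℕ} {f : ℝ → E} (h : MemHs s f) : MemLp f 2 volume := by
  cases s with
  | zero => exact h
  | succ n => exact h.1

lemma MemHs.of_succ {s : ℕ} {f : ℝ → E} (h : MemHs (s + 1) f) : MemHs s f := by
  induction s generalizing f with
  | zero => exact h.1
  | succ n ih => exact ⟨h.1, h.2.choose, h.2.choose_spec.1, ih h.2.choose_spec.2⟩

lemma MemHs.congr {s : ℕ} {f f₂ : ℝ → E} (h : MemHs s f) (hf : f =ᵐ[volume] f₂) : MemHs s f₂ := by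
  cases s with
  | zero => exact MemLp.ae_eq hf h
  | succ n => exact ⟨h.1.ae_eq hf, h.2.choose, h.2.choose_spec.1.congr hf .rfl, h.2.choose_spec.2⟩

lemma MemHs.sub [CompleteSpace E] {s : ℕ} {f f₂ : ℝ → E} (h : MemHs s f) (h₂ : MemHs s f₂) :
    MemHs s (fun x => f x - f₂ x) := by
  induction s generalizing f f₂ with
  | zero => exact MemLp.sub h h₂
  | succ n ih =>
    obtain ⟨h0, g, hg, hn⟩ := h
    obtain ⟨h0', g', hg', hn'⟩ := h₂
    exact ⟨h0.sub h0', _, hg.sub hg', ih hn hn'⟩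

lemma MemHs.add [CompleteSpace E] {s : ℕ} {f f₂ : ℝ → E} (h : MemHs s f) (h₂ : MemHs s f₂) :
    MemHs s (fun x => f x + f₂ x) := by
  have h0 : MemHs s (fun _ : ℝ => (0 : E)) := by
    have := h.sub h
    simpa using this
  have := h.sub (h0.sub h₂)
  simpa using this

/-- `c` is bounded, together with its derivatives up to order `n`. -/
def BddDeriv : ℕ → (ℝ → ℝ) → Prop
  | 0, c => Continuous c ∧ ∃ C, ∀ x, |c x| ≤ C
  | n + 1, c => (∃ C, ∀ x, |c x| ≤ C) ∧ ∃ c', (∀ x, HasDerivAt c (c' x) x) ∧ BddDeriv n c'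

lemma BddDeriv.bdd {n : ℕ} {c : ℝ → ℝ} (h : BddDeriv n c) : ∃ C, ∀ x, |c x| ≤ C := by
  cases n with
  | zero => exact h.2
  | succ n => exact h.1

lemma BddDeriv.continuous {n : ℕ} {c : ℝ → ℝ} (h : BddDeriv n c) : Continuous c := by
  cases n with
  | zero => exact h.1
  | succ n =>
    obtain ⟨_, c', h1, _⟩ := h
    exact continuous_iff_continuousAt.2 fun x => (h1 x).continuousAt

lemma BddDeriv.of_succ {n : ℕ} {c : ℝ → ℝ} (h : BddDeriv (n + 1) c) : BddDeriv n c := by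
  induction n generalizing c with
  | zero => exact ⟨h.continuous, h.bdd⟩
  | succ n ih => exact ⟨h.1, h.2.choose, h.2.choose_spec.1, ih h.2.choose_spec.2⟩

lemma BddDeriv.add {n : ℕ} {c d : ℝ → ℝ} (hc : BddDeriv n c) (hd : BddDeriv n d) :
    BddDeriv n (fun x => c x + d x) := by
  have hb : ∃ C, ∀ x, |c x + d x| ≤ C := by
    obtain ⟨C, h1⟩ := hc.bdd
    obtain ⟨D, h2⟩ := hd.bdd
    exact ⟨C + D, fun x => (abs_add_le _ _).trans (add_le_add (h1 x) (h2 x))⟩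
  induction n generalizing c d with
  | zero => exact ⟨hc.1.add hd.1, hb⟩
  | succ n ih =>
    obtain ⟨_, c', c1, c2⟩ := hc
    obtain ⟨_, d', d1, d2⟩ := hd
    refine ⟨hb, _, fun x => (c1 x).add (d1 x), ih c2 d2 ?_⟩
    obtain ⟨C, h1⟩ := c2.bdd
    obtain ⟨D, h2⟩ := d2.bdd
    exact ⟨C + D, fun x => (abs_add_le _ _).trans (add_le_add (h1 x) (h2 x))⟩

lemma BddDeriv.mul {n : ℕ} {c d : ℝ → ℝ} (hc : BddDeriv n c) (hd : BddDeriv n d) :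
    BddDeriv n (fun x => c x * d x) := by
  have hb : ∀ {c d : ℝ → ℝ}, BddDeriv n c → BddDeriv n d → ∃ C, ∀ x, |c x * d x| ≤ C := by
    intro c d hc hd
    obtain ⟨C, h1⟩ := hc.bdd
    obtain ⟨D, h2⟩ := hd.bdd
    refine ⟨C * D, fun x => ?_⟩
    rw [abs_mul]
    exact mul_le_mul (h1 x) (h2 x) (abs_nonneg _) ((abs_nonneg _).trans (h1 0))
  induction n generalizing c d with
  | zero => exact ⟨hc.1.mul hd.1, hb hc hd⟩
  | succ n ih =>
    have hc0 := hc.of_succ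
    have hd0 := hd.of_succ
    have := hb hc hd
    obtain ⟨_, c', c1, c2⟩ := hc
    obtain ⟨_, d', d1, d2⟩ := hd
    refine ⟨this, _, fun x => (c1 x).mul (d1 x), ?_⟩
    have hb' : ∀ {c d : ℝ → ℝ}, BddDeriv n c → BddDeriv n d → ∃ C, ∀ x, |c x * d x| ≤ C := by
      intro c d hc hd
      obtain ⟨C, h1⟩ := hc.bdd
      obtain ⟨D, h2⟩ := hd.bdd
      refine ⟨C * D, fun x => ?_⟩
      rw [abs_mul]
      exact mul_le_mul (h1 x) (h2 x) (abs_nonneg _) ((abs_nonneg _).trans (h1 0))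
    exact (ih c2 hd0 hb').add (ih hc0 d2 hb')

lemma bddDeriv_const (n : ℕ) (a : ℝ) : BddDeriv n (fun _ => a) := by
  induction n generalizing a with
  | zero => exact ⟨continuous_const, |a|, fun _ => le_rfl⟩
  | succ n ih => exact ⟨⟨|a|, fun _ => le_rfl⟩, _, fun x => hasDerivAt_const x a, ih 0⟩

/-- Used with `c` the logarithmic derivative of the exponential weight, which is bounded with all
its derivatives although the weight is not. -/
lemma MemHs.mul [CompleteSpace E] {n : ℕ} {c : ℝ → ℝ} {f : ℝ → E} (hc : BddDeriv n c)
    (hf : MemHs n f) : MemHs n (fun x => c x • f x) := by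
  have hL : MemLp (fun x => c x • f x) 2 volume := by
    obtain ⟨C, hC⟩ := hc.bdd
    refine (hf.memLp.const_smul C).mono
      (hc.continuous.aestronglyMeasurable.smul hf.memLp.aestronglyMeasurable)
      (Eventually.of_forall fun x => ?_)
    rw [norm_smul, Pi.smul_apply, norm_smul, Real.norm_eq_abs, Real.norm_eq_abs]
    exact mul_le_mul_of_nonneg_right ((hC x).trans (le_abs_self _)) (norm_nonneg _)
  induction n generalizing c f with
  | zero => exact hL
  | succ n ih =>
    have hc0 := hc.of_succ
    have hf0 := hf.of_succ
    obtain ⟨_, c', c1, c2⟩ := hc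
    obtain ⟨_, g, hg, hn⟩ := hf
    refine ⟨hL, _, hg.smul (IsPrimitive.of_hasDerivAt c1 c2.continuous), ?_⟩
    have aux : ∀ {c : ℝ → ℝ} {f : ℝ → E}, BddDeriv n c → MemHs n f →
        MemLp (fun x => c x • f x) 2 volume := by
      intro c f hc hf
      obtain ⟨C, hC⟩ := hc.bdd
      refine (hf.memLp.const_smul C).mono
        (hc.continuous.aestronglyMeasurable.smul hf.memLp.aestronglyMeasurable)
        (Eventually.of_forall fun x => ?_)
      rw [norm_smul, Pi.smul_apply, norm_smul, Real.norm_eq_abs, Real.norm_eq_abs]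
      exact mul_le_mul_of_nonneg_right ((hC x).trans (le_abs_self _)) (norm_nonneg _)
    exact (ih hc0 hn (aux hc0 hn)).add (ih c2 hf0 (aux c2 hf0))

/-! ### The exponential weight -/

lemma hasDerivAt_japanese (x : ℝ) :
    HasDerivAt (fun x => Real.sqrt (x ^ 2 + 1)) (x / Real.sqrt (x ^ 2 + 1)) x := by
  have h : HasDerivAt (fun x : ℝ => x ^ 2 + 1) (2 * x) x := by
    simpa using (hasDerivAt_pow 2 x).add_const 1
  convert h.sqrt (by positivity) using 1
  field_simp

/-- The derivative `x / ⟨x⟩` of the Japanese bracket. -/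
def japaneseDeriv (x : ℝ) : ℝ := x / Real.sqrt (x ^ 2 + 1)

lemma abs_japaneseDeriv_le (x : ℝ) : |japaneseDeriv x| ≤ 1 := by
  have h : 0 < Real.sqrt (x ^ 2 + 1) := Real.sqrt_pos.2 (by positivity)
  rw [japaneseDeriv, abs_div, abs_of_pos h, div_le_one h]
  exact Real.abs_le_sqrt (by linarith)

lemma hasDerivAt_inv_japanese (x : ℝ) : HasDerivAt (fun x => (Real.sqrt (x ^ 2 + 1))⁻¹)
    (-1 * (japaneseDeriv x * ((Real.sqrt (x ^ 2 + 1))⁻¹ * (Real.sqrt (x ^ 2 + 1))⁻¹))) x := by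
  have h : 0 < Real.sqrt (x ^ 2 + 1) := Real.sqrt_pos.2 (by positivity)
  refine ((hasDerivAt_japanese x).inv h.ne').congr_deriv ?_
  unfold japaneseDeriv
  field_simp

lemma hasDerivAt_japaneseDeriv (x : ℝ) : HasDerivAt japaneseDeriv
    ((Real.sqrt (x ^ 2 + 1))⁻¹ * ((Real.sqrt (x ^ 2 + 1))⁻¹ * (Real.sqrt (x ^ 2 + 1))⁻¹)) x := by
  have h : 0 < Real.sqrt (x ^ 2 + 1) := Real.sqrt_pos.2 (by positivity)
  have h2 : Real.sqrt (x ^ 2 + 1) ^ 2 = x ^ 2 + 1 := Real.sq_sqrt (by positivity)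
  refine ((hasDerivAt_id' x).div (hasDerivAt_japanese x) h.ne').congr_deriv ?_
  field_simp
  rw [h2]; ring

/-- The two functions are handled together because the pair `x/⟨x⟩`, `1/⟨x⟩` is closed under
differentiation up to products and constants. -/
lemma bddDeriv_japanese (n : ℕ) :
    BddDeriv n japaneseDeriv ∧ BddDeriv n (fun x => (Real.sqrt (x ^ 2 + 1))⁻¹) := by
  have hb : ∃ C, ∀ x : ℝ, |(Real.sqrt (x ^ 2 + 1))⁻¹| ≤ C := by
    refine ⟨1, fun x => ?_⟩
    have h : 1 ≤ Real.sqrt (x ^ 2 + 1) := Real.one_le_sqrt.2 (by nlinarith [sq_nonneg x])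
    rw [abs_of_nonneg (by positivity)]
    exact inv_le_one_of_one_le₀ h
  induction n with
  | zero =>
    exact ⟨⟨continuous_iff_continuousAt.2 fun x => (hasDerivAt_japaneseDeriv x).continuousAt, 1,
      abs_japaneseDeriv_le⟩,
      ⟨continuous_iff_continuousAt.2 fun x => (hasDerivAt_inv_japanese x).continuousAt, hb⟩⟩
  | succ n ih =>
    exact ⟨⟨⟨1, abs_japaneseDeriv_le⟩, _, hasDerivAt_japaneseDeriv, ih.2.mul (ih.2.mul ih.2)⟩,
      ⟨hb, _, hasDerivAt_inv_japanese, (bddDeriv_const n _).mul (ih.1.mul (ih.2.mul ih.2))⟩⟩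

lemma expWeight_pos (ε δ x : ℝ) : 0 < expWeight ε δ x := Real.exp_pos _

lemma hasDerivAt_expWeight (ε δ x : ℝ) : HasDerivAt (expWeight ε δ)
    (δ * ε * japaneseDeriv x * expWeight ε δ x) x := by
  have := ((hasDerivAt_japanese x).const_mul (δ * ε)).exp
  exact this.congr_deriv (mul_comm _ _)

lemma continuous_expWeight (ε δ : ℝ) : Continuous (expWeight ε δ) :=
  continuous_iff_continuousAt.2 fun x => (hasDerivAt_expWeight ε δ x).continuousAt

lemma expWeight_mul_neg (ε δ x : ℝ) : expWeight ε (-δ) x * expWeight ε δ x = 1 := by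
  rw [expWeight, expWeight, ← Real.exp_add]
  simp

/-- The iterated weak derivatives of a function of `H^s_{ε,δ}` exist and belong to the weighted
`L²` space. -/
lemma MemWeightedHs.iterate [CompleteSpace E] {ε δ : ℝ} {s : ℕ} {f : ℝ → E}
    (h : MemWeightedHs ε δ s f) :
    (∀ k ≤ s, MemLp (fun x => expWeight ε δ x • (weakDeriv^[k] f) x) 2 volume) ∧
    ∀ k < s, IsWeakDeriv (weakDeriv^[k] f) (weakDeriv^[k + 1] f) := by
  induction s generalizing f with
  | zero =>
    refine ⟨fun k hk => ?_, fun k hk => absurd hk (Nat.not_lt_zero k)⟩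
    rw [Nat.le_zero.1 hk]
    exact h.memLp
  | succ n ih =>
    have hw : IsPrimitive (expWeight ε (-δ)) (fun x => -δ * ε * japaneseDeriv x * expWeight ε (-δ) x) :=
      IsPrimitive.of_hasDerivAt (hasDerivAt_expWeight ε (-δ))
        ((continuous_const.mul (bddDeriv_japanese 0).1.1).mul (continuous_expWeight _ _))
    have h0 := h.of_succ
    obtain ⟨hL, g, hg, hn⟩ := h
    have h1 := hg.smul hw
    have e : (fun x => expWeight ε (-δ) x • expWeight ε δ x • f x) = f := by
      funext x
      rw [smul_smul, expWeight_mul_neg, one_smul]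
    rw [e] at h1
    -- With `p` the weight, `p f' = (p f)' - δ ε (x/⟨x⟩) (p f)`: the weighted derivative differs
    -- from the derivative of the weighted function by a smooth bounded multiple of the latter.
    have h2 : MemWeightedHs ε δ n (weakDeriv f) := by
      have h3 := hn.sub (MemHs.mul ((bddDeriv_const n (δ * ε)).mul (bddDeriv_japanese n).1) h0)
      refine MemHs.congr h3 ?_
      filter_upwards [h1.weakDeriv_ae] with x hx
      have h4 := expWeight_mul_neg ε δ x
      rw [hx, smul_add]
      simp only [smul_smul]
      rw [mul_comm (expWeight ε δ x) (expWeight ε (-δ) x), h4, one_smul, sub_eq_add_neg,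
        ← neg_smul]
      congr 2
      linear_combination (-(δ * ε * japaneseDeriv x * expWeight ε δ x)) * (-h4)
    obtain ⟨i1, i2⟩ := ih h2
    refine ⟨fun k hk => ?_, fun k hk => ?_⟩
    · cases k with
      | zero => exact hL
      | succ k => exact i1 k (by omega)
    · cases k with
      | zero => exact h1.isWeakDeriv_weakDeriv
      | succ k => exact i2 k (by omega)

end WeakDeriv

/-! ## Integration by parts with a degenerate symmetric operator -/

section Translation

variable {H : Type*} [NormedAddCommGroup H] [InnerProductSpace ℝ H]

lemma _root_.MeasureTheory.MemLp.integrable_inner_two {X : Type*} [MeasurableSpace X]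
    {μ : Measure X} {u v : X → H} (hu : MemLp u 2 μ) (hv : MemLp v 2 μ) :
    Integrable (fun x => ⟪u x, v x⟫_ℝ) μ := by
  refine (hu.norm.integrable_mul hv.norm).mono
    (hu.aestronglyMeasurable.inner hv.aestronglyMeasurable) (Eventually.of_forall fun x => ?_)
  rw [Pi.mul_apply, norm_mul, norm_norm, norm_norm]
  exact norm_inner_le_norm _ _

/-- The cross-correlation of two square-integrable functions is continuous. -/
lemma continuous_crossCorrelation {u v : ℝ → H} (hu : MemLp u 2 volume) (hv : MemLp v 2 volume) :
    Continuous fun s => ∫ x, ⟪u x, v (s + x)⟫_ℝ := by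
  have : Fact ((2 : ENNReal) ≠ ⊤) := ⟨by simp⟩
  have h1 : Continuous fun s : ℝ => (DomAddAct.mk s) +ᵥ hv.toLp v := by
    have : Continuous fun p : ℝᵈᵃᵃ × Lp H 2 (volume : Measure ℝ) => p.1 +ᵥ p.2 := continuous_vadd
    exact this.comp ((DomAddAct.continuous_mk).prodMk continuous_const)
  have h2 := (continuous_const (y := hu.toLp u)).inner (𝕜 := ℝ) h1
  refine h2.congr fun s => ?_
  rw [L2.inner_def]
  refine integral_congr_ae ?_
  rw [DomAddAct.mk_vadd_toLp]
  filter_upwards [hu.coeFn_toLp,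
    (hv.comp_measurePreserving <| measurePreserving_vadd s volume).coeFn_toLp] with x h3 h4
  rw [h3]
  exact congrArg _ h4

omit [InnerProductSpace ℝ H] in
lemma _root_.MeasureTheory.MemLp.comp_add {u : ℝ → H} (hu : MemLp u 2 volume) (s : ℝ) :
    MemLp (fun x => u (x + s)) 2 volume :=
  hu.comp_measurePreserving (measurePreserving_add_right volume s)

/-- If `W` and `(A W)'` are square integrable, with `A` symmetric, then `∫ ⟪(A W)', W⟫ = 0`,
whether or not `W` itself is differentiable. -/
lemma integral_inner_deriv_eq_zero [CompleteSpace H] {A : H →L[ℝ] H}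
    (hA : ∀ x y, ⟪A x, y⟫_ℝ = ⟪x, A y⟫_ℝ) {W Y Y' : ℝ → H} (hW : MemLp W 2 volume)
    (hY : IsPrimitive Y Y') (hY' : MemLp Y' 2 volume) (hYW : Y =ᵐ[volume] fun x => A (W x)) :
    ∫ x, ⟪Y' x, W x⟫_ℝ = 0 := by
  -- Genuine measurability, rather than almost everywhere, gives joint measurability of `Φ` in `(x,
  -- t)` for Fubini below.
  wlog hmeas : StronglyMeasurable W ∧ StronglyMeasurable Y' generalizing W Y'
  · have e1 := hW.aestronglyMeasurable.ae_eq_mk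
    have e2 := hY'.aestronglyMeasurable.ae_eq_mk
    have := this (hW.ae_eq e1) (hY.congr_deriv e2) (hY'.ae_eq e2)
      (hYW.trans (e1.mono fun x hx => by simp only [hx]))
      ⟨hW.aestronglyMeasurable.stronglyMeasurable_mk, hY'.aestronglyMeasurable.stronglyMeasurable_mk⟩
    rw [← this]
    refine integral_congr_ae ?_
    filter_upwards [e1, e2] with x h1 h2
    rw [← h1, ← h2]
  obtain ⟨mW, mY⟩ := hmeas
  set c : ℝ → ℝ := fun s => ∫ x, ⟪Y' x, W (s + x)⟫_ℝ with hc
  have cc : Continuous c := continuous_crossCorrelation hY' hW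
  have hc0 : ∫ x, ⟪Y' x, W x⟫_ℝ = c 0 := by simp [hc]
  rw [hc0]
  -- This says that the cross-correlation `c` has zero integral over `(-h, h)`. By Fubini the
  -- integral is that of `⟪Y(x+h) - Y(x), W(x+h) + W(x)⟫`. Continuity of `c` then forces `c 0 = 0`.
  have key : ∀ h : ℝ, 0 < h → ∫ t in (0:ℝ)..h, (c (h - t) + c (-t)) = 0 := by
    intro h hh
    let Φ : ℝ → ℝ → ℝ := fun x t => ⟪Y' (x + t), W (x + h) + W x⟫_ℝ
    have i0 : ∀ t, ∫ x, Φ x t = c (h - t) + c (-t) := by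
      intro t
      have e1 : ∀ s, c s = ∫ x, ⟪Y' (x + t), W (x + t + s)⟫_ℝ := by
        intro s
        rw [integral_add_right_eq_self (fun x => ⟪Y' x, W (x + s)⟫_ℝ) t]
        simp only [hc, add_comm]
      rw [e1, e1, ← integral_add ((hY'.comp_add t).integrable_inner_two ?_)
        ((hY'.comp_add t).integrable_inner_two ?_)]
      · refine integral_congr_ae (Eventually.of_forall fun x => ?_)
        simp only [Φ]
        rw [← inner_add_right]
        congr 3 <;> ring
      · have := hW.comp_add (t + (h - t))
        simpa only [add_assoc] using this
      · have := hW.comp_add (t + (-t))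
        simpa only [add_assoc] using this
    have hV : MemLp (fun x => W (x + h) + W x) 2 volume := (hW.comp_add h).add hW
    have i1 : Integrable (Function.uncurry Φ) (volume.prod (volume.restrict (Set.Ioc 0 h))) := by
      have hm : AEStronglyMeasurable (Function.uncurry Φ)
          (volume.prod (volume.restrict (Set.Ioc 0 h))) := by
        refine StronglyMeasurable.aestronglyMeasurable ?_
        refine StronglyMeasurable.inner (mY.comp_measurable (by fun_prop)) ?_
        exact (mW.comp_measurable (by fun_prop)).add (mW.comp_measurable (by fun_prop))
      rw [integrable_prod_iff' hm]
      refine ⟨Eventually.of_forall fun t => (hY'.comp_add t).integrable_inner_two hV, ?_⟩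
      have hb : ∀ t, ∫ x, ‖Function.uncurry Φ (x, t)‖ ≤
          (∫ x, ‖Y' x‖ ^ 2) + ∫ x, ‖W (x + h) + W x‖ ^ 2 := by
        intro t
        have j1 := ((hY'.comp_add t).integrable_norm_pow (p := 2) (by simp))
        have j2 := (hV.integrable_norm_pow (p := 2) (by simp))
        rw [← integral_add_right_eq_self (fun x => ‖Y' x‖ ^ 2) t, ← integral_add j1 j2]
        refine integral_mono_of_nonneg (Eventually.of_forall fun x => norm_nonneg _) (j1.add j2)
          (Eventually.of_forall fun x => ?_)
        have := norm_inner_le_norm (𝕜 := ℝ) (Y' (x + t)) (W (x + h) + W x)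
        simp only [Φ, Function.uncurry]
        nlinarith [sq_nonneg (‖Y' (x + t)‖ - ‖W (x + h) + W x‖),
          sq_nonneg (‖Y' (x + t)‖ + ‖W (x + h) + W x‖), norm_nonneg (Y' (x + t))]
      refine (integrable_const ((∫ x, ‖Y' x‖ ^ 2) + ∫ x, ‖W (x + h) + W x‖ ^ 2)).mono
        hm.norm.prod_swap.integral_prod_right' (Eventually.of_forall fun t => ?_)
      rw [Real.norm_of_nonneg (integral_nonneg fun _ => norm_nonneg _)]
      exact (hb t).trans (le_abs_self _)
    have e2 : ∫ t in (0:ℝ)..h, (c (h - t) + c (-t)) = ∫ x, ∫ t in (0:ℝ)..h, Φ x t := by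
      simp only [intervalIntegral.integral_of_le hh.le]
      rw [integral_integral_swap i1]
      simp only [i0]
    rw [e2]
    have e3 : ∀ x, ∫ t in (0:ℝ)..h, Φ x t = ⟪Y (x + h) - Y x, W (x + h) + W x⟫_ℝ := by
      intro x
      have h1 : Y (x + h) - Y x = ∫ t in (0:ℝ)..h, Y' (x + t) := by
        rw [intervalIntegral.integral_comp_add_left, ← hY.integral_eq, add_zero]
      rw [h1]
      have h2 : IntervalIntegrable (fun t => Y' (x + t)) volume 0 h := by
        have := (hY.intervalIntegrable (x + 0) (x + h)).comp_add_left x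
        simpa using this
      have := ((innerSL ℝ).flip (W (x + h) + W x)).intervalIntegral_comp_comm h2
      simp only [ContinuousLinearMap.flip_apply, innerSL_apply_apply] at this
      exact this
    simp only [e3]
    have iq : Integrable fun x => ⟪Y x, W x⟫_ℝ := by
      refine (MemLp.integrable_inner_two (A.comp_memLp' hW) hW).congr ?_
      filter_upwards [hYW] with x hx
      rw [hx]; rfl
    -- Symmetry of `A` cancels the cross terms, leaving a difference of translates whose integral is
    -- zero.
    have e4 : ∀ᵐ x, ⟪Y (x + h) - Y x, W (x + h) + W x⟫_ℝ
        = ⟪Y (x + h), W (x + h)⟫_ℝ - ⟪Y x, W x⟫_ℝ := by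
      have hs : ∀ᵐ x, Y (x + h) = A (W (x + h)) :=
        (measurePreserving_add_right volume h).quasiMeasurePreserving.ae hYW
      filter_upwards [hYW, hs] with x h1 h2
      rw [h1, h2, inner_sub_left, inner_add_right, inner_add_right, hA (W (x + h)) (W x),
        real_inner_comm (A (W x)) (W (x + h))]
      ring
    rw [integral_congr_ae e4, integral_sub (iq.comp_add_right h) iq,
      integral_add_right_eq_self (fun x => ⟪Y x, W x⟫_ℝ) h, sub_self]
  by_contra hne
  have hpos : 0 < |c 0| := abs_pos.2 hne
  obtain ⟨d, hd, hcd⟩ := Metric.continuousAt_iff.1 (cc.continuousAt (x := 0)) (|c 0| / 2) (by linarith)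
  have hk := key (d / 2) (by linarith)
  have hint : ∫ t in (0:ℝ)..(d / 2), (c (d / 2 - t) + c (-t) - 2 * c 0) = - (d * c 0) := by
    rw [intervalIntegral.integral_sub, hk, intervalIntegral.integral_const]
    · simp; ring
    · exact Continuous.intervalIntegrable (by fun_prop) _ _
    · exact continuous_const.intervalIntegrable _ _
  have hle : ‖∫ t in (0:ℝ)..(d / 2), (c (d / 2 - t) + c (-t) - 2 * c 0)‖
      ≤ (|c 0| / 2 + |c 0| / 2 ) * |d / 2 - 0| := by
    refine intervalIntegral.norm_integral_le_of_norm_le_const fun t ht => ?_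
    rw [Set.uIoc_of_le (by linarith)] at ht
    have h1 := hcd (x := d / 2 - t) (by
      rw [dist_zero_right, Real.norm_eq_abs, abs_lt]; constructor <;> linarith [ht.1, ht.2])
    have h2 := hcd (x := -t) (by
      rw [dist_zero_right, Real.norm_eq_abs, abs_lt]; constructor <;> linarith [ht.1, ht.2])
    rw [Real.dist_eq] at h1 h2
    rw [Real.norm_eq_abs]
    have : c (d / 2 - t) + c (-t) - 2 * c 0 = (c (d / 2 - t) - c 0) + (c (-t) - c 0) := by ring
    rw [this]
    exact (abs_add_le _ _).trans (by linarith)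
  rw [hint, norm_neg, Real.norm_eq_abs, abs_mul, abs_of_pos hd, sub_zero,
    abs_of_pos (by linarith : 0 < d / 2)] at hle
  nlinarith

end Translation

/-! ## Weighted measures on the line -/

section WeightedMeasure

variable {E : Type*} [NormedAddCommGroup E] [NormedSpace ℝ E]

/-- The measure `w(x) dx`. -/
def weightedMeasure (w : ℝ → ℝ) : Measure ℝ := volume.withDensity fun x => ENNReal.ofReal (w x)

variable {w : ℝ → ℝ}

lemma integral_weightedMeasure (hc : Continuous w) (hw : ∀ x, 0 < w x) (f : ℝ → E) :
    ∫ x, f x ∂weightedMeasure w = ∫ x, w x • f x := by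
  rw [weightedMeasure, integral_withDensity_eq_integral_toReal_smul hc.measurable.ennreal_ofReal
    (Eventually.of_forall fun x => ENNReal.ofReal_lt_top)]
  simp only [ENNReal.toReal_ofReal (hw _).le]

lemma integrable_weightedMeasure_iff (hc : Continuous w) (hw : ∀ x, 0 < w x) {f : ℝ → E} :
    Integrable f (weightedMeasure w) ↔ Integrable (fun x => w x • f x) := by
  rw [weightedMeasure, integrable_withDensity_iff_integrable_smul' hc.measurable.ennreal_ofReal
    (Eventually.of_forall fun x => ENNReal.ofReal_lt_top)]
  simp only [ENNReal.toReal_ofReal (hw _).le]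

lemma weightedMeasure_ac : weightedMeasure w ≪ volume := withDensity_absolutelyContinuous _ _

lemma ac_weightedMeasure (hc : Continuous w) (hw : ∀ x, 0 < w x) : volume ≪ weightedMeasure w :=
  withDensity_absolutelyContinuous' hc.measurable.ennreal_ofReal.aemeasurable
    (Eventually.of_forall fun x => by simpa using hw x)

lemma ae_weightedMeasure {p : ℝ → Prop} (h : ∀ᵐ x, p x) : ∀ᵐ x ∂weightedMeasure w, p x :=
  weightedMeasure_ac.ae_le h

lemma memLp_weightedMeasure_iff (hc : Continuous w) (hw : ∀ x, 0 < w x) {f : ℝ → E} :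
    MemLp f 2 (weightedMeasure fun x => w x ^ 2) ↔ MemLp (fun x => w x • f x) 2 volume := by
  have hc2 : Continuous fun x => w x ^ 2 := hc.pow 2
  have hw2 : ∀ x, 0 < w x ^ 2 := fun x => pow_pos (hw x) 2
  have key : AEStronglyMeasurable f volume →
      (MemLp f 2 (weightedMeasure fun x => w x ^ 2) ↔ MemLp (fun x => w x • f x) 2 volume) := by
    intro hf
    rw [memLp_two_iff_integrable_sq_norm (hf.mono_ac weightedMeasure_ac),
      memLp_two_iff_integrable_sq_norm (f := fun x => w x • f x)
        (hc.aestronglyMeasurable.smul hf),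
      integrable_weightedMeasure_iff hc2 hw2]
    simp only [norm_smul, mul_pow, Real.norm_eq_abs, sq_abs, smul_eq_mul]
  refine ⟨fun h => (key (h.aestronglyMeasurable.mono_ac (ac_weightedMeasure hc2 hw2))).1 h,
    fun h => (key ?_).2 h⟩
  have h1 : AEStronglyMeasurable (fun x => (w x)⁻¹ • w x • f x) volume :=
    (hc.inv₀ fun x => (hw x).ne').aestronglyMeasurable.smul h.aestronglyMeasurable
  refine h1.congr (Eventually.of_forall fun x => ?_)
  simp only
  rw [smul_smul, inv_mul_cancel₀ (hw x).ne', one_smul]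

lemma integral_sq_weightedMeasure (hc : Continuous w) (hw : ∀ x, 0 < w x) {f : ℝ → E}
    (hf : MemLp (fun x => w x • f x) 2 volume) :
    ∫ x, ‖f x‖ ^ 2 ∂weightedMeasure (fun x => w x ^ 2)
      = (eLpNorm (fun x => w x • f x) 2 volume).toReal ^ 2 := by
  rw [integral_weightedMeasure (w := fun x => w x ^ 2) (hc.pow 2) (fun x => pow_pos (hw x) 2)]
  have h1 : (eLpNorm (fun x => w x • f x) 2 volume).toReal ^ 2 = ∫ x, ‖w x • f x‖ ^ 2 := by
    rw [hf.eLpNorm_eq_integral_rpow_norm (by simp) (by simp), ENNReal.toReal_ofReal (by positivity)]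
    simp only [ENNReal.toReal_ofNat, Real.rpow_two]
    rw [← Real.rpow_natCast, ← Real.rpow_mul (integral_nonneg fun _ => by positivity)]
    norm_num
  rw [h1]
  simp only [norm_smul, mul_pow, Real.norm_eq_abs, sq_abs, smul_eq_mul]

/-- `w` is a positive continuous weight whose logarithm is `2 η`-Lipschitz. -/
structure SlowWeight (w w' : ℝ → ℝ) (η : ℝ) : Prop where
  isPrimitive : IsPrimitive w w'
  pos : ∀ x, 0 < w x
  deriv_le : ∀ᵐ x, |w' x| ≤ 2 * η * w x

lemma SlowWeight.continuous {w w' : ℝ → ℝ} {η : ℝ} (h : SlowWeight w w' η) : Continuous w :=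
  h.isPrimitive.continuous

lemma SlowWeight.integral_deriv {w w' : ℝ → ℝ} {η : ℝ} (h : SlowWeight w w' η) {F f : ℝ → ℝ}
    (hF : IsPrimitive F f) (iF : Integrable F (weightedMeasure w))
    (iff' : Integrable f (weightedMeasure w)) :
    Integrable (fun x => w x * F x) ∧ Integrable (fun x => w x * f x + w' x * F x) ∧
      IsPrimitive (fun x => w x * F x) (fun x => w x * f x + w' x * F x) := by
  rw [integrable_weightedMeasure_iff h.continuous h.pos] at iF iff'
  refine ⟨iF, iff'.add ?_, h.isPrimitive.mul hF⟩
  refine (iF.norm.const_mul (2 * η)).mono'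
    (h.isPrimitive.locallyIntegrable.aestronglyMeasurable.mul hF.continuous.aestronglyMeasurable) ?_
  filter_upwards [h.deriv_le] with x hx
  rw [norm_mul, norm_smul, Real.norm_eq_abs, Real.norm_eq_abs, Real.norm_eq_abs, abs_of_pos (h.pos x),
    ← mul_assoc]
  exact mul_le_mul_of_nonneg_right hx (abs_nonneg _)

/-- Integrating `(w F)'` over the line trades `∫ w f` for `-∫ w' F`. In a slow weight an exact
derivative therefore costs only the factor `2 η`; this is the integration by parts behind the
weighted energy estimates. -/
lemma SlowWeight.abs_integral_deriv_le {w w' : ℝ → ℝ} {η : ℝ} (h : SlowWeight w w' η) {F f : ℝ → ℝ}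
    (hF : IsPrimitive F f) (iF : Integrable F (weightedMeasure w))
    (iff' : Integrable f (weightedMeasure w)) :
    |∫ x, f x ∂weightedMeasure w| ≤ 2 * η * ∫ x, |F x| ∂weightedMeasure w := by
  obtain ⟨i1, i2, hp⟩ := h.integral_deriv hF iF iff'
  have h0 := hp.integral_eq_zero i1 i2
  have i3 : Integrable fun x => w x * f x := by
    simpa using (integrable_weightedMeasure_iff h.continuous h.pos).1 iff'
  have i4 : Integrable fun x => w' x * F x := by
    refine (i2.sub i3).congr (Eventually.of_forall fun x => ?_)
    simp
  rw [integral_add i3 i4] at h0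
  rw [integral_weightedMeasure h.continuous h.pos, integral_weightedMeasure h.continuous h.pos]
  simp only [smul_eq_mul]
  rw [eq_neg_of_add_eq_zero_left h0, abs_neg, ← integral_const_mul]
  refine (abs_integral_le_integral_abs).trans (integral_mono_ae i4.abs ?_ ?_)
  · refine Integrable.const_mul ?_ _
    refine i1.abs.congr (Eventually.of_forall fun x => ?_)
    simp only [abs_mul, abs_of_pos (h.pos x)]
  · filter_upwards [h.deriv_le] with x hx
    rw [abs_mul, ← mul_assoc]
    exact mul_le_mul_of_nonneg_right hx (abs_nonneg _)

/-- The weight `e^{-2 η |x - a|}`. -/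
def peakWeight (η a x : ℝ) : ℝ := Real.exp (-(2 * η) * |x - a|)

lemma peakWeight_pos (η a x : ℝ) : 0 < peakWeight η a x := Real.exp_pos _

lemma continuous_peakWeight (η a : ℝ) : Continuous (peakWeight η a) := by
  unfold peakWeight; fun_prop

lemma hasDerivAt_peakWeight {η a x : ℝ} (hx : x ≠ a) :
    HasDerivAt (peakWeight η a) (-(2 * η) * SignType.sign (x - a) * peakWeight η a x) x := by
  have h1 : HasDerivAt (fun y => |y - a|) (SignType.sign (x - a) : ℝ) x := by
    exact ((hasDerivAt_abs (sub_ne_zero.2 hx)).comp x ((hasDerivAt_id' x).sub_const a)).congr_deriv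
      (mul_one _)
  exact (h1.const_mul (-(2 * η))).exp.congr_deriv (mul_comm _ _)

lemma slowWeight_peakWeight {η : ℝ} (hη : 0 ≤ η) (a : ℝ) :
    SlowWeight (peakWeight η a)
      (fun x => -(2 * η) * SignType.sign (x - a) * peakWeight η a x) η := by
  have hb : ∀ x, |-(2 * η) * (SignType.sign (x - a) : ℝ) * peakWeight η a x|
      ≤ 2 * η * peakWeight η a x := by
    intro x
    rw [abs_mul, abs_mul, abs_neg, abs_of_nonneg (by linarith : 0 ≤ 2 * η),
      abs_of_pos (peakWeight_pos _ _ _)]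
    refine mul_le_mul_of_nonneg_right ?_ (peakWeight_pos _ _ _).le
    refine mul_le_of_le_one_right (by linarith) ?_
    rcases lt_trichotomy (x - a) 0 with h | h | h <;> simp [h]
  have hm : Measurable fun x : ℝ => ((SignType.sign (x - a) : SignType) : ℝ) := by
    have e : (fun x : ℝ => ((SignType.sign (x - a) : SignType) : ℝ))
        = fun x => if x < a then -1 else if x = a then 0 else 1 := by
      funext x
      rcases lt_trichotomy x a with h | h | h
      · simp [h]
      · simp [h]
      · simp [h, h.not_gt, h.ne']
    rw [e]
    exact Measurable.ite measurableSet_Iio measurable_const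
      (Measurable.ite (measurableSet_singleton a) measurable_const measurable_const)
  have hl : LocallyIntegrable (fun x => -(2 * η) * (SignType.sign (x - a) : ℝ) * peakWeight η a x)
      volume := by
    have h1 : LocallyIntegrable (fun x => 2 * η * peakWeight η a x) volume :=
      (continuous_const.mul (continuous_peakWeight η a)).locallyIntegrable
    refine h1.mono ((measurable_const.mul hm).mul
      (continuous_peakWeight η a).measurable).aestronglyMeasurable (Eventually.of_forall fun x => ?_)
    rw [Real.norm_eq_abs, Real.norm_eq_abs]
    exact (hb x).trans (le_abs_self _)
  refine ⟨⟨hl, fun x y => ?_⟩, peakWeight_pos _ _, Eventually.of_forall hb⟩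
  exact integral_eq_of_hasDerivAt_off_countable _ _ (Set.countable_singleton a)
    (continuous_peakWeight η a).continuousOn (fun t ht => hasDerivAt_peakWeight (by simpa using ht.2))
    (hl.intervalIntegrable' _ _)

lemma isFiniteMeasure_peakWeight {η : ℝ} (hη : 0 < η) (a : ℝ) :
    IsFiniteMeasure (weightedMeasure (peakWeight η a)) := by
  have h0 : Integrable (fun x => peakWeight η 0 x) := by
    rw [← integrableOn_univ, ← Set.Iic_union_Ioi (a := 0)]
    refine IntegrableOn.union ?_ ?_
    · refine (integrableOn_exp_mul_Iic (by linarith : 0 < 2 * η) 0).congr_fun (fun x hx => ?_)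
        measurableSet_Iic
      simp only [peakWeight, sub_zero, abs_of_nonpos (Set.mem_Iic.1 hx)]
      ring_nf
    · refine (integrableOn_exp_mul_Ioi (by linarith : -(2 * η) < 0) 0).congr_fun (fun x hx => ?_)
        measurableSet_Ioi
      simp only [peakWeight, sub_zero, abs_of_pos (Set.mem_Ioi.1 hx)]
  have h1 : Integrable (fun x => peakWeight η a x) := by
    refine (h0.comp_sub_right a).congr (Eventually.of_forall fun x => ?_)
    simp [peakWeight]
  exact isFiniteMeasure_withDensity_ofReal h1.2

/-- Point evaluation in terms of integrals against the peaked weight. -/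
lemma two_mul_eval_sub_le {η : ℝ} (hη : 0 < η) (a : ℝ) {F f : ℝ → ℝ} (hF : IsPrimitive F f)
    (iF : Integrable F (weightedMeasure (peakWeight η a)))
    (iff' : Integrable f (weightedMeasure (peakWeight η a))) :
    |2 * F a - 2 * η * ∫ x, F x ∂weightedMeasure (peakWeight η a)|
      ≤ ∫ x, |f x| ∂weightedMeasure (peakWeight η a) := by
  have h := slowWeight_peakWeight hη.le a
  obtain ⟨i1, i2, hp⟩ := h.integral_deriv hF iF iff'
  have i3 : Integrable fun x => peakWeight η a x * f x := by
    simpa using (integrable_weightedMeasure_iff h.continuous h.pos).1 iff'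
  -- The weight has a corner at `a`: integrating `(w F)'` on each half-line separately produces `F
  -- a` twice, since `w a = 1`.
  have h1 := hp.integral_Ioi i1 i2 a
  have h2 := hp.integral_Iic i1 i2 a
  have ea : peakWeight η a a = 1 := by simp [peakWeight]
  rw [ea, one_mul] at h1 h2
  have h1' : ∫ x in Set.Ioi a, (peakWeight η a x * f x - 2 * η * (peakWeight η a x * F x)) = -F a := by
    rw [← h1]
    refine setIntegral_congr_fun measurableSet_Ioi fun x hx => ?_
    have : SignType.sign (x - a) = 1 := sign_pos (sub_pos.2 hx)
    simp only [this, SignType.coe_one]; ring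
  have h2' : ∫ x in Set.Iic a, (peakWeight η a x * f x + 2 * η * (peakWeight η a x * F x)) = F a := by
    rw [integral_Iic_eq_integral_Iio] at h2 ⊢
    rw [← h2]
    refine setIntegral_congr_fun measurableSet_Iio fun x hx => ?_
    have : SignType.sign (x - a) = -1 := sign_neg (sub_neg.2 hx)
    simp only [this, SignType.coe_neg, SignType.coe_one]; ring
  rw [integral_sub i3.integrableOn (i1.const_mul _).integrableOn, integral_const_mul] at h1'
  rw [integral_add i3.integrableOn (i1.const_mul _).integrableOn, integral_const_mul] at h2'
  rw [integral_weightedMeasure h.continuous h.pos, integral_weightedMeasure h.continuous h.pos]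
  simp only [smul_eq_mul]
  have e1 := intervalIntegral.integral_Iic_add_Ioi (b := a) i1.integrableOn i1.integrableOn
  have i4 : Integrable fun x => peakWeight η a x * |f x| := by
    refine i3.abs.congr (Eventually.of_forall fun x => ?_)
    simp only [abs_mul, abs_of_pos (h.pos x)]
  have e2 := intervalIntegral.integral_Iic_add_Ioi (b := a) i4.integrableOn i4.integrableOn
  have b1 : ∀ s, |∫ x in s, peakWeight η a x * f x| ≤ ∫ x in s, peakWeight η a x * |f x| := by
    intro s
    refine abs_integral_le_integral_abs.trans (le_of_eq (integral_congr_ae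
      (Eventually.of_forall fun x => ?_)))
    simp only [abs_mul, abs_of_pos (h.pos x)]
  have b2 := abs_le.1 (b1 (Set.Iic a))
  have b3 := abs_le.1 (b1 (Set.Ioi a))
  rw [← e1, ← e2, abs_le]
  constructor <;> linarith [b2.1, b2.2, b3.1, b3.2]

end WeightedMeasure

/-! ## Energy estimate for symmetric hyperbolic differential-algebraic systems -/

section Energy

variable {E : Type*} [NormedAddCommGroup E] [InnerProductSpace ℝ E]

/-- Here `Z`, `Z'`, `Γ`, `Q` stand for the integrals of `‖z‖²`, `‖z'‖²`, `‖b z' - A z‖²` and `|q|²`.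
The bound on `η` is chosen so that `η (2/lam) B ≤ β/4`, the one on `θ` so that the feedback of `Z +
Z'` into `Γ` is at most `Γ/2`. -/
lemma energy_arith {β lam B K1 η θ Γ Z Z' Q : ℝ} (hβ : 0 < β) (hl : 0 < lam) (hBpos : 0 < B)
    (hK1pos : 1 ≤ K1) (hη0 : η ≤ min 1 (β * lam / (8 * B))) (hθ : 0 ≤ θ)
    (hθ0 : θ ≤ min 1 (1 / (6 * K1 ^ 2 * ((2 / β) * (2 / lam + 1 / β)
      + (2 / lam ^ 2) * (B * ((2 / β) * (2 / lam + 1 / β)) + 1)))))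
    (Γ0 : 0 ≤ Γ) (Z'0 : 0 ≤ Z')
    (I1 : Z ≤ (2 / lam ^ 2) * (B * Z' + Γ)) (I3 : Γ ≤ 3 * K1 ^ 2 * (θ ^ 2 * (Z + Z') + Q))
    (I4 : β * Z' ≤ η * ((2 / lam) * (B * Z' + Γ)) + (Γ / β + β / 4 * Z')) :
    Z + Z' ≤ ((2 / β) * (2 / lam + 1 / β)
      + (2 / lam ^ 2) * (B * ((2 / β) * (2 / lam + 1 / β)) + 1)) * (6 * K1 ^ 2) * Q := by
  set M1 := (2 / β) * (2 / lam + 1 / β) with hM1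
  have hM1pos : 0 < M1 := by positivity
  set M2 := (2 / lam ^ 2) * (B * M1 + 1) with hM2
  have hM2pos : 0 < M2 := by positivity
  have hη1 : η ≤ 1 := hη0.trans (min_le_left _ _)
  have hη2 : η * ((2 / lam) * B) ≤ β / 4 := by
    have := hη0.trans (min_le_right _ _)
    calc η * ((2 / lam) * B) ≤ (β * lam / (8 * B)) * ((2 / lam) * B) := by gcongr
      _ = β / 4 := by field_simp; norm_num
  have J1 : Z' ≤ M1 * Γ := by
    have a1 : η * ((2 / lam) * (B * Z' + Γ)) ≤ β / 4 * Z' + (2 / lam) * Γ := by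
      have a2 : η * ((2 / lam) * B) * Z' ≤ β / 4 * Z' := by gcongr
      have a3 : η * ((2 / lam) * Γ) ≤ 1 * ((2 / lam) * Γ) := by gcongr
      nlinarith
    have a4 : β / 2 * Z' ≤ (2 / lam + 1 / β) * Γ := by
      have : (2 / lam + 1 / β) * Γ = (2 / lam) * Γ + Γ / β := by ring
      linarith
    calc Z' = (2 / β) * (β / 2 * Z') := by field_simp
      _ ≤ (2 / β) * ((2 / lam + 1 / β) * Γ) := by gcongr
      _ = M1 * Γ := by rw [hM1]; ring
  have J2 : Z ≤ M2 * Γ := by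
    calc Z ≤ (2 / lam ^ 2) * (B * Z' + Γ) := I1
      _ ≤ (2 / lam ^ 2) * (B * (M1 * Γ) + Γ) := by gcongr
      _ = M2 * Γ := by rw [hM2]; ring
  have J3 : 3 * K1 ^ 2 * (θ ^ 2 * (M1 + M2)) ≤ 1 / 2 := by
    have t1 : θ ≤ 1 := hθ0.trans (min_le_left _ _)
    have t2 := hθ0.trans (min_le_right _ _)
    have t3 : θ ^ 2 ≤ 1 / (6 * K1 ^ 2 * (M1 + M2)) := by nlinarith
    calc 3 * K1 ^ 2 * (θ ^ 2 * (M1 + M2)) ≤ 3 * K1 ^ 2 * ((1 / (6 * K1 ^ 2 * (M1 + M2))) * (M1 + M2)) := by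
          gcongr
      _ = 1 / 2 := by field_simp; norm_num
  have J4 : Γ ≤ 6 * K1 ^ 2 * Q := by
    have : 3 * K1 ^ 2 * (θ ^ 2 * (Z + Z')) ≤ 1 / 2 * Γ := by
      calc 3 * K1 ^ 2 * (θ ^ 2 * (Z + Z')) ≤ 3 * K1 ^ 2 * (θ ^ 2 * (M2 * Γ + M1 * Γ)) := by gcongr
        _ = 3 * K1 ^ 2 * (θ ^ 2 * (M1 + M2)) * Γ := by ring
        _ ≤ 1 / 2 * Γ := by gcongr
    nlinarith
  calc Z + Z' ≤ M2 * Γ + M1 * Γ := add_le_add J2 J1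
    _ = (M1 + M2) * Γ := by ring
    _ ≤ (M1 + M2) * (6 * K1 ^ 2 * Q) := by gcongr
    _ = _ := by ring

/-- A pair of symmetric operators `b`, `A`, with `b` positive definite on `T`, such that
`ker A` is spanned on `T` by the unit vector `r`. -/
structure SymmetricPair (b A : E →L[ℝ] E) (T : Submodule ℝ E) (r : E) (β lam : ℝ) : Prop where
  β_pos : 0 < β
  lam_pos : 0 < lam
  b_symm : ∀ x y, ⟪b x, y⟫_ℝ = ⟪x, b y⟫_ℝ
  A_symm : ∀ x y, ⟪A x, y⟫_ℝ = ⟪x, A y⟫_ℝ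
  coercive : ∀ t ∈ T, β * ‖t‖ ^ 2 ≤ ⟪b t, t⟫_ℝ
  A_lower : ∀ z ∈ T, ⟪b r, z⟫_ℝ = 0 → lam * ‖z‖ ≤ ‖A z‖
  A_r : A r = 0
  r_mem : r ∈ T
  norm_r : ‖r‖ = 1

namespace SymmetricPair

variable {b A : E →L[ℝ] E} {T : Submodule ℝ E} {r : E} {β lam : ℝ}

/-- The scalar multiplier `e` is controlled by pairing the equation with `r`. -/
lemma abs_multiplier_le (P : SymmetricPair b A T r β lam) {z z' g c : E} {e : ℝ}
    (hz' : ⟪b r, z'⟫_ℝ = 0) (heq : b z' = A z + g - e • c) (hc : β / 2 ≤ ⟪c, r⟫_ℝ) :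
    |e| ≤ 2 / β * ‖g‖ := by
  have hβ := P.β_pos
  have h1 : ⟪b z', r⟫_ℝ = 0 := by rw [P.b_symm, real_inner_comm, hz']
  have h2 : ⟪A z, r⟫_ℝ = 0 := by rw [P.A_symm, P.A_r, inner_zero_right]
  rw [heq, inner_sub_left, inner_add_left, h2, zero_add, real_inner_smul_left] at h1
  have h3 : e * ⟪c, r⟫_ℝ = ⟪g, r⟫_ℝ := by linarith
  have h4 : |e| * (β / 2) ≤ ‖g‖ := by
    calc |e| * (β / 2) ≤ |e| * ⟪c, r⟫_ℝ := by gcongr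
      _ = |e * ⟪c, r⟫_ℝ| := by rw [abs_mul, abs_of_nonneg (by linarith : 0 ≤ ⟪c, r⟫_ℝ)]
      _ = |⟪g, r⟫_ℝ| := by rw [h3]
      _ ≤ ‖g‖ * ‖r‖ := abs_real_inner_le_norm _ _
      _ = ‖g‖ := by rw [P.norm_r, mul_one]
  rw [div_mul_eq_mul_div, le_div_iff₀ hβ]
  linarith

/-- Hyperbolic estimate: `L²` bounds for `z` transversal to the kernel direction. -/
theorem energy_estimate (P : SymmetricPair b A T r β lam) (Cc : ℝ) (hCc : 0 ≤ Cc) :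
    ∃ η₀ θ₀ K : ℝ, 0 < η₀ ∧ 0 < θ₀ ∧ 0 < K ∧
      ∀ (μ : Measure ℝ) (η θ : ℝ) (z z' g c : ℝ → E) (e q : ℝ → ℝ),
        0 ≤ η → η ≤ η₀ → 0 ≤ θ → θ ≤ θ₀ → MemLp z 2 μ → MemLp z' 2 μ → MemLp q 2 μ →
        (∀ᵐ x ∂μ, z x ∈ T ∧ z' x ∈ T ∧ ⟪b r, z x⟫_ℝ = 0 ∧ ⟪b r, z' x⟫_ℝ = 0 ∧
          b (z' x) = A (z x) + g x - e x • c x ∧ ‖g x‖ ≤ θ * (‖z x‖ + ‖z' x‖) + |q x| ∧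
          ‖c x‖ ≤ Cc ∧ β / 2 ≤ ⟪c x, r⟫_ℝ) →
        ∫ x, ⟪A (z x), z' x⟫_ℝ ∂μ ≤ η * ∫ x, ‖A (z x)‖ * ‖z x‖ ∂μ →
        (∫ x, ‖z x‖ ^ 2 ∂μ) + ∫ x, ‖z' x‖ ^ 2 ∂μ ≤ K * ∫ x, |q x| ^ 2 ∂μ := by
  have hβ := P.β_pos
  have hl := P.lam_pos
  set B := ‖b‖ ^ 2 + 1 with hB
  have hBpos : 0 < B := by positivity
  set K1 := 1 + 2 / β * Cc with hK1
  have hK1pos : 1 ≤ K1 := by rw [hK1]; have : 0 ≤ 2 / β * Cc := by positivity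
                             linarith
  set M1 := (2 / β) * (2 / lam + 1 / β) with hM1
  have hM1pos : 0 < M1 := by positivity
  set M2 := (2 / lam ^ 2) * (B * M1 + 1) with hM2
  have hM2pos : 0 < M2 := by positivity
  refine ⟨min 1 (β * lam / (8 * B)), min 1 (1 / (6 * K1 ^ 2 * (M1 + M2))), (M1 + M2) * (6 * K1 ^ 2),
    by positivity, by positivity, by positivity, ?_⟩
  intro μ η θ z z' g c e q hη hη0 hθ hθ0 Lz Lz' Lq hpt hen
  -- `G` is the whole defect `g - e c`. The multiplier `e`, on which nothing is assumed, is bounded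
  -- by `g` through the pairing with `r`, so `G` is controlled by `g` alone.
  let G : ℝ → E := fun x => b (z' x) - A (z x)
  have LG : MemLp G 2 μ := (b.comp_memLp' Lz').sub (A.comp_memLp' Lz)
  have sq : ∀ {F : ℝ → E}, MemLp F 2 μ → Integrable (fun x => ‖F x‖ ^ 2) μ := fun h =>
    h.integrable_norm_pow (p := 2) (by simp)
  have sz := sq Lz
  have sz' := sq Lz'
  have sG := sq LG
  have sq' : Integrable (fun x => |q x| ^ 2) μ := Lq.integrable_norm_pow (p := 2) (by simp)
  have hG : ∀ᵐ x ∂μ, ‖G x‖ ^ 2 ≤ 3 * K1 ^ 2 * (θ ^ 2 * (‖z x‖ ^ 2 + ‖z' x‖ ^ 2) + |q x| ^ 2) := by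
    filter_upwards [hpt] with x hx
    obtain ⟨-, -, -, h2, h3, h4, h5, h6⟩ := hx
    have he := P.abs_multiplier_le h2 h3 h6
    have h7 : ‖G x‖ ≤ K1 * (θ * (‖z x‖ + ‖z' x‖) + |q x|) := by
      have e1 : G x = g x - e x • c x := by simp only [G]; rw [h3]; abel
      calc ‖G x‖ ≤ ‖g x‖ + |e x| * ‖c x‖ := by
            rw [e1]; refine (norm_sub_le _ _).trans ?_
            rw [norm_smul, Real.norm_eq_abs]
        _ ≤ ‖g x‖ + (2 / β * ‖g x‖) * Cc := by gcongr
        _ = K1 * ‖g x‖ := by rw [hK1]; ring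
        _ ≤ _ := by gcongr
    calc ‖G x‖ ^ 2 ≤ (K1 * (θ * (‖z x‖ + ‖z' x‖) + |q x|)) ^ 2 := by gcongr
      _ = K1 ^ 2 * (θ * ‖z x‖ + θ * ‖z' x‖ + |q x|) ^ 2 := by ring
      _ ≤ K1 ^ 2 * (3 * ((θ * ‖z x‖) ^ 2 + (θ * ‖z' x‖) ^ 2 + |q x| ^ 2)) := by
          gcongr
          nlinarith [sq_nonneg (θ * ‖z x‖ - θ * ‖z' x‖), sq_nonneg (θ * ‖z x‖ - |q x|),
            sq_nonneg (θ * ‖z' x‖ - |q x|)]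
      _ = _ := by ring
  have hA : ∀ x, ‖A (z x)‖ ^ 2 ≤ 2 * (B * ‖z' x‖ ^ 2 + ‖G x‖ ^ 2) := by
    intro x
    have e1 : A (z x) = b (z' x) - G x := by simp only [G]; abel
    have h1 : ‖A (z x)‖ ≤ ‖b‖ * ‖z' x‖ + ‖G x‖ := by
      rw [e1]; exact (norm_sub_le _ _).trans (add_le_add (b.le_opNorm _) le_rfl)
    have h2 : ‖A (z x)‖ ^ 2 ≤ (‖b‖ * ‖z' x‖ + ‖G x‖) ^ 2 := by gcongr
    have h3 : B * ‖z' x‖ ^ 2 = ‖b‖ ^ 2 * ‖z' x‖ ^ 2 + ‖z' x‖ ^ 2 := by rw [hB]; ring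
    nlinarith [sq_nonneg (‖b‖ * ‖z' x‖ - ‖G x‖), sq_nonneg ‖z' x‖]
  -- No dissipation acts on `z` itself: it is recovered from `A z = b z' - G`, as `A` is bounded
  -- below on `T` transversally to `r`.
  have hzA : ∀ᵐ x ∂μ, ‖z x‖ ≤ ‖A (z x)‖ / lam := by
    filter_upwards [hpt] with x hx
    rw [le_div_iff₀ hl, mul_comm]
    exact P.A_lower _ hx.1 hx.2.2.1
  have hz2 : ∀ᵐ x ∂μ, ‖z x‖ ^ 2 ≤ (2 / lam ^ 2) * (B * ‖z' x‖ ^ 2 + ‖G x‖ ^ 2) := by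
    filter_upwards [hzA] with x hx
    calc ‖z x‖ ^ 2 ≤ (‖A (z x)‖ / lam) ^ 2 := by gcongr
      _ = ‖A (z x)‖ ^ 2 / lam ^ 2 := by rw [div_pow]
      _ ≤ (2 * (B * ‖z' x‖ ^ 2 + ‖G x‖ ^ 2)) / lam ^ 2 := by gcongr; exact hA x
      _ = _ := by ring
  have hAz : ∀ᵐ x ∂μ, ‖A (z x)‖ * ‖z x‖ ≤ (2 / lam) * (B * ‖z' x‖ ^ 2 + ‖G x‖ ^ 2) := by
    filter_upwards [hzA] with x hx
    calc ‖A (z x)‖ * ‖z x‖ ≤ ‖A (z x)‖ * (‖A (z x)‖ / lam) := by gcongr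
      _ = ‖A (z x)‖ ^ 2 / lam := by ring
      _ ≤ (2 * (B * ‖z' x‖ ^ 2 + ‖G x‖ ^ 2)) / lam := by gcongr; exact hA x
      _ = _ := by ring
  set Z := ∫ x, ‖z x‖ ^ 2 ∂μ with hZ
  set Z' := ∫ x, ‖z' x‖ ^ 2 ∂μ with hZ'
  set Γ := ∫ x, ‖G x‖ ^ 2 ∂μ with hΓ
  set Q := ∫ x, |q x| ^ 2 ∂μ with hQ
  have Γ0 : 0 ≤ Γ := integral_nonneg fun _ => by positivity
  have Z0 : 0 ≤ Z := integral_nonneg fun _ => by positivity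
  have Z'0 : 0 ≤ Z' := integral_nonneg fun _ => by positivity
  have sBG : Integrable (fun x => B * ‖z' x‖ ^ 2 + ‖G x‖ ^ 2) μ := (sz'.const_mul B).add sG
  have iBG : ∫ x, (B * ‖z' x‖ ^ 2 + ‖G x‖ ^ 2) ∂μ = B * Z' + Γ := by
    rw [integral_add (sz'.const_mul B) sG, integral_const_mul]
  have I1 : Z ≤ (2 / lam ^ 2) * (B * Z' + Γ) := by
    rw [← iBG, ← integral_const_mul]
    exact integral_mono_ae sz (sBG.const_mul _) hz2
  have I2 : ∫ x, ‖A (z x)‖ * ‖z x‖ ∂μ ≤ (2 / lam) * (B * Z' + Γ) := by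
    rw [← iBG, ← integral_const_mul]
    exact integral_mono_of_nonneg (Eventually.of_forall fun x => by positivity)
      (sBG.const_mul _) hAz
  have szz : Integrable (fun x => θ ^ 2 * (‖z x‖ ^ 2 + ‖z' x‖ ^ 2)) μ := (sz.add sz').const_mul _
  have I3 : Γ ≤ 3 * K1 ^ 2 * (θ ^ 2 * (Z + Z') + Q) := by
    have : ∫ x, 3 * K1 ^ 2 * (θ ^ 2 * (‖z x‖ ^ 2 + ‖z' x‖ ^ 2) + |q x| ^ 2) ∂μ
        = 3 * K1 ^ 2 * (θ ^ 2 * (Z + Z') + Q) := by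
      rw [integral_const_mul, integral_add szz sq', integral_const_mul, integral_add sz sz']
    rw [← this]
    exact integral_mono_ae sG ((szz.add sq').const_mul _) hG
  -- Coercivity of `b` bounds `z'` by `⟪A z, z'⟫ + ⟪G, z'⟫`; the first term is the one controlled by
  -- the hypothesis `hen`, being half an exact derivative in the applications.
  have I4 : β * Z' ≤ η * ((2 / lam) * (B * Z' + Γ)) + (Γ / β + β / 4 * Z') := by
    have ip1 := (b.comp_memLp' Lz').integrable_inner_two Lz'
    have ip2 : Integrable (fun x => ⟪A (z x), z' x⟫_ℝ) μ := (A.comp_memLp' Lz).integrable_inner_two Lz'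
    have ip3 := LG.integrable_inner_two Lz'
    have h1 : β * Z' ≤ ∫ x, ⟪b (z' x), z' x⟫_ℝ ∂μ := by
      rw [hZ', ← integral_const_mul]
      refine integral_mono_ae (sz'.const_mul _) ip1 ?_
      filter_upwards [hpt] with x hx
      exact P.coercive _ hx.2.1
    have h2 : ∫ x, ⟪b (z' x), z' x⟫_ℝ ∂μ = (∫ x, ⟪A (z x), z' x⟫_ℝ ∂μ) + ∫ x, ⟪G x, z' x⟫_ℝ ∂μ := by
      rw [← integral_add ip2 ip3]
      refine integral_congr_ae (Eventually.of_forall fun x => ?_)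
      simp only [G]
      rw [← inner_add_left]; congr 1; abel
    have h3 : ∫ x, ⟪G x, z' x⟫_ℝ ∂μ ≤ Γ / β + β / 4 * Z' := by
      have : ∫ x, (‖G x‖ ^ 2 / β + β / 4 * ‖z' x‖ ^ 2) ∂μ = Γ / β + β / 4 * Z' := by
        rw [integral_add (sG.div_const _) (sz'.const_mul _), integral_div, integral_const_mul]
      rw [← this]
      refine integral_mono_ae ip3 ((sG.div_const _).add (sz'.const_mul _))
        (Eventually.of_forall fun x => (real_inner_le_norm _ _).trans ?_)
      have : ‖G x‖ ^ 2 / β + β / 4 * ‖z' x‖ ^ 2 - ‖G x‖ * ‖z' x‖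
          = (‖G x‖ - β / 2 * ‖z' x‖) ^ 2 / β := by field_simp; ring
      have h0 : 0 ≤ (‖G x‖ - β / 2 * ‖z' x‖) ^ 2 / β := by positivity
      linarith
    have h4 : η * ∫ x, ‖A (z x)‖ * ‖z x‖ ∂μ ≤ η * ((2 / lam) * (B * Z' + Γ)) := by gcongr
    linarith
  exact energy_arith hβ hl hBpos hK1pos hη0 hθ hθ0 Γ0 Z'0 I1 I3 I4

/-- The energy hypothesis of `energy_estimate` for a slowly varying weight. -/
lemma integral_inner_le [CompleteSpace E] (P : SymmetricPair b A T r β lam) {w w' : ℝ → ℝ} {η : ℝ}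
    (h : SlowWeight w w' η) {z z' : ℝ → E} (hz : IsPrimitive z z')
    (Lz : MemLp z 2 (weightedMeasure w)) (Lz' : MemLp z' 2 (weightedMeasure w)) :
    ∫ x, ⟪A (z x), z' x⟫_ℝ ∂weightedMeasure w
      ≤ η * ∫ x, ‖A (z x)‖ * ‖z x‖ ∂weightedMeasure w := by
  have hη : 0 ≤ η := by
    obtain ⟨x, hx⟩ := h.deriv_le.exists
    have := (abs_nonneg _).trans hx
    have hp := h.pos x
    by_contra hn
    push Not at hn
    nlinarith
  have i1 := (A.comp_memLp' Lz).integrable_inner_two Lz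
  have i2 := (A.comp_memLp' Lz).integrable_inner_two Lz'
  have i3 := (A.comp_memLp' Lz').integrable_inner_two Lz
  have hF : IsPrimitive (fun x => ⟪A (z x), z x⟫_ℝ) (fun x => 2 * ⟪A (z x), z' x⟫_ℝ) := by
    refine ((hz.clm A).inner hz).congr_deriv (Eventually.of_forall fun x => ?_)
    simp only
    rw [P.A_symm (z' x), real_inner_comm (A (z x)) (z' x)]
    ring
  have h1 := h.abs_integral_deriv_le hF i1 (i2.const_mul 2)
  rw [integral_const_mul] at h1
  have h2 : ∫ x, |⟪A (z x), z x⟫_ℝ| ∂weightedMeasure w ≤ ∫ x, ‖A (z x)‖ * ‖z x‖ ∂weightedMeasure w := by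
    refine integral_mono i1.abs ?_ fun x => abs_real_inner_le_norm _ _
    exact (A.comp_memLp' Lz).norm.integrable_mul Lz.norm
  have h3 := (le_abs_self _).trans h1
  nlinarith

end SymmetricPair

end Energy

/-! ## The scalar profile equation -/

section ScalarProfile

lemma le_of_deriv_nonneg_of_le {f f' : ℝ → ℝ} (hf : ∀ x, HasDerivAt f (f' x) x) {x y : ℝ}
    (hxy : x ≤ y) (h : ∀ t, x ≤ t → t ≤ y → 0 ≤ f' t) : f x ≤ f y := by
  have hm : MonotoneOn f (Set.Icc x y) := by
    refine monotoneOn_of_deriv_nonneg (convex_Icc x y)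
      (fun t _ => (hf t).continuousAt.continuousWithinAt)
      (fun t _ => (hf t).differentiableAt.differentiableWithinAt) fun t ht => ?_
    rw [interior_Icc] at ht
    rw [(hf t).deriv]
    exact h t ht.1.le ht.2.le
  exact hm (Set.left_mem_Icc.2 hxy) (Set.right_mem_Icc.2 hxy) hxy

lemma le_of_deriv_nonpos_of_le {f f' : ℝ → ℝ} (hf : ∀ x, HasDerivAt f (f' x) x) {x y : ℝ}
    (hxy : x ≤ y) (h : ∀ t, x ≤ t → t ≤ y → f' t ≤ 0) : f y ≤ f x := by
  have := le_of_deriv_nonneg_of_le (fun t => (hf t).neg) hxy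
    (fun t h1 h2 => neg_nonneg.2 (h t h1 h2))
  simpa using this

/-- A positive solution of `a' = A`, `A' = m A`, `m' = -l A`, with `Λ₁ ≤ l ≤ Λ₂`, running from
`0` to `p`. -/
structure ScalarProfile (Λ₁ Λ₂ p : ℝ) (a A m l : ℝ → ℝ) : Prop where
  pos : 0 < Λ₁
  p_pos : 0 < p
  hasDerivAt_a : ∀ x, HasDerivAt a (A x) x
  hasDerivAt_A : ∀ x, HasDerivAt A (m x * A x) x
  hasDerivAt_m : ∀ x, HasDerivAt m (-(l x * A x)) x
  lower : ∀ x, Λ₁ ≤ l x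
  upper : ∀ x, l x ≤ Λ₂
  A_pos : ∀ x, 0 < A x
  a_atBot : Tendsto a atBot (𝓝 0)
  a_atTop : Tendsto a atTop (𝓝 p)
  A_atBot : Tendsto A atBot (𝓝 0)
  A_atTop : Tendsto A atTop (𝓝 0)

namespace ScalarProfile

variable {Λ₁ Λ₂ p : ℝ} {a A m l : ℝ → ℝ}

lemma a_mono (h : ScalarProfile Λ₁ Λ₂ p a A m l) : Monotone a := fun _ _ hxy =>
  le_of_deriv_nonneg_of_le h.hasDerivAt_a hxy fun t _ _ => (h.A_pos t).le

lemma a_nonneg (h : ScalarProfile Λ₁ Λ₂ p a A m l) (x : ℝ) : 0 ≤ a x :=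
  h.a_mono.le_of_tendsto h.a_atBot x

lemma a_le (h : ScalarProfile Λ₁ Λ₂ p a A m l) (x : ℝ) : a x ≤ p :=
  h.a_mono.ge_of_tendsto h.a_atTop x

lemma lam_le (h : ScalarProfile Λ₁ Λ₂ p a A m l) : Λ₁ ≤ Λ₂ := (h.lower 0).trans (h.upper 0)

/-- Constant `l` is the Burgers case, in which `m + l a` is conserved. The bounds on `l` turn this
conservation law into two monotone quantities, on which every comparison below rests. -/
lemma antitone_add (h : ScalarProfile Λ₁ Λ₂ p a A m l) {x y : ℝ} (hxy : x ≤ y) :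
    m y + Λ₁ * a y ≤ m x + Λ₁ * a x := by
  refine le_of_deriv_nonpos_of_le (fun t => (h.hasDerivAt_m t).add ((h.hasDerivAt_a t).const_mul Λ₁))
    hxy fun t _ _ => ?_
  nlinarith [h.lower t, h.A_pos t]

lemma monotone_add (h : ScalarProfile Λ₁ Λ₂ p a A m l) {x y : ℝ} (hxy : x ≤ y) :
    m x + Λ₂ * a x ≤ m y + Λ₂ * a y := by
  refine le_of_deriv_nonneg_of_le (fun t => (h.hasDerivAt_m t).add ((h.hasDerivAt_a t).const_mul Λ₂))
    hxy fun t _ _ => ?_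
  nlinarith [h.upper t, h.A_pos t]

/-- If `m` kept one sign, the positive function `A` would be monotone and could not tend to zero at
both ends. -/
lemma exists_zero (h : ScalarProfile Λ₁ Λ₂ p a A m l) : ∃ x₁, m x₁ = 0 := by
  have h1 : ∃ x, 0 ≤ m x := by
    by_contra hn
    push Not at hn
    have : ∀ x, A 0 ≤ A (min x 0) := fun x =>
      le_of_deriv_nonpos_of_le h.hasDerivAt_A (min_le_right x 0)
        fun t _ _ => by nlinarith [hn t, h.A_pos t]
    have h2 : A 0 ≤ 0 := ge_of_tendsto h.A_atBot (by
      filter_upwards [eventually_le_atBot 0] with x hx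
      have := this x
      rwa [min_eq_left hx] at this)
    exact absurd (h.A_pos 0) (not_lt.2 h2)
  have h2 : ∃ x, m x ≤ 0 := by
    by_contra hn
    push Not at hn
    have h2 : A 0 ≤ 0 := ge_of_tendsto h.A_atTop (by
      filter_upwards [eventually_ge_atTop 0] with x hx
      exact le_of_deriv_nonneg_of_le h.hasDerivAt_A hx
        fun t _ _ => by nlinarith [hn t, h.A_pos t])
    exact absurd (h.A_pos 0) (not_lt.2 h2)
  obtain ⟨x, hx⟩ := h1
  obtain ⟨y, hy⟩ := h2
  have hc : Continuous m := continuous_iff_continuousAt.2 fun x => (h.hasDerivAt_m x).continuousAt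
  obtain ⟨z, hz⟩ := mem_range_of_exists_le_of_exists_ge hc ⟨y, hy⟩ ⟨x, hx⟩
  exact ⟨z, hz⟩

/-- The difference `ψ` of the two sides vanishes at both ends, and `ψ'` is `A` times a nonincreasing
factor. According to the sign of that factor at `x`, `ψ` is monotone all the way from `x` to one of
the ends. -/
lemma A_lower (h : ScalarProfile Λ₁ Λ₂ p a A m l) (x : ℝ) : Λ₁ / 2 * (a x * (p - a x)) ≤ A x := by
  let ψ : ℝ → ℝ := fun x => A x - Λ₁ / 2 * (a x * (p - a x))
  have hψ : ∀ x, HasDerivAt ψ (A x * (m x + Λ₁ * a x - Λ₁ * p / 2)) x := fun x =>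
    ((h.hasDerivAt_A x).sub (((h.hasDerivAt_a x).mul
      ((h.hasDerivAt_a x).const_sub p)).const_mul (Λ₁ / 2))).congr_deriv (by ring)
  suffices 0 ≤ ψ x by simp only [ψ] at this; linarith
  rcases le_or_gt 0 (m x + Λ₁ * a x - Λ₁ * p / 2) with hn | hn
  · have ht : Tendsto ψ atBot (𝓝 0) := by
      have := h.A_atBot.sub ((h.a_atBot.mul (h.a_atBot.const_sub p)).const_mul (Λ₁ / 2))
      simpa using this
    refine le_of_tendsto ht ?_
    filter_upwards [eventually_le_atBot x] with y hy
    refine le_of_deriv_nonneg_of_le hψ hy fun t _ h2 => mul_nonneg (h.A_pos t).le ?_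
    linarith [h.antitone_add h2]
  · have ht : Tendsto ψ atTop (𝓝 0) := by
      have := h.A_atTop.sub ((h.a_atTop.mul (h.a_atTop.const_sub p)).const_mul (Λ₁ / 2))
      simpa using this
    refine le_of_tendsto ht ?_
    filter_upwards [eventually_ge_atTop x] with y hy
    refine le_of_deriv_nonpos_of_le hψ hy fun t h1 _ =>
      mul_nonpos_of_nonneg_of_nonpos (h.A_pos t).le ?_
    linarith [h.antitone_add h1]

lemma hasDerivAt_quad (h : ScalarProfile Λ₁ Λ₂ p a A m l) (Λ x₁ x : ℝ) :
    HasDerivAt (fun x => A x + Λ / 2 * (a x - a x₁) ^ 2) (A x * (m x + Λ * (a x - a x₁))) x := by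
  have h1 := ((h.hasDerivAt_a x).sub_const (a x₁)).pow 2
  refine ((h.hasDerivAt_A x).add (h1.const_mul (Λ / 2))).congr_deriv ?_
  ring

/-- The derivative of the left side is `A (m + Λ₁ (a - a x₁))`, whose second factor is nonincreasing
and vanishes at `x₁`: hence a maximum there. With `Λ₂` the same argument gives a minimum. -/
lemma quad_le (h : ScalarProfile Λ₁ Λ₂ p a A m l) {x₁ : ℝ} (h₁ : m x₁ = 0) (x : ℝ) :
    A x + Λ₁ / 2 * (a x - a x₁) ^ 2 ≤ A x₁ := by
  have e : A x₁ = A x₁ + Λ₁ / 2 * (a x₁ - a x₁) ^ 2 := by simp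
  rw [e]
  rcases le_total x x₁ with hx | hx
  · refine le_of_deriv_nonneg_of_le (h.hasDerivAt_quad Λ₁ x₁) hx fun t _ h2 =>
      mul_nonneg (h.A_pos t).le ?_
    linarith [h.antitone_add h2]
  · refine le_of_deriv_nonpos_of_le (h.hasDerivAt_quad Λ₁ x₁) hx fun t h2 _ =>
      mul_nonpos_of_nonneg_of_nonpos (h.A_pos t).le ?_
    linarith [h.antitone_add h2]

lemma le_quad (h : ScalarProfile Λ₁ Λ₂ p a A m l) {x₁ : ℝ} (h₁ : m x₁ = 0) (x : ℝ) :
    A x₁ ≤ A x + Λ₂ / 2 * (a x - a x₁) ^ 2 := by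
  have e : A x₁ = A x₁ + Λ₂ / 2 * (a x₁ - a x₁) ^ 2 := by simp
  rw [e]
  rcases le_total x x₁ with hx | hx
  · refine le_of_deriv_nonpos_of_le (h.hasDerivAt_quad Λ₂ x₁) hx fun t _ h2 =>
      mul_nonpos_of_nonneg_of_nonpos (h.A_pos t).le ?_
    linarith [h.monotone_add h2]
  · refine le_of_deriv_nonneg_of_le (h.hasDerivAt_quad Λ₂ x₁) hx fun t h2 _ =>
      mul_nonneg (h.A_pos t).le ?_
    linarith [h.monotone_add h2]

/-- The limits of the two quadratic inequalities at the ends compare `A x₁` with `a x₁ ^ 2` and `(p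
- a x₁) ^ 2`, from both sides. One of the squares is at least `p²/4`, so `A x₁` is of order `p²`,
and then so are both squares: the crest of `A` stays away from both end states. -/
lemma center (h : ScalarProfile Λ₁ Λ₂ p a A m l) {x₁ : ℝ} (h₁ : m x₁ = 0) :
    Λ₁ / (2 * Λ₂) * p ≤ a x₁ ∧ Λ₁ / (2 * Λ₂) * p ≤ p - a x₁ ∧ A x₁ ≤ Λ₂ * p ^ 2 := by
  have hΛ := h.pos
  have hΛ2 := h.lam_le
  have hp := h.p_pos
  have a0 := h.a_nonneg x₁
  have a1 := h.a_le x₁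
  have u1 : Λ₁ / 2 * (a x₁) ^ 2 ≤ A x₁ := by
    have ht := h.A_atBot.add (((h.a_atBot.sub_const (a x₁)).pow 2).const_mul (Λ₁ / 2))
    have := le_of_tendsto' ht (h.quad_le h₁)
    simpa using this
  have u2 : Λ₁ / 2 * (p - a x₁) ^ 2 ≤ A x₁ := by
    have ht := h.A_atTop.add (((h.a_atTop.sub_const (a x₁)).pow 2).const_mul (Λ₁ / 2))
    have := le_of_tendsto' ht (h.quad_le h₁)
    simpa using this
  have v1 : A x₁ ≤ Λ₂ / 2 * (a x₁) ^ 2 := by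
    have ht := h.A_atBot.add (((h.a_atBot.sub_const (a x₁)).pow 2).const_mul (Λ₂ / 2))
    have := ge_of_tendsto' ht (h.le_quad h₁)
    simpa using this
  have v2 : A x₁ ≤ Λ₂ / 2 * (p - a x₁) ^ 2 := by
    have ht := h.A_atTop.add (((h.a_atTop.sub_const (a x₁)).pow 2).const_mul (Λ₂ / 2))
    have := ge_of_tendsto' ht (h.le_quad h₁)
    simpa using this
  have w : Λ₁ / 8 * p ^ 2 ≤ A x₁ := by
    rcases le_total (p / 2) (a x₁) with hh | hh
    · have : (p / 2) ^ 2 ≤ (a x₁) ^ 2 := by gcongr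
      nlinarith
    · have : (p / 2) ^ 2 ≤ (p - a x₁) ^ 2 := by gcongr; linarith
      nlinarith
  have hΛ2p : 0 < Λ₂ := by linarith
  have key : (Λ₁ / (2 * Λ₂) * p) ^ 2 ≤ Λ₁ / (4 * Λ₂) * p ^ 2 := by
    have e : Λ₁ / (4 * Λ₂) * p ^ 2 - (Λ₁ / (2 * Λ₂) * p) ^ 2
        = Λ₁ * (Λ₂ - Λ₁) * p ^ 2 / (4 * Λ₂ ^ 2) := by field_simp; ring
    have : 0 ≤ Λ₁ * (Λ₂ - Λ₁) * p ^ 2 / (4 * Λ₂ ^ 2) := by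
      have : 0 ≤ Λ₂ - Λ₁ := by linarith
      positivity
    linarith
  have fin : ∀ y, 0 ≤ y → A x₁ ≤ Λ₂ / 2 * y ^ 2 → Λ₁ / (2 * Λ₂) * p ≤ y := by
    intro y hy hA
    refine abs_le_of_sq_le_sq' ?_ hy |>.2
    refine key.trans ?_
    have : Λ₁ / (4 * Λ₂) * p ^ 2 = (2 / Λ₂) * (Λ₁ / 8 * p ^ 2) := by field_simp; norm_num
    rw [this]
    calc (2 / Λ₂) * (Λ₁ / 8 * p ^ 2) ≤ (2 / Λ₂) * (Λ₂ / 2 * y ^ 2) := by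
          exact mul_le_mul_of_nonneg_left (w.trans hA) (by positivity)
      _ = y ^ 2 := by field_simp
  refine ⟨fin _ a0 v1, fin _ (by linarith) v2, v1.trans ?_⟩
  have : (a x₁) ^ 2 ≤ p ^ 2 := by gcongr
  nlinarith

/-- Both monotone combinations are compared with their values at a zero of `m`, using that `a`
varies by at most `p`. -/
lemma abs_m_le (h : ScalarProfile Λ₁ Λ₂ p a A m l) (x : ℝ) : |m x| ≤ Λ₂ * p := by
  obtain ⟨x₁, h₁⟩ := h.exists_zero
  have hΛ := h.pos
  have hΛ2 := h.lam_le
  have a0 := h.a_nonneg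
  have a1 := h.a_le
  rw [abs_le]
  rcases le_total x x₁ with hx | hx
  · have m1 := h.monotone_add hx
    have m2 := h.antitone_add hx
    have m3 := h.a_mono hx
    constructor <;> nlinarith [a0 x, a1 x, a0 x₁, a1 x₁]
  · have m1 := h.monotone_add hx
    have m2 := h.antitone_add hx
    have m3 := h.a_mono hx
    constructor <;> nlinarith [a0 x, a1 x, a0 x₁, a1 x₁]

lemma A_upper (h : ScalarProfile Λ₁ Λ₂ p a A m l) (x : ℝ) : A x ≤ Λ₂ * p ^ 2 := by
  obtain ⟨x₁, h₁⟩ := h.exists_zero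
  have h1 := h.quad_le h₁ x
  have h2 := (h.center h₁).2.2
  have : 0 ≤ Λ₁ / 2 * (a x - a x₁) ^ 2 := by have := h.pos; positivity
  linarith

/-- The multiplier inequality: `k A / p` dominates the growing part of `m` on each half-line. -/
theorem multiplier {Λ₁ Λ₂ t : ℝ} (hΛ : 0 < Λ₁) (hΛ₂ : Λ₁ ≤ Λ₂) (ht : 0 < t) :
    ∃ c k : ℝ, 0 < c ∧ 0 < k ∧ ∀ (p : ℝ) (a A m l : ℝ → ℝ), ScalarProfile Λ₁ Λ₂ p a A m l →
      t * p ≤ a 0 → t * p ≤ p - a 0 →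
      (∀ x, 0 ≤ x → c * p ≤ k * (A x / p) - m x) ∧ ∀ x ≤ 0, c * p ≤ k * (A x / p) + m x := by
  have hΛ2p : 0 < Λ₂ := by linarith
  set q := Λ₁ / (2 * Λ₂) with hq
  have hqp : 0 < q := by positivity
  set c := Λ₁ * q / 2 with hc
  have hcp : 0 < c := by positivity
  refine ⟨c, (Λ₂ + c) / (Λ₁ * t * q / 4), hcp, by positivity, fun p a A m l h h0 h0' => ?_⟩
  set k := (Λ₂ + c) / (Λ₁ * t * q / 4) with hk
  have hkp : 0 < k := by positivity
  have hp := h.p_pos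
  obtain ⟨x₁, h₁⟩ := h.exists_zero
  obtain ⟨c1, c2, -⟩ := h.center h₁
  -- `k` is chosen so that, once `A` is at least a fixed fraction of `p²`, the term `k A / p` beats
  -- the global bound `Λ₂ p` of `|m|` with `c p` to spare.
  have big : ∀ x, Λ₁ * t * q / 4 * p ^ 2 ≤ A x → (Λ₂ + c) * p ≤ k * (A x / p) := by
    intro x hx
    calc (Λ₂ + c) * p = k * (Λ₁ * t * q / 4 * p ^ 2 / p) := by rw [hk]; field_simp
      _ ≤ k * (A x / p) := by gcongr
  have hA0 : ∀ x, 0 ≤ k * (A x / p) := fun x => by have := h.A_pos x; positivity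
  have mid : ∀ x, t * p ≤ a x → q * p / 2 ≤ p - a x → (Λ₂ + c) * p ≤ k * (A x / p) := by
    intro x h1 h2
    refine big x (le_trans ?_ (h.A_lower x))
    have : t * p * (q * p / 2) ≤ a x * (p - a x) := by
      have := h.a_nonneg x
      gcongr
    nlinarith
  have mid' : ∀ x, q * p / 2 ≤ a x → t * p ≤ p - a x → (Λ₂ + c) * p ≤ k * (A x / p) := by
    intro x h1 h2
    refine big x (le_trans ?_ (h.A_lower x))
    have : (q * p / 2) * (t * p) ≤ a x * (p - a x) := by
      have := h.a_nonneg x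
      gcongr
    nlinarith
  -- For `x ≥ 0` the assumption at `0` keeps `a` away from `0`. Either `a` is also away from `p`,
  -- and `A` is large, or `a` is close to `p`, hence past the crest, where `m ≤ -Λ₁ (a - a x₁) ≤ -c
  -- p`. The other half-line is symmetric.
  constructor
  · intro x hx
    have hax := h.a_mono hx
    have hmx := abs_le.1 (h.abs_m_le x)
    rcases le_total (q * p / 2) (p - a x) with h2 | h2
    · have := mid x (h0.trans hax) h2
      nlinarith [hmx.2]
    · have hx1 : x₁ ≤ x := by
        by_contra hn
        have := h.a_mono (not_le.1 hn).le
        nlinarith [mul_pos hqp hp]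
      have := h.antitone_add hx1
      have h3 : q * p / 2 ≤ a x - a x₁ := by linarith
      have h4 : Λ₁ * (q * p / 2) ≤ Λ₁ * (a x - a x₁) := by gcongr
      have h5 := hA0 x
      have h6 : c * p = Λ₁ * (q * p / 2) := by rw [hc]; ring
      linarith
  · intro x hx
    have hax := h.a_mono hx
    have hmx := abs_le.1 (h.abs_m_le x)
    rcases le_total (q * p / 2) (a x) with h2 | h2
    · have := mid' x h2 (by linarith)
      nlinarith [hmx.1]
    · have hx1 : x ≤ x₁ := by
        by_contra hn
        have := h.a_mono (not_le.1 hn).le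
        nlinarith [mul_pos hqp hp]
      have := h.antitone_add hx1
      have h3 : q * p / 2 ≤ a x₁ - a x := by linarith
      have h4 : Λ₁ * (q * p / 2) ≤ Λ₁ * (a x₁ - a x) := by gcongr
      have h5 := hA0 x
      have h6 : c * p = Λ₁ * (q * p / 2) := by rw [hc]; ring
      linarith

end ScalarProfile

end ScalarProfile

set_option maxSynthPendingDepth 3

/-! ## Small profiles of the reduced system -/

section Profile

variable {E : Type*} [NormedAddCommGroup E] [InnerProductSpace ℝ E]

/-- Local data for a system `b(u) u' = h(u) - h(u_-)` near a state `u₀` where `dh` has a simple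
zero eigenvalue. Here `D`, `D2` are the first two derivatives of `h`, and `b1`, `b2` those of `b`. -/
structure ReducedModel (E : Type*) [NormedAddCommGroup E] [InnerProductSpace ℝ E] where
  h : E → E
  D : E → E →L[ℝ] E
  D2 : E → E →L[ℝ] E →L[ℝ] E
  b : E → E →L[ℝ] E
  b1 : E → E →L[ℝ] E →L[ℝ] E
  b2 : E → E →L[ℝ] E →L[ℝ] E →L[ℝ] E
  u₀ : E
  r : E
  N : Submodule ℝ E
  T : Submodule ℝ E
  lift : E →L[ℝ] E
  (β lam R C Λ : ℝ)
  mem_T : ∀ w, w ∈ T ↔ ∀ n ∈ N, ⟪D u₀ w, n⟫_ℝ = 0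
  pair : SymmetricPair (b u₀) (D u₀) T r β lam
  R_pos : 0 < R
  one_le_C : 1 ≤ C
  hasFDerivAt_h : ∀ u ∈ Metric.ball u₀ R, HasFDerivAt h (D u) u
  hasFDerivAt_D : ∀ u ∈ Metric.ball u₀ R, HasFDerivAt D (D2 u) u
  hasFDerivAt_b : ∀ u ∈ Metric.ball u₀ R, HasFDerivAt b (b1 u) u
  hasFDerivAt_b1 : ∀ u ∈ Metric.ball u₀ R, HasFDerivAt b1 (b2 u) u
  norm_D_le : ∀ u ∈ Metric.ball u₀ R, ‖D u‖ ≤ C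
  norm_D2_le : ∀ u ∈ Metric.ball u₀ R, ‖D2 u‖ ≤ C
  norm_b_le : ∀ u ∈ Metric.ball u₀ R, ‖b u‖ ≤ C
  norm_b1_le : ∀ u ∈ Metric.ball u₀ R, ‖b1 u‖ ≤ C
  norm_b2_le : ∀ u ∈ Metric.ball u₀ R, ‖b2 u‖ ≤ C
  continuousAt_D2 : ContinuousAt D2 u₀
  b_N : ∀ u ∈ Metric.ball u₀ R, ∀ x, ∀ n ∈ N, ⟪b u x, n⟫_ℝ = 0
  h_N : ∀ u ∈ Metric.ball u₀ R, ∀ u' ∈ Metric.ball u₀ R, ∀ n ∈ N,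
    ⟪h u - h u', n⟫_ℝ = ⟪D u₀ (u - u'), n⟫_ℝ
  lift_mem : ∀ f, lift f ∈ N
  lift_spec : ∀ f, ∀ n ∈ N, ⟪D u₀ (lift f), n⟫_ℝ = ⟪f, n⟫_ℝ
  Λ_pos : 0 < Λ
  nonlinear : ⟪D2 u₀ r r, r⟫_ℝ = -Λ

/-- A profile along which the coefficients are `θ`-close to their values at `u₀`. -/
structure SmallProfile (M : ReducedModel E) (θ : ℝ) (um : E) (ubar W W1 W2 : ℝ → E) : Prop where
  nonneg : 0 ≤ θ
  hasDerivAt : ∀ x, HasDerivAt ubar (W x) x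
  hasDerivAt_W : ∀ x, HasDerivAt W (W1 x) x
  hasDerivAt_W1 : ∀ x, HasDerivAt W1 (W2 x) x
  continuous_W2 : Continuous W2
  um_mem : um ∈ Metric.ball M.u₀ M.R
  mem : ∀ x, ubar x ∈ Metric.ball M.u₀ M.R
  D_le : ∀ x, ‖M.D (ubar x) - M.D M.u₀‖ ≤ θ
  b_le : ∀ x, ‖M.b (ubar x) - M.b M.u₀‖ ≤ θ
  D2_le : ∀ x, ‖M.D2 (ubar x) - M.D2 M.u₀‖ ≤ θ
  h_le : ∀ x, ‖M.h (ubar x) - M.h um‖ ≤ θ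
  ode : ∀ x, M.b (ubar x) (W x) = M.h (ubar x) - M.h um

namespace ReducedModel

variable (M : ReducedModel E)

/-- The covector `ℓ = b(u₀) r`. -/
def ell : E := M.b M.u₀ M.r

/-- The normalization `⟪b(u₀) r, r⟫`. -/
def sig : ℝ := ⟪M.ell, M.r⟫_ℝ

lemma u₀_mem : M.u₀ ∈ Metric.ball M.u₀ M.R := Metric.mem_ball_self M.R_pos

lemma β_le_sig : M.β ≤ M.sig := by
  have := M.pair.coercive _ M.pair.r_mem
  rw [M.pair.norm_r] at this
  simpa [sig, ell] using this

lemma sig_pos : 0 < M.sig := M.pair.β_pos.trans_le M.β_le_sig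

lemma norm_ell_le : ‖M.ell‖ ≤ M.C := by
  have := (M.b M.u₀).le_of_opNorm_le (M.norm_b_le _ M.u₀_mem) M.r
  rwa [M.pair.norm_r, mul_one] at this

lemma C_pos : 0 < M.C := zero_lt_one.trans_le M.one_le_C

lemma β_le_C : M.β ≤ M.C := by
  have h1 := real_inner_le_norm M.ell M.r
  rw [M.pair.norm_r, mul_one] at h1
  exact M.β_le_sig.trans (h1.trans M.norm_ell_le)

lemma norm_le_of_mem {t : E} (ht : t ∈ M.T) : M.β * ‖t‖ ≤ ‖M.b M.u₀ t‖ := by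
  have h1 := M.pair.coercive t ht
  have h2 := real_inner_le_norm (M.b M.u₀ t) t
  rcases eq_or_ne t 0 with h0 | h0
  · simp [h0]
  · have : 0 < ‖t‖ := norm_pos_iff.2 h0
    nlinarith

lemma hasDerivAt_mem {f f' : ℝ → E} (hf : ∀ x, HasDerivAt f (f' x) x) (h : ∀ x, f x ∈ M.T) (x : ℝ) :
    f' x ∈ M.T := by
  rw [M.mem_T]
  intro n hn
  have h1 : HasDerivAt (fun x => ⟪M.D M.u₀ (f x), n⟫_ℝ) ⟪M.D M.u₀ (f' x), n⟫_ℝ x := by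
    have := ((M.D M.u₀).hasFDerivAt.comp_hasDerivAt x (hf x)).inner ℝ (hasDerivAt_const x n)
    simpa using this
  have h2 : (fun x => ⟪M.D M.u₀ (f x), n⟫_ℝ) = fun _ => 0 :=
    funext fun x => (M.mem_T _).1 (h x) n hn
  rw [h2] at h1
  exact h1.unique (hasDerivAt_const x _)

end ReducedModel

namespace SmallProfile

variable {M : ReducedModel E} {θ : ℝ} {um : E} {ubar W W1 W2 : ℝ → E}

lemma continuous (P : SmallProfile M θ um ubar W W1 W2) : Continuous W :=
  continuous_iff_continuousAt.2 fun x => (P.hasDerivAt_W x).continuousAt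

lemma continuous_W1 (P : SmallProfile M θ um ubar W W1 W2) : Continuous W1 :=
  continuous_iff_continuousAt.2 fun x => (P.hasDerivAt_W1 x).continuousAt

/-- `b` takes values orthogonal to `N`, and the `N`-component of `h` is affine; hence `ubar - um`
satisfies the linear constraint defining `T`, and so does its derivative. -/
lemma W_mem (P : SmallProfile M θ um ubar W W1 W2) (x : ℝ) : W x ∈ M.T := by
  have h1 : ∀ x, ubar x - um ∈ M.T := fun x => by
    rw [M.mem_T]
    intro n hn
    rw [← M.h_N _ (P.mem x) _ P.um_mem n hn, ← P.ode, M.b_N _ (P.mem x) _ n hn]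
  exact M.hasDerivAt_mem (fun x => (P.hasDerivAt x).sub_const um) h1 x

lemma W1_mem (P : SmallProfile M θ um ubar W W1 W2) (x : ℝ) : W1 x ∈ M.T :=
  M.hasDerivAt_mem P.hasDerivAt_W P.W_mem x

lemma hasDerivAt_b (P : SmallProfile M θ um ubar W W1 W2) (x : ℝ) :
    HasDerivAt (fun x => M.b (ubar x)) (M.b1 (ubar x) (W x)) x :=
  (M.hasFDerivAt_b _ (P.mem x)).comp_hasDerivAt x (P.hasDerivAt x)

lemma second_ode (P : SmallProfile M θ um ubar W W1 W2) (x : ℝ) :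
    M.b (ubar x) (W1 x) = M.D (ubar x) (W x) - M.b1 (ubar x) (W x) (W x) := by
  have h1 := (P.hasDerivAt_b x).clm_apply (P.hasDerivAt_W x)
  have h2 : HasDerivAt (fun x => M.h (ubar x) - M.h um) (M.D (ubar x) (W x)) x :=
    ((M.hasFDerivAt_h _ (P.mem x)).comp_hasDerivAt x (P.hasDerivAt x)).sub_const _
  have h3 : (fun x => M.b (ubar x) (W x)) = fun x => M.h (ubar x) - M.h um := funext P.ode
  rw [h3] at h1
  rw [← h1.unique h2]
  abel

/-- Coercivity of `b(u₀)` on `T` inverts the profile equation; `θ ≤ β/2` absorbs the variation of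
`b`. -/
lemma norm_W_le (P : SmallProfile M θ um ubar W W1 W2) (hθ : θ ≤ M.β / 2) (x : ℝ) :
    ‖W x‖ ≤ 2 / M.β * θ := by
  have hβ := M.pair.β_pos
  have h1 := M.norm_le_of_mem (P.W_mem x)
  have e : M.b M.u₀ (W x) = (M.h (ubar x) - M.h um) - (M.b (ubar x) - M.b M.u₀) (W x) := by
    rw [sub_apply, P.ode]; abel
  have h2 : ‖M.b M.u₀ (W x)‖ ≤ θ + θ * ‖W x‖ := by
    rw [e]
    exact (norm_sub_le _ _).trans (add_le_add (P.h_le x) (ContinuousLinearMap.le_of_opNorm_le _ (P.b_le x) _))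
  have h3 : θ * ‖W x‖ ≤ M.β / 2 * ‖W x‖ := by gcongr
  have h4 : M.β / 2 * ‖W x‖ ≤ θ := by linarith
  calc ‖W x‖ = 2 / M.β * (M.β / 2 * ‖W x‖) := by field_simp
    _ ≤ 2 / M.β * θ := by gcongr

/-- The remainder of the differentiated profile equation, linearized at `u₀`. -/
lemma exists_remainder (M : ReducedModel E) : ∃ K θ₀ : ℝ, 0 < K ∧ 0 < θ₀ ∧
    ∀ {θ um} {ubar W W1 W2 : ℝ → E}, SmallProfile M θ um ubar W W1 W2 → θ ≤ θ₀ → ∀ x,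
      ‖M.b M.u₀ (W1 x) - M.D M.u₀ (W x)‖ ≤ K * θ * (‖W x‖ + ‖W1 x‖) ∧ ‖W1 x‖ ≤ K * ‖W x‖ := by
  have hβ := M.pair.β_pos
  have hC := M.C_pos
  set K1 := 1 + M.C * (2 / M.β) with hK1
  have hK1pos : 0 < K1 := by positivity
  refine ⟨max K1 ((2 / M.β) * (M.C + M.β)), min (M.β / 2) (M.β / (2 * K1)), by positivity,
    by positivity, ?_⟩
  intro θ um ubar W W1 W2 P hθ x
  have hθ0 := P.nonneg
  have hθ1 : θ ≤ M.β / 2 := hθ.trans (min_le_left _ _)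
  have hθ2 : K1 * θ ≤ M.β / 2 := by
    calc K1 * θ ≤ K1 * (M.β / (2 * K1)) := by gcongr; exact hθ.trans (min_le_right _ _)
      _ = M.β / 2 := by field_simp
  have e : M.b M.u₀ (W1 x) - M.D M.u₀ (W x)
      = (M.D (ubar x) - M.D M.u₀) (W x) - M.b1 (ubar x) (W x) (W x)
        - (M.b (ubar x) - M.b M.u₀) (W1 x) := by
    rw [sub_apply, sub_apply, P.second_ode]; abel
  have n1 := ContinuousLinearMap.le_of_opNorm_le _ (P.D_le x) (W x)
  have n2 := ContinuousLinearMap.le_of_opNorm_le _ (P.b_le x) (W1 x)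
  have n3 : ‖M.b1 (ubar x) (W x) (W x)‖ ≤ M.C * (2 / M.β * θ) * ‖W x‖ := by
    refine ((M.b1 (ubar x)).le_opNorm₂ _ _).trans ?_
    gcongr
    · exact M.norm_b1_le _ (P.mem x)
    · exact P.norm_W_le hθ1 x
  have h1 : ‖M.b M.u₀ (W1 x) - M.D M.u₀ (W x)‖ ≤ K1 * θ * (‖W x‖ + ‖W1 x‖) := by
    rw [e]
    refine (norm_sub_le _ _).trans ((add_le_add (norm_sub_le _ _) le_rfl).trans ?_)
    have : K1 * θ * (‖W x‖ + ‖W1 x‖) = θ * ‖W x‖ + M.C * (2 / M.β * θ) * ‖W x‖ + θ * ‖W1 x‖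
        + M.C * (2 / M.β * θ) * ‖W1 x‖ := by rw [hK1]; ring
    have : 0 ≤ M.C * (2 / M.β * θ) * ‖W1 x‖ := by positivity
    linarith
  refine ⟨h1.trans (by gcongr; exact le_max_left _ _), ?_⟩
  have h2 := M.norm_le_of_mem (P.W1_mem x)
  have h3 : ‖M.b M.u₀ (W1 x)‖ ≤ M.C * ‖W x‖ + M.β / 2 * (‖W x‖ + ‖W1 x‖) := by
    have e2 : M.b M.u₀ (W1 x) = M.D M.u₀ (W x) + (M.b M.u₀ (W1 x) - M.D M.u₀ (W x)) := by abel
    rw [e2]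
    refine (norm_add_le _ _).trans (add_le_add
      (ContinuousLinearMap.le_of_opNorm_le _ (M.norm_D_le _ M.u₀_mem) _) (h1.trans ?_))
    gcongr
  have h4 : M.β / 2 * ‖W1 x‖ ≤ (M.C + M.β) * ‖W x‖ := by nlinarith [norm_nonneg (W x)]
  calc ‖W1 x‖ = 2 / M.β * (M.β / 2 * ‖W1 x‖) := by field_simp
    _ ≤ 2 / M.β * ((M.C + M.β) * ‖W x‖) := by gcongr
    _ = 2 / M.β * (M.C + M.β) * ‖W x‖ := by ring
    _ ≤ _ := by gcongr; exact le_max_right _ _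

end SmallProfile

/-! ### Pointwise bounds from the peaked weight -/

lemma memLp_peakWeight {F : Type*} [NormedAddCommGroup F] {η : ℝ} (hη : 0 < η) (a : ℝ) {f : ℝ → F}
    (hf : Continuous f) {C : ℝ} (hC : ∀ x, ‖f x‖ ≤ C) : MemLp f 2 (weightedMeasure (peakWeight η a)) := by
  have := isFiniteMeasure_peakWeight hη a
  exact MemLp.of_bound hf.aestronglyMeasurable C (Eventually.of_forall hC)

/-- Point evaluation of `A²` reads `2 A(a)² ≈ 2 η ∫ A²` up to `∫ |2 A A'|`. When `A'` is small
relative to `η A` that error takes away only half of the integral: a slowly varying scalar is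
governed by its value at the peak. -/
lemma integral_sq_le_of_slow {η : ℝ} (hη : 0 < η) (a : ℝ) {A A' : ℝ → ℝ}
    (hA : IsPrimitive A A') (L : MemLp A 2 (weightedMeasure (peakWeight η a)))
    (L' : MemLp A' 2 (weightedMeasure (peakWeight η a)))
    (h : ∫ x, |A' x| ^ 2 ∂weightedMeasure (peakWeight η a)
      ≤ (η / 2) ^ 2 * ∫ x, |A x| ^ 2 ∂weightedMeasure (peakWeight η a)) :
    ∫ x, |A x| ^ 2 ∂weightedMeasure (peakWeight η a) ≤ 2 / η * A a ^ 2 := by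
  set μ := weightedMeasure (peakWeight η a) with hμ
  have s1 : Integrable (fun x => |A x| ^ 2) μ := L.integrable_norm_pow (p := 2) (by simp)
  have s2 : Integrable (fun x => |A' x| ^ 2) μ := L'.integrable_norm_pow (p := 2) (by simp)
  have i1 : Integrable (fun x => A x * A x) μ := L.integrable_mul L
  have i2 : Integrable (fun x => A x * A' x + A' x * A x) μ :=
    (L.integrable_mul L').add (L'.integrable_mul L)
  have h1 := two_mul_eval_sub_le hη a (hA.mul hA) i1 i2
  have h2 : ∫ x, |A x * A' x + A' x * A x| ∂μ ≤
      η / 2 * (∫ x, |A x| ^ 2 ∂μ) + 2 / η * ∫ x, |A' x| ^ 2 ∂μ := by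
    rw [← integral_const_mul, ← integral_const_mul, ← integral_add (s1.const_mul _) (s2.const_mul _)]
    refine integral_mono i2.abs ((s1.const_mul _).add (s2.const_mul _)) fun x => ?_
    have e : A x * A' x + A' x * A x = 2 * (A x * A' x) := by ring
    show _ ≤ η / 2 * |A x| ^ 2 + 2 / η * |A' x| ^ 2
    rw [e, abs_mul, abs_mul, abs_two]
    have e2 : η / 2 * |A x| ^ 2 + 2 / η * |A' x| ^ 2 - 2 * (|A x| * |A' x|)
      = (η * |A x| - 2 * |A' x|) ^ 2 / (2 * η) := by field_simp; ring
    have : 0 ≤ (η * |A x| - 2 * |A' x|) ^ 2 / (2 * η) := by positivity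
    linarith
  have h3 : ∫ x, A x * A x ∂μ = ∫ x, |A x| ^ 2 ∂μ :=
    integral_congr_ae (Eventually.of_forall fun x => by simp only [sq_abs]; ring)
  rw [h3] at h1
  have h4 := (abs_le.1 h1).1
  have h5 : 2 / η * ∫ x, |A' x| ^ 2 ∂μ ≤ η / 2 * ∫ x, |A x| ^ 2 ∂μ := by
    calc 2 / η * ∫ x, |A' x| ^ 2 ∂μ ≤ 2 / η * ((η / 2) ^ 2 * ∫ x, |A x| ^ 2 ∂μ) := by gcongr
      _ = η / 2 * ∫ x, |A x| ^ 2 ∂μ := by field_simp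
  have h6 : η * ∫ x, |A x| ^ 2 ∂μ ≤ 2 * (A a) ^ 2 := by nlinarith
  calc ∫ x, |A x| ^ 2 ∂μ = (1 / η) * (η * ∫ x, |A x| ^ 2 ∂μ) := by field_simp
    _ ≤ (1 / η) * (2 * (A a) ^ 2) := by gcongr
    _ = _ := by ring

/-- The converse direction, for `y`: its value at the peak is bounded by its weighted `H¹` norm.
Together with `integral_sq_le_of_slow` this turns an `L²` comparison into a pointwise one. -/
lemma norm_sq_eval_le [CompleteSpace E] {η : ℝ} (hη : 0 < η) (a : ℝ) {y y' : ℝ → E}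
    (hy : IsPrimitive y y') (L : MemLp y 2 (weightedMeasure (peakWeight η a)))
    (L' : MemLp y' 2 (weightedMeasure (peakWeight η a))) :
    ‖y a‖ ^ 2 ≤ (η + 1) * ((∫ x, ‖y x‖ ^ 2 ∂weightedMeasure (peakWeight η a))
      + ∫ x, ‖y' x‖ ^ 2 ∂weightedMeasure (peakWeight η a)) := by
  set μ := weightedMeasure (peakWeight η a) with hμ
  have s1 : Integrable (fun x => ‖y x‖ ^ 2) μ := L.integrable_norm_pow (p := 2) (by simp)
  have s2 : Integrable (fun x => ‖y' x‖ ^ 2) μ := L'.integrable_norm_pow (p := 2) (by simp)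
  have i1 := L.integrable_inner_two L
  have i2 : Integrable (fun x => ⟪y x, y' x⟫_ℝ + ⟪y' x, y x⟫_ℝ) μ :=
    (L.integrable_inner_two L').add (L'.integrable_inner_two L)
  have h1 := two_mul_eval_sub_le hη a (hy.inner hy) i1 i2
  have h2 : ∫ x, |⟪y x, y' x⟫_ℝ + ⟪y' x, y x⟫_ℝ| ∂μ ≤
      (∫ x, ‖y x‖ ^ 2 ∂μ) + ∫ x, ‖y' x‖ ^ 2 ∂μ := by
    rw [← integral_add s1 s2]
    refine integral_mono i2.abs (s1.add s2) fun x => ?_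
    have e : ⟪y x, y' x⟫_ℝ + ⟪y' x, y x⟫_ℝ = 2 * ⟪y x, y' x⟫_ℝ := by
      rw [real_inner_comm (y x) (y' x)]; ring
    rw [e, abs_mul, abs_two]
    have := abs_real_inner_le_norm (y x) (y' x)
    show _ ≤ ‖y x‖ ^ 2 + ‖y' x‖ ^ 2
    nlinarith [sq_nonneg (‖y x‖ - ‖y' x‖)]
  simp only [real_inner_self_eq_norm_sq] at h1
  have h4 := (abs_le.1 h1).2
  have h5 : 0 ≤ ∫ x, ‖y x‖ ^ 2 ∂μ := integral_nonneg fun _ => by positivity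
  have h6 : 0 ≤ ∫ x, ‖y' x‖ ^ 2 ∂μ := integral_nonneg fun _ => by positivity
  nlinarith

end Profile

/-! ### Pointwise comparison and the cone condition for profiles -/

section Cone

variable {E : Type*} [NormedAddCommGroup E] [InnerProductSpace ℝ E]

/-- If the source is controlled by a slowly varying scalar, so is the solution, pointwise. -/
theorem SymmetricPair.peak_estimate [CompleteSpace E] {b A : E →L[ℝ] E} {T : Submodule ℝ E} {r : E}
    {β lam : ℝ} (P : SymmetricPair b A T r β lam) (Cc Qm : ℝ) (hCc : 0 ≤ Cc) :
    ∃ θ₀ K : ℝ, 0 < θ₀ ∧ 0 < K ∧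
      ∀ (θ Q B : ℝ) (y y' g c : ℝ → E) (e S S' : ℝ → ℝ),
        0 ≤ θ → θ ≤ θ₀ → 0 ≤ Q → Q ≤ Qm →
        (∀ x, HasDerivAt y (y' x) x) → Continuous y' → (∀ x, HasDerivAt S (S' x) x) →
        Continuous S' → (∀ x, ‖y x‖ ≤ B) → (∀ x, ‖y' x‖ ≤ B) → (∀ x, |S x| ≤ B) →
        (∀ x, y x ∈ T) → (∀ x, y' x ∈ T) → (∀ x, ⟪b r, y x⟫_ℝ = 0) → (∀ x, ⟪b r, y' x⟫_ℝ = 0) →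
        (∀ x, b (y' x) = A (y x) + g x - e x • c x) →
        (∀ x, ‖g x‖ ≤ θ * (‖y x‖ + ‖y' x‖) + Q * |S x|) →
        (∀ x, ‖c x‖ ≤ Cc) → (∀ x, β / 2 ≤ ⟪c x, r⟫_ℝ) →
        (∀ x, |S' x| ≤ θ * (‖y x‖ + ‖y' x‖ + |S x|)) → ∀ x, ‖y x‖ ≤ K * Q * |S x| := by
  obtain ⟨η, θ₁, K, hη, hθ₁, hK, hmain⟩ := P.energy_estimate Cc hCc
  set K1 := 3 * (K * Qm ^ 2 + 1) with hK1
  have hK1p : 0 < K1 := by positivity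
  refine ⟨min θ₁ (min 1 ((η / 2) ^ 2 / K1)), Real.sqrt ((η + 1) * K * (2 / η)), by positivity,
    by positivity, ?_⟩
  intro θ Q B y y' g c e S S' hθ hθ0 hQ hQ0 hy hy'c hS hS'c By By' BS my my' ly ly' heq hg hc hcr hS' a
  have hθa : θ ≤ θ₁ := hθ0.trans (min_le_left _ _)
  have hθb : θ ≤ 1 := hθ0.trans ((min_le_right _ _).trans (min_le_left _ _))
  have hθc : θ * K1 ≤ (η / 2) ^ 2 := by
    rw [← le_div_iff₀ hK1p]; exact hθ0.trans ((min_le_right _ _).trans (min_le_right _ _))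
  set μ := weightedMeasure (peakWeight η a) with hμ
  have cy : Continuous y := continuous_iff_continuousAt.2 fun x => (hy x).continuousAt
  have cS : Continuous S := continuous_iff_continuousAt.2 fun x => (hS x).continuousAt
  have py := IsPrimitive.of_hasDerivAt hy hy'c
  have pS := IsPrimitive.of_hasDerivAt hS hS'c
  have BS' : ∀ x, ‖S' x‖ ≤ θ * (B + B + B) := fun x => (hS' x).trans (by
    gcongr; exacts [By x, By' x, BS x])
  have Ly : MemLp y 2 μ := memLp_peakWeight hη a cy By
  have Ly' : MemLp y' 2 μ := memLp_peakWeight hη a hy'c By'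
  have LS : MemLp S 2 μ := memLp_peakWeight hη a cS BS
  have LS' : MemLp S' 2 μ := memLp_peakWeight hη a hS'c BS'
  -- The energy estimate is applied in the weight centred at the point `a` of evaluation, with the
  -- fixed rate `η` that it tolerates.
  have h1 := hmain μ η θ y y' g c e (fun x => Q * S x) hη.le le_rfl hθ hθa Ly Ly' (LS.const_mul Q)
    (Eventually.of_forall fun x => ⟨my x, my' x, ly x, ly' x, heq x, by
      rw [abs_mul, abs_of_nonneg hQ]; exact hg x, hc x, hcr x⟩)
    (P.integral_inner_le (slowWeight_peakWeight hη.le a) py Ly Ly')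
  have e1 : ∫ x, |Q * S x| ^ 2 ∂μ = Q ^ 2 * ∫ x, |S x| ^ 2 ∂μ := by
    rw [← integral_const_mul]; congr 1; funext x; rw [abs_mul, mul_pow, sq_abs Q]
  rw [e1] at h1
  have s1 : Integrable (fun x => ‖y x‖ ^ 2) μ := Ly.integrable_norm_pow (p := 2) (by simp)
  have s2 : Integrable (fun x => ‖y' x‖ ^ 2) μ := Ly'.integrable_norm_pow (p := 2) (by simp)
  have s3 : Integrable (fun x => |S x| ^ 2) μ := LS.integrable_norm_pow (p := 2) (by simp)
  have s4 : Integrable (fun x => |S' x| ^ 2) μ := LS'.integrable_norm_pow (p := 2) (by simp)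
  set Y := ∫ x, ‖y x‖ ^ 2 ∂μ
  set Y' := ∫ x, ‖y' x‖ ^ 2 ∂μ
  set Sg := ∫ x, |S x| ^ 2 ∂μ with hSg
  have hSg0 : 0 ≤ Sg := integral_nonneg fun _ => by positivity
  have h2 : ∫ x, |S' x| ^ 2 ∂μ ≤ 3 * θ ^ 2 * (Y + Y' + Sg) := by
    have s12 : Integrable (fun x => ‖y x‖ ^ 2 + ‖y' x‖ ^ 2) μ := s1.add s2
    have e2 : ∫ x, 3 * θ ^ 2 * (‖y x‖ ^ 2 + ‖y' x‖ ^ 2 + |S x| ^ 2) ∂μ = 3 * θ ^ 2 * (Y + Y' + Sg) := by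
      rw [integral_const_mul, integral_add s12 s3, integral_add s1 s2]
    rw [← e2]
    refine integral_mono s4 ((s12.add s3).const_mul _) fun x => ?_
    calc |S' x| ^ 2 ≤ (θ * (‖y x‖ + ‖y' x‖ + |S x|)) ^ 2 := by gcongr; exact hS' x
      _ = θ ^ 2 * (‖y x‖ + ‖y' x‖ + |S x|) ^ 2 := by ring
      _ ≤ θ ^ 2 * (3 * (‖y x‖ ^ 2 + ‖y' x‖ ^ 2 + |S x| ^ 2)) := by
          gcongr
          nlinarith [sq_nonneg (‖y x‖ - ‖y' x‖), sq_nonneg (‖y x‖ - |S x|),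
            sq_nonneg (‖y' x‖ - |S x|)]
      _ = 3 * θ ^ 2 * (‖y x‖ ^ 2 + ‖y' x‖ ^ 2 + |S x| ^ 2) := by ring
  -- Since `y` and `y'` are already bounded by `S`, the bound on `S'` closes: `S` varies slowly on
  -- the scale `1/η`.
  have h3 : ∫ x, |S' x| ^ 2 ∂μ ≤ (η / 2) ^ 2 * Sg := by
    have hQ2 : Q ^ 2 ≤ Qm ^ 2 := by gcongr
    calc ∫ x, |S' x| ^ 2 ∂μ ≤ 3 * θ ^ 2 * (Y + Y' + Sg) := h2
      _ ≤ 3 * θ ^ 2 * (K * (Qm ^ 2 * Sg) + Sg) := by gcongr; exact h1.trans (by gcongr)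
      _ = θ * (θ * K1) * Sg := by rw [hK1]; ring
      _ ≤ 1 * (η / 2) ^ 2 * Sg := by gcongr
      _ = _ := by ring
  have h4 := integral_sq_le_of_slow hη a pS LS LS' h3
  have h5 := norm_sq_eval_le hη a py Ly Ly'
  have h6 : ‖y a‖ ^ 2 ≤ ((η + 1) * K * (2 / η)) * (Q * |S a|) ^ 2 := by
    calc ‖y a‖ ^ 2 ≤ (η + 1) * (K * (Q ^ 2 * (2 / η * S a ^ 2))) :=
          h5.trans (by gcongr; exact h1.trans (by gcongr))
      _ = _ := by rw [mul_pow, sq_abs]; ring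
  have h7 := Real.sqrt_le_sqrt h6
  rw [Real.sqrt_sq (norm_nonneg _), Real.sqrt_mul (by positivity), Real.sqrt_sq (by positivity)] at h7
  linarith

namespace ReducedModel

variable (M : ReducedModel E)

/-- The coordinate along `r` in the splitting `E = ℝ r ⊕ ℓ^⊥`. -/
def coord : E →L[ℝ] ℝ := M.sig⁻¹ • innerSL ℝ M.ell

lemma coord_apply (w : E) : M.coord w = M.sig⁻¹ * ⟪M.ell, w⟫_ℝ := rfl

lemma coord_r : M.coord M.r = 1 := by
  rw [coord_apply]; exact inv_mul_cancel₀ M.sig_pos.ne'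

lemma inner_ell (w : E) : ⟪M.ell, w⟫_ℝ = M.sig * M.coord w := by
  rw [coord_apply, mul_inv_cancel_left₀ M.sig_pos.ne']

lemma abs_coord_le (w : E) : |M.coord w| ≤ M.C / M.β * ‖w‖ := by
  have h1 := M.β_le_sig
  have h2 := M.pair.β_pos
  have h3 := M.C_pos
  rw [coord_apply, abs_mul, abs_of_pos (inv_pos.2 M.sig_pos)]
  calc M.sig⁻¹ * |⟪M.ell, w⟫_ℝ| ≤ M.β⁻¹ * (M.C * ‖w‖) := by
        gcongr
        exact (abs_real_inner_le_norm _ _).trans (by gcongr; exact M.norm_ell_le)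
    _ = _ := by ring

/-- The component transverse to `r`. -/
def trans : E →L[ℝ] E := ContinuousLinearMap.id ℝ E - M.coord.smulRight M.r

lemma trans_apply (w : E) : M.trans w = w - M.coord w • M.r := rfl

lemma coord_smul_add_trans (w : E) : M.coord w • M.r + M.trans w = w := by
  rw [trans_apply]; abel

lemma inner_ell_trans (w : E) : ⟪M.ell, M.trans w⟫_ℝ = 0 := by
  rw [M.inner_ell, trans_apply, map_sub, map_smul, M.coord_r]; simp

lemma trans_mem {w : E} (h : w ∈ M.T) : M.trans w ∈ M.T :=
  M.T.sub_mem h (M.T.smul_mem _ M.pair.r_mem)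

lemma norm_le_coord_add (w : E) : ‖w‖ ≤ |M.coord w| + ‖M.trans w‖ := by
  conv_lhs => rw [← M.coord_smul_add_trans w]
  refine (norm_add_le _ _).trans ?_
  rw [norm_smul, M.pair.norm_r, mul_one, Real.norm_eq_abs]

lemma norm_trans_le (w : E) : ‖M.trans w‖ ≤ (1 + M.C / M.β) * ‖w‖ := by
  rw [trans_apply]
  refine (norm_sub_le _ _).trans ?_
  rw [norm_smul, M.pair.norm_r, mul_one, Real.norm_eq_abs]
  have := M.abs_coord_le w
  linarith

lemma D_trans (w : E) : M.D M.u₀ (M.trans w) = M.D M.u₀ w := by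
  rw [trans_apply, map_sub, map_smul, M.pair.A_r]; simp

lemma b_trans (w : E) : M.b M.u₀ (M.trans w) = M.b M.u₀ w - M.coord w • M.ell := by
  rw [trans_apply, map_sub, map_smul]; rfl

/-- The derivative of a small profile lies in a thin cone around the line spanned by `r`. -/
theorem cone [CompleteSpace E] : ∃ K θ₀ : ℝ, 0 < K ∧ 0 < θ₀ ∧
    ∀ {θ um} {ubar W W1 W2 : ℝ → E}, SmallProfile M θ um ubar W W1 W2 → θ ≤ θ₀ → ∀ x,
      ‖M.trans (W x)‖ ≤ K * θ * |M.coord (W x)| ∧ |M.coord (W1 x)| ≤ K * θ * |M.coord (W x)| ∧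
      ‖W1 x‖ ≤ K * |M.coord (W x)| ∧ ‖W x‖ ≤ 2 * |M.coord (W x)| := by
  have hβ := M.pair.β_pos
  have hC := M.C_pos
  obtain ⟨K₁, θ₁, hK₁, hθ₁, hrem⟩ := SmallProfile.exists_remainder M
  obtain ⟨θ₂, K₂, hθ₂, hK₂, hpeak⟩ := M.pair.peak_estimate M.C 1 hC.le
  set τ := 2 * K₁ * (1 + 2 / M.β) with hτ
  have hτp : 0 < τ := by positivity
  have hτ1 : 2 * K₁ ≤ τ := by
    rw [hτ]; have : 0 ≤ 2 * K₁ * (2 / M.β) := by positivity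
    nlinarith
  have hτ2 : 2 / M.β * (2 * K₁) ≤ τ := by rw [hτ]; nlinarith
  set K₃ := max (K₂ * τ) (max (2 * K₁) ((2 / M.β) * (K₁ * (2 * (1 + K₁)))))
  have hK₃ : 0 < K₃ := by positivity
  refine ⟨K₃, min θ₁ (min (M.β / 2) (min (M.β / (4 * K₁)) (min (θ₂ / τ) (min (1 / τ) (1 / K₃))))),
    hK₃, by positivity, ?_⟩
  intro θ um ubar W W1 W2 P hθ
  simp only [le_min_iff] at hθ
  obtain ⟨t1, t2, t3, t4, t5, t6⟩ := hθ
  have hθ0 := P.nonneg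
  rw [le_div_iff₀ (by positivity)] at t3 t4 t5 t6
  let R : ℝ → E := fun x => M.b M.u₀ (W1 x) - M.D M.u₀ (W x)
  have hR := hrem P t1
  -- Removing the `r`-components leaves `D` unchanged, because `D(u₀) r = 0`, and subtracts a
  -- multiple of `ℓ` from `b`. The coefficient `coord (W1 x)` thus plays the role of the multiplier.
  have heq : ∀ x, M.b M.u₀ (M.trans (W1 x))
      = M.D M.u₀ (M.trans (W x)) + R x - M.coord (W1 x) • M.ell := fun x => by
    rw [M.D_trans, M.b_trans]; simp only [R]; abel
  have hmul : ∀ x, |M.coord (W1 x)| ≤ 2 / M.β * ‖R x‖ := fun x =>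
    M.pair.abs_multiplier_le (M.inner_ell_trans _) (heq x) (by
      have := M.β_le_sig; unfold sig at this; linarith)
  have hRb : ∀ x, ‖R x‖ ≤ 2 * K₁ * θ * (‖M.trans (W x)‖ + ‖M.trans (W1 x)‖ + |M.coord (W x)|) := by
    intro x
    have a1 := M.norm_le_coord_add (W x)
    have a2 := M.norm_le_coord_add (W1 x)
    have a3 : K₁ * θ * |M.coord (W1 x)| ≤ 1 / 2 * ‖R x‖ := by
      calc K₁ * θ * |M.coord (W1 x)| ≤ K₁ * θ * (2 / M.β * ‖R x‖) := by gcongr; exact hmul x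
        _ = (θ * (4 * K₁)) * (1 / (2 * M.β)) * ‖R x‖ := by field_simp; ring
        _ ≤ M.β * (1 / (2 * M.β)) * ‖R x‖ := by gcongr
        _ = _ := by field_simp
    have a4 : ‖R x‖ ≤ K₁ * θ * ((|M.coord (W x)| + ‖M.trans (W x)‖)
        + (|M.coord (W1 x)| + ‖M.trans (W1 x)‖)) := (hR x).1.trans (by gcongr)
    linarith
  have hWb : ∀ x, ‖W x‖ ≤ 1 := fun x => (P.norm_W_le t2 x).trans (by
    calc 2 / M.β * θ ≤ 2 / M.β * (M.β / 2) := by gcongr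
      _ = 1 := by field_simp)
  have hW1b : ∀ x, ‖W1 x‖ ≤ K₁ := fun x => (hR x).2.trans (by nlinarith [hWb x])
  set B := (1 + M.C / M.β) * (1 + K₁) with hB
  -- The scalar of the comparison is the `r`-component of `W` itself, whose derivative is the
  -- multiplier just bounded; the source amplitude `θ τ` makes the cone thin.
  have hcone : ∀ x, ‖M.trans (W x)‖ ≤ K₂ * (θ * τ) * |M.coord (W x)| := by
    refine hpeak (θ * τ) (θ * τ) B _ (fun x => M.trans (W1 x)) R (fun _ => M.ell)
      (fun x => M.coord (W1 x)) (fun x => M.coord (W x)) (fun x => M.coord (W1 x)) (by positivity)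
      t4 (by positivity) t5 (fun x => M.trans.hasFDerivAt.comp_hasDerivAt x (P.hasDerivAt_W x))
      (M.trans.continuous.comp P.continuous_W1)
      (fun x => M.coord.hasFDerivAt.comp_hasDerivAt x (P.hasDerivAt_W x))
      (M.coord.continuous.comp P.continuous_W1) ?_ ?_ ?_ (fun x => M.trans_mem (P.W_mem x))
      (fun x => M.trans_mem (P.W1_mem x)) (fun x => M.inner_ell_trans _)
      (fun x => M.inner_ell_trans _) heq ?_ (fun _ => M.norm_ell_le) ?_ ?_
    · intro x
      refine (M.norm_trans_le _).trans ?_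
      rw [hB]; gcongr; linarith [hWb x]
    · intro x
      refine (M.norm_trans_le _).trans ?_
      rw [hB]; gcongr; linarith [hW1b x]
    · intro x
      refine (M.abs_coord_le _).trans ?_
      rw [hB]; gcongr
      · linarith
      · linarith [hWb x]
    · intro x
      refine (hRb x).trans ?_
      calc 2 * K₁ * θ * (‖M.trans (W x)‖ + ‖M.trans (W1 x)‖ + |M.coord (W x)|)
          ≤ τ * θ * (‖M.trans (W x)‖ + ‖M.trans (W1 x)‖ + |M.coord (W x)|) := by gcongr
        _ = _ := by ring
    · intro x
      have := M.β_le_sig; unfold sig at this; linarith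
    · intro x
      refine (hmul x).trans ?_
      calc 2 / M.β * ‖R x‖ ≤ 2 / M.β * (2 * K₁ * θ
            * (‖M.trans (W x)‖ + ‖M.trans (W1 x)‖ + |M.coord (W x)|)) := by gcongr; exact hRb x
        _ = 2 / M.β * (2 * K₁) * θ * (‖M.trans (W x)‖ + ‖M.trans (W1 x)‖ + |M.coord (W x)|) := by ring
        _ ≤ τ * θ * (‖M.trans (W x)‖ + ‖M.trans (W1 x)‖ + |M.coord (W x)|) := by gcongr
        _ = _ := by ring
  intro x
  have c1 : ‖M.trans (W x)‖ ≤ K₃ * θ * |M.coord (W x)| :=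
    (hcone x).trans (by
      calc K₂ * (θ * τ) * |M.coord (W x)| = K₂ * τ * θ * |M.coord (W x)| := by ring
        _ ≤ _ := by gcongr; exact le_max_left _ _)
  have c2 : ‖W x‖ ≤ 2 * |M.coord (W x)| := by
    have h1 : K₃ * θ * |M.coord (W x)| ≤ 1 * |M.coord (W x)| := by gcongr; linarith
    linarith [M.norm_le_coord_add (W x)]
  have c3 : ‖W1 x‖ ≤ 2 * K₁ * |M.coord (W x)| := (hR x).2.trans (by nlinarith)
  refine ⟨c1, (hmul x).trans ?_, c3.trans ?_, c2⟩
  · have h2 : ‖R x‖ ≤ K₁ * θ * (2 * |M.coord (W x)| + 2 * K₁ * |M.coord (W x)|) :=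
      (hR x).1.trans (by gcongr)
    calc 2 / M.β * ‖R x‖ ≤ 2 / M.β * (K₁ * θ * (2 * |M.coord (W x)| + 2 * K₁ * |M.coord (W x)|)) := by
          gcongr
      _ = (2 / M.β) * (K₁ * (2 * (1 + K₁))) * θ * |M.coord (W x)| := by ring
      _ ≤ _ := by gcongr; exact (le_max_right _ _).trans (le_max_right _ _)
  · gcongr; exact (le_max_left _ _).trans (le_max_right _ _)

end ReducedModel

end Cone

/-! ### Monotonicity of the profile and its normalized direction -/

section Shock

variable {E : Type*} [NormedAddCommGroup E] [InnerProductSpace ℝ E]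

/-- Grönwall to the right of `a`, and by reflection to its left. -/
lemma eq_zero_of_norm_deriv_le_mul {F : Type*} [NormedAddCommGroup F] [NormedSpace ℝ F]
    {f f' : ℝ → F} {K : ℝ} (hf : ∀ x, HasDerivAt f (f' x) x) (hK : ∀ x, ‖f' x‖ ≤ K * ‖f x‖) {a : ℝ}
    (ha : f a = 0) (x : ℝ) : f x = 0 := by
  have key : ∀ {g g' : ℝ → F} {a : ℝ}, (∀ x, HasDerivAt g (g' x) x) →
      (∀ x, ‖g' x‖ ≤ K * ‖g x‖) → g a = 0 → ∀ x, a ≤ x → g x = 0 := by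
    intro g g' a hg hK ha x hx
    exact eq_zero_of_abs_deriv_le_mul_abs_self_of_eq_zero_right
      (fun t _ => (hg t).continuousAt.continuousWithinAt) (fun t _ => (hg t).hasDerivWithinAt) ha
      (fun t _ => hK t) x ⟨hx, le_rfl⟩
  rcases le_total a x with h | h
  · exact key hf hK ha x h
  · have h1 : ∀ x, HasDerivAt (fun x => f (-x)) (-f' (-x)) x := fun x => by
      exact ((hf (-x)).scomp x (hasDerivAt_neg x)).congr_deriv (by simp)
    have := key (a := -a) h1 (fun x => by rw [norm_neg]; exact hK (-x)) (by simpa using ha) (-x)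
      (by linarith)
    simpa using this

/-- A small profile joining `um` to `up`, with `up - um` of size `ε` and nearly parallel
to `r`. -/
structure SmallShock (M : ReducedModel E) (θ ε : ℝ) (um up : E) (ubar W W1 W2 : ℝ → E) : Prop
    extends SmallProfile M θ um ubar W W1 W2 where
  ε_pos : 0 < ε
  up_mem : up ∈ Metric.ball M.u₀ M.R
  rankineHugoniot : M.h um = M.h up
  tendsto_atBot : Tendsto ubar atBot (𝓝 um)
  tendsto_atTop : Tendsto ubar atTop (𝓝 up)
  coord_lower : ε / 2 ≤ M.coord (up - um)
  coord_upper : M.coord (up - um) ≤ 2 * ε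

namespace SmallShock

variable {M : ReducedModel E} {θ ε : ℝ} {um up : E} {ubar W W1 W2 : ℝ → E}

/-- `W` is bounded by the flux difference `h(ubar) - h(um)`, which vanishes at `+∞` as well by the
Rankine-Hugoniot relation. -/
lemma tendsto_W (P : SmallShock M θ ε um up ubar W W1 W2) (hθ : θ ≤ M.β / 2) :
    Tendsto W atBot (𝓝 0) ∧ Tendsto W atTop (𝓝 0) := by
  have hβ := M.pair.β_pos
  have key : ∀ x, ‖W x‖ ≤ 2 / M.β * ‖M.h (ubar x) - M.h um‖ := by
    intro x
    have h1 := M.norm_le_of_mem (P.W_mem x)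
    have e : M.b M.u₀ (W x) = (M.h (ubar x) - M.h um) - (M.b (ubar x) - M.b M.u₀) (W x) := by
      rw [sub_apply, P.ode]; abel
    have h2 : ‖M.b M.u₀ (W x)‖ ≤ ‖M.h (ubar x) - M.h um‖ + θ * ‖W x‖ := by
      rw [e]
      exact (norm_sub_le _ _).trans
        (add_le_add le_rfl (ContinuousLinearMap.le_of_opNorm_le _ (P.b_le x) _))
    have h3 : θ * ‖W x‖ ≤ M.β / 2 * ‖W x‖ := by gcongr
    have h4 : M.β / 2 * ‖W x‖ ≤ ‖M.h (ubar x) - M.h um‖ := by linarith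
    calc ‖W x‖ = 2 / M.β * (M.β / 2 * ‖W x‖) := by field_simp
      _ ≤ _ := by gcongr
  have main : ∀ {l : Filter ℝ}, Tendsto (fun x => M.h (ubar x)) l (𝓝 (M.h um)) →
      Tendsto W l (𝓝 0) := by
    intro l hl
    refine squeeze_zero_norm key ?_
    have := ((hl.sub_const (M.h um)).norm).const_mul (2 / M.β)
    simpa using this
  refine ⟨main ?_, main ?_⟩
  · exact ((M.hasFDerivAt_h _ P.um_mem).continuousAt.tendsto.comp P.tendsto_atBot)
  · rw [P.rankineHugoniot]
    exact ((M.hasFDerivAt_h _ P.up_mem).continuousAt.tendsto.comp P.tendsto_atTop)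

lemma tendsto_coord (P : SmallShock M θ ε um up ubar W W1 W2) :
    Tendsto (fun x => M.coord (ubar x - um)) atBot (𝓝 0) ∧
      Tendsto (fun x => M.coord (ubar x - um)) atTop (𝓝 (M.coord (up - um))) := by
  constructor
  · have := (M.coord.continuous.tendsto _).comp (P.tendsto_atBot.sub_const um)
    rwa [sub_self, map_zero] at this
  · exact (M.coord.continuous.tendsto _).comp (P.tendsto_atTop.sub_const um)

lemma hasDerivAt_coord (P : SmallShock M θ ε um up ubar W W1 W2) (x : ℝ) :
    HasDerivAt (fun x => M.coord (ubar x - um)) (M.coord (W x)) x :=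
  M.coord.hasFDerivAt.comp_hasDerivAt x ((P.hasDerivAt x).sub_const um)

/-- A zero would propagate to the whole line by Grönwall, so a value `≤ 0` somewhere forces the sign
`≤ 0` everywhere; then `coord (ubar - um)` would decrease, against its positive limit at `+∞`. -/
lemma coord_pos (P : SmallShock M θ ε um up ubar W W1 W2) {K : ℝ}
    (h1 : ∀ x, ‖M.coord (W1 x)‖ ≤ K * ‖M.coord (W x)‖) (x : ℝ) : 0 < M.coord (W x) := by
  have hp := P.ε_pos
  have hA : ∀ x, HasDerivAt (fun x => M.coord (W x)) (M.coord (W1 x)) x := fun x =>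
    M.coord.hasFDerivAt.comp_hasDerivAt x (P.hasDerivAt_W x)
  have cA : Continuous fun x => M.coord (W x) := M.coord.continuous.comp P.continuous
  obtain ⟨t0, t1⟩ := P.tendsto_coord
  by_contra hn
  push Not at hn
  have hall : ∀ y, M.coord (W y) ≤ 0 := by
    rcases hn.eq_or_lt with h0 | hlt
    · intro y; exact (eq_zero_of_norm_deriv_le_mul hA h1 h0 y).le
    · intro y
      by_contra hy
      push Not at hy
      obtain ⟨z, hz⟩ := mem_range_of_exists_le_of_exists_ge cA ⟨x, hlt.le⟩ ⟨y, hy.le⟩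
      exact hlt.ne (eq_zero_of_norm_deriv_le_mul hA h1 hz x)
  have hanti : Antitone fun x => M.coord (ubar x - um) := fun _ _ hxy =>
    le_of_deriv_nonpos_of_le P.hasDerivAt_coord hxy fun t _ _ => hall t
  have h2 := hanti.le_of_tendsto t1 0
  have h3 := hanti.ge_of_tendsto t0 0
  have := P.coord_lower
  linarith

/-- Integration of the cone inequality. It converts the condition that `ubar 0` stays at distance `κ
ε` from the end states into the scalar condition required by the multiplier. -/
lemma norm_sub_le_coord (P : SmallShock M θ ε um up ubar W W1 W2) [CompleteSpace E]
    (hW : ∀ x, ‖W x‖ ≤ 2 * M.coord (W x)) (x : ℝ) :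
    ‖ubar x - um‖ ≤ 2 * M.coord (ubar x - um) ∧
      ‖up - ubar x‖ ≤ 2 * (M.coord (up - um) - M.coord (ubar x - um)) := by
  have cA : Continuous fun x => M.coord (W x) := M.coord.continuous.comp P.continuous
  have key : ∀ x y, x ≤ y →
      ‖ubar y - ubar x‖ ≤ 2 * (M.coord (ubar y - um) - M.coord (ubar x - um)) := by
    intro x y hxy
    rw [← (IsPrimitive.of_hasDerivAt P.hasDerivAt P.continuous).integral_eq x y,
      ← (IsPrimitive.of_hasDerivAt P.hasDerivAt_coord cA).integral_eq x y,
      ← intervalIntegral.integral_const_mul]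
    exact intervalIntegral.norm_integral_le_of_norm_le hxy (Eventually.of_forall fun t _ => hW t)
      ((cA.const_mul _).intervalIntegrable _ _)
  obtain ⟨t0, t1⟩ := P.tendsto_coord
  constructor
  · have l1 : Tendsto (fun y => ‖ubar x - ubar y‖) atBot (𝓝 ‖ubar x - um‖) :=
      (P.tendsto_atBot.const_sub _).norm
    have l2 := (t0.const_sub (M.coord (ubar x - um))).const_mul 2
    rw [sub_zero] at l2
    refine le_of_tendsto_of_tendsto l1 l2 ?_
    filter_upwards [eventually_le_atBot x] with y hy
    exact key y x hy
  · have l1 : Tendsto (fun y => ‖ubar y - ubar x‖) atTop (𝓝 ‖up - ubar x‖) :=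
      (P.tendsto_atTop.sub_const _).norm
    have l2 := (t1.sub_const (M.coord (ubar x - um))).const_mul 2
    refine le_of_tendsto_of_tendsto l1 l2 ?_
    filter_upwards [eventually_ge_atTop x] with y hy
    exact key x y hy

end SmallShock

/-- The profile derivative, written `W = A k` with `k` normalized along `r`. -/
structure NormalizedProfile (M : ReducedModel E) (K θ : ℝ) (ubar : ℝ → E) (A m m1 : ℝ → ℝ)
    (k k1 k2 : ℝ → E) : Prop where
  nonneg : 0 ≤ θ
  A_pos : ∀ x, 0 < A x
  hasDerivAt : ∀ x, HasDerivAt ubar (A x • k x) x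
  hasDerivAt_A : ∀ x, HasDerivAt A (m x * A x) x
  hasDerivAt_m : ∀ x, HasDerivAt m (m1 x) x
  hasDerivAt_k : ∀ x, HasDerivAt k (k1 x) x
  hasDerivAt_k1 : ∀ x, HasDerivAt k1 (k2 x) x
  continuous_k2 : Continuous k2
  coord_k : ∀ x, M.coord (k x) = 1
  k_mem : ∀ x, k x ∈ M.T
  mem : ∀ x, ubar x ∈ Metric.ball M.u₀ M.R
  D_le : ∀ x, ‖M.D (ubar x) - M.D M.u₀‖ ≤ θ
  b_le : ∀ x, ‖M.b (ubar x) - M.b M.u₀‖ ≤ θ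
  D2_le : ∀ x, ‖M.D2 (ubar x) - M.D2 M.u₀‖ ≤ θ
  eq : ∀ x, M.b (ubar x) (k1 x) = M.D (ubar x) (k x) - m x • M.b (ubar x) (k x)
    - A x • M.b1 (ubar x) (k x) (k x)
  A_le : ∀ x, A x ≤ K * θ
  m_le : ∀ x, |m x| ≤ K * θ
  k_le : ∀ x, ‖k x - M.r‖ ≤ K * θ
  norm_k : ∀ x, ‖k x‖ ≤ 2
  norm_k1 : ∀ x, ‖k1 x‖ ≤ K

/-- Positivity of `A = coord W` allows division by it: `k = W / A` and `m = A' / A`. The cone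
bounds, homogeneous in `A`, become uniform bounds on `k - r`, `m` and `k'`. -/
lemma SmallShock.exists_normalized (M : ReducedModel E) [CompleteSpace E] :
    ∃ K θ₀ : ℝ, 0 < K ∧ 0 < θ₀ ∧ ∀ {θ ε um up} {ubar W W1 W2 : ℝ → E},
      SmallShock M θ ε um up ubar W W1 W2 → θ ≤ θ₀ →
      ∃ (A m m1 : ℝ → ℝ) (k k1 k2 : ℝ → E), NormalizedProfile M K θ ubar A m m1 k k1 k2 ∧
        (∀ x, HasDerivAt (fun x => M.coord (ubar x - um)) (A x) x) ∧
        Tendsto A atBot (𝓝 0) ∧ Tendsto A atTop (𝓝 0) ∧ (∀ x, ‖W x‖ ≤ 2 * M.coord (W x)) ∧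
        Continuous m1 := by
  obtain ⟨K₁, θ₁, hK₁, hθ₁, hc⟩ := M.cone
  have hβ := M.pair.β_pos
  have hC := M.C_pos
  refine ⟨K₁ + M.C / M.β * (2 / M.β) + 2, min θ₁ (min (M.β / 2) (1 / K₁)), by positivity,
    by positivity, ?_⟩
  intro θ ε um up ubar W W1 W2 P hθ
  simp only [le_min_iff] at hθ
  obtain ⟨t1, t2, t3⟩ := hθ
  rw [le_div_iff₀ hK₁] at t3
  have hθ0 := P.nonneg
  have hcone := hc P.toSmallProfile t1
  have hpos := P.coord_pos (K := K₁ * θ) fun x => (hcone x).2.1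
  have habs : ∀ x, |M.coord (W x)| = M.coord (W x) := fun x => abs_of_pos (hpos x)
  simp only [habs] at hcone
  have hA : ∀ x, HasDerivAt (fun x => M.coord (W x)) (M.coord (W1 x)) x := fun x =>
    M.coord.hasFDerivAt.comp_hasDerivAt x (P.hasDerivAt_W x)
  have hA1 : ∀ x, HasDerivAt (fun x => M.coord (W1 x)) (M.coord (W2 x)) x := fun x =>
    M.coord.hasFDerivAt.comp_hasDerivAt x (P.hasDerivAt_W1 x)
  have cA : Continuous fun x => M.coord (W x) := M.coord.continuous.comp P.continuous
  have cA1 : Continuous fun x => M.coord (W1 x) := M.coord.continuous.comp P.continuous_W1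
  have cA2 : Continuous fun x => M.coord (W2 x) := M.coord.continuous.comp P.continuous_W2
  have hinv : ∀ x, HasDerivAt (fun x => (M.coord (W x))⁻¹)
      (-M.coord (W1 x) / M.coord (W x) ^ 2) x := fun x => (hA x).inv (hpos x).ne'
  let A : ℝ → ℝ := fun x => M.coord (W x)
  let i : ℝ → ℝ := fun x => (M.coord (W x))⁻¹
  let m : ℝ → ℝ := fun x => M.coord (W1 x) * i x
  let m1 : ℝ → ℝ := fun x => M.coord (W2 x) * i x - m x * m x
  have hi : ∀ x, HasDerivAt i (-(m x * i x)) x := fun x => (hinv x).congr_deriv (by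
    simp only [m, i]; have := (hpos x).ne'; field_simp)
  have hiA : ∀ x, i x * M.coord (W x) = 1 := fun x => inv_mul_cancel₀ (hpos x).ne'
  have hip : ∀ x, 0 < i x := fun x => inv_pos.2 (hpos x)
  have hm : ∀ x, HasDerivAt m (m1 x) x := fun x => ((hA1 x).mul (hi x)).congr_deriv (by
    simp only [m1, m]; ring)
  let k : ℝ → E := fun x => i x • W x
  let k1 : ℝ → E := fun x => i x • W1 x - m x • k x
  let k2 : ℝ → E := fun x => (i x • W2 x - (m x * i x) • W1 x) - (m x • k1 x + m1 x • k x)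
  have hk : ∀ x, HasDerivAt k (k1 x) x := fun x => ((hi x).smul (P.hasDerivAt_W x)).congr_deriv (by
    simp only [k1, k, smul_smul]; module)
  have hk1 : ∀ x, HasDerivAt k1 (k2 x) x := fun x =>
    (((hi x).smul (P.hasDerivAt_W1 x)).sub ((hm x).smul (hk x))).congr_deriv (by
    simp only [k2]; module)
  have ci : Continuous i := cA.inv₀ fun x => (hpos x).ne'
  have cm : Continuous m := cA1.mul ci
  have cm1 : Continuous m1 := (cA2.mul ci).sub (cm.mul cm)
  have ck : Continuous k := ci.smul P.continuous
  have ck1 : Continuous k1 := (ci.smul P.continuous_W1).sub (cm.smul ck)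
  have mk : ∀ x, k x ∈ M.T := fun x => M.T.smul_mem _ (P.W_mem x)
  have hWA : ∀ x, W x = A x • k x := fun x => by
    simp only [k, A, smul_smul]; rw [mul_comm, hiA, one_smul]
  have hW1 : ∀ x, i x • W1 x = k1 x + m x • k x := fun x => by simp only [k1]; abel
  have hck : ∀ x, M.coord (k x) = 1 := fun x => by
    simp only [k, map_smul, smul_eq_mul]; exact hiA x
  have bm : ∀ x, |m x| ≤ K₁ * θ := fun x => by
    simp only [m]
    rw [abs_mul, abs_of_pos (hip x)]
    calc |M.coord (W1 x)| * i x ≤ (K₁ * θ * M.coord (W x)) * i x := by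
          gcongr; exacts [(hip x).le, (hcone x).2.1]
      _ = K₁ * θ * (i x * M.coord (W x)) := by ring
      _ = _ := by rw [hiA, mul_one]
  have bk : ∀ x, ‖k x‖ ≤ 2 := fun x => by
    simp only [k]
    rw [norm_smul, Real.norm_eq_abs, abs_of_pos (hip x)]
    calc i x * ‖W x‖ ≤ i x * (2 * M.coord (W x)) := by
          gcongr; exacts [(hip x).le, (hcone x).2.2.2]
      _ = 2 * (i x * M.coord (W x)) := by ring
      _ = 2 := by rw [hiA, mul_one]
  have hKK : K₁ ≤ K₁ + M.C / M.β * (2 / M.β) + 2 := by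
    have : 0 ≤ M.C / M.β * (2 / M.β) := by positivity
    linarith
  have hKK2 : K₁ + 2 ≤ K₁ + M.C / M.β * (2 / M.β) + 2 := by
    have : 0 ≤ M.C / M.β * (2 / M.β) := by positivity
    linarith
  obtain ⟨w0, w1⟩ := P.tendsto_W t2
  refine ⟨A, m, m1, k, k1, k2, ⟨hθ0, hpos, ?_, ?_, hm, hk, hk1, ?_, hck, mk, P.mem, P.D_le, P.b_le,
    P.D2_le, ?_, ?_, ?_, ?_, bk, ?_⟩, P.hasDerivAt_coord, ?_, ?_, fun x => (hcone x).2.2.2, cm1⟩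
  · intro x; rw [← hWA]; exact P.hasDerivAt x
  · intro x
    refine (hA x).congr_deriv ?_
    simp only [m, A]; rw [mul_assoc, hiA, mul_one]
  · exact ((ci.smul P.continuous_W2).sub ((cm.mul ci).smul P.continuous_W1)).sub
      ((cm.smul ck1).add (cm1.smul ck))
  · intro x
    have h1 := congrArg (fun v => i x • v) (P.second_ode x)
    rw [← map_smul, hW1, smul_sub, ← map_smul] at h1
    have e1 : i x • W x = k x := rfl
    have e2 : i x • M.b1 (ubar x) (W x) (W x) = A x • M.b1 (ubar x) (k x) (k x) := by
      have aux : ∀ (B : E →L[ℝ] E →L[ℝ] E) (w v : E) (i a : ℝ), w = a • v → i * a = 1 →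
          i • B w w = a • B v v := by
        rintro B _ v i a rfl h
        simp [smul_smul, ← mul_assoc, h]
      exact aux _ _ _ _ _ (hWA x) (hiA x)
    rw [e1, e2, map_add, map_smul] at h1
    rw [sub_right_comm, ← h1]; abel
  · intro x
    have h1 := (le_abs_self _).trans (M.abs_coord_le (W x))
    have h2 := P.norm_W_le t2 x
    calc A x ≤ M.C / M.β * (2 / M.β * θ) := h1.trans (by gcongr)
      _ = M.C / M.β * (2 / M.β) * θ := by ring
      _ ≤ _ := by gcongr; linarith
  · intro x; exact (bm x).trans (by gcongr)
  · intro x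
    have e : k x - M.r = i x • M.trans (W x) := by
      rw [M.trans_apply, smul_sub, smul_smul, hiA, one_smul]
    rw [e, norm_smul, Real.norm_eq_abs, abs_of_pos (hip x)]
    calc i x * ‖M.trans (W x)‖ ≤ i x * (K₁ * θ * M.coord (W x)) := by
          gcongr; exacts [(hip x).le, (hcone x).1]
      _ = K₁ * θ * (i x * M.coord (W x)) := by ring
      _ = K₁ * θ := by rw [hiA, mul_one]
      _ ≤ _ := by gcongr
  · intro x
    have h1 : ‖i x • W1 x‖ ≤ K₁ := by
      rw [norm_smul, Real.norm_eq_abs, abs_of_pos (hip x)]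
      calc i x * ‖W1 x‖ ≤ i x * (K₁ * M.coord (W x)) := by
            gcongr; exacts [(hip x).le, (hcone x).2.2.1]
        _ = K₁ * (i x * M.coord (W x)) := by ring
        _ = _ := by rw [hiA, mul_one]
    have h2 : ‖m x • k x‖ ≤ 1 * 2 := by
      rw [norm_smul, Real.norm_eq_abs]
      gcongr
      exacts [(bm x).trans (by linarith), bk x]
    exact ((norm_sub_le _ _).trans (add_le_add h1 h2)).trans (by linarith)
  · have := (M.coord.continuous.tendsto _).comp w0
    rwa [map_zero] at this
  · have := (M.coord.continuous.tendsto _).comp w1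
    rwa [map_zero] at this

end Shock

/-! ### Sharp bounds for the direction and the rate of a profile -/

section Normalized

variable {E : Type*} [NormedAddCommGroup E] [InnerProductSpace ℝ E]

namespace NormalizedProfile

variable {M : ReducedModel E} {K θ : ℝ} {ubar : ℝ → E} {A m m1 : ℝ → ℝ} {k k1 k2 : ℝ → E}

lemma k1_mem (P : NormalizedProfile M K θ ubar A m m1 k k1 k2) (x : ℝ) : k1 x ∈ M.T :=
  M.hasDerivAt_mem P.hasDerivAt_k P.k_mem x

lemma k2_mem (P : NormalizedProfile M K θ ubar A m m1 k k1 k2) (x : ℝ) : k2 x ∈ M.T :=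
  M.hasDerivAt_mem P.hasDerivAt_k1 P.k1_mem x

lemma coord_k1 (P : NormalizedProfile M K θ ubar A m m1 k k1 k2) (x : ℝ) : M.coord (k1 x) = 0 := by
  have h1 : HasDerivAt (fun x => M.coord (k x)) (M.coord (k1 x)) x :=
    M.coord.hasFDerivAt.comp_hasDerivAt x (P.hasDerivAt_k x)
  rw [funext P.coord_k] at h1
  exact h1.unique (hasDerivAt_const x _)

lemma coord_k2 (P : NormalizedProfile M K θ ubar A m m1 k k1 k2) (x : ℝ) : M.coord (k2 x) = 0 := by
  have h1 : HasDerivAt (fun x => M.coord (k1 x)) (M.coord (k2 x)) x :=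
    M.coord.hasFDerivAt.comp_hasDerivAt x (P.hasDerivAt_k1 x)
  rw [funext P.coord_k1] at h1
  exact h1.unique (hasDerivAt_const x _)

/-- The source in the equation for `k''`. -/
def source (M : ReducedModel E) (ubar : ℝ → E) (A m : ℝ → ℝ) (k k1 k2 : ℝ → E) (x : ℝ) : E :=
  A x • M.D2 (ubar x) (k x) (k x) + (M.D (ubar x) - M.D M.u₀) (k1 x)
    - (M.b (ubar x) - M.b M.u₀) (k2 x) - A x • M.b1 (ubar x) (k x) (k1 x)
    - (m x * A x) • M.b1 (ubar x) (k x) (k x) - m x • M.b (ubar x) (k1 x)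
    - (m x * A x) • M.b1 (ubar x) (k x) (k x)
    - A x • (M.b1 (ubar x) (k x) (k1 x)
      + (A x • M.b2 (ubar x) (k x) (k x) (k x) + M.b1 (ubar x) (k1 x) (k x)))

/-- Differentiating the equation of `k` gives a system for `k'` of the form handled by
`peak_estimate`. The term `m' b k`, not known to be small beforehand, is isolated as the multiplier
term. -/
lemma second_eq (P : NormalizedProfile M K θ ubar A m m1 k k1 k2) (x : ℝ) :
    M.b M.u₀ (k2 x) = M.D M.u₀ (k1 x) + source M ubar A m k k1 k2 x
      - m1 x • M.b (ubar x) (k x) := by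
  have hb : HasDerivAt (fun x => M.b (ubar x)) (A x • M.b1 (ubar x) (k x)) x := by
    have := (M.hasFDerivAt_b _ (P.mem x)).comp_hasDerivAt x (P.hasDerivAt x)
    rwa [map_smul] at this
  have hb1 : HasDerivAt (fun x => M.b1 (ubar x)) (A x • M.b2 (ubar x) (k x)) x := by
    have := (M.hasFDerivAt_b1 _ (P.mem x)).comp_hasDerivAt x (P.hasDerivAt x)
    rwa [map_smul] at this
  have hD : HasDerivAt (fun x => M.D (ubar x)) (A x • M.D2 (ubar x) (k x)) x := by
    have := (M.hasFDerivAt_D _ (P.mem x)).comp_hasDerivAt x (P.hasDerivAt x)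
    rwa [map_smul] at this
  have hk := P.hasDerivAt_k x
  have h1 := hb.clm_apply (P.hasDerivAt_k1 x)
  have h2 := ((hD.clm_apply hk).sub ((P.hasDerivAt_m x).smul (hb.clm_apply hk))).sub
    ((P.hasDerivAt_A x).smul ((hb1.clm_apply hk).clm_apply hk))
  have h3 : (fun x => M.b (ubar x) (k1 x)) = fun x => M.D (ubar x) (k x) - m x • M.b (ubar x) (k x)
    - A x • M.b1 (ubar x) (k x) (k x) := funext P.eq
  rw [h3] at h1
  have h4 := h1.unique h2
  simp only [smul_apply, add_apply, smul_add, smul_smul] at h4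
  have e : M.b M.u₀ (k2 x) = M.b (ubar x) (k2 x) - (M.b (ubar x) - M.b M.u₀) (k2 x) := by
    rw [sub_apply]; abel
  have e2 := eq_sub_of_add_eq' h4
  rw [e, e2]
  simp only [source, sub_apply, smul_add, smul_smul]
  module

lemma norm_b1_apply_le (P : NormalizedProfile M K θ ubar A m m1 k k1 k2) (x : ℝ) (v w : E) :
    ‖M.b1 (ubar x) v w‖ ≤ M.C * ‖v‖ * ‖w‖ :=
  ((M.b1 (ubar x)).le_opNorm₂ _ _).trans (by gcongr; exact M.norm_b1_le _ (P.mem x))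

lemma norm_b2_apply_le (P : NormalizedProfile M K θ ubar A m m1 k k1 k2) (x : ℝ) (u v w : E) :
    ‖M.b2 (ubar x) u v w‖ ≤ M.C * ‖u‖ * ‖v‖ * ‖w‖ :=
  ((M.b2 (ubar x) u).le_opNorm₂ _ _).trans (by
    gcongr; exact (M.b2 (ubar x)).le_of_opNorm_le (M.norm_b2_le _ (P.mem x)) _)

lemma norm_b_apply_le (P : NormalizedProfile M K θ ubar A m m1 k k1 k2) (x : ℝ) (v : E) :
    ‖M.b (ubar x) v‖ ≤ M.C * ‖v‖ := (M.b (ubar x)).le_of_opNorm_le (M.norm_b_le _ (P.mem x)) _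

lemma K_nonneg (P : NormalizedProfile M K θ ubar A m m1 k k1 k2) : 0 ≤ K :=
  (norm_nonneg _).trans (P.norm_k1 0)

/-- The source, up to its leading term, is small. -/
lemma norm_source_sub_le (P : NormalizedProfile M K θ ubar A m m1 k k1 k2) (x : ℝ) :
    ‖source M ubar A m k k1 k2 x - A x • M.D2 (ubar x) (k x) (k x)‖ ≤
      (1 + 7 * M.C * K) * θ * (‖k1 x‖ + ‖k2 x‖) + 16 * M.C * K * θ * A x := by
  have hA := P.A_pos x
  have hC := M.C_pos
  have hK := P.K_nonneg
  have hθ := P.nonneg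
  have hk := P.norm_k x
  have n1 : ‖(M.D (ubar x) - M.D M.u₀) (k1 x)‖ ≤ θ * ‖k1 x‖ :=
    ContinuousLinearMap.le_of_opNorm_le _ (P.D_le x) _
  have n2 : ‖(M.b (ubar x) - M.b M.u₀) (k2 x)‖ ≤ θ * ‖k2 x‖ :=
    ContinuousLinearMap.le_of_opNorm_le _ (P.b_le x) _
  have n3 : ‖A x • M.b1 (ubar x) (k x) (k1 x)‖ ≤ K * θ * (M.C * 2 * ‖k1 x‖) := by
    rw [norm_smul, Real.norm_eq_abs, abs_of_pos hA]
    gcongr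
    · exact P.A_le x
    · exact (P.norm_b1_apply_le x _ _).trans (by gcongr)
  have n4 : ‖(m x * A x) • M.b1 (ubar x) (k x) (k x)‖ ≤ K * θ * A x * (M.C * 2 * 2) := by
    rw [norm_smul, Real.norm_eq_abs, abs_mul, abs_of_pos hA]
    gcongr
    · exact P.m_le x
    · exact (P.norm_b1_apply_le x _ _).trans (by gcongr)
  have n5 : ‖m x • M.b (ubar x) (k1 x)‖ ≤ K * θ * (M.C * ‖k1 x‖) := by
    rw [norm_smul, Real.norm_eq_abs]
    gcongr
    · exact P.m_le x
    · exact P.norm_b_apply_le x _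
  have n6 : ‖A x • (M.b1 (ubar x) (k x) (k1 x)
      + (A x • M.b2 (ubar x) (k x) (k x) (k x) + M.b1 (ubar x) (k1 x) (k x)))‖
      ≤ K * θ * (M.C * 2 * ‖k1 x‖) + (K * θ * A x * (M.C * 2 * 2 * 2)
        + K * θ * (M.C * ‖k1 x‖ * 2)) := by
    rw [smul_add, smul_add, smul_smul]
    refine (norm_add_le _ _).trans (add_le_add n3 ((norm_add_le _ _).trans (add_le_add ?_ ?_)))
    · rw [norm_smul, Real.norm_eq_abs, abs_mul, abs_of_pos hA]
      gcongr
      · exact P.A_le x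
      · exact (P.norm_b2_apply_le x _ _ _).trans (by gcongr)
    · rw [norm_smul, Real.norm_eq_abs, abs_of_pos hA]
      gcongr
      · exact P.A_le x
      · exact (P.norm_b1_apply_le x _ _).trans (by gcongr)
  have e : source M ubar A m k k1 k2 x - A x • M.D2 (ubar x) (k x) (k x)
      = (M.D (ubar x) - M.D M.u₀) (k1 x)
    - (M.b (ubar x) - M.b M.u₀) (k2 x) - A x • M.b1 (ubar x) (k x) (k1 x)
    - (m x * A x) • M.b1 (ubar x) (k x) (k x) - m x • M.b (ubar x) (k1 x)
    - (m x * A x) • M.b1 (ubar x) (k x) (k x)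
    - A x • (M.b1 (ubar x) (k x) (k1 x)
      + (A x • M.b2 (ubar x) (k x) (k x) (k x) + M.b1 (ubar x) (k1 x) (k x))) := by
    rw [source]; abel
  rw [e]
  have h7 := (norm_sub_le _ _).trans (add_le_add ((norm_sub_le _ _).trans (add_le_add
    ((norm_sub_le _ _).trans (add_le_add ((norm_sub_le _ _).trans (add_le_add
    ((norm_sub_le _ _).trans (add_le_add ((norm_sub_le _ _).trans (add_le_add n1 n2)) n3)) n4)) n5)) n4)) n6)
  refine h7.trans ?_
  have : 0 ≤ 7 * M.C * K * θ * ‖k2 x‖ := by positivity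
  linarith

lemma norm_D2_apply_le (P : NormalizedProfile M K θ ubar A m m1 k k1 k2) (x : ℝ) :
    ‖A x • M.D2 (ubar x) (k x) (k x)‖ ≤ 4 * M.C * A x := by
  have hC := M.C_pos
  have hk := P.norm_k x
  rw [norm_smul, Real.norm_eq_abs, abs_of_pos (P.A_pos x)]
  have : ‖M.D2 (ubar x) (k x) (k x)‖ ≤ M.C * 2 * 2 :=
    ((M.D2 (ubar x)).le_opNorm₂ _ _).trans (by gcongr; exact M.norm_D2_le _ (P.mem x))
  nlinarith [P.A_pos x]

/-- The leading term of the source, tested against `r`. -/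
lemma abs_leading_le (P : NormalizedProfile M K θ ubar A m m1 k k1 k2) (x : ℝ) :
    |⟪A x • M.D2 (ubar x) (k x) (k x), M.r⟫_ℝ + A x * M.Λ| ≤ (4 + 3 * M.C * K) * θ * A x := by
  have hA := P.A_pos x
  have hC := M.C_pos
  have hK := P.K_nonneg
  have hθ := P.nonneg
  have hk := P.norm_k x
  have hr := M.pair.norm_r
  have e : M.D2 (ubar x) (k x) (k x) = M.D2 M.u₀ M.r M.r + ((M.D2 (ubar x) - M.D2 M.u₀) (k x) (k x)
      + (M.D2 M.u₀ (k x - M.r) (k x) + M.D2 M.u₀ M.r (k x - M.r))) := by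
    simp only [map_sub, sub_apply]; abel
  have n1 : ‖(M.D2 (ubar x) - M.D2 M.u₀) (k x) (k x)‖ ≤ θ * 2 * 2 :=
    (ContinuousLinearMap.le_opNorm₂ _ _ _).trans (by gcongr; exact P.D2_le x)
  have n2 : ‖M.D2 M.u₀ (k x - M.r) (k x)‖ ≤ M.C * (K * θ) * 2 :=
    (ContinuousLinearMap.le_opNorm₂ _ _ _).trans (by
      gcongr; exacts [M.norm_D2_le _ M.u₀_mem, P.k_le x])
  have n3 : ‖M.D2 M.u₀ M.r (k x - M.r)‖ ≤ M.C * 1 * (K * θ) :=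
    (ContinuousLinearMap.le_opNorm₂ _ _ _).trans (by
      gcongr; exacts [M.norm_D2_le _ M.u₀_mem, hr.le, P.k_le x])
  have n4 := (norm_add_le _ _).trans (add_le_add n1 ((norm_add_le _ _).trans (add_le_add n2 n3)))
  have e2 : ⟪A x • M.D2 (ubar x) (k x) (k x), M.r⟫_ℝ + A x * M.Λ
      = A x * ⟪(M.D2 (ubar x) - M.D2 M.u₀) (k x) (k x)
      + (M.D2 M.u₀ (k x - M.r) (k x) + M.D2 M.u₀ M.r (k x - M.r)), M.r⟫_ℝ := by
    rw [e, real_inner_smul_left, inner_add_left, M.nonlinear]; ring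
  rw [e2, abs_mul, abs_of_pos hA]
  have n5 := abs_real_inner_le_norm ((M.D2 (ubar x) - M.D2 M.u₀) (k x) (k x)
      + (M.D2 M.u₀ (k x - M.r) (k x) + M.D2 M.u₀ M.r (k x - M.r))) M.r
  rw [hr, mul_one] at n5
  calc A x * _ ≤ A x * (θ * 2 * 2 + (M.C * (K * θ) * 2 + M.C * 1 * (K * θ))) := by
        gcongr; exact n5.trans n4
    _ = _ := by ring

lemma inner_b_k (P : NormalizedProfile M K θ ubar A m m1 k k1 k2) (x : ℝ)
    (hθ : (2 + M.C * K) * θ ≤ M.β / 2) :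
    M.β / 2 ≤ ⟪M.b (ubar x) (k x), M.r⟫_ℝ ∧ ⟪M.b (ubar x) (k x), M.r⟫_ℝ ≤ 2 * M.C := by
  have hr := M.pair.norm_r
  have hC := M.C_pos
  have hk := P.norm_k x
  have hθ0 := P.nonneg
  constructor
  · have e : ⟪M.b (ubar x) (k x), M.r⟫_ℝ = M.sig
        + ⟪(M.b (ubar x) - M.b M.u₀) (k x) + M.b M.u₀ (k x - M.r), M.r⟫_ℝ := by
      rw [ReducedModel.sig, ReducedModel.ell, ← inner_add_left]
      congr 1
      simp only [map_sub, sub_apply]; abel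
    have n1 : ‖(M.b (ubar x) - M.b M.u₀) (k x)‖ ≤ θ * 2 :=
      (ContinuousLinearMap.le_of_opNorm_le _ (P.b_le x) _).trans (by gcongr)
    have n2 : ‖M.b M.u₀ (k x - M.r)‖ ≤ M.C * (K * θ) :=
      (ContinuousLinearMap.le_of_opNorm_le _ (M.norm_b_le _ M.u₀_mem) _).trans (by
        gcongr; exact P.k_le x)
    have n3 := abs_real_inner_le_norm ((M.b (ubar x) - M.b M.u₀) (k x) + M.b M.u₀ (k x - M.r)) M.r
    rw [hr, mul_one] at n3
    have n4 := (abs_le.1 (n3.trans ((norm_add_le _ _).trans (add_le_add n1 n2)))).1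
    rw [e]
    have := M.β_le_sig
    linarith
  · have := real_inner_le_norm (M.b (ubar x) (k x)) M.r
    rw [hr, mul_one] at this
    have h2 := P.norm_b_apply_le x (k x)
    nlinarith

set_option maxHeartbeats 800000 in
/-- `k'` and `k''` are controlled by the amplitude of the profile, and the rate `m` decreases
proportionally to it. -/
theorem bounds (M : ReducedModel E) [CompleteSpace E] (K : ℝ) (hK : 0 < K) :
    ∃ K' θ₀ : ℝ, 0 < K' ∧ 0 < θ₀ ∧ ∀ {θ : ℝ} {ubar : ℝ → E} {A m m1 : ℝ → ℝ} {k k1 k2 : ℝ → E},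
      NormalizedProfile M K θ ubar A m m1 k k1 k2 → θ ≤ θ₀ → ∀ x,
        ‖k1 x‖ ≤ K' * A x ∧ M.Λ / (4 * M.C) * A x ≤ -m1 x ∧ -m1 x ≤ 3 * M.Λ / M.β * A x := by
  have hβ := M.pair.β_pos
  have hC := M.C_pos
  have hΛ := M.Λ_pos
  set τ := 1 + 7 * M.C * K + K with hτ
  have hτp : 0 < τ := by positivity
  set τ2 := (1 + 4 * M.C / M.β) * τ with hτ2
  have hτ2p : 0 < τ2 := by positivity
  set Qm := 20 * M.C with hQm
  obtain ⟨θ₁, K₁, hθ₁, hK₁, hpeak⟩ := M.pair.peak_estimate (M.C * 2) Qm (by positivity)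
  set K₂ := 2 / M.β * ((M.C + M.β / 2) * (K₁ * Qm) + (1 + 4 * M.C / M.β) * Qm) with hK₂
  have hK₂p : 0 < K₂ := by positivity
  set K₃ := (4 + 3 * M.C * K) + (τ * (K₁ * Qm + K₂) + 16 * M.C * K) with hK₃
  have hK₃p : 0 < K₃ := by positivity
  refine ⟨K₁ * Qm, min (θ₁ / τ) (min (M.β / (2 * τ2)) (min (M.β / (2 * (2 + M.C * K)))
    (min (1 / (4 * K)) (M.Λ / (2 * K₃))))), by positivity, by positivity, ?_⟩
  intro θ ubar A m m1 k k1 k2 P hθ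
  simp only [le_min_iff] at hθ
  obtain ⟨t1, t2, t3, t4, t5⟩ := hθ
  rw [le_div_iff₀ (by positivity)] at t1 t2 t3 t4 t5
  have hθ0 := P.nonneg
  have hA := P.A_pos
  have hin := fun x => P.inner_b_k x (by linarith)
  have hsrc : ∀ x, ‖source M ubar A m k k1 k2 x‖ ≤ θ * τ * (‖k1 x‖ + ‖k2 x‖) + Qm * A x := by
    intro x
    have h1 := P.norm_source_sub_le x
    have h2 := P.norm_D2_apply_le x
    have h3 := norm_add_le (source M ubar A m k k1 k2 x - A x • M.D2 (ubar x) (k x) (k x))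
      (A x • M.D2 (ubar x) (k x) (k x))
    rw [sub_add_cancel] at h3
    have h4 : 16 * M.C * K * θ * A x ≤ 16 * M.C * A x := by
      calc 16 * M.C * K * θ * A x = 4 * M.C * A x * (θ * (4 * K)) := by ring
        _ ≤ 4 * M.C * A x * 1 := by have := hA x; gcongr
        _ ≤ _ := by nlinarith [mul_pos hC (hA x)]
    have h5 : 0 ≤ K * θ * (‖k1 x‖ + ‖k2 x‖) := by positivity
    have h6 : θ * τ * (‖k1 x‖ + ‖k2 x‖) = (1 + 7 * M.C * K) * θ * (‖k1 x‖ + ‖k2 x‖)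
      + K * θ * (‖k1 x‖ + ‖k2 x‖) := by rw [hτ]; ring
    rw [h6, hQm]
    linarith
  have hc : ∀ x, ‖M.b (ubar x) (k x)‖ ≤ M.C * 2 := fun x =>
    (P.norm_b_apply_le x _).trans (by gcongr; exact P.norm_k x)
  have l1 : ∀ x, ⟪M.ell, k1 x⟫_ℝ = 0 := fun x => by rw [M.inner_ell, P.coord_k1, mul_zero]
  have l2 : ∀ x, ⟪M.ell, k2 x⟫_ℝ = 0 := fun x => by rw [M.inner_ell, P.coord_k2, mul_zero]
  have hm1 : ∀ x, |m1 x| ≤ 2 / M.β * ‖source M ubar A m k k1 k2 x‖ := fun x =>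
    M.pair.abs_multiplier_le (l2 x) (P.second_eq x) (hin x).1
  -- Coercivity of `b(u₀)` on `T`, with the `k''` part of the source absorbed. It provides the a
  -- priori bound that `hpeak` requires, and is used again once `k' = O(A)` is known.
  have hk2 : ∀ x, ‖k2 x‖ ≤ 2 / M.β * ((M.C + M.β / 2) * ‖k1 x‖ + (1 + 4 * M.C / M.β) * Qm * A x) := by
    intro x
    have h1 := M.norm_le_of_mem (P.k2_mem x)
    have h2 : ‖M.b M.u₀ (k2 x)‖ ≤ M.C * ‖k1 x‖ + (1 + 4 * M.C / M.β) * ‖source M ubar A m k k1 k2 x‖ := by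
      rw [P.second_eq]
      have a1 : ‖M.D M.u₀ (k1 x)‖ ≤ M.C * ‖k1 x‖ :=
        ContinuousLinearMap.le_of_opNorm_le _ (M.norm_D_le _ M.u₀_mem) _
      have a2 : ‖m1 x • M.b (ubar x) (k x)‖ ≤ (2 / M.β * ‖source M ubar A m k k1 k2 x‖) * (M.C * 2) := by
        rw [norm_smul, Real.norm_eq_abs]; gcongr; exacts [hm1 x, hc x]
      refine ((norm_sub_le _ _).trans (add_le_add ((norm_add_le _ _).trans
        (add_le_add a1 le_rfl)) a2)).trans (le_of_eq ?_)
      ring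
    have h3 : (1 + 4 * M.C / M.β) * ‖source M ubar A m k k1 k2 x‖
        ≤ M.β / 2 * (‖k1 x‖ + ‖k2 x‖) + (1 + 4 * M.C / M.β) * Qm * A x := by
      calc (1 + 4 * M.C / M.β) * ‖source M ubar A m k k1 k2 x‖
          ≤ (1 + 4 * M.C / M.β) * (θ * τ * (‖k1 x‖ + ‖k2 x‖) + Qm * A x) := by gcongr; exact hsrc x
        _ = (θ * (2 * τ2)) / 2 * (‖k1 x‖ + ‖k2 x‖) + (1 + 4 * M.C / M.β) * Qm * A x := by
            rw [hτ2]; ring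
        _ ≤ _ := by gcongr
    have h4 : M.β / 2 * ‖k2 x‖ ≤ (M.C + M.β / 2) * ‖k1 x‖ + (1 + 4 * M.C / M.β) * Qm * A x := by
      linarith
    calc ‖k2 x‖ = 2 / M.β * (M.β / 2 * ‖k2 x‖) := by field_simp
      _ ≤ _ := by gcongr
  set B := K * θ + K + 2 / M.β * ((M.C + M.β / 2) * K + (1 + 4 * M.C / M.β) * Qm * (K * θ)) with hB
  have hB2 : 0 ≤ 2 / M.β * ((M.C + M.β / 2) * K + (1 + 4 * M.C / M.β) * Qm * (K * θ)) := by positivity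
  have hBK : 0 ≤ K * θ := by positivity
  have ck : ∀ {f f' : ℝ → E}, (∀ x, HasDerivAt f (f' x) x) → Continuous f := fun h =>
    continuous_iff_continuousAt.2 fun x => (h x).continuousAt
  have cA : Continuous A := continuous_iff_continuousAt.2 fun x => (P.hasDerivAt_A x).continuousAt
  have cm : Continuous m := continuous_iff_continuousAt.2 fun x => (P.hasDerivAt_m x).continuousAt
  -- The comparison scalar is now `A`: its derivative `m A` is small relative to it because `|m| ≤ K
  -- θ`.
  have hk1 : ∀ x, ‖k1 x‖ ≤ K₁ * Qm * A x := by
    intro x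
    have := hpeak (θ * τ) Qm B k1 k2 (source M ubar A m k k1 k2) (fun x => M.b (ubar x) (k x)) m1 A
      (fun x => m x * A x) (by positivity) t1 (by positivity) le_rfl P.hasDerivAt_k1 P.continuous_k2
      P.hasDerivAt_A (cm.mul cA) (fun x => by have := P.norm_k1 x; linarith)
      (fun x => (hk2 x).trans (by
        have h1 := P.norm_k1 x
        have h2 := P.A_le x
        have h3 : 2 / M.β * ((M.C + M.β / 2) * ‖k1 x‖ + (1 + 4 * M.C / M.β) * Qm * A x)
            ≤ 2 / M.β * ((M.C + M.β / 2) * K + (1 + 4 * M.C / M.β) * Qm * (K * θ)) := by gcongr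
        rw [hB]
        linarith))
      (fun x => by rw [abs_of_pos (hA x)]; have := P.A_le x; linarith)
      P.k1_mem P.k2_mem l1 l2 P.second_eq
      (fun x => by rw [abs_of_pos (hA x)]; exact hsrc x) hc (fun x => (hin x).1)
      (fun x => by
        rw [abs_mul]
        have h1 := P.m_le x
        have h2 : 0 ≤ 1 + 7 * M.C * K := by positivity
        calc |m x| * |A x| ≤ K * θ * |A x| := by gcongr
          _ ≤ θ * τ * |A x| := by
            rw [mul_comm K]; gcongr; rw [hτ]; linarith
          _ ≤ _ := by gcongr; linarith [norm_nonneg (k1 x), norm_nonneg (k2 x)]) x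
    rwa [abs_of_pos (hA x)] at this
  intro x
  have hAx := hA x
  have hk2' : ‖k2 x‖ ≤ K₂ * A x := by
    calc ‖k2 x‖ ≤ 2 / M.β * ((M.C + M.β / 2) * (K₁ * Qm * A x) + (1 + 4 * M.C / M.β) * Qm * A x) :=
          (hk2 x).trans (by gcongr; exact hk1 x)
      _ = _ := by rw [hK₂]; ring
  -- Pairing with `r` removes `b(u₀) k''`, since `k''` has no `r`-component, and `D(u₀) k'`, since
  -- `D(u₀) r = 0`. This determines `m'`; the leading part of the source then contributes `-Λ A`, by
  -- genuine nonlinearity.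
  have hpair : m1 x * ⟪M.b (ubar x) (k x), M.r⟫_ℝ = ⟪source M ubar A m k k1 k2 x, M.r⟫_ℝ := by
    have h1 := congrArg (fun v => ⟪v, M.r⟫_ℝ) (P.second_eq x)
    simp only [inner_sub_left, inner_add_left, real_inner_smul_left] at h1
    rw [M.pair.b_symm, real_inner_comm, M.pair.A_symm, M.pair.A_r, inner_zero_right] at h1
    have : ⟪M.b M.u₀ M.r, k2 x⟫_ℝ = 0 := l2 x
    rw [this] at h1
    linarith
  have herr : |⟪source M ubar A m k k1 k2 x, M.r⟫_ℝ + A x * M.Λ| ≤ M.Λ / 2 * A x := by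
    have h1 := P.norm_source_sub_le x
    have h2 := P.abs_leading_le x
    have h3 := abs_real_inner_le_norm
      (source M ubar A m k k1 k2 x - A x • M.D2 (ubar x) (k x) (k x)) M.r
    rw [M.pair.norm_r, mul_one] at h3
    have e : ⟪source M ubar A m k k1 k2 x, M.r⟫_ℝ + A x * M.Λ
        = (⟪A x • M.D2 (ubar x) (k x) (k x), M.r⟫_ℝ + A x * M.Λ)
          + ⟪source M ubar A m k k1 k2 x - A x • M.D2 (ubar x) (k x) (k x), M.r⟫_ℝ := by
      rw [inner_sub_left]; ring
    rw [e]
    have h4 : (1 + 7 * M.C * K) * θ * (‖k1 x‖ + ‖k2 x‖) ≤ τ * θ * (K₁ * Qm * A x + K₂ * A x) := by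
      gcongr
      · rw [hτ]; linarith
      · exact hk1 x
    calc _ ≤ (4 + 3 * M.C * K) * θ * A x
          + (τ * θ * (K₁ * Qm * A x + K₂ * A x) + 16 * M.C * K * θ * A x) :=
          (abs_add_le _ _).trans (add_le_add h2 (h3.trans (h1.trans (add_le_add h4 le_rfl))))
      _ = (θ * (2 * K₃)) / 2 * A x := by rw [hK₃]; ring
      _ ≤ _ := by gcongr
  obtain ⟨c1, c2⟩ := hin x
  obtain ⟨e1, e2⟩ := abs_le.1 herr
  rw [← hpair] at e1 e2
  have hneg : 0 ≤ -m1 x := by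
    by_contra hn
    push Not at hn
    nlinarith [mul_pos hΛ hAx]
  refine ⟨hk1 x, ?_, ?_⟩
  · have h1 : M.Λ / 2 * A x ≤ -m1 x * (2 * M.C) := by nlinarith
    calc M.Λ / (4 * M.C) * A x = (M.Λ / 2 * A x) / (2 * M.C) := by field_simp; norm_num
      _ ≤ (-m1 x * (2 * M.C)) / (2 * M.C) := by gcongr
      _ = _ := by field_simp
  · have h1 : -m1 x * (M.β / 2) ≤ 3 / 2 * (M.Λ * A x) := by nlinarith
    calc -m1 x = (-m1 x * (M.β / 2)) / (M.β / 2) := by field_simp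
      _ ≤ (3 / 2 * (M.Λ * A x)) / (M.β / 2) := by gcongr
      _ = _ := by field_simp

end NormalizedProfile

end Normalized

/-! ### Shock layers: all profile bounds in powers of `ε` -/

section Layer

variable {E : Type*} [NormedAddCommGroup E] [InnerProductSpace ℝ E]

/-- A shock layer of strength `ε`: `ubar' = A k` with `k` normalized along `r`, all quantities
scaled by the appropriate powers of `ε`. -/
structure ShockLayer (M : ReducedModel E) (K c k₀ θ ε : ℝ) (ubar : ℝ → E) (a A m : ℝ → ℝ)
    (k k1 : ℝ → E) : Prop where
  ε_pos : 0 < ε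
  nonneg : 0 ≤ θ
  mem : ∀ x, ubar x ∈ Metric.ball M.u₀ M.R
  D_le : ∀ x, ‖M.D (ubar x) - M.D M.u₀‖ ≤ θ
  b_le : ∀ x, ‖M.b (ubar x) - M.b M.u₀‖ ≤ θ
  hasDerivAt : ∀ x, HasDerivAt ubar (A x • k x) x
  hasDerivAt_a : ∀ x, HasDerivAt a (A x) x
  hasDerivAt_A : ∀ x, HasDerivAt A (m x * A x) x
  hasDerivAt_k : ∀ x, HasDerivAt k (k1 x) x
  continuous_m : Continuous m
  continuous_k1 : Continuous k1
  coord_k : ∀ x, M.coord (k x) = 1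
  coord_k1 : ∀ x, M.coord (k1 x) = 0
  k_mem : ∀ x, k x ∈ M.T
  k1_mem : ∀ x, k1 x ∈ M.T
  eq : ∀ x, M.b (ubar x) (k1 x) = M.D (ubar x) (k x) - m x • M.b (ubar x) (k x)
    - A x • M.b1 (ubar x) (k x) (k x)
  inner_b_k : ∀ x, M.β / 2 ≤ ⟪M.b (ubar x) (k x), M.r⟫_ℝ
  norm_k : ∀ x, ‖k x‖ ≤ 2
  norm_k1 : ∀ x, ‖k1 x‖ ≤ K * ε ^ 2
  m_le : ∀ x, |m x| ≤ K * ε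
  A_pos : ∀ x, 0 < A x
  A_le : ∀ x, A x ≤ K * ε ^ 2
  a_nonneg : ∀ x, 0 ≤ a x
  a_le : ∀ x, a x ≤ K * ε
  mult_pos : ∀ x, 0 ≤ x → c * ε ≤ k₀ * (A x / ε) - m x
  mult_neg : ∀ x, x ≤ 0 → c * ε ≤ k₀ * (A x / ε) + m x

/-- With `l = -m'/A` the amplitude is a `ScalarProfile` of height `p = coord (up - um)`, and `ε/2 ≤
p ≤ 2 ε` translates powers of `p` into powers of `ε`. The value `t = κ/4` comes from `κ ε ≤ 2 a 0`,
by the cone inequality, and `p ≤ 2 ε`; likewise at the other end. -/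
theorem SmallShock.exists_layer (M : ReducedModel E) [CompleteSpace E] {κ : ℝ} (hκ : 0 < κ) :
    ∃ K c k₀ θ₀ : ℝ, 0 < K ∧ 0 < c ∧ 0 < k₀ ∧ 0 < θ₀ ∧
      ∀ {θ ε um up} {ubar W W1 W2 : ℝ → E}, SmallShock M θ ε um up ubar W W1 W2 → θ ≤ θ₀ →
        κ * ε ≤ ‖ubar 0 - um‖ → κ * ε ≤ ‖ubar 0 - up‖ →
        ∃ (a A m : ℝ → ℝ) (k k1 : ℝ → E), ShockLayer M K c k₀ θ ε ubar a A m k k1 := by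
  have hβ := M.pair.β_pos
  have hC := M.C_pos
  have hΛ := M.Λ_pos
  obtain ⟨K₁, θ₁, hK₁, hθ₁, h1⟩ := SmallShock.exists_normalized M
  obtain ⟨K₂, θ₂, hK₂, hθ₂, h2⟩ := NormalizedProfile.bounds M K₁ hK₁
  set Λ₁ := M.Λ / (4 * M.C)
  set Λ₂ := 3 * M.Λ / M.β
  have hΛ₁ : 0 < Λ₁ := by positivity
  have hΛ₂ : 0 < Λ₂ := by positivity
  have h12 : Λ₁ ≤ Λ₂ := by
    have := M.β_le_C
    rw [div_le_div_iff₀ (by positivity) hβ]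
    nlinarith
  obtain ⟨c, k₀, hc, hk₀, h3⟩ := ScalarProfile.multiplier hΛ₁ h12 (t := κ / 4) (by positivity)
  refine ⟨K₂ * (Λ₂ * 4) + Λ₂ * 4 + 2, c / 2, 2 * k₀,
    min θ₁ (min θ₂ (M.β / (2 * (2 + M.C * K₁)))), by positivity,
    by positivity, by positivity, by positivity, ?_⟩
  intro θ ε um up ubar W W1 W2 P hθ hum hup
  simp only [le_min_iff] at hθ
  obtain ⟨t1, t2, t3⟩ := hθ
  rw [le_div_iff₀ (by positivity)] at t3
  have hε := P.ε_pos
  obtain ⟨A, m, m1, k, k1, k2, N, ha, A0, A1, hW, cm1⟩ := h1 P t1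
  have hb := h2 N t2
  set a : ℝ → ℝ := fun x => M.coord (ubar x - um) with hadef
  set p := M.coord (up - um) with hp
  obtain ⟨p0, p1⟩ := P.tendsto_coord
  have pl := P.coord_lower
  have pu := P.coord_upper
  rw [← hp] at pl pu
  have S : ScalarProfile Λ₁ Λ₂ p a A m (fun x => -m1 x / A x) :=
    { pos := hΛ₁
      p_pos := by linarith
      hasDerivAt_a := ha
      hasDerivAt_A := N.hasDerivAt_A
      hasDerivAt_m := fun x => (N.hasDerivAt_m x).congr_deriv (by
        have := (N.A_pos x).ne'; field_simp)
      lower := fun x => by rw [le_div_iff₀ (N.A_pos x)]; exact (hb x).2.1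
      upper := fun x => by rw [div_le_iff₀ (N.A_pos x)]; exact (hb x).2.2
      A_pos := N.A_pos
      a_atBot := p0
      a_atTop := p1
      A_atBot := A0
      A_atTop := A1 }
  obtain ⟨d1, d2⟩ := P.norm_sub_le_coord hW 0
  rw [norm_sub_rev] at hup
  have hm := h3 p a A m _ S (by simp only [hadef]; nlinarith) (by simp only [hadef]; nlinarith)
  have hAle : ∀ x, A x ≤ Λ₂ * 4 * ε ^ 2 := fun x => (S.A_upper x).trans (by
    have : p ^ 2 ≤ (2 * ε) ^ 2 := by gcongr; linarith
    nlinarith)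
  have hcp : c / 2 * ε ≤ c * p := by nlinarith
  have hkp : ∀ x, k₀ * (A x / p) ≤ 2 * k₀ * (A x / ε) := fun x => by
    calc k₀ * (A x / p) ≤ k₀ * (A x / (ε / 2)) := by
          have := N.A_pos x; gcongr
      _ = _ := by field_simp
  have hK0 : 0 ≤ K₂ * (Λ₂ * 4) := by positivity
  refine ⟨a, A, m, k, k1, ?_⟩
  exact
    { ε_pos := hε
      nonneg := N.nonneg
      mem := N.mem
      D_le := N.D_le
      b_le := N.b_le
      hasDerivAt := N.hasDerivAt
      hasDerivAt_a := ha
      hasDerivAt_A := N.hasDerivAt_A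
      hasDerivAt_k := N.hasDerivAt_k
      continuous_m := continuous_iff_continuousAt.2 fun x => (N.hasDerivAt_m x).continuousAt
      continuous_k1 := continuous_iff_continuousAt.2 fun x => (N.hasDerivAt_k1 x).continuousAt
      coord_k := N.coord_k
      coord_k1 := N.coord_k1
      k_mem := N.k_mem
      k1_mem := N.k1_mem
      eq := N.eq
      inner_b_k := fun x => (N.inner_b_k x (by linarith)).1
      norm_k := N.norm_k
      norm_k1 := fun x => by
        calc ‖k1 x‖ ≤ K₂ * (Λ₂ * 4 * ε ^ 2) := (hb x).1.trans (by gcongr; exact hAle x)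
          _ = K₂ * (Λ₂ * 4) * ε ^ 2 := by ring
          _ ≤ _ := by gcongr; linarith
      m_le := fun x => by
        calc |m x| ≤ Λ₂ * p := S.abs_m_le x
          _ ≤ Λ₂ * (4 * ε) := by gcongr; linarith
          _ = Λ₂ * 4 * ε := by ring
          _ ≤ _ := by gcongr; linarith
      A_pos := N.A_pos
      A_le := fun x => (hAle x).trans (by gcongr; linarith)
      a_nonneg := S.a_nonneg
      a_le := fun x => by
        calc a x ≤ p := S.a_le x
          _ ≤ 2 * ε := pu
          _ ≤ _ := by gcongr; linarith
      mult_pos := fun x hx => by linarith [hm.1 x hx, hkp x]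
      mult_neg := fun x hx => by linarith [hm.2 x hx, hkp x] }

end Layer

/-! ## Bookkeeping of `L²` bounds -/

section L2

variable {X : Type*} [MeasurableSpace X] {μ : Measure X} {F : Type*} [NormedAddCommGroup F]

/-- The `L²` norm, as a real number. -/
def l2Norm (μ : Measure X) (f : X → F) : ℝ := (eLpNorm f 2 μ).toReal

lemma l2Norm_nonneg (f : X → F) : 0 ≤ l2Norm μ f := ENNReal.toReal_nonneg

lemma l2Norm_sq {f : X → F} (hf : MemLp f 2 μ) : l2Norm μ f ^ 2 = ∫ x, ‖f x‖ ^ 2 ∂μ := by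
  rw [l2Norm, hf.eLpNorm_eq_integral_rpow_norm (by simp) (by simp),
    ENNReal.toReal_ofReal (by positivity)]
  simp only [ENNReal.toReal_ofNat, Real.rpow_two]
  rw [← Real.rpow_natCast, ← Real.rpow_mul (integral_nonneg fun _ => by positivity)]
  norm_num

lemma l2Norm_le_of_integral_le {G : Type*} [NormedAddCommGroup G] {f : X → F} {g : X → G} {K : ℝ}
    (hf : MemLp f 2 μ) (hg : MemLp g 2 μ) (h : ∫ x, ‖f x‖ ^ 2 ∂μ ≤ K * ∫ x, ‖g x‖ ^ 2 ∂μ) :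
    l2Norm μ f ≤ Real.sqrt K * l2Norm μ g := by
  rw [← l2Norm_sq hf, ← l2Norm_sq hg] at h
  have := Real.sqrt_le_sqrt h
  rwa [Real.sqrt_sq (l2Norm_nonneg f), Real.sqrt_mul' _ (sq_nonneg _),
    Real.sqrt_sq (l2Norm_nonneg g)] at this

/-- `φ` is square integrable with `L²` norm at most `B`. -/
structure L2Bound (μ : Measure X) (φ : X → ℝ) (B : ℝ) : Prop where
  memLp : MemLp φ 2 μ
  l2Norm_le : l2Norm μ φ ≤ B

namespace L2Bound

variable {φ ψ : X → ℝ} {B B' : ℝ}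

lemma of_memLp {f : X → F} (hf : MemLp f 2 μ) : L2Bound μ (fun x => ‖f x‖) (l2Norm μ f) :=
  ⟨hf.norm, by rw [l2Norm, eLpNorm_norm]; rfl⟩

lemma add (h : L2Bound μ φ B) (h' : L2Bound μ ψ B') : L2Bound μ (fun x => φ x + ψ x) (B + B') := by
  refine ⟨h.memLp.add h'.memLp, ?_⟩
  have h1 := eLpNorm_add_le h.memLp.aestronglyMeasurable h'.memLp.aestronglyMeasurable
    (p := 2) (by norm_num)
  have h2 := ENNReal.toReal_mono (ENNReal.add_ne_top.2 ⟨h.memLp.eLpNorm_ne_top,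
    h'.memLp.eLpNorm_ne_top⟩) h1
  rw [ENNReal.toReal_add h.memLp.eLpNorm_ne_top h'.memLp.eLpNorm_ne_top] at h2
  exact h2.trans (add_le_add h.l2Norm_le h'.l2Norm_le)

lemma const_mul (h : L2Bound μ φ B) {c : ℝ} (hc : 0 ≤ c) : L2Bound μ (fun x => c * φ x) (c * B) := by
  refine ⟨h.memLp.const_mul c, ?_⟩
  have h1 : l2Norm μ (fun x => c * φ x) = c * l2Norm μ φ := by
    have : (fun x => c * φ x) = c • φ := rfl
    rw [l2Norm, this, eLpNorm_const_smul, ENNReal.toReal_mul]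
    simp [l2Norm, abs_of_nonneg hc]
  rw [h1]
  exact mul_le_mul_of_nonneg_left h.l2Norm_le hc

lemma l2Norm_le_of_ae (h : L2Bound μ φ B) {f : X → F} (hf : ∀ᵐ x ∂μ, ‖f x‖ ≤ φ x) :
    l2Norm μ f ≤ B := by
  refine le_trans (ENNReal.toReal_mono h.memLp.eLpNorm_ne_top ?_) h.l2Norm_le
  exact eLpNorm_mono_ae (hf.mono fun x hx => hx.trans (le_abs_self _))

end L2Bound

end L2

/-! ## A scalar equation on two half-lines -/

section HalfLine

/-- The equation is multiplied by `w E y` with `E = exp(-2 s k₀ a / ε)`. The factor `E` is bounded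
above and below uniformly in `ε` since `0 ≤ a ≤ K ε`, while its derivative adds `k₀ A / ε` to `-s
m`, making the sum at least `c ε` on `I`. The sign `s = ±1` selects the half-line, and `y 0 = 0`
removes the boundary term. -/
lemma halfLine_aux {c k₀ K ε η B s : ℝ} (hc : 0 < c) (hk₀ : 0 ≤ k₀) (hε : 0 < ε)
    (hη : 2 * η ≤ c * ε) (hs : s * s = 1) (hs1 : |s| = 1) {I : Set ℝ} (mI : MeasurableSet I)
    {w w' a A m y y' e : ℝ → ℝ} (hw : SlowWeight w w' η)
    (ha : ∀ x, HasDerivAt a (A x) x) (cA : Continuous A) (bA : ∀ x, |A x| ≤ B)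
    (a0 : ∀ x, 0 ≤ a x) (a1 : ∀ x, a x ≤ K * ε)
    (hI : ∀ x ∈ I, c * ε ≤ k₀ * (A x / ε) - s * m x)
    (hzero : ∀ {F f : ℝ → ℝ}, IsPrimitive F f → Integrable F → Integrable f → F 0 = 0 →
      ∫ x in I, f x = 0)
    (hy : IsPrimitive y y') (Ly : MemLp y 2 (weightedMeasure w))
    (Ly' : MemLp y' 2 (weightedMeasure w)) (Le : MemLp e 2 (weightedMeasure w))
    (heq : ∀ᵐ x, y' x = m x * y x + e x) (y0 : y 0 = 0) :
    ∫ x in I, w x * (y x * y x)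
      ≤ Real.exp (4 * k₀ * K) * (4 / (c * ε) ^ 2) * ∫ x in I, w x * (e x * e x) := by
  set E : ℝ → ℝ := fun x => Real.exp (-(s * (2 * k₀ / ε)) * a x) with hE
  have hE' : ∀ x, HasDerivAt E (-(s * (2 * k₀ / ε)) * A x * E x) x := fun x =>
    (((ha x).const_mul (-(s * (2 * k₀ / ε)))).exp).congr_deriv (mul_comm _ _)
  have cE : Continuous E := continuous_iff_continuousAt.2 fun x => (hE' x).continuousAt
  have Epos : ∀ x, 0 < E x := fun x => Real.exp_pos _
  have habs : ∀ x, |-(s * (2 * k₀ / ε)) * a x| ≤ 2 * k₀ * K := fun x => by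
    rw [abs_mul, abs_neg, abs_mul, hs1, one_mul, abs_of_nonneg (by positivity), abs_of_nonneg (a0 x)]
    calc 2 * k₀ / ε * a x ≤ 2 * k₀ / ε * (K * ε) := by gcongr; exact a1 x
      _ = _ := by field_simp
  have Ele : ∀ x, E x ≤ Real.exp (2 * k₀ * K) := fun x =>
    Real.exp_le_exp.2 (le_of_abs_le (habs x))
  have Ege : ∀ x, Real.exp (-(2 * k₀ * K)) ≤ E x := fun x =>
    Real.exp_le_exp.2 (neg_le_of_abs_le (habs x))
  have pE := IsPrimitive.of_hasDerivAt hE' ((continuous_const.mul cA).mul cE)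
  set μ := weightedMeasure w with hμ
  have cw := hw.continuous
  have bdd : ∀ {g f : ℝ → ℝ} {C : ℝ}, Continuous g → (∀ x, |g x| ≤ C) → Integrable f μ →
      Integrable (fun x => g x * f x) μ := by
    intro g f C hg hC hf
    refine (hf.norm.const_mul C).mono' (hg.aestronglyMeasurable.mul hf.aestronglyMeasurable)
      (Eventually.of_forall fun x => ?_)
    rw [norm_mul]
    exact mul_le_mul_of_nonneg_right (hC x) (norm_nonneg _)
  have bE : ∀ x, |E x| ≤ Real.exp (2 * k₀ * K) := fun x => by rw [abs_of_pos (Epos x)]; exact Ele x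
  have iyy : Integrable (fun x => y x * y x) μ := Ly.integrable_mul Ly
  have iyy' : Integrable (fun x => y x * y' x + y' x * y x) μ :=
    (Ly.integrable_mul Ly').add (Ly'.integrable_mul Ly)
  have iee : Integrable (fun x => e x * e x) μ := Le.integrable_mul Le
  have iF : Integrable (fun x => E x * (y x * y x)) μ := bdd cE bE iyy
  have iF' : Integrable (fun x => E x * (y x * y' x + y' x * y x)
      + -(s * (2 * k₀ / ε)) * A x * E x * (y x * y x)) μ := by
    refine (bdd cE bE iyy').add (bdd ((continuous_const.mul cA).mul cE)
      (C := |-(s * (2 * k₀ / ε))| * B * Real.exp (2 * k₀ * K)) (fun x => ?_) iyy)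
    rw [abs_mul, abs_mul]
    have := (abs_nonneg _).trans (bA x)
    gcongr
    exacts [bA x, bE x]
  obtain ⟨i1, i2, hp⟩ := hw.integral_deriv (pE.mul (hy.mul hy)) iF iF'
  have hz := hzero hp i1 i2 (by simp [y0])
  have iR : Integrable (fun x => w x * (E x * (e x * e x))) := by
    simpa using (integrable_weightedMeasure_iff cw hw.pos).1 (bdd cE bE iee)
  have i1' : Integrable (fun x => w x * (y x * y x)) := by
    simpa using (integrable_weightedMeasure_iff cw hw.pos).1 iyy
  have iR' : Integrable (fun x => w x * (e x * e x)) := by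
    simpa using (integrable_weightedMeasure_iff cw hw.pos).1 iee
  have hcε : 0 < c * ε := by positivity
  -- Of the dissipation `2 c ε`, the derivative of the weight uses at most `c ε`, because `2 η ≤ c
  -- ε`, and Young's inequality for `y e` uses `c ε / 2`; the remaining `c ε / 2` is the left side.
  -- The exact derivative is kept on the right, its integral being zero.
  have key : ∫ x in I, (c * ε / 2) * (w x * (E x * (y x * y x)))
      ≤ ∫ x in I, ((2 / (c * ε)) * (w x * (E x * (e x * e x)))
        + -s * (w x * (E x * (y x * y' x + y' x * y x) + -(s * (2 * k₀ / ε)) * A x * E x * (y x * y x))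
          + w' x * (E x * (y x * y x)))) := by
    refine setIntegral_mono_on_ae (i1.const_mul _).integrableOn
      ((iR.const_mul _).add (i2.const_mul _)).integrableOn mI ?_
    filter_upwards [heq, hw.deriv_le] with x hx hw' hxI
    have h1 := hI x hxI
    have hwx := hw.pos x
    have hwE : 0 < w x * E x := mul_pos hwx (Epos x)
    have h2 : -s * w' x ≥ -(c * ε * w x) := by
      have : |s * w' x| ≤ c * ε * w x := by
        rw [abs_mul, hs1, one_mul]; exact hw'.trans (by gcongr)
      have := le_of_abs_le this
      linarith
    have h3 : 2 * |y x * e x| ≤ c * ε / 2 * (y x * y x) + 2 / (c * ε) * (e x * e x) := by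
      have e1 : c * ε / 2 * (y x * y x) + 2 / (c * ε) * (e x * e x) - 2 * |y x * e x|
          = (c * ε * |y x| - 2 * |e x|) ^ 2 / (2 * (c * ε)) := by
        rw [abs_mul, ← abs_mul_abs_self (y x), ← abs_mul_abs_self (e x)]; field_simp; ring
      have : 0 ≤ (c * ε * |y x| - 2 * |e x|) ^ 2 / (2 * (c * ε)) := by positivity
      linarith
    have h4 : |s * (y x * e x)| ≤ |y x * e x| := by rw [abs_mul, hs1, one_mul]
    have h5 := le_of_abs_le h4
    have e2 : -s * (w x * (E x * (y x * y' x + y' x * y x)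
        + -(s * (2 * k₀ / ε)) * A x * E x * (y x * y x)) + w' x * (E x * (y x * y x)))
        = w x * E x * (2 * (k₀ * (A x / ε) - s * m x) * (y x * y x) - 2 * (s * (y x * e x)))
          + (-s * w' x) * (E x * (y x * y x)) := by
      rw [hx]
      have : -s * (w x * (-(s * (2 * k₀ / ε)) * A x * E x * (y x * y x)))
          = (s * s) * (w x * ((2 * k₀ / ε) * A x * E x * (y x * y x))) := by ring
      rw [hs] at this
      calc _ = -s * (w x * (E x * (y x * (m x * y x + e x) + (m x * y x + e x) * y x)))
            + -s * (w x * (-(s * (2 * k₀ / ε)) * A x * E x * (y x * y x)))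
            + (-s * w' x) * (E x * (y x * y x)) := by ring
        _ = _ := by rw [this]; ring
    rw [e2]
    have hyy : 0 ≤ y x * y x := mul_self_nonneg _
    have h6 : w x * E x * (2 * (c * ε) * (y x * y x)
        - (c * ε / 2 * (y x * y x) + 2 / (c * ε) * (e x * e x)))
        ≤ w x * E x * (2 * (k₀ * (A x / ε) - s * m x) * (y x * y x) - 2 * (s * (y x * e x))) := by
      gcongr
      linarith
    have h7 : -(c * ε * w x) * (E x * (y x * y x)) ≤ (-s * w' x) * (E x * (y x * y x)) :=
      mul_le_mul_of_nonneg_right h2 (mul_nonneg (Epos x).le hyy)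
    linarith
  rw [integral_add (iR.const_mul _).integrableOn (i2.const_mul _).integrableOn, integral_const_mul,
    integral_const_mul, integral_const_mul, hz, mul_zero, add_zero] at key
  set J := ∫ x in I, w x * (y x * y x)
  set J' := ∫ x in I, w x * (E x * (y x * y x))
  set R := ∫ x in I, w x * (E x * (e x * e x))
  set R' := ∫ x in I, w x * (e x * e x)
  have b1 : Real.exp (-(2 * k₀ * K)) * J ≤ J' := by
    rw [← integral_const_mul]
    refine setIntegral_mono_on (i1'.const_mul _).integrableOn i1.integrableOn mI fun x _ => ?_
    have := mul_nonneg (hw.pos x).le (mul_self_nonneg (y x))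
    nlinarith [Ege x]
  have b2 : R ≤ Real.exp (2 * k₀ * K) * R' := by
    rw [← integral_const_mul]
    refine setIntegral_mono_on iR.integrableOn (iR'.const_mul _).integrableOn mI fun x _ => ?_
    have := mul_nonneg (hw.pos x).le (mul_self_nonneg (e x))
    nlinarith [Ele x]
  have hexp : Real.exp (2 * k₀ * K) * Real.exp (-(2 * k₀ * K)) = 1 := by
    rw [← Real.exp_add]; simp
  have hexp2 : Real.exp (4 * k₀ * K) = Real.exp (2 * k₀ * K) * Real.exp (2 * k₀ * K) := by
    rw [← Real.exp_add]; ring_nf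
  have hX := Real.exp_pos (2 * k₀ * K)
  calc J = Real.exp (2 * k₀ * K) * (Real.exp (-(2 * k₀ * K)) * J) := by rw [← mul_assoc, hexp, one_mul]
    _ ≤ Real.exp (2 * k₀ * K) * J' := by gcongr
    _ = Real.exp (2 * k₀ * K) * ((2 / (c * ε)) * (c * ε / 2 * J')) := by field_simp
    _ ≤ Real.exp (2 * k₀ * K) * ((2 / (c * ε)) * (2 / (c * ε) * (Real.exp (2 * k₀ * K) * R'))) := by
        refine mul_le_mul_of_nonneg_left (mul_le_mul_of_nonneg_left ?_ (by positivity)) hX.le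
        exact key.trans (by gcongr)
    _ = _ := by rw [hexp2]; field_simp; ring

/-- Solutions of `y' = m y + e` vanishing at `0`, when `m` is dissipative on both half-lines up to
an exact derivative. -/
theorem l2Norm_le_of_halfLine {c k₀ K ε η B : ℝ} (hc : 0 < c) (hk₀ : 0 ≤ k₀)
    (hε : 0 < ε) (hη : 2 * η ≤ c * ε) {w w' a A m y y' e : ℝ → ℝ} (hw : SlowWeight w w' η)
    (ha : ∀ x, HasDerivAt a (A x) x) (cA : Continuous A) (bA : ∀ x, |A x| ≤ B)
    (a0 : ∀ x, 0 ≤ a x) (a1 : ∀ x, a x ≤ K * ε)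
    (hpos : ∀ x, 0 ≤ x → c * ε ≤ k₀ * (A x / ε) - m x)
    (hneg : ∀ x, x ≤ 0 → c * ε ≤ k₀ * (A x / ε) + m x)
    (hy : IsPrimitive y y') (Ly : MemLp y 2 (weightedMeasure w))
    (Ly' : MemLp y' 2 (weightedMeasure w)) (Le : MemLp e 2 (weightedMeasure w))
    (heq : ∀ᵐ x, y' x = m x * y x + e x) (y0 : y 0 = 0) :
    l2Norm (weightedMeasure w) y
      ≤ Real.sqrt (Real.exp (4 * k₀ * K) * (4 / (c * ε) ^ 2)) * l2Norm (weightedMeasure w) e := by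
  refine l2Norm_le_of_integral_le Ly Le ?_
  have cw := hw.continuous
  have split : ∀ {f : ℝ → ℝ}, MemLp f 2 (weightedMeasure w) → ∫ x, ‖f x‖ ^ 2 ∂weightedMeasure w
      = (∫ x in Set.Iic 0, w x * (f x * f x)) + ∫ x in Set.Ioi 0, w x * (f x * f x) := by
    intro f hf
    have h1 : Integrable (fun x => f x * f x) (weightedMeasure w) := hf.integrable_mul hf
    have h2 : Integrable (fun x => w x * (f x * f x)) := by
      simpa using (integrable_weightedMeasure_iff cw hw.pos).1 h1
    rw [integral_weightedMeasure cw hw.pos,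
      intervalIntegral.integral_Iic_add_Ioi h2.integrableOn h2.integrableOn]
    congr 1; funext x
    rw [smul_eq_mul, Real.norm_eq_abs, sq_abs, sq]
  rw [split Ly, split Le, mul_add]
  refine add_le_add ?_ ?_
  · exact halfLine_aux (s := -1) hc hk₀ hε hη (by norm_num) (by norm_num) measurableSet_Iic hw ha
      cA bA a0 a1 (fun x hx => by have := hneg x hx; linarith)
      (fun hF i1 i2 h0 => by rw [hF.integral_Iic i1 i2, h0]) hy Ly Ly' Le heq y0
  · exact halfLine_aux (s := 1) hc hk₀ hε hη (by norm_num) (by norm_num) measurableSet_Ioi hw ha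
      cA bA a0 a1 (fun x hx => by have := hpos x (Set.mem_Ioi.1 hx).le; linarith)
      (fun hF i1 i2 h0 => by rw [hF.integral_Ioi i1 i2, h0, neg_zero]) hy Ly Ly' Le heq y0

end HalfLine

/-! ## The linearized reduced system around a shock layer -/

section LinearReduced

variable {E : Type*} [NormedAddCommGroup E] [InnerProductSpace ℝ E]

/-- A solution of `b(ubar) u' = D(ubar) u + G` with the algebraic constraint `P_N D u = P_N f`. -/
structure LinearProblem (M : ReducedModel E) (w : ℝ → ℝ) (ubar u u' f f' G : ℝ → E) : Prop where
  prim_u : IsPrimitive u u'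
  prim_f : IsPrimitive f f'
  memLp_u : MemLp u 2 (weightedMeasure w)
  memLp_u' : MemLp u' 2 (weightedMeasure w)
  memLp_f : MemLp f 2 (weightedMeasure w)
  memLp_f' : MemLp f' 2 (weightedMeasure w)
  memLp_G : MemLp G 2 (weightedMeasure w)
  eq : ∀ᵐ x, M.b (ubar x) (u' x) = M.D (ubar x) (u x) + G x
  constraint : ∀ x, ∀ n ∈ M.N, ⟪M.D M.u₀ (u x), n⟫_ℝ = ⟪f x, n⟫_ℝ

lemma LinearProblem.constraint_deriv {M : ReducedModel E} [CompleteSpace E] {w : ℝ → ℝ}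
    {ubar u u' f f' G : ℝ → E} (h : LinearProblem M w ubar u u' f f' G) :
    ∀ᵐ x, ∀ n ∈ M.N, ⟪M.D M.u₀ (u' x), n⟫_ℝ = ⟪f' x, n⟫_ℝ := by
  filter_upwards [h.prim_u.ae_hasDerivAt, h.prim_f.ae_hasDerivAt] with x h1 h2 n hn
  have h3 : HasDerivAt (fun x => ⟪M.D M.u₀ (u x), n⟫_ℝ) ⟪M.D M.u₀ (u' x), n⟫_ℝ x := by
    have := ((M.D M.u₀).hasFDerivAt.comp_hasDerivAt x h1).inner ℝ (hasDerivAt_const x n)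
    simpa using this
  have h4 : HasDerivAt (fun x => ⟪f x, n⟫_ℝ) ⟪f' x, n⟫_ℝ x := by
    have := h2.inner ℝ (hasDerivAt_const x n)
    simpa using this
  rw [funext fun x => h.constraint x n hn] at h3
  exact h3.unique h4

/-- `ℓ` lies in the range of `b(u₀)`, which is orthogonal to `N`. Correcting the constraint
therefore does not disturb the amplitude along `r`. -/
lemma ReducedModel.coord_lift (M : ReducedModel E) (f : E) : M.coord (M.lift f) = 0 := by
  rw [M.coord_apply, ReducedModel.ell, M.b_N _ M.u₀_mem _ _ (M.lift_mem f), mul_zero]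

lemma ReducedModel.sub_lift_mem (M : ReducedModel E) {u f : E}
    (h : ∀ n ∈ M.N, ⟪M.D M.u₀ u, n⟫_ℝ = ⟪f, n⟫_ℝ) : u - M.lift f ∈ M.T := by
  rw [M.mem_T]
  intro n hn
  rw [map_sub, inner_sub_left, h n hn, M.lift_spec f n hn, sub_self]

set_option maxHeartbeats 1000000 in
/-- A priori estimates for the linearized reduced system, with the loss of one power of `ε`. -/
theorem ShockLayer.linear_estimate (M : ReducedModel E) [CompleteSpace E] {K c k₀ : ℝ} (hK : 0 < K)
    (hc : 0 < c) (hk₀ : 0 < k₀) : ∃ C θ₀ ε₀ δ₀ : ℝ, 0 < C ∧ 0 < θ₀ ∧ 0 < ε₀ ∧ 0 < δ₀ ∧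
      ∀ {θ ε : ℝ} {ubar : ℝ → E} {a A m : ℝ → ℝ} {k k1 : ℝ → E},
      ShockLayer M K c k₀ θ ε ubar a A m k k1 → θ ≤ θ₀ → ε ≤ ε₀ →
      ∀ {w w' : ℝ → ℝ} {η : ℝ}, SlowWeight w w' η → 0 ≤ η → η ≤ δ₀ * ε →
      ∀ {u u' f f' G : ℝ → E}, LinearProblem M w ubar u u' f f' G →
        l2Norm (weightedMeasure w) u' ≤ C * (ε * l2Norm (weightedMeasure w) u
          + (l2Norm (weightedMeasure w) G + l2Norm (weightedMeasure w) f
            + l2Norm (weightedMeasure w) f')) ∧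
        (⟪M.ell, u 0⟫_ℝ = 0 → l2Norm (weightedMeasure w) u ≤ C * ε⁻¹ *
          (l2Norm (weightedMeasure w) G + l2Norm (weightedMeasure w) f
            + l2Norm (weightedMeasure w) f')) := by
  have hβ := M.pair.β_pos
  have hC := M.C_pos
  obtain ⟨η₀, θ₁, Ke, hη₀, hθ₁, hKe, hen⟩ := M.pair.energy_estimate (M.C * 2) (by positivity)
  set L := ‖M.lift‖ with hL
  have hL0 : 0 ≤ L := norm_nonneg _
  set s := Real.sqrt Ke with hs
  have hs0 : 0 ≤ s := Real.sqrt_nonneg _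
  set C1 := 1 + M.C * L with hC1
  set C2 := 4 * M.C * K with hC2
  set P := 2 / M.β * (2 * s + 1) with hP
  have hPp : 0 < P := by positivity
  set H := Real.sqrt (Real.exp (4 * k₀ * K)) * (2 / c) with hH
  have hHp : 0 < H := by positivity
  set C4 := 2 * H * P * C1 with hC4
  set Ca := L + s * C1 + 2 * P * C1 + (s * C2 + K + 2 * (P * C2) + 2 * K) * (M.C / M.β) with hCa
  set Cb := L + 2 * C4 + s * C1 + s * C2 * C4 with hCb
  refine ⟨Ca + Cb + 1, min θ₁ 1, min 1 (1 / (2 * H * P * C2)), min (c / 2) η₀, by positivity,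
    by positivity, by positivity, by positivity, ?_⟩
  intro θ ε ubar a A m k k1 S hθ hε0 w w' η hw hη0 hη u u' f f' G Q
  simp only [le_min_iff] at hθ hε0
  obtain ⟨t1, t2⟩ := hθ
  obtain ⟨ε1, ε2⟩ := hε0
  rw [le_div_iff₀ (by positivity)] at ε2
  have hε := S.ε_pos
  have hηc : 2 * η ≤ c * ε := by
    have : η ≤ c / 2 * ε := hη.trans (by gcongr; exact min_le_left _ _)
    linarith
  have hηη : η ≤ η₀ := hη.trans (by
    calc min (c / 2) η₀ * ε ≤ η₀ * 1 := by gcongr; exact min_le_right _ _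
      _ = η₀ := mul_one _)
  have hθ0 := S.nonneg
  set μ := weightedMeasure w with hμ
  have ck : Continuous k := continuous_iff_continuousAt.2 fun x => (S.hasDerivAt_k x).continuousAt
  have cA : Continuous A := continuous_iff_continuousAt.2 fun x => (S.hasDerivAt_A x).continuousAt
  have pk := IsPrimitive.of_hasDerivAt S.hasDerivAt_k S.continuous_k1
  -- Decomposition `u = lift f + y k + z`: the lift restores the homogeneous constraint, `y`
  -- measures the component along the profile direction `k`, and `z` lies in `T` and is orthogonal
  -- to `ℓ`.
  let y : ℝ → ℝ := fun x => M.coord (u x)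
  let y' : ℝ → ℝ := fun x => M.coord (u' x)
  have py : IsPrimitive y y' := Q.prim_u.clm M.coord
  have Ly : MemLp y 2 μ := M.coord.comp_memLp' Q.memLp_u
  have Ly' : MemLp y' 2 μ := M.coord.comp_memLp' Q.memLp_u'
  let z : ℝ → E := fun x => (u x - M.lift (f x)) - y x • k x
  let z' : ℝ → E := fun x => (u' x - M.lift (f' x)) - (y x • k1 x + y' x • k x)
  have pz : IsPrimitive z z' := (Q.prim_u.sub (Q.prim_f.clm M.lift)).sub (py.smul pk)
  have Lsm : ∀ {φ : ℝ → ℝ} {v : ℝ → E} {B : ℝ}, MemLp φ 2 μ → Continuous v → (∀ x, ‖v x‖ ≤ B) →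
      MemLp (fun x => φ x • v x) 2 μ := fun {φ v B} hφ hv hB =>
    MemLp.of_le_mul (c := B) hφ (hφ.aestronglyMeasurable.smul hv.aestronglyMeasurable)
      (Eventually.of_forall fun x => by
        rw [norm_smul, mul_comm]; exact mul_le_mul_of_nonneg_right (hB x) (norm_nonneg _))
  have Lz : MemLp z 2 μ := (Q.memLp_u.sub (M.lift.comp_memLp' Q.memLp_f)).sub (Lsm Ly ck S.norm_k)
  have Lz' : MemLp z' 2 μ := (Q.memLp_u'.sub (M.lift.comp_memLp' Q.memLp_f')).sub
    ((Lsm Ly S.continuous_k1 S.norm_k1).add (Lsm Ly' ck S.norm_k))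
  -- The defect in the amplitude equation `y' = m y + e`. It turns out to be exactly the multiplier
  -- in the equation of `z`, hence is controlled by pairing with `r`.
  let e : ℝ → ℝ := fun x => y' x - m x * y x
  have Le : MemLp e 2 μ := by
    refine Ly'.sub (MemLp.of_le_mul (c := K * ε) Ly
      (S.continuous_m.aestronglyMeasurable.mul Ly.aestronglyMeasurable)
      (Eventually.of_forall fun x => ?_))
    rw [norm_mul]; exact mul_le_mul_of_nonneg_right (S.m_le x) (norm_nonneg _)
  let q : ℝ → ℝ := fun x => ‖G x‖ + (M.C * L * (‖f x‖ + ‖f' x‖) + C2 * ε ^ 2 * ‖y x‖)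
  let g : ℝ → E := fun x => (M.D (ubar x) - M.D M.u₀) (z x) - (M.b (ubar x) - M.b M.u₀) (z' x)
    + (G x + M.D (ubar x) (M.lift (f x)) - M.b (ubar x) (M.lift (f' x)))
    + (y x * A x) • M.b1 (ubar x) (k x) (k x)
  set NG := l2Norm μ G
  set Nf := l2Norm μ f
  set Nf' := l2Norm μ f'
  set Ny := l2Norm μ y
  have hNG : 0 ≤ NG := l2Norm_nonneg _
  have hNf : 0 ≤ Nf := l2Norm_nonneg _
  have hNf' : 0 ≤ Nf' := l2Norm_nonneg _
  have hNy : 0 ≤ Ny := l2Norm_nonneg _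
  have bG := L2Bound.of_memLp Q.memLp_G
  have bf := L2Bound.of_memLp Q.memLp_f
  have bf' := L2Bound.of_memLp Q.memLp_f'
  have bu := L2Bound.of_memLp Q.memLp_u
  have bu' := L2Bound.of_memLp Q.memLp_u'
  have bz := L2Bound.of_memLp Lz
  have bz' := L2Bound.of_memLp Lz'
  have be := L2Bound.of_memLp Le
  have by' : L2Bound μ (fun x => ‖y x‖) Ny := L2Bound.of_memLp Ly
  have bq : L2Bound μ q (NG + (M.C * L * (Nf + Nf') + C2 * ε ^ 2 * Ny)) :=
    bG.add (((bf.add bf').const_mul (by positivity)).add (by'.const_mul (by positivity)))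
  have q0 : ∀ x, 0 ≤ q x := fun x => by simp only [q]; positivity
  have hpt : ∀ᵐ x ∂μ, z x ∈ M.T ∧ z' x ∈ M.T ∧ ⟪M.b M.u₀ M.r, z x⟫_ℝ = 0 ∧
      ⟪M.b M.u₀ M.r, z' x⟫_ℝ = 0 ∧
      M.b M.u₀ (z' x) = M.D M.u₀ (z x) + g x - e x • M.b (ubar x) (k x) ∧
      ‖g x‖ ≤ θ * (‖z x‖ + ‖z' x‖) + |q x| ∧ ‖M.b (ubar x) (k x)‖ ≤ M.C * 2 ∧
      M.β / 2 ≤ ⟪M.b (ubar x) (k x), M.r⟫_ℝ := by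
    filter_upwards [ae_weightedMeasure Q.eq, ae_weightedMeasure Q.constraint_deriv] with x heq hcd
    have kx := S.norm_k x
    refine ⟨?_, ?_, ?_, ?_, ?_, ?_, ?_, S.inner_b_k x⟩
    · exact M.T.sub_mem (M.sub_lift_mem (Q.constraint x)) (M.T.smul_mem _ (S.k_mem x))
    · exact M.T.sub_mem (M.sub_lift_mem hcd) (M.T.add_mem (M.T.smul_mem _ (S.k1_mem x))
        (M.T.smul_mem _ (S.k_mem x)))
    · change ⟪M.ell, z x⟫_ℝ = 0
      rw [M.inner_ell]
      simp only [z, y, map_sub, map_smul, S.coord_k, M.coord_lift, smul_eq_mul]; ring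
    · change ⟪M.ell, z' x⟫_ℝ = 0
      rw [M.inner_ell]
      simp only [z', y', map_sub, map_add, map_smul, S.coord_k, S.coord_k1, M.coord_lift, smul_eq_mul]
      ring
    · have e1 : M.b M.u₀ (z' x) = M.b (ubar x) (z' x) - (M.b (ubar x) - M.b M.u₀) (z' x) := by
        rw [sub_apply]; abel
      -- The equation of `k` replaces `y b k'`, so that `y D k` cancels and `y'`, `m y` combine into
      -- `e`. The remaining term `y A b₁(k, k)` is of order `ε² y`.
      have e2 : M.b (ubar x) (z' x) = M.D (ubar x) (u x) + G x - M.b (ubar x) (M.lift (f' x))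
          - (y x • (M.D (ubar x) (k x) - m x • M.b (ubar x) (k x)
            - A x • M.b1 (ubar x) (k x) (k x)) + y' x • M.b (ubar x) (k x)) := by
        simp only [z', map_sub, map_add, map_smul]; rw [heq, S.eq]
      have e3 : M.D (ubar x) (z x) = M.D (ubar x) (u x) - M.D (ubar x) (M.lift (f x))
          - y x • M.D (ubar x) (k x) := by simp only [z, map_sub, map_smul]
      have e4 : M.D M.u₀ (z x) = M.D (ubar x) (z x) - (M.D (ubar x) - M.D M.u₀) (z x) := by
        rw [sub_apply]; abel
      rw [e1, e2, e4]
      simp only [g, e]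
      rw [e3]
      module
    · rw [abs_of_nonneg (q0 x)]
      have n1 : ‖(M.D (ubar x) - M.D M.u₀) (z x)‖ ≤ θ * ‖z x‖ :=
        ContinuousLinearMap.le_of_opNorm_le _ (S.D_le x) _
      have n2 : ‖(M.b (ubar x) - M.b M.u₀) (z' x)‖ ≤ θ * ‖z' x‖ :=
        ContinuousLinearMap.le_of_opNorm_le _ (S.b_le x) _
      have n3 : ‖M.D (ubar x) (M.lift (f x))‖ ≤ M.C * (L * ‖f x‖) :=
        (ContinuousLinearMap.le_of_opNorm_le _ (M.norm_D_le _ (S.mem x)) _).trans (by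
          gcongr; exact M.lift.le_opNorm _)
      have n4 : ‖M.b (ubar x) (M.lift (f' x))‖ ≤ M.C * (L * ‖f' x‖) :=
        (ContinuousLinearMap.le_of_opNorm_le _ (M.norm_b_le _ (S.mem x)) _).trans (by
          gcongr; exact M.lift.le_opNorm _)
      have n5 : ‖(y x * A x) • M.b1 (ubar x) (k x) (k x)‖ ≤ (‖y x‖ * (K * ε ^ 2)) * (M.C * 2 * 2) := by
        rw [norm_smul, norm_mul, Real.norm_eq_abs (A x), abs_of_pos (S.A_pos x)]
        gcongr
        · exact S.A_le x
        · exact ((M.b1 (ubar x)).le_opNorm₂ _ _).trans (by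
            gcongr; exact M.norm_b1_le _ (S.mem x))
      have n6 := (norm_add_le _ _).trans (add_le_add ((norm_add_le _ _).trans (add_le_add
        ((norm_sub_le _ _).trans (add_le_add n1 n2)) ((norm_sub_le _ _).trans (add_le_add
        ((norm_add_le (G x) _).trans (add_le_add le_rfl n3)) n4)))) n5)
      refine n6.trans (le_of_eq ?_)
      simp only [q, hC2]; ring
    · exact (ContinuousLinearMap.le_of_opNorm_le _ (M.norm_b_le _ (S.mem x)) _).trans (by gcongr)
  have h1 := hen μ η θ z z' g (fun x => M.b (ubar x) (k x)) e q hη0 hηη hθ0 t1 Lz Lz' bq.memLp hpt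
    (M.pair.integral_inner_le hw pz Lz Lz')
  have iz : 0 ≤ ∫ x, ‖z x‖ ^ 2 ∂μ := integral_nonneg fun _ => by positivity
  have iz' : 0 ≤ ∫ x, ‖z' x‖ ^ 2 ∂μ := integral_nonneg fun _ => by positivity
  set Bq := NG + (M.C * L * (Nf + Nf') + C2 * ε ^ 2 * Ny) with hBq
  have nz : l2Norm μ z ≤ s * Bq := (l2Norm_le_of_integral_le Lz bq.memLp (K := Ke) (by
    have : (fun x => ‖q x‖ ^ 2) = fun x => |q x| ^ 2 := rfl
    rw [this]; linarith)).trans (by gcongr; exact bq.l2Norm_le)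
  have nz' : l2Norm μ z' ≤ s * Bq := (l2Norm_le_of_integral_le Lz' bq.memLp (K := Ke) (by
    have : (fun x => ‖q x‖ ^ 2) = fun x => |q x| ^ 2 := rfl
    rw [this]; linarith)).trans (by gcongr; exact bq.l2Norm_le)
  have ne : l2Norm μ e ≤ P * Bq := by
    have b1 := ((bz.add bz').add bq).const_mul (c := 2 / M.β) (by positivity)
    refine (b1.l2Norm_le_of_ae ?_).trans ?_
    · filter_upwards [hpt] with x hx
      obtain ⟨-, -, -, p1, p2, p3, -, p4⟩ := hx
      rw [abs_of_nonneg (q0 x)] at p3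
      refine (M.pair.abs_multiplier_le p1 p2 p4).trans ?_
      have : θ * (‖z x‖ + ‖z' x‖) ≤ 1 * (‖z x‖ + ‖z' x‖) := by gcongr
      gcongr
      linarith
    · calc 2 / M.β * (l2Norm μ z + l2Norm μ z' + Bq) ≤ 2 / M.β * (s * Bq + s * Bq + Bq) := by gcongr
        _ = _ := by rw [hP]; ring
  set R := NG + Nf + Nf' with hR
  have hR0 : 0 ≤ R := by positivity
  have hBqR : Bq ≤ C1 * R + C2 * ε ^ 2 * Ny := by
    have : 0 ≤ M.C * L * NG := by positivity
    rw [hBq, hC1, hR]; linarith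
  have hNyu : Ny ≤ M.C / M.β * l2Norm μ u :=
    (bu.const_mul (c := M.C / M.β) (by positivity)).l2Norm_le_of_ae
      (Eventually.of_forall fun x => M.abs_coord_le (u x))
  have hNfR : Nf ≤ R := by rw [hR]; linarith
  have hNf'R : Nf' ≤ R := by rw [hR]; linarith
  have hCa0 : 0 ≤ Ca := by positivity
  have hCb0 : 0 ≤ Cb := by positivity
  constructor
  · have b1 := ((bf'.const_mul hL0).add bz').add
      ((by'.const_mul (c := K * ε ^ 2) (by positivity)).add
        ((be.add (by'.const_mul (c := K * ε) (by positivity))).const_mul (c := 2) (by norm_num)))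
    have h2 : l2Norm μ u' ≤ _ := b1.l2Norm_le_of_ae (f := u') (Eventually.of_forall fun x => by
      have e1 : u' x = (M.lift (f' x) + z' x) + (y x • k1 x + y' x • k x) := by
        simp only [z']; abel
      have e2 : y' x = e x + m x * y x := by simp only [e]; ring
      rw [e1]
      refine (norm_add_le _ _).trans (add_le_add ((norm_add_le _ _).trans (add_le_add
        (M.lift.le_opNorm _) le_rfl)) ((norm_add_le _ _).trans (add_le_add ?_ ?_)))
      · rw [norm_smul, mul_comm]; gcongr; exact S.norm_k1 x
      · rw [norm_smul, mul_comm]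
        have : ‖y' x‖ ≤ ‖e x‖ + K * ε * ‖y x‖ := by
          rw [e2]; refine (norm_add_le _ _).trans (add_le_add le_rfl ?_)
          rw [norm_mul]; gcongr; exact S.m_le x
        gcongr
        exact S.norm_k x)
    have hεε : ε ^ 2 ≤ ε := pow_le_of_le_one hε.le ε1 two_ne_zero
    set Nu := l2Norm μ u
    have hNu : 0 ≤ Nu := l2Norm_nonneg _
    have hyε : ε * Ny ≤ M.C / M.β * (ε * Nu) := by
      calc ε * Ny ≤ ε * (M.C / M.β * Nu) := by gcongr
        _ = _ := by ring
    calc l2Norm μ u' ≤ L * Nf' + l2Norm μ z' + (K * ε ^ 2 * Ny + 2 * (l2Norm μ e + K * ε * Ny)) := h2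
      _ ≤ L * R + s * (C1 * R + C2 * ε ^ 2 * Ny) + (K * ε ^ 2 * Ny
          + 2 * (P * (C1 * R + C2 * ε ^ 2 * Ny) + K * ε * Ny)) := by
          gcongr
          · exact nz'.trans (by gcongr)
          · exact ne.trans (by gcongr)
      _ ≤ L * R + s * (C1 * R + C2 * ε * Ny) + (K * ε * Ny
          + 2 * (P * (C1 * R + C2 * ε * Ny) + K * ε * Ny)) := by gcongr
      _ = (L + s * C1 + 2 * P * C1) * R + (s * C2 + K + 2 * (P * C2) + 2 * K) * (ε * Ny) := by ring
      _ ≤ (L + s * C1 + 2 * P * C1) * R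
          + (s * C2 + K + 2 * (P * C2) + 2 * K) * (M.C / M.β * (ε * Nu)) :=
          add_le_add le_rfl (mul_le_mul_of_nonneg_left hyε (by positivity))
      _ ≤ Ca * R + Ca * (ε * Nu) := by
          refine add_le_add (mul_le_mul_of_nonneg_right ?_ hR0) ?_
          · rw [hCa]; exact le_add_of_nonneg_right (by positivity)
          · rw [← mul_assoc]
            refine mul_le_mul_of_nonneg_right ?_ (by positivity)
            rw [hCa]; exact le_add_of_nonneg_left (by positivity)
      _ = Ca * (ε * Nu + R) := by ring
      _ ≤ _ := by gcongr; linarith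
  · intro h0
    have y0 : y 0 = 0 := by simp only [y]; rw [M.coord_apply, h0, mul_zero]
    -- The only place where the normalization at `0` enters, and where the factor `ε⁻¹` is lost.
    have h2 := l2Norm_le_of_halfLine hc hk₀.le hε hηc hw S.hasDerivAt_a cA
      (B := K * ε ^ 2) (fun x => by rw [abs_of_pos (S.A_pos x)]; exact S.A_le x) S.a_nonneg S.a_le
      S.mult_pos S.mult_neg py Ly Ly' Le (Eventually.of_forall fun x => by simp only [e]; ring) y0
    have hsq : Real.sqrt (Real.exp (4 * k₀ * K) * (4 / (c * ε) ^ 2)) = H * ε⁻¹ := by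
      rw [Real.sqrt_mul (Real.exp_pos _).le, hH]
      have : (4 : ℝ) / (c * ε) ^ 2 = (2 / c * ε⁻¹) ^ 2 := by field_simp; norm_num
      rw [this, Real.sqrt_sq (by positivity)]; ring
    rw [hsq] at h2
    have hy2 : Ny ≤ C4 * ε⁻¹ * R := by
      have h3 : Ny ≤ H * ε⁻¹ * (P * (C1 * R + C2 * ε ^ 2 * Ny)) :=
        h2.trans (by gcongr; exact ne.trans (by gcongr))
      have h4 : H * ε⁻¹ * (P * (C1 * R + C2 * ε ^ 2 * Ny))
          = H * P * C1 * ε⁻¹ * R + (ε * (2 * H * P * C2)) / 2 * Ny := by field_simp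
      -- The feedback of `y` through its `O(ε²)` coupling in the source, even after the loss of
      -- `ε⁻¹`, carries a factor `ε` and is absorbed.
      have h5 : (ε * (2 * H * P * C2)) / 2 * Ny ≤ 1 / 2 * Ny := by gcongr
      have h6 : C4 * ε⁻¹ * R = 2 * (H * P * C1 * ε⁻¹ * R) := by rw [hC4]; ring
      linarith
    have b1 := ((bf.const_mul hL0).add (by'.const_mul (c := 2) (by norm_num))).add bz
    have h7 : l2Norm μ u ≤ _ := b1.l2Norm_le_of_ae (f := u) (Eventually.of_forall fun x => by
      have e1 : u x = (M.lift (f x) + y x • k x) + z x := by simp only [z]; abel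
      rw [e1]
      refine (norm_add_le _ _).trans (add_le_add ((norm_add_le _ _).trans (add_le_add
        (M.lift.le_opNorm _) ?_)) le_rfl)
      rw [norm_smul, mul_comm]; gcongr; exact S.norm_k x)
    have hεi : 1 ≤ ε⁻¹ := (one_le_inv₀ hε).2 ε1
    have hRi : R ≤ ε⁻¹ * R := le_mul_of_one_le_left hR0 hεi
    have hε2 : ε ^ 2 ≤ 1 := pow_le_one₀ hε.le ε1
    calc l2Norm μ u ≤ L * Nf + 2 * Ny + l2Norm μ z := h7
      _ ≤ L * R + 2 * Ny + s * (C1 * R + C2 * ε ^ 2 * Ny) := by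
          gcongr; exact nz.trans (by gcongr)
      _ ≤ L * R + 2 * Ny + s * (C1 * R + C2 * 1 * Ny) := by gcongr
      _ ≤ L * (ε⁻¹ * R) + 2 * (C4 * ε⁻¹ * R) + s * (C1 * (ε⁻¹ * R) + C2 * 1 * (C4 * ε⁻¹ * R)) := by
          gcongr
      _ = Cb * ε⁻¹ * R := by rw [hCb]; ring
      _ ≤ _ := by gcongr; linarith

end LinearReduced

/-! ## The reduced coefficients near the reference equilibrium -/

namespace RelaxationSystem

variable {H : Type*} [NormedAddCommGroup H] [InnerProductSpace ℝ H] [CompleteSpace H]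
  (S : RelaxationSystem H)

instance instCompleteSpace : CompleteSpace S.𝕌 := FiniteDimensional.complete ℝ S.𝕌

lemma vstar_u₀ : S.vstar S.u₀ = S.vref :=
  (S.contDiff_q.contDiffAt (x := (S.u₀, S.vref))).implicitFunction_apply_self (by simp)
    S.isInvertible_dvq_ref

lemma M_u₀ : S.M S.u₀ = S.Uref := by rw [M, vstar_u₀, u₀_add_vref]

lemma contDiffAt_vstar : ContDiffAt ℝ ω S.vstar S.u₀ :=
  (S.contDiff_q.contDiffAt (x := (S.u₀, S.vref))).contDiffAt_implicitFunction (by simp)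
    S.isInvertible_dvq_ref

lemma eventually_q_vstar : ∀ᶠ u in 𝓝 S.u₀, S.q (u, S.vstar u) = 0 := by
  have h0 : S.q (S.u₀, S.vref) = 0 := by
    rw [q]
    simp only [S.u₀_add_vref, S.Q_Uref, map_zero]
  rw [← h0]
  exact (S.contDiff_q.contDiffAt (x := (S.u₀, S.vref))).eventually_apply_implicitFunction (by simp)
    S.isInvertible_dvq_ref

lemma eventually_contDiffAt_vstar : ∀ᶠ u in 𝓝 S.u₀, ContDiffAt ℝ ω S.vstar u :=
  S.contDiffAt_vstar.eventually (by simp)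

lemma PV_coe (v : S.𝕍) : S.PV (v : H) = v := by
  simp [PV]

lemma coe_PU_add_coe_PV (x : H) : (S.PU x : H) + (S.PV x : H) = x := by
  simp [PU, PV]

lemma inner_PU (x : H) (u : S.𝕌) : ⟪S.PU x, u⟫_ℝ = ⟪x, (u : H)⟫_ℝ :=
  Submodule.inner_orthogonalProjectionOnto_eq_of_mem_right u _

lemma inner_PV (x : H) (v : S.𝕍) : ⟪S.PV x, v⟫_ℝ = ⟪x, (v : H)⟫_ℝ :=
  Submodule.inner_orthogonalProjectionOnto_eq_of_mem_right v _

lemma inner_PU' (x : H) (u : S.𝕌) : ⟪u, S.PU x⟫_ℝ = ⟪(u : H), x⟫_ℝ := by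
  rw [real_inner_comm, S.inner_PU, real_inner_comm]

lemma inner_PV' (x : H) (v : S.𝕍) : ⟪v, S.PV x⟫_ℝ = ⟪(v : H), x⟫_ℝ := by
  rw [real_inner_comm, S.inner_PV, real_inner_comm]

lemma norm_PU_le (x : H) : ‖S.PU x‖ ≤ ‖x‖ := S.𝕌.norm_orthogonalProjectionOnto_apply_le x

lemma norm_PV_le (x : H) : ‖S.PV x‖ ≤ ‖x‖ := S.𝕍.norm_orthogonalProjectionOnto_apply_le x

lemma A_symm (x y : H) : ⟪S.A x, y⟫_ℝ = ⟪x, S.A y⟫_ℝ :=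
  S.A_selfAdjoint.isSymmetric x y

lemma A11_symm (x y : S.𝕌) : ⟪S.A11 x, y⟫_ℝ = ⟪x, S.A11 y⟫_ℝ := by
  calc ⟪S.A11 x, y⟫_ℝ = ⟪S.A x, (y : H)⟫_ℝ := S.inner_PU _ _
    _ = ⟪(x : H), S.A y⟫_ℝ := S.A_symm _ _
    _ = ⟪x, S.A11 y⟫_ℝ := (S.inner_PU' _ _).symm

lemma inner_A12 (v : S.𝕍) (u : S.𝕌) : ⟪S.A12 v, u⟫_ℝ = ⟪v, S.A21 u⟫_ℝ := by
  calc ⟪S.A12 v, u⟫_ℝ = ⟪S.A v, (u : H)⟫_ℝ := S.inner_PU _ _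
    _ = ⟪(v : H), S.A u⟫_ℝ := S.A_symm _ _
    _ = ⟪v, S.A21 u⟫_ℝ := (S.inner_PV' _ _).symm

/-- `dvq u₀ vref`, the linearized collision operator on the microscopic space. -/
lemma inner_dvq_ref (v w : S.𝕍) :
    ⟪S.dvq S.u₀ S.vref v, w⟫_ℝ = ⟪S.L S.Uref v, (w : H)⟫_ℝ := by
  rw [dvq, S.u₀_add_vref, ContinuousLinearMap.comp_apply, S.inner_PV]; rfl

lemma dvq_ref_symm (v w : S.𝕍) : ⟪S.dvq S.u₀ S.vref v, w⟫_ℝ = ⟪v, S.dvq S.u₀ S.vref w⟫_ℝ := by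
  rw [real_inner_comm _ v, inner_dvq_ref, inner_dvq_ref, real_inner_comm _ (S.L S.Uref w)]
  exact S.L_selfAdjoint.isSymmetric (v : H) w

lemma exists_dvq_ref_neg : ∃ c > 0, ∀ v : S.𝕍, c * ‖v‖ ^ 2 ≤ -⟪S.dvq S.u₀ S.vref v, v⟫_ℝ := by
  obtain ⟨c, hc, h⟩ := S.L_neg
  refine ⟨c, hc, fun v => ?_⟩
  rw [inner_dvq_ref]
  have := h v v.2
  have e : ‖v‖ = ‖(v : H)‖ := rfl
  rw [e, L]; linarith

lemma L_Uref_coe (u : S.𝕌) : S.L S.Uref u = 0 := by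
  have : (u : H) ∈ ((2 : ℝ) • S.Q S.Uref).ker := by rw [S.L_ker]; exact u.2
  exact this

lemma dvq_eq_fderiv (u : S.𝕌) (v : S.𝕍) : fderiv ℝ S.q (u, v) ∘L .inr ℝ S.𝕌 S.𝕍 = S.dvq u v := by
  rw [(S.hasFDerivAt_q _).fderiv]
  ext w
  simp [dvq, addMap]

lemma isInvertible_dvq_u₀ : (S.dvq S.u₀ (S.vstar S.u₀)).IsInvertible := by
  rw [vstar_u₀, ← dvq_eq_fderiv]; exact S.isInvertible_dvq_ref

lemma contDiffAt_M : ContDiffAt ℝ ω S.M S.u₀ :=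
  (S.𝕌.subtypeL.contDiff.contDiffAt).add (S.𝕍.subtypeL.contDiff.contDiffAt.comp _ S.contDiffAt_vstar)

/-- `∂_v q` along the equilibrium manifold. -/
def dvqM (u : S.𝕌) : S.𝕍 →L[ℝ] S.𝕍 := S.dvq u (S.vstar u)

lemma dvqM_apply (u : S.𝕌) (v : S.𝕍) : S.dvqM u v = S.PV (S.L (S.M u) v) := rfl

lemma contDiffAt_L_M : ContDiffAt ℝ ω (fun u => S.L (S.M u)) S.u₀ :=
  ((S.Q.contDiff.contDiffAt.comp _ S.contDiffAt_M).const_smul (2 : ℝ))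

lemma contDiffAt_dvqM : ContDiffAt ℝ ω S.dvqM S.u₀ :=
  contDiffAt_const.clm_comp (S.contDiffAt_L_M.clm_comp contDiffAt_const)

lemma contDiffAt_dvqM_inverse : ContDiffAt ℝ ω (fun u => (S.dvqM u).inverse) S.u₀ :=
  ContDiffAt.comp (g := ContinuousLinearMap.inverse) S.u₀
    S.isInvertible_dvq_u₀.contDiffAt_map_inverse S.contDiffAt_dvqM

lemma eventually_isInvertible_dvqM : ∀ᶠ u in 𝓝 S.u₀, (S.dvqM u).IsInvertible := by
  obtain ⟨e, he⟩ := S.isInvertible_dvq_u₀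
  have h : S.dvqM S.u₀ ∈ Set.range ((↑) : (S.𝕍 ≃L[ℝ] S.𝕍) → S.𝕍 →L[ℝ] S.𝕍) := ⟨e, he⟩
  exact S.contDiffAt_dvqM.continuousAt.eventually_mem
    ((ContinuousLinearEquiv.isOpen).mem_nhds h)

lemma contDiffAt_fderiv_vstar : ContDiffAt ℝ ω (fderiv ℝ S.vstar) S.u₀ :=
  S.contDiffAt_vstar.fderiv_right (m := ω) (by simp)

lemma contDiffAt_hstar : ContDiffAt ℝ ω S.hstar S.u₀ :=
  (S.A11.contDiff.contDiffAt).add (S.A12.contDiff.contDiffAt.comp _ S.contDiffAt_vstar)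

lemma contDiffAt_dhstar : ContDiffAt ℝ ω S.dhstar S.u₀ :=
  S.contDiffAt_hstar.fderiv_right (m := ω) (by simp)

lemma contDiffAt_cstar : ContDiffAt ℝ ω S.cstar S.u₀ :=
  S.contDiffAt_dvqM_inverse.clm_comp
    ((contDiffAt_const.add (contDiffAt_const.clm_comp S.contDiffAt_fderiv_vstar)).sub
      (S.contDiffAt_fderiv_vstar.clm_comp
        (contDiffAt_const.add (contDiffAt_const.clm_comp S.contDiffAt_fderiv_vstar))))

lemma contDiffAt_bstar : ContDiffAt ℝ ω S.bstar S.u₀ :=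
  (contDiffAt_const.clm_comp S.contDiffAt_cstar).neg

lemma dhstar_eq {u : S.𝕌} (h : DifferentiableAt ℝ S.vstar u) :
    S.dhstar u = S.A11 + S.A12 ∘L fderiv ℝ S.vstar u :=
  (S.A11.hasFDerivAt.add (S.A12.hasFDerivAt.comp u h.hasFDerivAt)).fderiv

/-- The differentiated equilibrium condition. -/
lemma eventually_dvqM_fderiv_vstar :
    ∀ᶠ u in 𝓝 S.u₀, ∀ w, S.dvqM u (fderiv ℝ S.vstar u w) = -S.PV (S.L (S.M u) w) := by
  filter_upwards [S.eventually_q_vstar.eventually_nhds, S.eventually_contDiffAt_vstar] with u h1 h2 w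
  have hv := (h2.differentiableAt (by simp)).hasFDerivAt
  have h3 := (S.hasFDerivAt_q (u, S.vstar u)).comp u ((hasFDerivAt_id u).prodMk hv)
  have h4 : (fun u => S.q (u, S.vstar u)) =ᶠ[𝓝 u] fun _ => 0 := h1
  have h5 := (h3.congr_of_eventuallyEq (f₁ := fun _ => (0 : S.𝕍)) h4.symm).unique (hasFDerivAt_const _ _)
  have h6 := DFunLike.congr_fun h5 w
  simp only [ContinuousLinearMap.comp_apply, ContinuousLinearMap.prod_apply, addMap,
    ContinuousLinearMap.coprod_apply, map_add, zero_apply] at h6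
  rw [dvqM_apply, eq_neg_iff_add_eq_zero, add_comm]
  exact h6

/-- The operator `L` at `Uref` vanishes on `𝕌`, so the differentiated equilibrium relation has zero
right side at `u₀`. This is what makes both reduced coefficients symmetric there. -/
lemma fderiv_vstar_u₀ : fderiv ℝ S.vstar S.u₀ = 0 := by
  ext1 w
  have h := S.eventually_dvqM_fderiv_vstar.self_of_nhds w
  rw [M_u₀, L_Uref_coe, map_zero, neg_zero] at h
  obtain ⟨e, he⟩ := S.isInvertible_dvq_u₀
  have h2 : e (fderiv ℝ S.vstar S.u₀ w) = 0 := by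
    rw [← h, ← ContinuousLinearEquiv.coe_coe, he]; rfl
  simpa using h2

lemma dhstar_u₀ : S.dhstar S.u₀ = S.A11 := by
  rw [S.dhstar_eq (S.contDiffAt_vstar.differentiableAt (by simp)), fderiv_vstar_u₀]
  simp

lemma bstar_u₀_apply (u : S.𝕌) :
    S.bstar S.u₀ u = -S.A12 ((S.dvqM S.u₀).inverse (S.A21 u)) := by
  simp only [bstar, cstar, fderiv_vstar_u₀]
  simp [dvqM]

lemma dvqM_inverse_apply {u : S.𝕌} (h : (S.dvqM u).IsInvertible) (v : S.𝕍) :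
    S.dvqM u ((S.dvqM u).inverse v) = v := by
  obtain ⟨e, he⟩ := h
  rw [← he, ContinuousLinearMap.inverse_equiv]
  exact e.apply_symm_apply v

/-- As `A₁₂` is the adjoint of `A₂₁`, `b_*(u₀)` is the quadratic form of `-∂_v q` evaluated on `(∂_v
q)⁻¹ A₂₁ u`; symmetry and positivity are inherited from the collision operator. -/
lemma inner_bstar_u₀ (u w : S.𝕌) : ⟪S.bstar S.u₀ u, w⟫_ℝ
    = -⟪(S.dvqM S.u₀).inverse (S.A21 u), S.dvqM S.u₀ ((S.dvqM S.u₀).inverse (S.A21 w))⟫_ℝ := by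
  rw [bstar_u₀_apply, inner_neg_left, S.inner_A12, S.dvqM_inverse_apply S.isInvertible_dvq_u₀]

lemma dvqM_u₀ : S.dvqM S.u₀ = S.dvq S.u₀ S.vref := by rw [dvqM, vstar_u₀]

lemma bstar_u₀_symm (u w : S.𝕌) : ⟪S.bstar S.u₀ u, w⟫_ℝ = ⟪u, S.bstar S.u₀ w⟫_ℝ := by
  rw [real_inner_comm _ u, inner_bstar_u₀, inner_bstar_u₀, dvqM_u₀, ← S.dvq_ref_symm, real_inner_comm]

/-- Negativity of `∂_v q` gives `c ‖v‖²` with `v = (∂_v q)⁻¹ A₂₁ u`, and `‖A₂₁ u‖ ≤ B ‖v‖`. The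
bound also identifies `ker b_*(u₀)` with `ker A₂₁`. -/
lemma exists_bstar_u₀_lower : ∃ c > 0, ∀ u, c * ‖S.A21 u‖ ^ 2 ≤ ⟪S.bstar S.u₀ u, u⟫_ℝ := by
  obtain ⟨c, hc, h⟩ := S.exists_dvq_ref_neg
  set B := ‖S.dvqM S.u₀‖ + 1
  have hB : 0 < B := by positivity
  refine ⟨c / B ^ 2, by positivity, fun u => ?_⟩
  rw [inner_bstar_u₀]
  have e := S.dvqM_inverse_apply S.isInvertible_dvq_u₀ (S.A21 u)
  set v := (S.dvqM S.u₀).inverse (S.A21 u)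
  have h1 : ‖S.A21 u‖ ≤ B * ‖v‖ := by
    rw [← e]; exact ((S.dvqM S.u₀).le_opNorm v).trans (by gcongr; exact le_add_of_nonneg_right zero_le_one)
  have h2 := h v
  rw [← dvqM_u₀, real_inner_comm] at h2
  calc c / B ^ 2 * ‖S.A21 u‖ ^ 2 ≤ c / B ^ 2 * (B * ‖v‖) ^ 2 := by gcongr
    _ = c * ‖v‖ ^ 2 := by field_simp
    _ ≤ _ := h2

end RelaxationSystem

/-! ## The reduced model of a relaxation system -/

section LinearAlgebra

variable {E F : Type*} [NormedAddCommGroup E] [InnerProductSpace ℝ E] [FiniteDimensional ℝ E]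
  [NormedAddCommGroup F] [NormedSpace ℝ F]

lemma exists_lower_bound_of_injOn (f : E →L[ℝ] F) (T : Submodule ℝ E)
    (h : ∀ t ∈ T, f t = 0 → t = 0) : ∃ c > 0, ∀ t ∈ T, c * ‖t‖ ≤ ‖f t‖ := by
  let g : T →ₗ[ℝ] F := (f : E →ₗ[ℝ] F) ∘ₗ T.subtype
  have hg : LinearMap.ker g = ⊥ := by
    rw [LinearMap.ker_eq_bot']
    intro t ht
    exact Subtype.ext (h t t.2 ht)
  obtain ⟨K, hK, hanti⟩ := g.exists_antilipschitzWith hg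
  refine ⟨(K : ℝ)⁻¹, by positivity, fun t ht => ?_⟩
  have h1 := hanti.le_mul_dist (⟨t, ht⟩ : T) 0
  rw [dist_zero_right, map_zero, dist_zero_right] at h1
  have h2 : ‖t‖ ≤ K * ‖f t‖ := h1
  rw [inv_mul_le_iff₀ (by exact_mod_cast hK)]
  exact h2

/-- For a symmetric `b`, the zero eigenprojection vanishes on the orthogonal of `ker b`. -/
lemma zeroEigenprojection_eq_zero {b : E →ₗ[ℝ] E} (hb : b.IsSymmetric) {x : E}
    (hx : ∀ n ∈ LinearMap.ker b, ⟪x, n⟫_ℝ = 0) : zeroEigenprojection b x = 0 := by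
  have hmem : ∀ {x : E}, (∀ n ∈ LinearMap.ker b, ⟪x, n⟫_ℝ = 0) → x ∈ LinearMap.range b := by
    intro x hx
    rw [← Submodule.orthogonal_orthogonal (LinearMap.range b), hb.orthogonal_range]
    exact (Submodule.mem_orthogonal' _ _).2 hx
  -- For symmetric `b` the orthogonal of the kernel is the range, and a preimage may be corrected by
  -- a kernel element so as to lie again in that orthogonal; iterating puts `x` in the range of
  -- every power.
  have key : ∀ (k : ℕ) (x : E), (∀ n ∈ LinearMap.ker b, ⟪x, n⟫_ℝ = 0) →
      x ∈ LinearMap.range (b ^ k) := by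
    intro k
    induction k with
    | zero => intro x _; simp
    | succ k ih =>
      intro x hx
      obtain ⟨y, hy⟩ := hmem hx
      set p : E := (LinearMap.ker b).starProjection y
      have hp : p ∈ LinearMap.ker b := Submodule.starProjection_apply_mem _ _
      obtain ⟨z, hz⟩ := ih (y - p) fun n hn => by
        have := (LinearMap.ker b).sub_starProjection_mem_orthogonal y
        exact (Submodule.mem_orthogonal' _ _).1 this n hn
      refine ⟨z, ?_⟩
      rw [pow_succ', Module.End.mul_apply, hz, map_sub, hy, LinearMap.mem_ker.1 hp, sub_zero]
  rw [zeroEigenprojection, Submodule.projection_apply_eq_zero_iff, Submodule.mem_iInf]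
  exact fun k => key k x hx

end LinearAlgebra

lemma tendsto_clm_apply {X E G : Type*} [NormedAddCommGroup E] [NormedSpace ℝ E]
    [NormedAddCommGroup G] [NormedSpace ℝ G] {l : Filter X} {B : X → E →L[ℝ] G} {B₀ : E →L[ℝ] G}
    {v : X → E} {v₀ : E} (hB : Tendsto B l (𝓝 B₀)) (hv : Tendsto v l (𝓝 v₀)) :
    Tendsto (fun x => B x (v x)) l (𝓝 (B₀ v₀)) :=
  (isBoundedBilinearMap_apply.continuous.tendsto (B₀, v₀)).comp (hB.prodMk_nhds hv)

lemma tendsto_slope_along {E G : Type*} [NormedAddCommGroup E] [NormedSpace ℝ E]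
    [NormedAddCommGroup G] [NormedSpace ℝ G] {t : ℕ → ℝ} (ht : Tendsto t atTop (𝓝[≠] 0))
    {φ : E → G} {φ' : E →L[ℝ] G} {x : E} (hφ : HasFDerivAt φ φ' x) (r : E) :
    Tendsto (fun n => (t n)⁻¹ • (φ (x + t n • r) - φ x)) atTop (𝓝 (φ' r)) := by
  have h1 : HasDerivAt (fun s : ℝ => φ (x + s • r)) (φ' r) 0 := by
    have h2 : HasDerivAt (fun s : ℝ => x + s • r) r 0 := by
      simpa using ((hasDerivAt_id (0 : ℝ)).smul_const r).const_add x
    have h3 : HasFDerivAt φ φ' (x + (0 : ℝ) • r) := by simpa using hφ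
    exact h3.comp_hasDerivAt 0 h2
  refine (h1.tendsto_slope.comp ht).congr fun n => ?_
  simp [slope]

namespace RelaxationSystem

variable {H : Type*} [NormedAddCommGroup H] [InnerProductSpace ℝ H] [CompleteSpace H]
  (S : RelaxationSystem H)

/-- The kernel of `A₂₁`, which is that of `b_*(u₀)`. -/
def N : Submodule ℝ S.𝕌 := S.A21.ker

lemma A21_of_mem_N {n : S.𝕌} (hn : n ∈ S.N) : S.A21 n = 0 := hn

lemma ker_bstar_u₀ : (S.bstar S.u₀).ker = S.N := by
  obtain ⟨c, hc, h⟩ := S.exists_bstar_u₀_lower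
  ext u
  constructor
  · intro hu
    have h1 := h u
    have h2 : S.bstar S.u₀ u = 0 := hu
    rw [h2, inner_zero_left] at h1
    have h3 : ‖S.A21 u‖ ^ 2 ≤ 0 := by
      by_contra hn
      push Not at hn
      nlinarith
    exact norm_eq_zero.1 (pow_eq_zero_iff two_ne_zero |>.1 (le_antisymm h3 (sq_nonneg _)))
  · intro hu
    change S.bstar S.u₀ u = 0
    rw [bstar_u₀_apply, S.A21_of_mem_N hu]; simp

lemma inner_A12_N (v : S.𝕍) {n : S.𝕌} (hn : n ∈ S.N) : ⟪S.A12 v, n⟫_ℝ = 0 := by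
  rw [S.inner_A12, S.A21_of_mem_N hn, inner_zero_right]

variable {S}

/-- Nondegeneracy taken at `u₀`: there `b_*` is symmetric, so its zero eigenprojection kills every
vector orthogonal to `N`, in particular `A₁₁ n`. -/
lemma eq_zero_of_mem_N (hred : S.GoodReduced) {n : S.𝕌} (hn : n ∈ S.N)
    (h : ∀ n' ∈ S.N, ⟪S.A11 n, n'⟫_ℝ = 0) : n = 0 := by
  have h1 := hred.nondegenerate.self_of_nhds
  rw [dhstar_u₀] at h1
  have hn2 : n ∈ (S.bstar S.u₀).ker := by rw [ker_bstar_u₀]; exact hn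
  have h2 : n ∈ (zeroEigenprojection (S.bstar S.u₀ : S.𝕌 →ₗ[ℝ] S.𝕌) ∘ₗ
      (S.A11 : S.𝕌 →ₗ[ℝ] S.𝕌)).ker ⊓ (S.bstar S.u₀).ker := by
    refine ⟨?_, hn2⟩
    refine zeroEigenprojection_eq_zero (fun x y => S.bstar_u₀_symm x y) fun n' hn' => ?_
    have : n' ∈ (S.bstar S.u₀).ker := hn'
    rw [ker_bstar_u₀] at this
    exact h n' this
  rw [h1] at h2
  exact h2

/-- The compression of `A₁₁` to `N` is injective by `eq_zero_of_mem_N`, hence invertible in finite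
dimension. -/
lemma exists_lift (hred : S.GoodReduced) : ∃ R : S.𝕌 →L[ℝ] S.𝕌, (∀ f, R f ∈ S.N) ∧
    ∀ f, ∀ n ∈ S.N, ⟪S.A11 (R f), n⟫_ℝ = ⟪f, n⟫_ℝ := by
  let P : S.𝕌 →ₗ[ℝ] S.N := (S.N.orthogonalProjectionOnto : S.𝕌 →ₗ[ℝ] S.N)
  have hP : ∀ (x : S.𝕌) (n : S.N), ⟪P x, n⟫_ℝ = ⟪x, (n : S.𝕌)⟫_ℝ := fun x n =>
    Submodule.inner_orthogonalProjectionOnto_eq_of_mem_right n x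
  let g : S.N →ₗ[ℝ] S.N := P ∘ₗ (S.A11 : S.𝕌 →ₗ[ℝ] S.𝕌) ∘ₗ S.N.subtype
  have hg : Function.Injective g := by
    rw [← LinearMap.ker_eq_bot, LinearMap.ker_eq_bot']
    intro n hn
    refine Subtype.ext (eq_zero_of_mem_N hred n.2 fun n' hn' => ?_)
    have h1 := hP (S.A11 n) ⟨n', hn'⟩
    have h2 : P (S.A11 n) = 0 := hn
    rw [h2, inner_zero_left] at h1
    exact h1.symm
  let e := LinearEquiv.ofInjectiveEndo g hg
  let R : S.𝕌 →ₗ[ℝ] S.𝕌 := S.N.subtype ∘ₗ (e.symm : S.N →ₗ[ℝ] S.N) ∘ₗ P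
  refine ⟨LinearMap.toContinuousLinearMap R, fun f => (e.symm (P f)).2, fun f n hn => ?_⟩
  have h1 : g (e.symm (P f)) = P f := e.apply_symm_apply (P f)
  have h2 := hP (S.A11 (R f)) ⟨n, hn⟩
  have h3 := hP f ⟨n, hn⟩
  have h4 : P (S.A11 (R f)) = P f := h1
  rw [h4, h3] at h2
  exact h2.symm

variable (S) in
/-- The states compatible with the constraint `P_N A₁₁ w = 0`. -/
def T : Submodule ℝ S.𝕌 where
  carrier := {w | ∀ n ∈ S.N, ⟪S.A11 w, n⟫_ℝ = 0}
  add_mem' := fun {a b} ha hb n hn => by rw [map_add, inner_add_left, ha n hn, hb n hn, add_zero]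
  zero_mem' := fun n _ => by simp
  smul_mem' := fun c a ha n hn => by rw [map_smul, real_inner_smul_left, ha n hn, mul_zero]

lemma mem_T_iff (w : S.𝕌) : w ∈ S.T ↔ ∀ n ∈ S.N, ⟪S.A11 w, n⟫_ℝ = 0 := Iff.rfl

/-- `b_*(u₀)` controls `A₂₁`, and `A₂₁` is injective on `T` because `T` meets `N = ker A₂₁` only at
zero. -/
lemma exists_coercive (hred : S.GoodReduced) :
    ∃ β > 0, ∀ t ∈ S.T, β * ‖t‖ ^ 2 ≤ ⟪S.bstar S.u₀ t, t⟫_ℝ := by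
  obtain ⟨c, hc, h⟩ := S.exists_bstar_u₀_lower
  obtain ⟨d, hd, h2⟩ := exists_lower_bound_of_injOn S.A21 S.T fun t ht h0 =>
    eq_zero_of_mem_N hred h0 ht
  refine ⟨c * d ^ 2, by positivity, fun t ht => ?_⟩
  calc c * d ^ 2 * ‖t‖ ^ 2 = c * (d * ‖t‖) ^ 2 := by ring
    _ ≤ c * ‖S.A21 t‖ ^ 2 := by gcongr; exact h2 t ht
    _ ≤ _ := h t

namespace GenuinelyNonlinear

variable {α : S.𝕌 → ℝ} {r : S.𝕌}

lemma A11_r (hα : S.GenuinelyNonlinear α r) : S.A11 r = 0 := by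
  rw [← dhstar_u₀]; exact hα.eigenvector

lemma r_mem_T (hα : S.GenuinelyNonlinear α r) : r ∈ S.T := fun n _ => by
  rw [hα.A11_r, inner_zero_left]

lemma exists_smul_of_A11_eq_zero (hα : S.GenuinelyNonlinear α r) {z : S.𝕌} (hz : S.A11 z = 0) :
    ∃ t : ℝ, t • r = z := by
  have h := hα.eigenvalue.self_of_nhds.2
  rw [hα.zero, dhstar_u₀] at h
  have hmem : ∀ {z : S.𝕌}, S.A11 z = 0 →
      z ∈ Module.End.maxGenEigenspace (S.A11 : S.𝕌 →ₗ[ℝ] S.𝕌) 0 := fun {z} hz =>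
    (Module.End.mem_maxGenEigenspace _ _ _).2 ⟨1, by simpa using hz⟩
  have hr0 : (⟨r, hmem hα.A11_r⟩ : Module.End.maxGenEigenspace (S.A11 : S.𝕌 →ₗ[ℝ] S.𝕌) 0) ≠ 0 := by
    intro h0
    have : r = 0 := congrArg Subtype.val h0
    have h1 := hα.norm_r
    rw [this, norm_zero] at h1
    exact zero_ne_one h1
  obtain ⟨t, ht⟩ := (finrank_eq_one_iff_of_nonzero' _ hr0).1 h ⟨z, hmem hz⟩
  exact ⟨t, congrArg Subtype.val ht⟩

/-- `ker A₁₁` is the line of `r`, by simplicity of the eigenvalue, and `⟪b_*(u₀) r, r⟫ > 0` makes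
that line transversal to the hyperplane considered. -/
lemma exists_lower (hα : S.GenuinelyNonlinear α r) {β : ℝ} (hβ : 0 < β)
    (h : ∀ t ∈ S.T, β * ‖t‖ ^ 2 ≤ ⟪S.bstar S.u₀ t, t⟫_ℝ) :
    ∃ c > 0, ∀ z, ⟪S.bstar S.u₀ r, z⟫_ℝ = 0 → c * ‖z‖ ≤ ‖S.A11 z‖ := by
  have hr := h r hα.r_mem_T
  rw [hα.norm_r] at hr
  obtain ⟨c, hc, h2⟩ := exists_lower_bound_of_injOn S.A11 (innerSL ℝ (S.bstar S.u₀ r)).ker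
    fun z hz h0 => by
      obtain ⟨t, rfl⟩ := hα.exists_smul_of_A11_eq_zero h0
      have h3 : ⟪S.bstar S.u₀ r, t • r⟫_ℝ = 0 := hz
      rw [real_inner_smul_right] at h3
      rcases mul_eq_zero.1 h3 with h4 | h4
      · rw [h4, zero_smul]
      · rw [h4] at hr; linarith
  exact ⟨c, hc, fun z hz => h2 z hz⟩

/-- Genuine nonlinearity, in terms of the second derivative of the flux. -/
lemma inner_fderiv_dhstar (hα : S.GenuinelyNonlinear α r) :
    ⟪fderiv ℝ S.dhstar S.u₀ r r, r⟫_ℝ = fderiv ℝ α S.u₀ r := by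
  have hD : HasFDerivAt S.dhstar (fderiv ℝ S.dhstar S.u₀) S.u₀ :=
    (S.contDiffAt_dhstar.differentiableAt (by simp)).hasFDerivAt
  let t : ℕ → ℝ := fun n => ((n : ℝ) + 1)⁻¹
  have ht0 : ∀ n, t n ≠ 0 := fun n => by simp only [t]; positivity
  have ht : Tendsto t atTop (𝓝 0) := tendsto_inv_atTop_zero.comp
    (tendsto_natCast_atTop_atTop.atTop_add tendsto_const_nhds)
  have htne : Tendsto t atTop (𝓝[≠] 0) :=
    tendsto_nhdsWithin_iff.2 ⟨ht, Eventually.of_forall ht0⟩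
  have hα' := tendsto_slope_along htne hα.differentiableAt.hasFDerivAt r
  have hD' := tendsto_slope_along htne hD r
  -- No regularity of an eigenvector field is assumed: unit eigenvectors are taken along the
  -- sequence `u₀ + t n • r`, and a convergent subsequence is extracted.
  have hev : ∀ᶠ n in atTop, ∃ w : S.𝕌, ‖w‖ = 1 ∧
      S.dhstar (S.u₀ + t n • r) w = α (S.u₀ + t n • r) • w := by
    have h1 : Tendsto (fun n => S.u₀ + t n • r) atTop (𝓝 S.u₀) := by
      simpa using (ht.smul_const r).const_add S.u₀
    filter_upwards [h1.eventually hα.eigenvalue] with n hn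
    obtain ⟨w, hw⟩ := hn.1.exists_hasEigenvector
    have hw0 : ‖w‖ ≠ 0 := norm_ne_zero_iff.2 hw.2
    refine ⟨‖w‖⁻¹ • w, by rw [norm_smul, norm_inv, norm_norm, inv_mul_cancel₀ hw0], ?_⟩
    have h2 : S.dhstar (S.u₀ + t n • r) w = α (S.u₀ + t n • r) • w := hw.apply_eq_smul
    rw [map_smul, h2, smul_comm]
  have hex : ∀ n, ∃ w : S.𝕌, ‖w‖ = 1 ∧ ((∃ w : S.𝕌, ‖w‖ = 1 ∧
      S.dhstar (S.u₀ + t n • r) w = α (S.u₀ + t n • r) • w) →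
      S.dhstar (S.u₀ + t n • r) w = α (S.u₀ + t n • r) • w) := by
    intro n
    by_cases h : ∃ w : S.𝕌, ‖w‖ = 1 ∧ S.dhstar (S.u₀ + t n • r) w = α (S.u₀ + t n • r) • w
    · obtain ⟨w, h1, h2⟩ := h; exact ⟨w, h1, fun _ => h2⟩
    · exact ⟨r, hα.norm_r, fun h' => absurd h' h⟩
  choose w hw1 hw2 using hex
  obtain ⟨w₀, hw₀, σ, hσ, hlim⟩ := (isCompact_sphere (0 : S.𝕌) 1).tendsto_subseq
    (fun n => by simpa using hw1 n : ∀ n, w n ∈ Metric.sphere (0 : S.𝕌) 1)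
  have hσt := hσ.tendsto_atTop
  have hn0 : ‖w₀‖ = 1 := by simpa using hw₀
  have hu : Tendsto (fun n => S.u₀ + t (σ n) • r) atTop (𝓝 S.u₀) := by
    simpa using ((ht.comp hσt).smul_const r).const_add S.u₀
  have heq : ∀ᶠ n in atTop, S.dhstar (S.u₀ + t (σ n) • r) (w (σ n))
      = α (S.u₀ + t (σ n) • r) • w (σ n) :=
    (hσt.eventually hev).mono fun n hn => hw2 (σ n) hn
  have hA : S.A11 w₀ = 0 := by
    have l1 : Tendsto (fun n => S.dhstar (S.u₀ + t (σ n) • r) (w (σ n))) atTop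
        (𝓝 (S.dhstar S.u₀ w₀)) := tendsto_clm_apply (hD.continuousAt.tendsto.comp hu) hlim
    have l2 : Tendsto (fun n => α (S.u₀ + t (σ n) • r) • w (σ n)) atTop (𝓝 (α S.u₀ • w₀)) :=
      (hα.differentiableAt.continuousAt.tendsto.comp hu).smul hlim
    have := tendsto_nhds_unique (l1.congr' heq) l2
    rwa [hα.zero, zero_smul, dhstar_u₀] at this
  obtain ⟨a, ha⟩ := hα.exists_smul_of_A11_eq_zero hA
  have ha0 : a ≠ 0 := by
    rintro rfl
    rw [← ha, zero_smul, norm_zero] at hn0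
    exact zero_ne_one hn0
  -- The limit `w₀` is a nonzero multiple of `r`. After pairing with `r`, the term `dh_*(u₀) w`
  -- drops out by symmetry, so the difference quotient of `dh_*` applied to `w` becomes that of `α`
  -- times `⟪w, r⟫`.
  have l1 : Tendsto (fun n => ⟪((t (σ n))⁻¹ • (S.dhstar (S.u₀ + t (σ n) • r) - S.dhstar S.u₀))
      (w (σ n)), r⟫_ℝ) atTop (𝓝 ⟪fderiv ℝ S.dhstar S.u₀ r w₀, r⟫_ℝ) :=
    (tendsto_clm_apply (hD'.comp hσt) hlim).inner tendsto_const_nhds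
  have l2 : Tendsto (fun n => ((t (σ n))⁻¹ • (α (S.u₀ + t (σ n) • r) - α S.u₀)) * ⟪w (σ n), r⟫_ℝ)
      atTop (𝓝 (fderiv ℝ α S.u₀ r * ⟪w₀, r⟫_ℝ)) :=
    ((hα'.comp hσt).mul (hlim.inner tendsto_const_nhds))
  have l3 := tendsto_nhds_unique (l1.congr' (heq.mono fun n hn => ?_)) l2
  · rw [← ha, map_smul, real_inner_smul_left, real_inner_smul_left, real_inner_self_eq_norm_sq,
      hα.norm_r, one_pow, mul_one, mul_comm _ a] at l3
    exact mul_left_cancel₀ ha0 l3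
  · have h0 : ⟪S.dhstar S.u₀ (w (σ n)), r⟫_ℝ = 0 := by
      rw [dhstar_u₀, A11_symm, hα.A11_r, inner_zero_right]
    rw [smul_apply, sub_apply, real_inner_smul_left, inner_sub_left, h0, hn, real_inner_smul_left,
      hα.zero]
    simp; ring

end GenuinelyNonlinear

end RelaxationSystem

/-! ### Local constants, and profiles as small shocks of the reduced model -/

namespace RelaxationSystem

variable {H : Type*} [NormedAddCommGroup H] [InnerProductSpace ℝ H] [CompleteSpace H]
  {S : RelaxationSystem H}

lemma _root_.ContinuousAt.eventually_norm_le_add_one {X G : Type*} [TopologicalSpace X]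
    [NormedAddCommGroup G] {φ : X → G} {x : X} (h : ContinuousAt φ x) :
    ∀ᶠ y in 𝓝 x, ‖φ y‖ ≤ ‖φ x‖ + 1 :=
  (h.norm.eventually_lt_const (lt_add_one _)).mono fun _ hy => hy.le

/-- The reduced system of a relaxation system, near the reference state. -/
theorem exists_reducedModel (hred : S.GoodReduced) {α : S.𝕌 → ℝ} {r : S.𝕌}
    (hα : S.GenuinelyNonlinear α r) : ∃ M : ReducedModel S.𝕌, M.h = S.hstar ∧ M.D = S.dhstar ∧
      M.b = S.bstar ∧ M.u₀ = S.u₀ ∧ M.r = r ∧ M.N = S.N := by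
  obtain ⟨β, hβ, hcoer⟩ := exists_coercive hred
  obtain ⟨lam, hlam, hlow⟩ := hα.exists_lower hβ hcoer
  obtain ⟨R₀, hR1, hR2⟩ := exists_lift hred
  have cb1 : ContDiffAt ℝ ω (fderiv ℝ S.bstar) S.u₀ := S.contDiffAt_bstar.fderiv_right (m := ω) (by simp)
  have cb2 : ContDiffAt ℝ ω (fderiv ℝ (fderiv ℝ S.bstar)) S.u₀ := cb1.fderiv_right (m := ω) (by simp)
  have cD2 : ContDiffAt ℝ ω (fderiv ℝ S.dhstar) S.u₀ :=
    S.contDiffAt_dhstar.fderiv_right (m := ω) (by simp)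
  have dif : ∀ {G : Type u_1} [NormedAddCommGroup G] [NormedSpace ℝ G] {φ : S.𝕌 → G},
      ContDiffAt ℝ ω φ S.u₀ → ∀ᶠ u in 𝓝 S.u₀, HasFDerivAt φ (fderiv ℝ φ u) u := fun h =>
    (h.eventually (by simp)).mono fun u hu => (hu.differentiableAt (by simp)).hasFDerivAt
  set C := 1 + (‖S.dhstar S.u₀‖ + 1) + (‖fderiv ℝ S.dhstar S.u₀‖ + 1) + (‖S.bstar S.u₀‖ + 1)
    + (‖fderiv ℝ S.bstar S.u₀‖ + 1) + (‖fderiv ℝ (fderiv ℝ S.bstar) S.u₀‖ + 1) with hC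
  have hall : ∀ᶠ u in 𝓝 S.u₀, HasFDerivAt S.hstar (fderiv ℝ S.hstar u) u ∧
      HasFDerivAt S.dhstar (fderiv ℝ S.dhstar u) u ∧ HasFDerivAt S.bstar (fderiv ℝ S.bstar u) u ∧
      HasFDerivAt (fderiv ℝ S.bstar) (fderiv ℝ (fderiv ℝ S.bstar) u) u ∧
      ‖S.dhstar u‖ ≤ ‖S.dhstar S.u₀‖ + 1 ∧ ‖fderiv ℝ S.dhstar u‖ ≤ ‖fderiv ℝ S.dhstar S.u₀‖ + 1 ∧
      ‖S.bstar u‖ ≤ ‖S.bstar S.u₀‖ + 1 ∧ ‖fderiv ℝ S.bstar u‖ ≤ ‖fderiv ℝ S.bstar S.u₀‖ + 1 ∧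
      ‖fderiv ℝ (fderiv ℝ S.bstar) u‖ ≤ ‖fderiv ℝ (fderiv ℝ S.bstar) S.u₀‖ + 1 := by
    filter_upwards [dif S.contDiffAt_hstar, dif S.contDiffAt_dhstar, dif S.contDiffAt_bstar, dif cb1,
      S.contDiffAt_dhstar.continuousAt.eventually_norm_le_add_one,
      cD2.continuousAt.eventually_norm_le_add_one,
      S.contDiffAt_bstar.continuousAt.eventually_norm_le_add_one,
      cb1.continuousAt.eventually_norm_le_add_one, cb2.continuousAt.eventually_norm_le_add_one]
      with u h1 h2 h3 h4 h5 h6 h7 h8 h9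
    exact ⟨h1, h2, h3, h4, h5, h6, h7, h8, h9⟩
  obtain ⟨R, hR, hball⟩ := Metric.eventually_nhds_iff_ball.1 hall
  have n1 := norm_nonneg (S.dhstar S.u₀)
  have n2 := norm_nonneg (fderiv ℝ S.dhstar S.u₀)
  have n3 := norm_nonneg (S.bstar S.u₀)
  have n4 := norm_nonneg (fderiv ℝ S.bstar S.u₀)
  have n5 := norm_nonneg (fderiv ℝ (fderiv ℝ S.bstar) S.u₀)
  let M : ReducedModel S.𝕌 :=
    { h := S.hstar
      D := S.dhstar
      D2 := fderiv ℝ S.dhstar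
      b := S.bstar
      b1 := fderiv ℝ S.bstar
      b2 := fderiv ℝ (fderiv ℝ S.bstar)
      u₀ := S.u₀
      r := r
      N := S.N
      T := S.T
      lift := R₀
      β := β
      lam := lam
      R := R
      C := C
      Λ := -fderiv ℝ α S.u₀ r
      mem_T := fun w => by rw [dhstar_u₀]; exact mem_T_iff w
      pair :=
        { β_pos := hβ
          lam_pos := hlam
          b_symm := S.bstar_u₀_symm
          A_symm := by rw [dhstar_u₀]; exact S.A11_symm
          coercive := hcoer
          A_lower := fun z _ hz => by rw [dhstar_u₀]; exact hlow z hz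
          A_r := hα.eigenvector
          r_mem := hα.r_mem_T
          norm_r := hα.norm_r }
      R_pos := hR
      one_le_C := by rw [hC]; linarith
      hasFDerivAt_h := fun u hu => (hball u hu).1
      hasFDerivAt_D := fun u hu => (hball u hu).2.1
      hasFDerivAt_b := fun u hu => (hball u hu).2.2.1
      hasFDerivAt_b1 := fun u hu => (hball u hu).2.2.2.1
      norm_D_le := fun u hu => by have := (hball u hu).2.2.2.2.1; rw [hC]; linarith
      norm_D2_le := fun u hu => by have := (hball u hu).2.2.2.2.2.1; rw [hC]; linarith
      norm_b_le := fun u hu => by have := (hball u hu).2.2.2.2.2.2.1; rw [hC]; linarith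
      norm_b1_le := fun u hu => by have := (hball u hu).2.2.2.2.2.2.2.1; rw [hC]; linarith
      norm_b2_le := fun u hu => by have := (hball u hu).2.2.2.2.2.2.2.2; rw [hC]; linarith
      continuousAt_D2 := cD2.continuousAt
      -- `b_*` factors through `A₁₂` at every state, not only at `u₀`, so its range is always
      -- orthogonal to `ker A₂₁`. For the same reason the `N`-component of `h_*` is linear.
      b_N := fun u _ x n hn => by
        change ⟪-S.A12 (S.cstar u x), n⟫_ℝ = 0
        rw [inner_neg_left, S.inner_A12_N _ hn, neg_zero]
      h_N := fun u _ u' _ n hn => by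
        have e : S.hstar u - S.hstar u' = S.A11 (u - u') + S.A12 (S.vstar u - S.vstar u') := by
          simp only [hstar, map_sub]; abel
        rw [e, inner_add_left, S.inner_A12_N _ hn, add_zero, dhstar_u₀]
      lift_mem := hR1
      lift_spec := by rw [dhstar_u₀]; exact hR2
      Λ_pos := by have := hα.nonlinear; linarith
      nonlinear := by rw [hα.inner_fderiv_dhstar, neg_neg] }
  exact ⟨M, rfl, rfl, rfl, rfl, rfl, rfl⟩

/-- Uniform properties of the equilibrium manifold near the reference state. -/
structure NearEquilibrium (S : RelaxationSystem H) (C c τ : ℝ) (u : S.𝕌) : Prop where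
  contDiffAt : ContDiffAt ℝ ω S.vstar u
  norm_fderiv_le : ‖fderiv ℝ S.vstar u‖ ≤ τ
  norm_fderiv_fderiv_le : ‖fderiv ℝ (fderiv ℝ S.vstar) u‖ ≤ C
  norm_L_le : ‖S.L (S.M u)‖ ≤ C
  isInvertible : (S.dvqM u).IsInvertible
  norm_inverse_le : ‖(S.dvqM u).inverse‖ ≤ C
  neg : ∀ v, c * ‖v‖ ^ 2 ≤ -⟪S.dvqM u v, v⟫_ℝ
  dvqM_fderiv : ∀ w, S.dvqM u (fderiv ℝ S.vstar u w) = -S.PV (S.L (S.M u) w)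

/-- `C` and `c` are fixed before `τ`; only the neighbourhood depends on `τ`. The smallness required
of `dv_*` later depends on `C` and `c`, so this order matters. -/
theorem exists_nearEquilibrium (S : RelaxationSystem H) : ∃ C c : ℝ, 0 < C ∧ 0 < c ∧
    ∀ τ > 0, ∀ᶠ u in 𝓝 S.u₀, S.NearEquilibrium C c τ u := by
  obtain ⟨c, hc, hneg⟩ := S.exists_dvq_ref_neg
  have cT := S.contDiffAt_fderiv_vstar
  have cT2 : ContDiffAt ℝ ω (fderiv ℝ (fderiv ℝ S.vstar)) S.u₀ := cT.fderiv_right (m := ω) (by simp)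
  set C := (‖fderiv ℝ (fderiv ℝ S.vstar) S.u₀‖ + 1) + (‖S.L (S.M S.u₀)‖ + 1)
    + (‖(S.dvqM S.u₀).inverse‖ + 1) with hC
  have n1 := norm_nonneg (fderiv ℝ (fderiv ℝ S.vstar) S.u₀)
  have n2 := norm_nonneg (S.L (S.M S.u₀))
  have n3 := norm_nonneg ((S.dvqM S.u₀).inverse)
  refine ⟨C, c / 2, by positivity, by positivity, fun τ hτ => ?_⟩
  have e1 : ∀ᶠ u in 𝓝 S.u₀, ‖fderiv ℝ S.vstar u‖ < τ :=
    cT.continuousAt.norm.eventually_lt_const (by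
      show ‖fderiv ℝ S.vstar S.u₀‖ < τ; rw [fderiv_vstar_u₀, norm_zero]; exact hτ)
  have e2 : ∀ᶠ u in 𝓝 S.u₀, ‖S.dvqM u - S.dvqM S.u₀‖ < c / 2 :=
    (S.contDiffAt_dvqM.continuousAt.sub continuousAt_const).norm.eventually_lt_const (by
      show ‖S.dvqM S.u₀ - S.dvqM S.u₀‖ < c / 2; rw [sub_self, norm_zero]; positivity)
  filter_upwards [S.eventually_contDiffAt_vstar, e1, cT2.continuousAt.eventually_norm_le_add_one,
    S.contDiffAt_L_M.continuousAt.eventually_norm_le_add_one, S.eventually_isInvertible_dvqM,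
    S.contDiffAt_dvqM_inverse.continuousAt.eventually_norm_le_add_one, e2,
    S.eventually_dvqM_fderiv_vstar] with u h1 h2 h3 h4 h5 h6 h7 h8
  refine ⟨h1, h2.le, by rw [hC]; linarith, by rw [hC]; linarith, h5, by rw [hC]; linarith, ?_, h8⟩
  intro v
  have a1 := hneg v
  rw [← dvqM_u₀] at a1
  have a2 : |⟪(S.dvqM u - S.dvqM S.u₀) v, v⟫_ℝ| ≤ c / 2 * ‖v‖ * ‖v‖ :=
    (abs_real_inner_le_norm _ _).trans (by
      gcongr; exact ContinuousLinearMap.le_of_opNorm_le _ h7.le _)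
  have a3 : ⟪S.dvqM u v, v⟫_ℝ = ⟪S.dvqM S.u₀ v, v⟫_ℝ + ⟪(S.dvqM u - S.dvqM S.u₀) v, v⟫_ℝ := by
    rw [← inner_add_left, sub_apply]; congr 1; abel
  have a4 := (abs_le.1 a2).2
  rw [a3]
  nlinarith

/-- A small-amplitude Navier--Stokes profile is a small shock of the reduced model. -/
theorem exists_smallShock {M : ReducedModel S.𝕌} (hh : M.h = S.hstar) (hb : M.b = S.bstar)
    (hu : M.u₀ = S.u₀) {θ : ℝ} (hθ : 0 < θ) : ∃ ρ > 0, ∀ {ε : ℝ} {um up : S.𝕌} {ubar : ℝ → S.𝕌},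
      ε = ‖up - um‖ → 0 < ε → um ∈ Metric.ball S.u₀ ρ → up ∈ Metric.ball S.u₀ ρ →
      ‖ε⁻¹ • (up - um) - M.r‖ ≤ ρ → S.IsNSProfile um up ubar → (∀ x, ubar x ∈ Metric.ball S.u₀ ρ) →
      SmallShock M θ ε um up ubar (deriv ubar) (deriv^[2] ubar) (deriv^[3] ubar) := by
  have hβ := M.pair.β_pos
  have hCp := M.C_pos
  have cont : ∀ {G : Type u_1} [NormedAddCommGroup G] {φ : S.𝕌 → G}, ContinuousAt φ M.u₀ →
      ∀ {η : ℝ}, 0 < η → ∀ᶠ u in 𝓝 M.u₀, ‖φ u - φ M.u₀‖ < η := fun {_ _ φ} h η hη =>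
    (h.sub continuousAt_const).norm.eventually_lt_const (by
      show ‖φ M.u₀ - φ M.u₀‖ < η; rw [sub_self, norm_zero]; exact hη)
  have hall : ∀ᶠ u in 𝓝 M.u₀, u ∈ Metric.ball M.u₀ M.R ∧ ‖M.D u - M.D M.u₀‖ < θ ∧
      ‖M.b u - M.b M.u₀‖ < θ ∧ ‖M.D2 u - M.D2 M.u₀‖ < θ ∧ ‖M.h u - M.h M.u₀‖ < θ / 2 := by
    filter_upwards [Metric.ball_mem_nhds M.u₀ M.R_pos,
      cont (M.hasFDerivAt_D _ M.u₀_mem).continuousAt hθ, cont (M.hasFDerivAt_b _ M.u₀_mem).continuousAt hθ,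
      cont M.continuousAt_D2 hθ, cont (M.hasFDerivAt_h _ M.u₀_mem).continuousAt (half_pos hθ)]
      with u h1 h2 h3 h4 h5
    exact ⟨h1, h2, h3, h4, h5⟩
  obtain ⟨ρ, hρ, hball⟩ := Metric.eventually_nhds_iff_ball.1 hall
  refine ⟨min ρ (M.β / (2 * M.C)), by positivity, ?_⟩
  intro ε um up ubar hε hε0 hum hup hr P hmem
  rw [← hu] at hum hup hmem
  have sub : Metric.ball M.u₀ (min ρ (M.β / (2 * M.C))) ⊆ Metric.ball M.u₀ ρ :=
    Metric.ball_subset_ball (min_le_left _ _)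
  have hx := fun x => hball _ (sub (hmem x))
  have hm := hball _ (sub hum)
  -- The radius `β/(2C)` is the one for which closeness of the unit difference to `r` puts its
  -- coordinate within `1/2` of `coord r = 1`.
  have hc : |M.coord (ε⁻¹ • (up - um) - M.r)| ≤ 1 / 2 := by
    calc |M.coord (ε⁻¹ • (up - um) - M.r)| ≤ M.C / M.β * (M.β / (2 * M.C)) :=
          (M.abs_coord_le _).trans (by gcongr; exact hr.trans (min_le_right _ _))
      _ = 1 / 2 := by field_simp
  rw [map_sub, map_smul, M.coord_r, smul_eq_mul, abs_le] at hc
  have hcε : M.coord (up - um) = ε * (ε⁻¹ * M.coord (up - um)) := by field_simp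
  have hd : ∀ n x, HasDerivAt (deriv^[n] ubar) (deriv^[n + 1] ubar x) x := by
    intro n x
    rw [Function.iterate_succ_apply']
    have h1 : ContDiff ℝ 1 (deriv^[n] ubar) := by
      have h2 : ContDiff ℝ (1 + n : ℕ) ubar := contDiff_infty.1 P.smooth _
      exact ContDiff.iterate_deriv' 1 n (by exact_mod_cast h2)
    exact ((h1.differentiable one_ne_zero) x).hasDerivAt
  exact
    { nonneg := hθ.le
      hasDerivAt := hd 0
      hasDerivAt_W := hd 1
      hasDerivAt_W1 := hd 2
      continuous_W2 := continuous_iff_continuousAt.2 fun x => (hd 3 x).continuousAt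
      um_mem := hm.1
      mem := fun x => (hx x).1
      D_le := fun x => (hx x).2.1.le
      b_le := fun x => (hx x).2.2.1.le
      D2_le := fun x => (hx x).2.2.2.1.le
      h_le := fun x => by
        have h1 := (hx x).2.2.2.2
        have h2 := hm.2.2.2.2
        have e : M.h (ubar x) - M.h um = (M.h (ubar x) - M.h M.u₀) - (M.h um - M.h M.u₀) := by abel
        rw [e]
        exact (norm_sub_le _ _).trans (by linarith)
      ode := fun x => by rw [hh, hb]; exact P.ode x
      ε_pos := hε0
      up_mem := (hball _ (sub hup)).1
      rankineHugoniot := by rw [hh]; exact P.rankineHugoniot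
      tendsto_atBot := P.tendsto_atBot
      tendsto_atTop := P.tendsto_atTop
      coord_lower := by rw [hcε]; nlinarith [hc.1]
      coord_upper := by rw [hcε]; nlinarith [hc.2] }

end RelaxationSystem

/-! ## Weighted symmetric products and absorption lemmas -/

section Auxiliary

lemma SlowWeight.sq {p p' : ℝ → ℝ} {η : ℝ} (h : SlowWeight p p' (η / 2)) :
    SlowWeight (fun x => p x ^ 2) (fun x => 2 * p x * p' x) η where
  isPrimitive := by
    have h1 := h.isPrimitive.mul h.isPrimitive
    have e : (fun x => p x ^ 2) = fun x => p x * p x := funext fun x => pow_two (p x)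
    rw [e]
    exact h1.congr_deriv (Eventually.of_forall fun x => by simp only; ring)
  pos := fun x => pow_pos (h.pos x) 2
  deriv_le := by
    filter_upwards [h.deriv_le] with x hx
    have hp := h.pos x
    rw [abs_mul, abs_mul, abs_of_pos hp, abs_two]
    calc 2 * p x * |p' x| ≤ 2 * p x * (2 * (η / 2) * p x) := by gcongr
      _ = 2 * η * p x ^ 2 := by ring

lemma _root_.MeasureTheory.MemLp.clm_apply_of_continuous {X E F : Type*} [NormedAddCommGroup E]
    [NormedSpace ℝ E] [NormedAddCommGroup F] [NormedSpace ℝ F] [TopologicalSpace X] [MeasurableSpace X]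
    [OpensMeasurableSpace X] [SecondCountableTopologyEither X (E →L[ℝ] F)] {μ : Measure X} {Φ : X → E →L[ℝ] F} {C : ℝ} (hΦ : Continuous Φ) (hC : ∀ x, ‖Φ x‖ ≤ C)
    {u : X → E} (hu : MemLp u 2 μ) : MemLp (fun x => Φ x (u x)) 2 μ := by
  refine (hu.norm.const_mul C).mono' ?_ (Eventually.of_forall fun x => (Φ x).le_of_opNorm_le (hC x) _)
  exact isBoundedBilinearMap_apply.continuous.comp_aestronglyMeasurable
    (hΦ.aestronglyMeasurable.prodMk hu.aestronglyMeasurable)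

/-- Weighted version of the identity `∫ ⟪(A W)', W⟫ = 0`. -/
lemma abs_integral_inner_deriv_le {H : Type*} [NormedAddCommGroup H] [InnerProductSpace ℝ H]
    [CompleteSpace H] {A : H →L[ℝ] H} (hA : ∀ x y, ⟪A x, y⟫_ℝ = ⟪x, A y⟫_ℝ) {p p' : ℝ → ℝ} {η : ℝ}
    (hη : 0 ≤ η) (hp : SlowWeight p p' (η / 2)) {W Y Y' : ℝ → H}
    (hW : MemLp W 2 (weightedMeasure fun x => p x ^ 2)) (hY : IsPrimitive Y Y')
    (hY' : MemLp Y' 2 (weightedMeasure fun x => p x ^ 2)) (hYW : Y =ᵐ[volume] fun x => A (W x)) :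
    |∫ x, ⟪Y' x, W x⟫_ℝ ∂(weightedMeasure fun x => p x ^ 2)|
      ≤ η * ‖A‖ * l2Norm (weightedMeasure fun x => p x ^ 2) W ^ 2 := by
  have hc := hp.continuous
  have iW := (memLp_weightedMeasure_iff hc hp.pos).1 hW
  have iY' := (memLp_weightedMeasure_iff hc hp.pos).1 hY'
  have iAW := A.comp_memLp' iW
  have hb : ∀ᵐ x, ‖p' x • Y x‖ ≤ η * ‖A‖ * ‖p x • W x‖ := by
    filter_upwards [hp.deriv_le, hYW] with x h1 h2
    rw [h2, norm_smul, norm_smul, Real.norm_eq_abs, Real.norm_eq_abs, abs_of_pos (hp.pos x)]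
    calc |p' x| * ‖A (W x)‖ ≤ (2 * (η / 2) * p x) * (‖A‖ * ‖W x‖) :=
          mul_le_mul h1 (A.le_opNorm _) (norm_nonneg _)
            (by have := hp.pos x; positivity)
      _ = _ := by ring
  have iY : MemLp (fun x => p' x • Y x) 2 volume :=
    (iW.norm.const_mul (η * ‖A‖)).mono'
      (hp.isPrimitive.locallyIntegrable.aestronglyMeasurable.smul hY.continuous.aestronglyMeasurable) hb
  have h0 := integral_inner_deriv_eq_zero hA iW (hp.isPrimitive.smul hY) (iY'.add iY) (by
    filter_upwards [hYW] with x hx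
    rw [hx, map_smul])
  simp only [inner_add_left] at h0
  rw [integral_add (iY'.integrable_inner_two iW) (iY.integrable_inner_two iW)] at h0
  have e : ∫ x, ⟪Y' x, W x⟫_ℝ ∂(weightedMeasure fun x => p x ^ 2)
      = ∫ x, ⟪p x • Y' x, p x • W x⟫_ℝ := by
    rw [integral_weightedMeasure (w := fun x => p x ^ 2) (hc.pow 2) (fun x => pow_pos (hp.pos x) 2)]
    refine integral_congr_ae (Eventually.of_forall fun x => ?_)
    simp only [real_inner_smul_left, real_inner_smul_right, smul_eq_mul]
    ring
  rw [e, eq_neg_of_add_eq_zero_left h0, abs_neg, l2Norm_sq hW,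
    integral_sq_weightedMeasure hc hp.pos iW]
  have e2 : (eLpNorm (fun x => p x • W x) 2 volume).toReal ^ 2 = ∫ x, ‖p x • W x‖ ^ 2 := l2Norm_sq iW
  rw [e2, ← integral_const_mul]
  refine abs_integral_le_integral_abs.trans (integral_mono_ae (iY.integrable_inner_two iW).abs
    ((iW.integrable_norm_pow (by norm_num)).const_mul _) ?_)
  filter_upwards [hb] with x hx
  calc |⟪p' x • Y x, p x • W x⟫_ℝ| ≤ ‖p' x • Y x‖ * ‖p x • W x‖ := abs_real_inner_le_norm _ _
    _ ≤ (η * ‖A‖ * ‖p x • W x‖) * ‖p x • W x‖ := by gcongr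
    _ = _ := by ring

/-- If the conclusion failed, `a` and `R` would both be bounded by multiples of `X`, and each term
on the right would be at most `c X² / 4`. It is applied with `X` the fluctuation of `U'` and `a` its
macroscopic part. -/
lemma exists_le_of_quadratic {c ν : ℝ} (hc : 0 < c) (hν : 0 < ν) : ∃ σ₀ K : ℝ, 0 < σ₀ ∧ 0 < K ∧
    ∀ {σ X a R : ℝ}, σ ≤ σ₀ → 0 ≤ X → 0 ≤ a → 0 ≤ R →
      c * X ^ 2 ≤ σ * (2 * a + X) ^ 2 + R * (2 * a + X) → X ≤ ν * a + K * R := by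
  set t := 2 / ν + 1 with ht
  have htp : 0 < t := by positivity
  refine ⟨c / (4 * t ^ 2), 4 * t / c, by positivity, by positivity, ?_⟩
  intro σ X a R hσ hX ha hR h
  by_contra! hlt
  have hK : 0 < 4 * t / c := by positivity
  have hX0 : 0 < X := lt_of_le_of_lt (by positivity) hlt
  have h1 : ν * a ≤ X := by have := mul_nonneg hK.le hR; linarith
  have h2 : 4 * t / c * R ≤ X := by have := mul_nonneg hν.le ha; linarith
  have h3 : 2 * a + X ≤ t * X := by
    have : a ≤ X / ν := by rw [le_div_iff₀ hν]; linarith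
    calc 2 * a + X ≤ 2 * (X / ν) + X := by linarith
      _ = t * X := by rw [ht]; ring
  have h4 : R ≤ c / (4 * t) * X := by
    calc R = c / (4 * t) * (4 * t / c * R) := by field_simp
      _ ≤ _ := by gcongr
  have h5 : σ * (2 * a + X) ^ 2 ≤ c / 4 * X ^ 2 := by
    calc σ * (2 * a + X) ^ 2 ≤ c / (4 * t ^ 2) * (t * X) ^ 2 := by gcongr
      _ = _ := by field_simp
  have h6 : R * (2 * a + X) ≤ c / 4 * X ^ 2 := by
    calc R * (2 * a + X) ≤ c / (4 * t) * X * (t * X) := by gcongr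
      _ = _ := by field_simp
  have h7 : 0 < c * X ^ 2 := by positivity
  linarith

/-- Here `a`, `b`, `X`, `R` stand for the sizes of `u`, `u'`, the fluctuation of `U'`, and the data.
The loop `b → X → b` is closed by the smallness of `ν`. The loop through `a ≲ ε⁻¹ X` closes too,
because `X ≲ ν b` and `b` contains `a` only with a factor `ε`. `ν` depends on `C`, `K` alone, since
`B` may depend on `ν`. -/
lemma exists_absorption {C K : ℝ} (hC : 1 ≤ C) (hK : 1 ≤ K) : ∃ ν > 0, ∀ B : ℝ, 1 ≤ B →
    ∃ ε₀ C' : ℝ, 0 < ε₀ ∧ 0 < C' ∧ ∀ {ε a b X R : ℝ}, 0 < ε → ε ≤ ε₀ → 0 ≤ a → 0 ≤ b → 0 ≤ X →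
      0 ≤ R → b ≤ C * (ε * a + K * (R + X)) → X ≤ ν * b + B * (R + ε ^ 2 * (a + b + X)) →
      b + X ≤ C' * (ε * a + R) ∧ (a ≤ C * ε⁻¹ * (K * (R + X)) → a ≤ C' * ε⁻¹ * R) := by
  have hC0 : 0 < C := by linarith
  have hK0 : 0 < K := by linarith
  set P := C * K with hP
  have hP1 : 1 ≤ P := one_le_mul_of_one_le_of_one_le hC hK
  have hP0 : 0 < P := by linarith
  refine ⟨1 / (64 * P * C), by positivity, fun B hB => ?_⟩
  have hB0 : 0 < B := by linarith
  refine ⟨1 / (64 * P * B * C), 64 * P ^ 2 * B * C, by positivity, by positivity, ?_⟩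
  intro ε a b X R hε hε₀ ha hb hX hR h1 h2
  have n1 : 1 / (64 * P * C) ≤ 1 / (64 * P) := by
    rw [div_le_div_iff₀ (by positivity) (by positivity)]
    nlinarith
  have hε1' : ε * (64 * P * B * C) ≤ 1 := by rwa [le_div_iff₀ (by positivity)] at hε₀
  have hε1 : ε * (64 * P * B) ≤ 1 := by
    have : ε * (64 * P * B) * 1 ≤ ε * (64 * P * B) * C := by gcongr
    linarith
  have hPB : 1 ≤ P * B := one_le_mul_of_one_le_of_one_le hP1 hB
  have hε2 : ε ≤ 1 := by nlinarith
  have hBε : B * ε ≤ 1 / 64 := by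
    have : B * ε * 1 ≤ B * ε * P := by gcongr
    linarith
  have hPBε : P * (B * ε) ≤ 1 / 64 := by linarith
  have q1 : P * (B * ε ^ 2 * (a + b + X)) ≤ 1 / 64 * (ε * a) + 1 / 64 * (b + X) := by
    have e1 : P * (B * ε ^ 2 * (a + b + X)) = P * (B * ε) * (ε * a + ε * (b + X)) := by ring
    have e2 : P * (B * ε) * (ε * a + ε * (b + X)) ≤ 1 / 64 * (ε * a + 1 * (b + X)) := by gcongr
    linarith
  have q2 : P * (1 / (64 * P * C) * b) ≤ 1 / 64 * b := by
    calc P * (1 / (64 * P * C) * b) ≤ P * (1 / (64 * P) * b) := by gcongr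
      _ = 1 / 64 * b := by field_simp
  have h3 : P * X ≤ 1 / 64 * b + P * B * R + 1 / 64 * (ε * a) + 1 / 64 * (b + X) := by
    have := mul_le_mul_of_nonneg_left h2 hP0.le
    linarith
  have hXP : X ≤ P * X := le_mul_of_one_le_left hX hP1
  have hRB : P * R ≤ P * B * R := by
    have : P * R * 1 ≤ P * R * B := by gcongr
    linarith
  have hεa : 0 ≤ ε * a := by positivity
  have hCε : ε * a ≤ C * (ε * a) := le_mul_of_one_le_left hεa hC
  have hPBR : 0 ≤ P * B * R := by positivity
  have h4 : b + X ≤ 2 * C * (ε * a) + 4 * (P * B * R) := by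
    have e : C * (ε * a + K * (R + X)) = C * (ε * a) + P * R + P * X := by rw [hP]; ring
    rw [e] at h1
    linarith
  have w1 : P * B * R ≤ P ^ 2 * B * C * R := by
    have : P * B * R * (1 * 1) ≤ P * B * R * (P * C) := by gcongr
    linarith
  have w2 : C * (ε * a) ≤ P ^ 2 * B * C * (ε * a) := by
    have : C * (ε * a) * (1 * 1) ≤ C * (ε * a) * (P * B * P) := by
      gcongr
    linarith
  refine ⟨by linarith, fun h5 => ?_⟩
  -- the fluctuation is small compared with `ε a`
  have h6 : ε * a ≤ P * R + P * X := by
    calc ε * a ≤ ε * (C * ε⁻¹ * (K * (R + X))) := by gcongr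
      _ = P * R + P * X := by rw [hP]; field_simp
  have q3 : P * (1 / (64 * P * C) * b) ≤ 1 / 32 * (ε * a) + 1 / 16 * (P * B * R) := by
    have e1 : P * (1 / (64 * P * C) * b) = 1 / (64 * C) * b := by field_simp
    have e2 : 1 / (64 * C) * b ≤ 1 / (64 * C) * (2 * C * (ε * a) + 4 * (P * B * R)) := by
      gcongr; linarith
    have e3 : 1 / (64 * C) * (2 * C * (ε * a) + 4 * (P * B * R))
        = 1 / 32 * (ε * a) + 1 / 16 * (P * B * R) / C := by field_simp; ring
    have e4 : 1 / 16 * (P * B * R) / C ≤ 1 / 16 * (P * B * R) := div_le_self (by positivity) hC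
    linarith
  have q4 : P * (B * ε ^ 2 * (a + b + X)) ≤ 1 / 8 * (ε * a) + 1 / 16 * (P * B * R) := by
    have e1 : P * (B * ε ^ 2 * (a + b + X)) = P * (B * ε) * (ε * a) + P * (B * ε) * ε * (b + X) := by
      ring
    have e2 : P * (B * ε) * (ε * a) ≤ 1 / 64 * (ε * a) := by gcongr
    have e3 : P * (B * ε) * ε * (b + X) ≤ P * (B * ε) * ε * (2 * C * (ε * a) + 4 * (P * B * R)) := by
      gcongr
    have e4 : P * (B * ε) * ε * (4 * (P * B * R)) ≤ 1 / 64 * 1 * (4 * (P * B * R)) := by gcongr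
    have e5 : P * (B * ε) * C ≤ 1 / 64 := by linarith
    have e6 : P * (B * ε) * C * ε * (2 * (ε * a)) ≤ 1 / 64 * 1 * (2 * (ε * a)) := by gcongr
    linarith
  have h7 : P * X ≤ 1 / 2 * (ε * a) + 2 * (P * B * R) := by
    have := mul_le_mul_of_nonneg_left h2 hP0.le
    linarith
  have h8 : ε * a ≤ 8 * (P * B * R) := by linarith
  calc a = ε⁻¹ * (ε * a) := by field_simp
    _ ≤ ε⁻¹ * (8 * (P ^ 2 * B * C * R)) := by
      refine mul_le_mul_of_nonneg_left ?_ (by positivity)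
      linarith
    _ ≤ ε⁻¹ * (64 * (P ^ 2 * B * C * R)) := by
      have : 0 ≤ P ^ 2 * B * C * R := by positivity
      gcongr
      linarith
    _ = _ := by ring

end Auxiliary

/-! ## The linearized relaxation system along a path of equilibria -/

namespace RelaxationSystem

variable {H : Type*} [NormedAddCommGroup H] [InnerProductSpace ℝ H] [CompleteSpace H]
  {S : RelaxationSystem H}

/-- The differential `w ↦ w + dv_*(u) w` of the equilibrium map. -/
def dM (S : RelaxationSystem H) (u : S.𝕌) : S.𝕌 →L[ℝ] H :=
  S.𝕌.subtypeL + S.𝕍.subtypeL ∘L fderiv ℝ S.vstar u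

/-- A path of equilibria varying on the scale `ε²`. -/
structure EquilibriumPath (S : RelaxationSystem H) (C c K τ ε : ℝ) (ubar : ℝ → S.𝕌) (m₁ m₂ : ℝ → H) :
    Prop where
  near : ∀ x, S.NearEquilibrium C c τ (ubar x)
  continuous : Continuous ubar
  hasDerivAt_M : ∀ x, HasDerivAt (fun x => S.M (ubar x)) (m₁ x) x
  hasDerivAt_m₁ : ∀ x, HasDerivAt m₁ (m₂ x) x
  continuous_m₂ : Continuous m₂
  norm_m₁_le : ∀ x, ‖m₁ x‖ ≤ K * ε ^ 2
  norm_m₂_le : ∀ x, ‖m₂ x‖ ≤ K * ε ^ 2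

lemma NearEquilibrium.norm_dM_le {C c τ : ℝ} {u : S.𝕌} (h : S.NearEquilibrium C c τ u) (hτ : τ ≤ 1)
    (w : S.𝕌) : ‖S.dM u w‖ ≤ 2 * ‖w‖ := by
  have h1 : ‖fderiv ℝ S.vstar u w‖ ≤ 1 * ‖w‖ :=
    ContinuousLinearMap.le_of_opNorm_le _ (h.norm_fderiv_le.trans hτ) w
  calc ‖S.dM u w‖ ≤ ‖(w : H)‖ + ‖(fderiv ℝ S.vstar u w : H)‖ := norm_add_le _ _
    _ = ‖w‖ + ‖fderiv ℝ S.vstar u w‖ := rfl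
    _ ≤ 2 * ‖w‖ := by linarith

lemma NearEquilibrium.hasFDerivAt_dM {C c τ : ℝ} {u : S.𝕌} (h : S.NearEquilibrium C c τ u) :
    HasFDerivAt S.dM ((ContinuousLinearMap.compL ℝ S.𝕌 S.𝕍 H S.𝕍.subtypeL) ∘L
      fderiv ℝ (fderiv ℝ S.vstar) u) u := by
  have h1 : ContDiffAt ℝ ω (fderiv ℝ S.vstar) u := h.contDiffAt.fderiv_right (m := ω) (by simp)
  have h2 := (h1.differentiableAt (by simp)).hasFDerivAt
  exact ((ContinuousLinearMap.compL ℝ S.𝕌 S.𝕍 H S.𝕍.subtypeL).hasFDerivAt.comp u h2).const_add _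

/-- `ubar' = A k` is `O(ε²)`, and so is its derivative `A k' + m A k`; the second derivative of
`v_*` enters quadratically in `ubar'`, hence also at order `ε²` or smaller. -/
theorem _root_.ShockLayer.exists_equilibriumPath {M : ReducedModel S.𝕌} {K c₁ k₀ θ ε : ℝ} {ubar : ℝ → S.𝕌}
    {a A m : ℝ → ℝ} {k k1 : ℝ → S.𝕌} (h : ShockLayer M K c₁ k₀ θ ε ubar a A m k k1) {C c τ : ℝ}
    (hK : 0 ≤ K) (hC : 0 ≤ C) (hτ : τ ≤ 1) (hε : ε ≤ 1)
    (near : ∀ x, S.NearEquilibrium C c τ (ubar x)) :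
    ∃ m₁ m₂, S.EquilibriumPath C c (4 * K + 6 * K ^ 2 + 4 * C * K ^ 2) τ ε ubar m₁ m₂ := by
  have hε0 := h.ε_pos
  have cu : Continuous ubar := continuous_iff_continuousAt.2 fun x => (h.hasDerivAt x).continuousAt
  have cA : Continuous A := continuous_iff_continuousAt.2 fun x => (h.hasDerivAt_A x).continuousAt
  have ck : Continuous k := continuous_iff_continuousAt.2 fun x => (h.hasDerivAt_k x).continuousAt
  have cJ : Continuous fun x => S.dM (ubar x) := continuous_iff_continuousAt.2 fun x =>
    (near x).hasFDerivAt_dM.continuousAt.comp cu.continuousAt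
  have cT2 : Continuous fun x => fderiv ℝ (fderiv ℝ S.vstar) (ubar x) :=
    continuous_iff_continuousAt.2 fun x => by
      have h1 : ContDiffAt ℝ ω (fderiv ℝ S.vstar) (ubar x) :=
        (near x).contDiffAt.fderiv_right (m := ω) (by simp)
      have h2 : ContDiffAt ℝ ω (fderiv ℝ (fderiv ℝ S.vstar)) (ubar x) :=
        h1.fderiv_right (m := ω) (by simp)
      exact ContinuousAt.comp (g := fderiv ℝ (fderiv ℝ S.vstar)) h2.continuousAt cu.continuousAt
  have hz : ∀ x, ‖A x • k x‖ ≤ 2 * K * ε ^ 2 := fun x => by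
    rw [norm_smul, Real.norm_eq_abs, abs_of_pos (h.A_pos x)]
    calc A x * ‖k x‖ ≤ (K * ε ^ 2) * 2 :=
          mul_le_mul (h.A_le x) (h.norm_k x) (norm_nonneg _) (by positivity)
      _ = _ := by ring
  have hz1 : ∀ x, ‖A x • k1 x + (m x * A x) • k x‖ ≤ 3 * K ^ 2 * ε ^ 2 := fun x => by
    have e1 : ‖A x • k1 x‖ ≤ (K * ε ^ 2) * (K * ε ^ 2) := by
      rw [norm_smul, Real.norm_eq_abs, abs_of_pos (h.A_pos x)]
      exact mul_le_mul (h.A_le x) (h.norm_k1 x) (norm_nonneg _) (by positivity)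
    have e2 : ‖(m x * A x) • k x‖ ≤ (K * ε) * (2 * K * ε ^ 2) := by
      rw [mul_smul, norm_smul, Real.norm_eq_abs]
      exact mul_le_mul (h.m_le x) (hz x) (norm_nonneg _) (by positivity)
    have e3 : ε ^ 2 ≤ 1 := pow_le_one₀ hε0.le hε
    calc _ ≤ _ := norm_add_le _ _
      _ ≤ (K * ε ^ 2) * (K * ε ^ 2) + (K * ε) * (2 * K * ε ^ 2) := add_le_add e1 e2
      _ = K ^ 2 * ε ^ 2 * ε ^ 2 + 2 * K ^ 2 * ε ^ 2 * ε := by ring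
      _ ≤ K ^ 2 * ε ^ 2 * 1 + 2 * K ^ 2 * ε ^ 2 * 1 := by gcongr
      _ = _ := by ring
  refine ⟨fun x => S.dM (ubar x) (A x • k x), fun x => S.dM (ubar x) (A x • k1 x + (m x * A x) • k x)
    + ((fderiv ℝ (fderiv ℝ S.vstar) (ubar x) (A x • k x) (A x • k x) : S.𝕍) : H), ?_⟩
  refine ⟨near, cu, fun x => ?_, fun x => ?_, ?_, fun x => ?_, fun x => ?_⟩
  · have h1 := (((near x).contDiffAt.differentiableAt (by simp)).hasFDerivAt).comp_hasDerivAt x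
      (h.hasDerivAt x)
    exact (S.𝕌.subtypeL.hasFDerivAt.comp_hasDerivAt x (h.hasDerivAt x)).add
      (S.𝕍.subtypeL.hasFDerivAt.comp_hasDerivAt x h1)
  · have h1 := (near x).hasFDerivAt_dM.comp_hasDerivAt x (h.hasDerivAt x)
    have h2 := h1.clm_apply ((h.hasDerivAt_A x).smul (h.hasDerivAt_k x))
    refine h2.congr_deriv ?_
    rw [add_comm]
    rfl
  · exact (cJ.clm_apply ((cA.smul h.continuous_k1).add ((h.continuous_m.mul cA).smul ck))).add
      (continuous_subtype_val.comp ((cT2.clm_apply (cA.smul ck)).clm_apply (cA.smul ck)))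
  · refine ((near x).norm_dM_le hτ _).trans ?_
    have := hz x
    have h3 : 0 ≤ (6 * K ^ 2 + 4 * C * K ^ 2) * ε ^ 2 := by positivity
    linarith
  · have h1 := ((near x).norm_dM_le hτ (A x • k1 x + (m x * A x) • k x))
    have h2 : ‖fderiv ℝ (fderiv ℝ S.vstar) (ubar x) (A x • k x) (A x • k x)‖
        ≤ C * (2 * K * ε ^ 2) * (2 * K * ε ^ 2) := by
      refine (ContinuousLinearMap.le_opNorm₂ _ _ _).trans ?_
      have := (near x).norm_fderiv_fderiv_le
      have := hz x
      gcongr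
    have h3 : C * (2 * K * ε ^ 2) * (2 * K * ε ^ 2) ≤ 4 * C * K ^ 2 * ε ^ 2 := by
      have e3 : ε ^ 2 ≤ 1 := pow_le_one₀ hε0.le hε
      calc C * (2 * K * ε ^ 2) * (2 * K * ε ^ 2) = 4 * C * K ^ 2 * ε ^ 2 * ε ^ 2 := by ring
        _ ≤ 4 * C * K ^ 2 * ε ^ 2 * 1 := by gcongr
        _ = _ := by ring
    have h4 := hz1 x
    have h5 : 0 ≤ K * ε ^ 2 := by positivity
    refine (norm_add_le _ _).trans ?_
    rw [← Submodule.coe_norm]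
    linarith

/-- A solution of the linearized system, with square integrability for the measure `μ`. -/
structure LinearizedSolution (S : RelaxationSystem H) (μ : Measure ℝ) (ubar : ℝ → S.𝕌) (U U' : ℝ → H)
    (f f' f'' : ℝ → S.𝕌) (g g' : ℝ → S.𝕍) : Prop where
  prim_U : IsPrimitive U U'
  prim_f : IsPrimitive f f'
  prim_f' : IsPrimitive f' f''
  prim_g : IsPrimitive g g'
  memLp_U : MemLp U 2 μ
  memLp_U' : MemLp U' 2 μ
  memLp_f : MemLp f 2 μ
  memLp_f' : MemLp f' 2 μ
  memLp_f'' : MemLp f'' 2 μ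
  memLp_g : MemLp g 2 μ
  memLp_g' : MemLp g' 2 μ
  macro_eq : ∀ x, S.PU (S.A (U x)) = f x
  micro_eq : ∀ᵐ x, S.PV (S.A (U' x)) - S.PV (S.L (S.M (ubar x)) (U x)) = g x

lemma LinearizedSolution.macro_eq_deriv {μ : Measure ℝ} {ubar : ℝ → S.𝕌} {U U' : ℝ → H}
    {f f' f'' : ℝ → S.𝕌} {g g' : ℝ → S.𝕍} (h : S.LinearizedSolution μ ubar U U' f f' f'' g g') :
    ∀ᵐ x, S.PU (S.A (U' x)) = f' x := by
  filter_upwards [h.prim_U.ae_hasDerivAt, h.prim_f.ae_hasDerivAt] with x h1 h2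
  have h3 : HasDerivAt f (S.PU (S.A (U' x))) x := by
    have e : f = fun x => S.PU (S.A (U x)) := funext fun x => (h.macro_eq x).symm
    rw [e]
    exact (S.PU ∘L S.A).hasFDerivAt.comp_hasDerivAt x h1
  exact h3.unique h2

/-- The deviation of `U` from the tangent space of the equilibrium manifold. -/
def fluctuation (S : RelaxationSystem H) (u : S.𝕌) (U : H) : S.𝕍 :=
  S.PV U - fderiv ℝ S.vstar u (S.PU U)

namespace NearEquilibrium

variable {C c τ : ℝ} {u : S.𝕌} (h : S.NearEquilibrium C c τ u)
include h

/-- The differentiated relation `q(u, v_*(u)) = 0` says that `P_𝕍 L` kills tangent vectors `x +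
dv_*(u) x`, so only the fluctuation survives. -/
lemma PV_L_eq (U : H) : S.PV (S.L (S.M u) U) = S.dvqM u (S.fluctuation u U) := by
  rw [fluctuation, map_sub, h.dvqM_fderiv, sub_neg_eq_add, dvqM_apply, ← map_add, ← map_add,
    add_comm (S.PV U : H), coe_PU_add_coe_PV]

lemma norm_PV_le (hτ : τ ≤ 1) (U : H) : ‖S.PV U‖ ≤ ‖S.fluctuation u U‖ + ‖S.PU U‖ := by
  have e : S.PV U = S.fluctuation u U + fderiv ℝ S.vstar u (S.PU U) := by rw [fluctuation]; abel
  have h1 : ‖fderiv ℝ S.vstar u (S.PU U)‖ ≤ 1 * ‖S.PU U‖ :=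
    ContinuousLinearMap.le_of_opNorm_le _ (h.norm_fderiv_le.trans hτ) _
  calc ‖S.PV U‖ = ‖S.fluctuation u U + fderiv ℝ S.vstar u (S.PU U)‖ := by rw [← e]
    _ ≤ _ := norm_add_le _ _
    _ ≤ _ := by linarith

lemma norm_le (hτ : τ ≤ 1) (U : H) : ‖U‖ ≤ 2 * ‖S.PU U‖ + ‖S.fluctuation u U‖ := by
  have h1 := h.norm_PV_le hτ U
  calc ‖U‖ = ‖(S.PU U : H) + (S.PV U : H)‖ := by rw [coe_PU_add_coe_PV]
    _ ≤ ‖S.PU U‖ + ‖S.PV U‖ := norm_add_le _ _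
    _ ≤ _ := by linarith

lemma inverse_apply (v : S.𝕍) : (S.dvqM u).inverse (S.dvqM u v) = v := by
  obtain ⟨e, he⟩ := h.isInvertible
  rw [← he, ContinuousLinearMap.inverse_equiv]
  exact e.symm_apply_apply v

/-- Dissipation of the fluctuation of the derivative. -/
lemma inner_L_le (hC : 0 ≤ C) (U : H) :
    ⟪S.L (S.M u) U, U⟫_ℝ ≤ -c * ‖S.fluctuation u U‖ ^ 2
      + C * τ * (‖S.fluctuation u U‖ * ‖S.PU U‖) := by
  -- Collisions take values in `𝕍`, so the pairing sees only `P_𝕍 U`, that is, the fluctuation plus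
  -- an error of size `τ ‖P_𝕌 U‖`.
  have hmem : S.L (S.M u) U ∈ S.𝕍 := S.𝕍.smul_mem _ (S.Q_mem _ _)
  have e1 : ⟪S.L (S.M u) U, U⟫_ℝ = ⟪S.PV (S.L (S.M u) U), S.PV U⟫_ℝ := by
    have e2 : S.PV (S.L (S.M u) U) = ⟨S.L (S.M u) U, hmem⟩ := S.PV_coe ⟨_, hmem⟩
    rw [e2, inner_PV']
  set w := S.fluctuation u U with hw
  have e3 : S.PV U = w + fderiv ℝ S.vstar u (S.PU U) := by rw [hw, fluctuation]; abel
  rw [e1, h.PV_L_eq, ← hw, e3, inner_add_right]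
  have h1 := h.neg w
  have h2 : ‖S.dvqM u w‖ ≤ C * ‖w‖ := by
    rw [dvqM_apply]
    exact (S.norm_PV_le _).trans (ContinuousLinearMap.le_of_opNorm_le _ h.norm_L_le _)
  have h3 : ‖fderiv ℝ S.vstar u (S.PU U)‖ ≤ τ * ‖S.PU U‖ :=
    ContinuousLinearMap.le_of_opNorm_le _ h.norm_fderiv_le _
  have h4 : ⟪S.dvqM u w, fderiv ℝ S.vstar u (S.PU U)⟫_ℝ ≤ C * ‖w‖ * (τ * ‖S.PU U‖) :=
    (real_inner_le_norm _ _).trans (mul_le_mul h2 h3 (norm_nonneg _) (by positivity))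
  linarith

/-- The Chapman--Enskog relation. -/
lemma chapmanEnskog {U U' : H} {f f' : S.𝕌} {g : S.𝕍} (h1 : S.PU (S.A U) = f)
    (h2 : S.PU (S.A U') = f') (h3 : S.PV (S.A U') - S.PV (S.L (S.M u) U) = g) :
    S.bstar u (S.PU U') - S.dhstar u (S.PU U) = -f + S.A12 ((S.dvqM u).inverse
      (fderiv ℝ S.vstar u f' + S.A22 (S.fluctuation u U')
        - fderiv ℝ S.vstar u (S.A12 (S.fluctuation u U')) - g)) := by
  set T := fderiv ℝ S.vstar u with hT
  set w := S.fluctuation u U with hw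
  set w' := S.fluctuation u U' with hw'
  set x := S.PU U with hx
  set x' := S.PU U' with hx'
  have e : S.PV U = T x + w := by rw [hw, fluctuation]; abel
  have e' : S.PV U' = T x' + w' := by rw [hw', fluctuation]; abel
  have dec : ∀ V : H, S.A V = S.A (S.PU V) + S.A (S.PV V) := fun V => by
    rw [← map_add, coe_PU_add_coe_PV]
  have f1 : f = S.A11 x + S.A12 (T x) + S.A12 w := by
    rw [← h1, dec, map_add, e, ← hx, add_assoc, ← map_add S.A12]; rfl
  have f2 : f' = S.A11 x' + S.A12 (T x') + S.A12 w' := by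
    rw [← h2, dec, map_add, e', ← hx', add_assoc, ← map_add S.A12]; rfl
  have f3 : S.dvqM u w = S.A21 x' + S.A22 (T x') + S.A22 w' - g := by
    rw [← h.PV_L_eq, eq_sub_iff_add_eq, ← h3, add_sub_cancel, dec, map_add, e', ← hx', add_assoc,
      ← map_add S.A22]; rfl
  have f4 : w = (S.dvqM u).inverse (S.A21 x' + S.A22 (T x') + S.A22 w' - g) := by
    rw [← f3, h.inverse_apply]
  -- The differentiated macroscopic equation is inserted to make the combination of coefficients
  -- defining `c_*` appear; what remains involves only `f'`, `g` and the fluctuation of `U'`.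
  have f5 : S.A21 x' + S.A22 (T x') + S.A22 w' - g = (S.A21 x' + S.A22 (T x')
      - T (S.A11 x' + S.A12 (T x'))) + (T f' + S.A22 w' - T (S.A12 w') - g) := by
    rw [f2, map_add T (S.A11 x' + S.A12 (T x'))]; abel
  have f6 : S.bstar u x' = -S.A12 ((S.dvqM u).inverse (S.A21 x' + S.A22 (T x')
      - T (S.A11 x' + S.A12 (T x')))) := rfl
  rw [f5, map_add] at f4
  have f7 := congrArg S.A12 f4
  rw [map_add] at f7
  rw [f6, S.dhstar_eq (h.contDiffAt.differentiableAt (by simp)), f1, f7]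
  simp only [add_apply, ContinuousLinearMap.comp_apply, ← hT]
  abel

end NearEquilibrium

end RelaxationSystem

/-! ## Integral estimates for the linearized relaxation system -/

lemma integral_mul_le_l2Norm {X : Type*} [MeasurableSpace X] {μ : Measure X} {φ ψ : X → ℝ}
    (hφ : MemLp φ 2 μ) (hψ : MemLp ψ 2 μ) : ∫ x, φ x * ψ x ∂μ ≤ l2Norm μ φ * l2Norm μ ψ := by
  have h := real_inner_le_norm (hφ.toLp φ) (hψ.toLp ψ)
  rw [L2.inner_def, Lp.norm_toLp, Lp.norm_toLp] at h
  refine le_of_eq_of_le (integral_congr_ae ?_) h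
  filter_upwards [hφ.coeFn_toLp, hψ.coeFn_toLp] with x h1 h2
  rw [h1, h2, real_inner_eq_re_inner]
  simp [mul_comm]

namespace RelaxationSystem

variable {H : Type*} [NormedAddCommGroup H] [InnerProductSpace ℝ H] [CompleteSpace H]
  {S : RelaxationSystem H}

namespace EquilibriumPath

variable {C c K τ ε : ℝ} {ubar : ℝ → S.𝕌} {m₁ m₂ : ℝ → H} (h : S.EquilibriumPath C c K τ ε ubar m₁ m₂)
include h

lemma continuous_fderiv : Continuous fun x => fderiv ℝ S.vstar (ubar x) :=
  continuous_iff_continuousAt.2 fun x => by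
    have h1 : ContDiffAt ℝ ω (fderiv ℝ S.vstar) (ubar x) :=
      (h.near x).contDiffAt.fderiv_right (m := ω) (by simp)
    exact ContinuousAt.comp (g := fderiv ℝ S.vstar) h1.continuousAt h.continuous.continuousAt

lemma continuous_M : Continuous fun x => S.M (ubar x) :=
  continuous_iff_continuousAt.2 fun x => (h.hasDerivAt_M x).continuousAt

lemma continuous_m₁ : Continuous m₁ :=
  continuous_iff_continuousAt.2 fun x => (h.hasDerivAt_m₁ x).continuousAt

lemma prim_M : IsPrimitive (fun x => S.M (ubar x)) m₁ :=
  IsPrimitive.of_hasDerivAt h.hasDerivAt_M h.continuous_m₁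

lemma prim_m₁ : IsPrimitive m₁ m₂ := IsPrimitive.of_hasDerivAt h.hasDerivAt_m₁ h.continuous_m₂

end EquilibriumPath

lemma norm_L_apply_le (a x : H) : ‖S.L a x‖ ≤ 2 * ‖S.Q‖ * ‖a‖ * ‖x‖ := by
  have h1 : S.L a x = (2 : ℝ) • S.Q a x := rfl
  rw [h1, norm_smul, Real.norm_two, mul_assoc, mul_assoc]
  have := S.Q.le_opNorm₂ a x
  linarith

lemma memLp_L {μ : Measure ℝ} {m U : ℝ → H} (hm : Continuous m) {B : ℝ} (hB : ∀ x, ‖m x‖ ≤ B)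
    (hU : MemLp U 2 μ) : MemLp (fun x => S.L (m x) (U x)) 2 μ := by
  have hc : Continuous fun x => S.L (m x) := (S.Q.continuous.comp hm).const_smul (2 : ℝ)
  refine hU.clm_apply_of_continuous hc (C := 2 * ‖S.Q‖ * B) fun x => ?_
  refine ContinuousLinearMap.opNorm_le_bound _ ?_ fun y => (S.norm_L_apply_le _ _).trans ?_
  · have := (norm_nonneg _).trans (hB x)
    positivity
  · have := hB x
    gcongr

lemma isPrimitive_L {m m' U U' : ℝ → H} (hm : IsPrimitive m m') (hU : IsPrimitive U U') :
    IsPrimitive (fun x => S.L (m x) (U x)) (fun x => S.L (m x) (U' x) + S.L (m' x) (U x)) :=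
  IsPrimitive.bilin ((2 : ℝ) • S.Q) hm hU

lemma coe_PV_L (a x : H) : (S.PV (S.L a x) : H) = S.L a x :=
  congrArg Subtype.val (S.PV_coe ⟨_, S.𝕍.smul_mem (2 : ℝ) (S.Q_mem a x)⟩)

section Estimates

variable {C c K τ ε : ℝ} {ubar : ℝ → S.𝕌} {m₁ m₂ : ℝ → H} {U U' : ℝ → H} {f f' f'' : ℝ → S.𝕌}
  {g g' : ℝ → S.𝕍} {μ : Measure ℝ}

lemma EquilibriumPath.memLp_fluctuation (h : S.EquilibriumPath C c K τ ε ubar m₁ m₂)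
    (hU : MemLp U 2 μ) : MemLp (fun x => S.fluctuation (ubar x) (U x)) 2 μ :=
  (S.PV.comp_memLp' hU).sub ((S.PU.comp_memLp' hU).clm_apply_of_continuous h.continuous_fderiv
    fun x => (h.near x).norm_fderiv_le)

lemma EquilibriumPath.l2Norm_le (h : S.EquilibriumPath C c K τ ε ubar m₁ m₂) (hτ : τ ≤ 1)
    (hU : MemLp U 2 μ) : l2Norm μ U ≤ 2 * l2Norm μ (fun x => S.PU (U x))
      + l2Norm μ (fun x => S.fluctuation (ubar x) (U x)) :=
  (((L2Bound.of_memLp (S.PU.comp_memLp' hU)).const_mul zero_le_two).add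
    (L2Bound.of_memLp (h.memLp_fluctuation hU))).l2Norm_le_of_ae
    (Eventually.of_forall fun x => (h.near x).norm_le hτ (U x))

/-- The energy estimate for the fluctuation of the derivative. -/
theorem exists_fluctuation_estimate (S : RelaxationSystem H) {C c K ν : ℝ} (hC : 0 < C) (hc : 0 < c)
    (hK : 0 ≤ K) (hν : 0 < ν) : ∃ τ₀ η₀ B : ℝ, 0 < τ₀ ∧ τ₀ ≤ 1 ∧ 0 < η₀ ∧ 1 ≤ B ∧
      ∀ {τ ε : ℝ} {ubar : ℝ → S.𝕌} {m₁ m₂ : ℝ → H}, S.EquilibriumPath C c K τ ε ubar m₁ m₂ → τ ≤ τ₀ →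
      ∀ {p p' : ℝ → ℝ} {η : ℝ}, SlowWeight p p' (η / 2) → 0 ≤ η → η ≤ η₀ →
      ∀ {U U' : ℝ → H} {f f' f'' : ℝ → S.𝕌} {g g' : ℝ → S.𝕍},
      S.LinearizedSolution (weightedMeasure fun x => p x ^ 2) ubar U U' f f' f'' g g' →
      l2Norm (weightedMeasure fun x => p x ^ 2) (fun x => S.fluctuation (ubar x) (U' x))
        ≤ ν * l2Norm (weightedMeasure fun x => p x ^ 2) (fun x => S.PU (U' x))
          + B * (l2Norm (weightedMeasure fun x => p x ^ 2) f''
            + l2Norm (weightedMeasure fun x => p x ^ 2) g'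
            + ε ^ 2 * l2Norm (weightedMeasure fun x => p x ^ 2) U) := by
  obtain ⟨σ₀, K₁, hσ₀, hK₁, hq⟩ := exists_le_of_quadratic hc hν
  refine ⟨min 1 (σ₀ / (4 * C)), σ₀ / (2 * (‖S.A‖ + 1)), 1 + K₁ * (1 + 2 * ‖S.Q‖ * K), by positivity,
    min_le_left _ _, by positivity, le_add_of_nonneg_right (by positivity), ?_⟩
  intro τ ε ubar m₁ m₂ h hτ p p' η hp hη hη₀ U U' f f' f'' g g' hs
  set μ := weightedMeasure fun x => p x ^ 2 with hμ
  have hτ1 : τ ≤ 1 := hτ.trans (min_le_left _ _)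
  set w := fun x => S.fluctuation (ubar x) (U' x) with hw
  have hLw : MemLp w 2 μ := h.memLp_fluctuation hs.memLp_U'
  -- By the two equations `Y = A U'` almost everywhere, and `Y` is visibly a primitive. This
  -- supplies `(A U')'` without any second derivative of `U`.
  set Y : ℝ → H := fun x => (f' x : H) + S.L (S.M (ubar x)) (U x) + (g x : H) with hY
  set Y' : ℝ → H := fun x => (f'' x : H) + (S.L (S.M (ubar x)) (U' x) + S.L (m₁ x) (U x)) + (g' x : H)
    with hY'
  have prim : IsPrimitive Y Y' := ((hs.prim_f'.clm S.𝕌.subtypeL).add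
    (isPrimitive_L h.prim_M hs.prim_U)).add (hs.prim_g.clm S.𝕍.subtypeL)
  have hLM : MemLp (fun x => S.L (S.M (ubar x)) (U' x)) 2 μ :=
    hs.memLp_U'.clm_apply_of_continuous ((S.Q.continuous.comp h.continuous_M).const_smul (2 : ℝ))
      fun x => (h.near x).norm_L_le
  have mY' : MemLp Y' 2 μ := ((S.𝕌.subtypeL.comp_memLp' hs.memLp_f'').add
    (hLM.add (memLp_L h.continuous_m₁ h.norm_m₁_le hs.memLp_U))).add
      (S.𝕍.subtypeL.comp_memLp' hs.memLp_g')
  have hYA : Y =ᵐ[volume] fun x => S.A (U' x) := by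
    filter_upwards [hs.macro_eq_deriv, hs.micro_eq] with x h1 h2
    rw [← S.coe_PU_add_coe_PV (S.A (U' x)), h1, eq_add_of_sub_eq h2, hY]
    simp only [Submodule.coe_add, S.coe_PV_L]
    abel_nf
  have h1 := abs_integral_inner_deriv_le S.A_symm hη hp hs.memLp_U' prim mY' hYA
  rw [← hμ] at h1
  set R : ℝ → ℝ := fun x => ‖f'' x‖ + ‖g' x‖ + (2 * ‖S.Q‖ * K * ε ^ 2) * ‖U x‖ with hR
  have bR : L2Bound μ R (l2Norm μ f'' + l2Norm μ g' + (2 * ‖S.Q‖ * K * ε ^ 2) * l2Norm μ U) :=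
    ((L2Bound.of_memLp hs.memLp_f'').add (L2Bound.of_memLp hs.memLp_g')).add
      ((L2Bound.of_memLp hs.memLp_U).const_mul (by positivity))
  have bU := L2Bound.of_memLp hs.memLp_U'
  -- In `⟪Y', U'⟫` the term `⟪L U', U'⟫` dissipates the fluctuation, while the derivative of the
  -- coefficient of `L` contributes the `ε² U` in `R`.
  have pt : ∀ x, c * ‖w x‖ ^ 2 ≤ -⟪Y' x, U' x⟫_ℝ + 2 * C * |τ| * ‖U' x‖ ^ 2 + R x * ‖U' x‖ := by
    intro x
    have a1 := (h.near x).inner_L_le hC.le (U' x)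
    have a2 : ⟪Y' x, U' x⟫_ℝ = ⟪S.L (S.M (ubar x)) (U' x), U' x⟫_ℝ
        + ⟪(f'' x : H) + S.L (m₁ x) (U x) + (g' x : H), U' x⟫_ℝ := by
      rw [← inner_add_left, hY']; congr 1; simp only; abel
    have a3 : ‖(f'' x : H) + S.L (m₁ x) (U x) + (g' x : H)‖ ≤ R x := by
      have b1 : ‖S.L (m₁ x) (U x)‖ ≤ 2 * ‖S.Q‖ * K * ε ^ 2 * ‖U x‖ :=
        (S.norm_L_apply_le _ _).trans (by
          have := h.norm_m₁_le x
          calc 2 * ‖S.Q‖ * ‖m₁ x‖ * ‖U x‖ ≤ 2 * ‖S.Q‖ * (K * ε ^ 2) * ‖U x‖ := by gcongr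
            _ = _ := by ring)
      refine (norm_add₃_le).trans ?_
      rw [hR]
      simp only [← Submodule.coe_norm]
      linarith
    have a4 : ⟪(f'' x : H) + S.L (m₁ x) (U x) + (g' x : H), U' x⟫_ℝ ≤ R x * ‖U' x‖ :=
      (real_inner_le_norm _ _).trans (by gcongr)
    have a5 : ‖w x‖ ≤ 2 * ‖U' x‖ := by
      have b1 : ‖fderiv ℝ S.vstar (ubar x) (S.PU (U' x))‖ ≤ 1 * ‖S.PU (U' x)‖ :=
        ContinuousLinearMap.le_of_opNorm_le _ ((h.near x).norm_fderiv_le.trans hτ1) _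
      have b2 := S.norm_PU_le (U' x)
      have b3 := S.norm_PV_le (U' x)
      calc ‖w x‖ ≤ _ := norm_sub_le _ _
        _ ≤ _ := by linarith
    have a6 : C * τ * (‖w x‖ * ‖S.PU (U' x)‖) ≤ 2 * C * |τ| * ‖U' x‖ ^ 2 := by
      calc C * τ * (‖w x‖ * ‖S.PU (U' x)‖) ≤ C * |τ| * ((2 * ‖U' x‖) * ‖U' x‖) := by
            have b2 := S.norm_PU_le (U' x)
            have b3 := le_abs_self τ
            gcongr
        _ = _ := by ring
    linarith
  have i1 := mY'.integrable_inner_two hs.memLp_U'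
  have i2 : Integrable (fun x => ‖U' x‖ ^ 2) μ := hs.memLp_U'.integrable_norm_pow (by norm_num)
  have i3 : Integrable (fun x => R x * ‖U' x‖) μ := bR.memLp.integrable_mul bU.memLp
  have i4 : Integrable (fun x => ‖w x‖ ^ 2) μ := hLw.integrable_norm_pow (by norm_num)
  have hint := integral_mono (i4.const_mul c) ((i1.neg.add (i2.const_mul (2 * C * |τ|))).add i3) pt
  have e1 : ∫ x, c * ‖w x‖ ^ 2 ∂μ = c * l2Norm μ w ^ 2 := by rw [integral_const_mul, l2Norm_sq hLw]
  have e2 : ∫ x, (-⟪Y' x, U' x⟫_ℝ + 2 * C * |τ| * ‖U' x‖ ^ 2 + R x * ‖U' x‖) ∂μ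
      = -(∫ x, ⟪Y' x, U' x⟫_ℝ ∂μ) + 2 * C * |τ| * l2Norm μ U' ^ 2 + ∫ x, R x * ‖U' x‖ ∂μ := by
    have j1 : Integrable (fun x => -⟪Y' x, U' x⟫_ℝ) μ := i1.neg
    have j2 : Integrable (fun x => -⟪Y' x, U' x⟫_ℝ + 2 * C * |τ| * ‖U' x‖ ^ 2) μ :=
      j1.add (i2.const_mul _)
    rw [integral_add j2 i3, integral_add j1 (i2.const_mul _), integral_neg, integral_const_mul,
      l2Norm_sq hs.memLp_U']
  have hint2 : c * l2Norm μ w ^ 2 ≤ -(∫ x, ⟪Y' x, U' x⟫_ℝ ∂μ) + 2 * C * |τ| * l2Norm μ U' ^ 2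
      + ∫ x, R x * ‖U' x‖ ∂μ := by
    rw [← e1, ← e2]; exact hint
  have nU := l2Norm_nonneg (μ := μ) U'
  have nR : 0 ≤ l2Norm μ R := l2Norm_nonneg R
  have h3 : ∫ x, R x * ‖U' x‖ ∂μ ≤ l2Norm μ R * l2Norm μ U' :=
    (integral_mul_le_l2Norm bR.memLp bU.memLp).trans
      (mul_le_mul_of_nonneg_left bU.l2Norm_le nR)
  have h4 := (abs_le.1 h1).1
  have hX : l2Norm μ U' ≤ 2 * l2Norm μ (fun x => S.PU (U' x)) + l2Norm μ w := h.l2Norm_le hτ1 hs.memLp_U'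
  have h5 : c * l2Norm μ w ^ 2 ≤ (η * ‖S.A‖ + 2 * C * |τ|)
      * (2 * l2Norm μ (fun x => S.PU (U' x)) + l2Norm μ w) ^ 2
      + l2Norm μ R * (2 * l2Norm μ (fun x => S.PU (U' x)) + l2Norm μ w) := by
    calc c * l2Norm μ w ^ 2 ≤ (η * ‖S.A‖ + 2 * C * |τ|) * l2Norm μ U' ^ 2 + l2Norm μ R * l2Norm μ U' := by
          linarith
      _ ≤ _ := by gcongr
  have hτ0 : 0 ≤ τ := (norm_nonneg _).trans (h.near 0).norm_fderiv_le
  -- The threshold `σ₀` is shared equally between the derivative of the weight and the cross term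
  -- due to `dv_* ≠ 0` away from `u₀`.
  have hσ : η * ‖S.A‖ + 2 * C * |τ| ≤ σ₀ := by
    have b1 : η * ‖S.A‖ ≤ σ₀ / 2 := by
      calc η * ‖S.A‖ ≤ σ₀ / (2 * (‖S.A‖ + 1)) * (‖S.A‖ + 1) := by gcongr; linarith
        _ = σ₀ / 2 := by field_simp
    have b2 : 2 * C * |τ| ≤ σ₀ / 2 := by
      rw [abs_of_nonneg hτ0]
      calc 2 * C * τ ≤ 2 * C * (σ₀ / (4 * C)) := by
            have := hτ.trans (min_le_right _ _)
            gcongr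
        _ = σ₀ / 2 := by field_simp; norm_num
    linarith
  have h6 := hq hσ (l2Norm_nonneg w) (l2Norm_nonneg fun x => S.PU (U' x)) nR h5
  have n1 := l2Norm_nonneg (μ := μ) f''
  have n2 := l2Norm_nonneg (μ := μ) g'
  have n3 := mul_nonneg (sq_nonneg ε) (l2Norm_nonneg (μ := μ) U)
  have q : 0 ≤ 2 * ‖S.Q‖ * K := by positivity
  have h7 : K₁ * l2Norm μ R ≤ (1 + K₁ * (1 + 2 * ‖S.Q‖ * K)) * (l2Norm μ f'' + l2Norm μ g'
      + ε ^ 2 * l2Norm μ U) := by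
    set s := l2Norm μ f'' + l2Norm μ g' + ε ^ 2 * l2Norm μ U with hs'
    have b0 : 0 ≤ s := by positivity
    have b1 : l2Norm μ R ≤ (1 + 2 * ‖S.Q‖ * K) * s := by
      have b2 := mul_nonneg q (add_nonneg n1 n2)
      have b3 := bR.l2Norm_le
      rw [hs']
      linarith
    calc K₁ * l2Norm μ R ≤ K₁ * ((1 + 2 * ‖S.Q‖ * K) * s) := by gcongr
      _ ≤ K₁ * ((1 + 2 * ‖S.Q‖ * K) * s) + s := le_add_of_nonneg_right b0
      _ = _ := by ring
  exact h6.trans (add_le_add le_rfl h7)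

end Estimates

end RelaxationSystem

/-! ## The a priori estimate for the linearized relaxation system -/

namespace RelaxationSystem

variable {H : Type*} [NormedAddCommGroup H] [InnerProductSpace ℝ H] [CompleteSpace H]
  {S : RelaxationSystem H}

lemma norm_A12_le (v : S.𝕍) : ‖S.A12 v‖ ≤ ‖S.A‖ * ‖v‖ :=
  (S.norm_PU_le _).trans (S.A.le_opNorm _)

lemma norm_A22_le (v : S.𝕍) : ‖S.A22 v‖ ≤ ‖S.A‖ * ‖v‖ :=
  (S.norm_PV_le _).trans (S.A.le_opNorm _)

lemma PU_A (U : H) : S.PU (S.A U) = S.A11 (S.PU U) + S.A12 (S.PV U) := by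
  conv_lhs => rw [← S.coe_PU_add_coe_PV U, map_add, map_add]
  rfl

lemma PV_A (U : H) : S.PV (S.A U) = S.A21 (S.PU U) + S.A22 (S.PV U) := by
  conv_lhs => rw [← S.coe_PU_add_coe_PV U, map_add, map_add]
  rfl

namespace NearEquilibrium

variable {C c τ : ℝ} {u : S.𝕌} (h : S.NearEquilibrium C c τ u)
include h

lemma norm_residual_le (hC : 0 ≤ C) (hτ : τ ≤ 1) {U U' : H} {f f' : S.𝕌} {g : S.𝕍}
    (h1 : S.PU (S.A U) = f) (h2 : S.PU (S.A U') = f')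
    (h3 : S.PV (S.A U') - S.PV (S.L (S.M u) U) = g) :
    ‖S.bstar u (S.PU U') - S.dhstar u (S.PU U)‖ ≤ (1 + ‖S.A‖ * C * (1 + 2 * ‖S.A‖))
      * (‖f‖ + ‖f'‖ + ‖g‖ + ‖S.fluctuation u U'‖) := by
  rw [h.chapmanEnskog h1 h2 h3]
  set w := S.fluctuation u U'
  have hT : ∀ z, ‖fderiv ℝ S.vstar u z‖ ≤ ‖z‖ := fun z => by
    simpa using ContinuousLinearMap.le_of_opNorm_le _ (h.norm_fderiv_le.trans hτ) z
  set z := fderiv ℝ S.vstar u f' + S.A22 w - fderiv ℝ S.vstar u (S.A12 w) - g with hz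
  have b1 : ‖z‖ ≤ ‖f'‖ + ‖S.A‖ * ‖w‖ + ‖S.A‖ * ‖w‖ + ‖g‖ :=
    (norm_sub_le _ _).trans (add_le_add ((norm_sub_le _ _).trans (add_le_add ((norm_add_le _ _).trans
      (add_le_add (hT _) (S.norm_A22_le w))) ((hT _).trans (S.norm_A12_le w)))) le_rfl)
  have b2 : ‖z‖ ≤ (1 + 2 * ‖S.A‖) * (‖f‖ + ‖f'‖ + ‖g‖ + ‖w‖) := by
    have n1 := norm_nonneg f
    have n2 := norm_nonneg w
    have n3 := mul_nonneg (norm_nonneg S.A) (add_nonneg (add_nonneg n1 (norm_nonneg f')) (norm_nonneg g))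
    linarith
  have b3 : ‖S.A12 ((S.dvqM u).inverse z)‖
      ≤ ‖S.A‖ * (C * ((1 + 2 * ‖S.A‖) * (‖f‖ + ‖f'‖ + ‖g‖ + ‖w‖))) := by
    refine (S.norm_A12_le _).trans (mul_le_mul_of_nonneg_left ?_ (norm_nonneg _))
    exact (ContinuousLinearMap.le_of_opNorm_le _ h.norm_inverse_le _).trans
      (mul_le_mul_of_nonneg_left b2 hC)
  refine (norm_add_le _ _).trans ?_
  rw [norm_neg]
  have n1 := norm_nonneg f'
  have n2 := norm_nonneg w
  have n3 := norm_nonneg g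
  linarith

/-- The microscopic equation is solved for the fluctuation of `U` by inverting `∂_v q`. -/
lemma norm_fluctuation_le (hC : 0 ≤ C) {U U' : H} {g : S.𝕍}
    (h3 : S.PV (S.A U') - S.PV (S.L (S.M u) U) = g) :
    ‖S.fluctuation u U‖ ≤ C * ‖S.A‖ * ‖U'‖ + C * ‖g‖ := by
  have e : S.fluctuation u U = (S.dvqM u).inverse (S.PV (S.A U') - g) := by
    rw [← h.inverse_apply (S.fluctuation u U), ← h.PV_L_eq, ← h3, sub_sub_cancel]
  rw [e]
  have b1 : ‖S.PV (S.A U') - g‖ ≤ ‖S.A‖ * ‖U'‖ + ‖g‖ :=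
    (norm_sub_le _ _).trans (add_le_add ((S.norm_PV_le _).trans (S.A.le_opNorm _)) le_rfl)
  calc _ ≤ C * ‖S.PV (S.A U') - g‖ := ContinuousLinearMap.le_of_opNorm_le _ h.norm_inverse_le _
    _ ≤ C * (‖S.A‖ * ‖U'‖ + ‖g‖) := by gcongr
    _ = _ := by ring

end NearEquilibrium

lemma le_of_absorbed {C K ε x z R u : ℝ} (hC : 0 ≤ C) (hK : 0 ≤ K) (hε : 0 < ε) (hε1 : ε ≤ 1)
    (hx : 0 ≤ x) (hR : 0 ≤ R) (h1 : z ≤ C * (ε * x + R)) (h2 : x ≤ C * ε⁻¹ * R)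
    (h3 : u ≤ K * (x + z + R)) : u ≤ K * (1 + C) ^ 2 * (ε⁻¹ * R) := by
  have e1 : R ≤ ε⁻¹ * R := le_mul_of_one_le_left hR ((one_le_inv₀ hε).2 hε1)
  have e2 : ε * x ≤ 1 * x := by gcongr
  have e3 : C * (ε * x + R) ≤ C * (x + ε⁻¹ * R) := by gcongr; linarith
  have e5 : (1 + C) * x ≤ (1 + C) * (C * ε⁻¹ * R) := by gcongr
  have e4 : x + z + R ≤ (1 + C) * ((1 + C) * (ε⁻¹ * R)) := by linarith
  calc u ≤ K * ((1 + C) * ((1 + C) * (ε⁻¹ * R))) := h3.trans (by gcongr)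
    _ = _ := by ring

/-- Dictionary: `x`, `y` are the norms of `P_𝕌 U`, `P_𝕌 U'`; `W`, `X` those of the fluctuations of
`U`, `U'`; `u`, `u'` the full norms; `F`, `F₁`, `F₂`, `G`, `G₁` the data; and `r` the Chapman-Enskog
residual. Eliminating `u`, `W` and `r` leads to `exists_absorption`. -/
lemma exists_closed_estimate {C₁ K₁ A : ℝ} (hC₁ : 0 ≤ C₁) (hK₁ : 0 ≤ K₁) (hA : 0 ≤ A) :
    ∃ ν > 0, ∀ B ≥ 1, ∃ ε₀ C₀ : ℝ, 0 < ε₀ ∧ ε₀ ≤ 1 ∧ 0 < C₀ ∧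
      ∀ {ε x y X W u u' F F₁ F₂ G G₁ r : ℝ}, 0 < ε → ε ≤ ε₀ → 0 ≤ x → 0 ≤ y → 0 ≤ X → 0 ≤ F → 0 ≤ F₁ →
      0 ≤ F₂ → 0 ≤ G → 0 ≤ G₁ → x ≤ u → y ≤ C₁ * (ε * x + (r + F + F₁)) →
      r ≤ K₁ * (F + F₁ + G + X) → X ≤ ν * y + B * (F₂ + G₁ + ε ^ 2 * u) → u' ≤ 2 * y + X →
      u ≤ 2 * x + W → W ≤ A * u' + A * G →
      u' ≤ C₀ * (ε * u + (F + F₁ + F₂ + G + G₁)) ∧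
      (x ≤ C₁ * ε⁻¹ * (r + F + F₁) → u ≤ C₀ * ε⁻¹ * (F + F₁ + F₂ + G + G₁)) := by
  obtain ⟨ν, hν, habs⟩ := exists_absorption (C := C₁ + 1) (K := K₁ + 1) (by linarith) (by linarith)
  refine ⟨ν, hν, fun B hB => ?_⟩
  set K₃ := 2 + 2 * A with hK₃
  have hK₃0 : 0 < K₃ := by positivity
  have hB0 : 0 < B := by linarith
  obtain ⟨ε₂, C₂, hε₂, hC₂, habs⟩ := habs (B * (1 + K₃)) (by
    have : 1 * 1 ≤ B * (1 + K₃) := by gcongr; linarith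
    linarith)
  refine ⟨min 1 ε₂, 2 * C₂ + K₃ * (1 + C₂) ^ 2, by positivity, min_le_left _ _, by positivity, ?_⟩
  intro ε x y X W u u' F F₁ F₂ G G₁ r hε hε₀ hx hy hX hF hF₁ hF₂ hG hG₁ hxu h1 h2 h3 h4 h5 h6
  have hε1 : ε ≤ 1 := hε₀.trans (min_le_left _ _)
  set R := F + F₁ + F₂ + G + G₁ with hR
  have nR : 0 ≤ R := by positivity
  have hsum : r + F + F₁ ≤ (K₁ + 1) * (R + X) := by
    have : 0 ≤ K₁ * (F₂ + G₁) := by positivity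
    rw [hR]
    linarith
  have nS : 0 ≤ (K₁ + 1) * (R + X) := by positivity
  have a1 : y ≤ (C₁ + 1) * (ε * x + (K₁ + 1) * (R + X)) := by
    calc y ≤ C₁ * (ε * x + (K₁ + 1) * (R + X)) := h1.trans (by gcongr)
      _ ≤ _ := by gcongr; linarith
  have hu : u ≤ K₃ * (x + (y + X) + R) := by
    have e2 : A * u' ≤ A * (2 * y + X) := by gcongr
    have e3 : A * G ≤ A * R := by gcongr; rw [hR]; linarith
    have e5 : 0 ≤ A * (2 * x + X + R) := by positivity
    rw [hK₃]
    linarith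
  have a2 : X ≤ ν * y + B * (1 + K₃) * (R + ε ^ 2 * (x + y + X)) := by
    refine h3.trans (add_le_add le_rfl ?_)
    rw [mul_assoc]
    refine mul_le_mul_of_nonneg_left ?_ hB0.le
    have e1 : ε ^ 2 * u ≤ ε ^ 2 * (K₃ * (x + (y + X) + R)) := by gcongr
    have e2 : ε ^ 2 * (K₃ * R) ≤ 1 * (K₃ * R) := by gcongr; exact pow_le_one₀ hε.le hε1
    have e3 : 0 ≤ ε ^ 2 * (x + y + X) := by positivity
    have e4 : F₂ + G₁ ≤ R := by rw [hR]; linarith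
    linarith
  obtain ⟨r1, r2⟩ := habs hε (hε₀.trans (min_le_right _ _)) hx hy hX nR a1 a2
  have hu0 : 0 ≤ u := hx.trans hxu
  constructor
  · have e1 : C₂ * (ε * x + R) ≤ C₂ * (ε * u + R) := by gcongr
    have e2 : 0 ≤ K₃ * (1 + C₂) ^ 2 * (ε * u + R) := by positivity
    linarith
  · intro h0
    have a3 : x ≤ (C₁ + 1) * ε⁻¹ * ((K₁ + 1) * (R + X)) := by
      calc x ≤ C₁ * ε⁻¹ * ((K₁ + 1) * (R + X)) := h0.trans (by gcongr)
        _ ≤ _ := by gcongr; linarith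
    have r4 := le_of_absorbed hC₂.le hK₃0.le hε hε1 hx nR r1 (r2 a3) hu
    refine r4.trans ?_
    rw [mul_assoc _ ε⁻¹]
    refine mul_le_mul_of_nonneg_right ?_ (by positivity)
    linarith

variable {M : ReducedModel S.𝕌}

lemma LinearizedSolution.linearProblem (hD : M.D = S.dhstar)
    (hu : M.u₀ = S.u₀) (hN : M.N = S.N) {K c₁ k₀ θ ε : ℝ} {ubar : ℝ → S.𝕌} {a A m : ℝ → ℝ}
    {k k1 : ℝ → S.𝕌} (h : ShockLayer M K c₁ k₀ θ ε ubar a A m k k1) {w : ℝ → ℝ} {U U' : ℝ → H}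
    {f f' f'' : ℝ → S.𝕌} {g g' : ℝ → S.𝕍}
    (hs : S.LinearizedSolution (weightedMeasure w) ubar U U' f f' f'' g g') :
    LinearProblem M w ubar (fun x => S.PU (U x)) (fun x => S.PU (U' x)) f f'
      (fun x => M.b (ubar x) (S.PU (U' x)) - M.D (ubar x) (S.PU (U x))) where
  prim_u := hs.prim_U.clm S.PU
  prim_f := hs.prim_f
  memLp_u := S.PU.comp_memLp' hs.memLp_U
  memLp_u' := S.PU.comp_memLp' hs.memLp_U'
  memLp_f := hs.memLp_f
  memLp_f' := hs.memLp_f'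
  memLp_G := by
    have cu : Continuous ubar := continuous_iff_continuousAt.2 fun x => (h.hasDerivAt x).continuousAt
    refine ((S.PU.comp_memLp' hs.memLp_U').clm_apply_of_continuous (C := M.C)
      (Φ := fun x => M.b (ubar x)) (continuous_iff_continuousAt.2 fun x => ?_)
      fun x => M.norm_b_le _ (h.mem x)).sub ((S.PU.comp_memLp' hs.memLp_U).clm_apply_of_continuous
      (C := M.C) (Φ := fun x => M.D (ubar x)) (continuous_iff_continuousAt.2 fun x => ?_)
      fun x => M.norm_D_le _ (h.mem x))
    · exact ContinuousAt.comp (g := M.b) (M.hasFDerivAt_b _ (h.mem x)).continuousAt cu.continuousAt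
    · exact ContinuousAt.comp (g := M.D) (M.hasFDerivAt_D _ (h.mem x)).continuousAt cu.continuousAt
  eq := Eventually.of_forall fun x => by abel
  -- Against `N` the coupling `A₁₂ v` disappears, so the macroscopic equation becomes an algebraic
  -- constraint on `u` alone.
  constraint := fun x n hn => by
    rw [hN] at hn
    rw [hD, hu, S.dhstar_u₀, ← hs.macro_eq x, S.PU_A, inner_add_left, S.inner_A12_N _ hn, add_zero]

/-- Combines `linear_estimate`, whose source is the Chapman-Enskog residual, with the fluctuation
estimates for `U` and `U'`. The constants of the reduced problem fix `ν`; `ν` fixes `τ₀` and `B`;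
`B` fixes the size of `ε`. -/
theorem exists_linearized_estimate (hD : M.D = S.dhstar) (hb : M.b = S.bstar)
    (hu : M.u₀ = S.u₀) (hN : M.N = S.N) {K c₁ k₀ : ℝ} (hK : 0 < K) (hc₁ : 0 < c₁) (hk₀ : 0 < k₀)
    {C c K' : ℝ} (hC : 0 < C) (hc : 0 < c) (hK' : 0 ≤ K') :
    ∃ C₀ θ₀ τ₀ ε₀ δ₀ : ℝ, 0 < C₀ ∧ 0 < θ₀ ∧ 0 < τ₀ ∧ τ₀ ≤ 1 ∧ 0 < ε₀ ∧ ε₀ ≤ 1 ∧ 0 < δ₀ ∧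
      ∀ {θ τ ε : ℝ} {ubar : ℝ → S.𝕌} {a A m : ℝ → ℝ} {k k1 : ℝ → S.𝕌} {m₁ m₂ : ℝ → H},
      ShockLayer M K c₁ k₀ θ ε ubar a A m k k1 → S.EquilibriumPath C c K' τ ε ubar m₁ m₂ →
      θ ≤ θ₀ → τ ≤ τ₀ → ε ≤ ε₀ →
      ∀ {p p' : ℝ → ℝ} {η : ℝ}, SlowWeight p p' (η / 2) → 0 ≤ η → η ≤ δ₀ * ε →
      ∀ {μ : Measure ℝ} {U U' : ℝ → H} {f f' f'' : ℝ → S.𝕌} {g g' : ℝ → S.𝕍},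
      μ = (weightedMeasure fun x => p x ^ 2) → S.LinearizedSolution μ ubar U U' f f' f'' g g' →
      l2Norm μ U' ≤ C₀ * (ε * l2Norm μ U
        + (l2Norm μ f + l2Norm μ f' + l2Norm μ f'' + l2Norm μ g + l2Norm μ g')) ∧
      (⟪M.ell, S.PU (U 0)⟫_ℝ = 0 → l2Norm μ U ≤ C₀ * ε⁻¹ *
        (l2Norm μ f + l2Norm μ f' + l2Norm μ f'' + l2Norm μ g + l2Norm μ g')) := by
  obtain ⟨C₁, θ₀, ε₁, δ₁, hC₁, hθ₀, hε₁, hδ₁, hlin⟩ := ShockLayer.linear_estimate M hK hc₁ hk₀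
  have hK₁ : 0 ≤ 1 + ‖S.A‖ * C * (1 + 2 * ‖S.A‖) := by positivity
  have hA : 0 ≤ C * (1 + ‖S.A‖) := by positivity
  obtain ⟨ν, hν, habs⟩ := exists_closed_estimate hC₁.le hK₁ hA
  obtain ⟨τ₀, η₀, B, hτ₀, hτ₀1, hη₀, hB, hfl⟩ := S.exists_fluctuation_estimate hC hc hK' hν
  obtain ⟨ε₂, C₀, hε₂, hε₂1, hC₀, habs⟩ := habs B hB
  refine ⟨C₀, θ₀, τ₀, min ε₁ ε₂, min δ₁ η₀, hC₀, hθ₀, hτ₀, hτ₀1, by positivity,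
    (min_le_right _ _).trans hε₂1, by positivity, ?_⟩
  intro θ τ ε ubar a A m k k1 m₁ m₂ h hp hθ hτ hε p p' η hw hη hηδ μ U U' f f' f'' g g' hμ hs
  subst hμ
  have hε0 := h.ε_pos
  have hε1 : ε ≤ 1 := hε.trans ((min_le_right _ _).trans hε₂1)
  have hτ1 := hτ.trans hτ₀1
  have hη1 : η ≤ δ₁ * ε := hηδ.trans (by gcongr; exact min_le_left _ _)
  have hη2 : η ≤ η₀ := hηδ.trans (by
    calc min δ₁ η₀ * ε ≤ η₀ * 1 := by gcongr; exact min_le_right _ _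
      _ = η₀ := mul_one _)
  obtain ⟨l1, l2⟩ := hlin h hθ (hε.trans (min_le_left _ _)) hw.sq hη hη1
    (hs.linearProblem hD hu hN h)
  have l3 := hfl hp hτ hw hη hη2 hs
  have gG := (((((L2Bound.of_memLp hs.memLp_f).add (L2Bound.of_memLp hs.memLp_f')).add
      (L2Bound.of_memLp hs.memLp_g)).add (L2Bound.of_memLp (hp.memLp_fluctuation hs.memLp_U'))).const_mul
      hK₁).l2Norm_le_of_ae (f := fun x => M.b (ubar x) (S.PU (U' x)) - M.D (ubar x) (S.PU (U x)))
        (ae_weightedMeasure (by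
    filter_upwards [hs.macro_eq_deriv, hs.micro_eq] with t t1 t2
    rw [hb, hD]
    exact (hp.near t).norm_residual_le hC.le hτ1 (hs.macro_eq t) t1 t2))
  have hw2 := (((L2Bound.of_memLp hs.memLp_U').const_mul hA).add
      ((L2Bound.of_memLp hs.memLp_g).const_mul hA)).l2Norm_le_of_ae
      (f := fun t => S.fluctuation (ubar t) (U t)) (ae_weightedMeasure (by
    filter_upwards [hs.micro_eq] with t t2
    refine ((hp.near t).norm_fluctuation_le hC.le t2).trans ?_
    gcongr
    · exact le_add_of_nonneg_left zero_le_one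
    · exact le_mul_of_one_le_right hC.le (le_add_of_nonneg_right (norm_nonneg _))))
  exact habs hε0 (hε.trans (min_le_right _ _)) (l2Norm_nonneg _) (l2Norm_nonneg _) (l2Norm_nonneg _)
    (l2Norm_nonneg _) (l2Norm_nonneg _) (l2Norm_nonneg _) (l2Norm_nonneg _) (l2Norm_nonneg _)
    ((L2Bound.of_memLp hs.memLp_U).l2Norm_le_of_ae (Eventually.of_forall fun t => S.norm_PU_le (U t)))
    l1 gG l3 (hp.l2Norm_le hτ1 hs.memLp_U') (hp.l2Norm_le hτ1 hs.memLp_U) hw2 |>.imp id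
    fun H h0 => H (l2 h0)

end RelaxationSystem

/-! ## Weighted Sobolev norms through continuous representatives -/

section Representatives

lemma slowWeight_expWeight {ε δ : ℝ} (hε : 0 ≤ ε) (hδ : 0 ≤ δ) : SlowWeight (expWeight ε δ)
    (fun x => δ * ε * japaneseDeriv x * expWeight ε δ x) (δ * ε / 2) where
  isPrimitive := IsPrimitive.of_hasDerivAt (hasDerivAt_expWeight ε δ)
    ((continuous_const.mul (bddDeriv_japanese 0).1.1).mul (continuous_expWeight _ _))
  pos := expWeight_pos ε δ
  deriv_le := Eventually.of_forall fun x => by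
    have h1 := expWeight_pos ε δ x
    have h2 := abs_japaneseDeriv_le x
    rw [abs_mul, abs_mul, abs_of_pos h1, abs_of_nonneg (mul_nonneg hδ hε)]
    calc δ * ε * |japaneseDeriv x| * expWeight ε δ x ≤ δ * ε * 1 * expWeight ε δ x := by gcongr
      _ = _ := by ring

/-- A function of `H^s_{ε,δ}` has a chain of primitives representing its weak derivatives. -/
lemma MemWeightedHs.exists_primitives {E : Type*} [NormedAddCommGroup E] [NormedSpace ℝ E]
    [CompleteSpace E] {ε δ : ℝ} {s : ℕ} {f : ℝ → E} (h : MemWeightedHs ε δ s f) :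
    ∃ F : ℕ → ℝ → E, (∀ k < s, IsPrimitive (F k) (F (k + 1))) ∧
      (∀ k ≤ s, weakDeriv^[k] f =ᵐ[volume] F k) ∧
      (∀ k ≤ s, MemLp (F k) 2 (weightedMeasure fun x => expWeight ε δ x ^ 2)) ∧
      weightedHsNorm ε δ s f = Real.sqrt ε * ∑ k ∈ Finset.range (s + 1),
        ε⁻¹ ^ k * l2Norm (weightedMeasure fun x => expWeight ε δ x ^ 2) (F k) := by
  obtain ⟨h1, h2⟩ := h.iterate
  choose! P hP1 hP2 using fun k (hk : k < s) => (h2 k hk).exists_isPrimitive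
  -- Continuous representatives exist only below the top order; the top weak derivative is kept as
  -- it is.
  set F : ℕ → ℝ → E := fun k => if k < s then P k else weakDeriv^[k] f with hF
  have hae : ∀ k ≤ s, weakDeriv^[k] f =ᵐ[volume] F k := by
    intro k hk
    by_cases hks : k < s
    · simp only [hF, if_pos hks]; exact hP2 k hks
    · simp only [hF, if_neg hks]; rfl
  have hmem : ∀ k ≤ s, MemLp (fun x => expWeight ε δ x • F k x) 2 volume := fun k hk =>
    (h1 k hk).ae_eq ((hae k hk).mono fun x hx => by simp only [hx])
  have hc := continuous_expWeight ε δ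
  have hp := expWeight_pos ε δ
  refine ⟨F, fun k hk => ?_, hae, fun k hk => (memLp_weightedMeasure_iff hc hp).2 (hmem k hk), ?_⟩
  · have e : F k = P k := by simp only [hF, if_pos hk]
    rw [e]
    exact (hP1 k hk).congr_deriv (hae (k + 1) hk)
  · rw [weightedHsNorm]
    congr 1
    refine Finset.sum_congr rfl fun k hk => ?_
    have hk' : k ≤ s := Nat.lt_succ_iff.1 (Finset.mem_range.1 hk)
    congr 1
    have e1 : eLpNorm (fun x => expWeight ε δ x • (weakDeriv^[k] f) x) 2 volume
        = eLpNorm (fun x => expWeight ε δ x • F k x) 2 volume :=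
      eLpNorm_congr_ae ((hae k hk').mono fun x hx => by simp only [hx])
    rw [e1]
    refine (pow_left_inj₀ ENNReal.toReal_nonneg (l2Norm_nonneg _) two_ne_zero).1 ?_
    rw [l2Norm_sq ((memLp_weightedMeasure_iff hc hp).2 (hmem k hk')),
      integral_sq_weightedMeasure hc hp (hmem k hk')]

end Representatives

/-! ### The differentiated system and the summation of scaled norms -/

namespace RelaxationSystem

variable {H : Type*} [NormedAddCommGroup H] [InnerProductSpace ℝ H] [CompleteSpace H]
  {S : RelaxationSystem H}

/-- The derivative of a solution of the linearized system solves a linearized system. -/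
lemma LinearizedSolution.deriv {C c K τ ε : ℝ} {ubar : ℝ → S.𝕌} {m₁ m₂ : ℝ → H}
    (hp : S.EquilibriumPath C c K τ ε ubar m₁ m₂) {w : ℝ → ℝ} {U U' U'' : ℝ → H}
    {f f' f'' f''' : ℝ → S.𝕌} {g g' g'' : ℝ → S.𝕍}
    (hs : S.LinearizedSolution (weightedMeasure w) ubar U U' f f' f'' g g') (pU : IsPrimitive U' U'')
    (pf : IsPrimitive f'' f''') (pg : IsPrimitive g' g'') (mU : MemLp U'' 2 (weightedMeasure w))
    (mf : MemLp f''' 2 (weightedMeasure w)) (mg : MemLp g'' 2 (weightedMeasure w)) :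
    S.LinearizedSolution (weightedMeasure w) ubar U' U'' f' f'' f''' (fun x => g' x + S.PV (S.L (m₁ x) (U x)))
      (fun x => g'' x + S.PV (S.L (m₁ x) (U' x) + S.L (m₂ x) (U x))) where
  prim_U := pU
  prim_f := hs.prim_f'
  prim_f' := pf
  prim_g := pg.add ((isPrimitive_L hp.prim_m₁ hs.prim_U).clm S.PV)
  memLp_U := hs.memLp_U'
  memLp_U' := mU
  memLp_f := hs.memLp_f'
  memLp_f' := hs.memLp_f''
  memLp_f'' := mf
  memLp_g := hs.memLp_g'.add (S.PV.comp_memLp' (memLp_L hp.continuous_m₁ hp.norm_m₁_le hs.memLp_U))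
  memLp_g' := mg.add (S.PV.comp_memLp' ((memLp_L hp.continuous_m₁ hp.norm_m₁_le hs.memLp_U').add
    (memLp_L hp.continuous_m₂ hp.norm_m₂_le hs.memLp_U)))
  macro_eq := fun x => by
    have h1 : (fun x => S.PU (S.A (U' x))) =ᵐ[volume] f' := hs.macro_eq_deriv
    exact congrFun ((((S.PU ∘L S.A).continuous.comp pU.continuous).ae_eq_iff_eq volume
      hs.prim_f'.continuous).1 h1) x
  micro_eq := by
    have p1 := isPrimitive_L (S := S) hp.prim_M hs.prim_U
    have h1 : (fun x => S.PV (S.A (U' x))) =ᵐ[volume]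
        fun x => g x + S.PV (S.L (S.M (ubar x)) (U x)) :=
      hs.micro_eq.mono fun x hx => (eq_add_of_sub_eq hx)
    -- Both sides are continuous, so the microscopic equation holds everywhere and may be
    -- differentiated pointwise almost everywhere. The derivative of the coefficient goes into the
    -- new source.
    have h2 := (((S.PV ∘L S.A).continuous.comp pU.continuous).ae_eq_iff_eq volume
      (hs.prim_g.continuous.add (S.PV.continuous.comp p1.continuous))).1 h1
    filter_upwards [pU.ae_hasDerivAt, hs.prim_g.ae_hasDerivAt, p1.ae_hasDerivAt] with x d1 d2 d3
    have d4 := (S.PV ∘L S.A).hasFDerivAt.comp_hasDerivAt x d1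
    have d5 := d2.add (S.PV.hasFDerivAt.comp_hasDerivAt x d3)
    have e := (d4.congr_of_eventuallyEq (Eventually.of_forall fun y => (congrFun h2 y).symm)).unique d5
    have e' : S.PV (S.A (U'' x)) = g' x + S.PV (S.L (S.M (ubar x)) (U' x) + S.L (m₁ x) (U x)) := e
    rw [e', map_add]
    abel

/-- The commutators come from differentiating `M(ubar)`, at most twice, and each derivative is
`O(ε²)`. They carry the same power `ε²` as the gap between `U` and `U''` in the scaled norm. -/
lemma EquilibriumPath.l2Norm_source_le {C c K τ ε : ℝ} {ubar : ℝ → S.𝕌} {m₁ m₂ : ℝ → H}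
    (hp : S.EquilibriumPath C c K τ ε ubar m₁ m₂) (hK : 0 ≤ K) {μ : Measure ℝ} {U U' : ℝ → H}
    {g' g'' : ℝ → S.𝕍} (mU : MemLp U 2 μ) (mU' : MemLp U' 2 μ) (mg : MemLp g' 2 μ) (mg' : MemLp g'' 2 μ) :
    l2Norm μ (fun x => g' x + S.PV (S.L (m₁ x) (U x)))
      ≤ l2Norm μ g' + 2 * ‖S.Q‖ * K * ε ^ 2 * l2Norm μ U ∧
    l2Norm μ (fun x => g'' x + S.PV (S.L (m₁ x) (U' x) + S.L (m₂ x) (U x)))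
      ≤ l2Norm μ g'' + (2 * ‖S.Q‖ * K * ε ^ 2 * l2Norm μ U' + 2 * ‖S.Q‖ * K * ε ^ 2 * l2Norm μ U) := by
  have hb : 0 ≤ 2 * ‖S.Q‖ * K * ε ^ 2 := by positivity
  have key : ∀ {m : H} (V : H), ‖m‖ ≤ K * ε ^ 2 → ‖S.L m V‖ ≤ 2 * ‖S.Q‖ * K * ε ^ 2 * ‖V‖ :=
    fun {m} V hm => (S.norm_L_apply_le _ _).trans (by
      calc 2 * ‖S.Q‖ * ‖m‖ * ‖V‖ ≤ 2 * ‖S.Q‖ * (K * ε ^ 2) * ‖V‖ := by gcongr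
        _ = _ := by ring)
  refine ⟨((L2Bound.of_memLp mg).add ((L2Bound.of_memLp mU).const_mul hb)).l2Norm_le_of_ae
    (Eventually.of_forall fun x => (norm_add_le _ _).trans (add_le_add le_rfl
      ((S.norm_PV_le _).trans (key _ (hp.norm_m₁_le x))))),
    ((L2Bound.of_memLp mg').add (((L2Bound.of_memLp mU').const_mul hb).add
      ((L2Bound.of_memLp mU).const_mul hb))).l2Norm_le_of_ae
    (Eventually.of_forall fun x => (norm_add_le _ _).trans (add_le_add le_rfl
      ((S.norm_PV_le _).trans ((norm_add_le _ _).trans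
        (add_le_add (key _ (hp.norm_m₁_le x)) (key _ (hp.norm_m₂_le x)))))))⟩

/-- Here `e = ε⁻¹`, and `u₀`, `u₁`, `u₂` are the norms of `U`, `U'`, `U''`. Only `h0` loses a factor
`e`; each further derivative gains `ε`, which offsets the scaling of the norm. The third derivative
of `f` enters through `h2`, the estimate of the differentiated system. -/
lemma scaled_sum_le {C B e ε u₀ u₁ u₂ F₀ F₁ F₂ F₃ G₀ G₁ G₂ g₁ g₂ : ℝ} (hC : 0 ≤ C) (hB : 0 ≤ B)
    (he : 1 ≤ e) (heε : e * ε = 1) (hu₁ : 0 ≤ u₁) (hF₀ : 0 ≤ F₀) (hF₁ : 0 ≤ F₁)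
    (hF₂ : 0 ≤ F₂) (hF₃ : 0 ≤ F₃) (hG₀ : 0 ≤ G₀) (hG₁ : 0 ≤ G₁) (hG₂ : 0 ≤ G₂)
    (h0 : u₀ ≤ C * e * (F₀ + F₁ + F₂ + G₀ + G₁)) (h1 : u₁ ≤ C * (ε * u₀ + (F₀ + F₁ + F₂ + G₀ + G₁)))
    (h2 : u₂ ≤ C * (ε * u₁ + (F₁ + F₂ + F₃ + g₁ + g₂))) (hg₁ : g₁ ≤ G₁ + B * ε ^ 2 * u₀)
    (hg₂ : g₂ ≤ G₂ + (B * ε ^ 2 * u₁ + B * ε ^ 2 * u₀)) :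
    u₀ + e * u₁ + e ^ 2 * u₂ ≤ (C + (C ^ 2 + C) + C * ((1 + B) * (C ^ 2 + C) + 1 + 2 * B * C)) * e *
      ((F₀ + e * F₁ + e ^ 2 * F₂ + e ^ 3 * F₃) + (G₀ + e * G₁ + e ^ 2 * G₂)) := by
  have he0 : 0 ≤ e := by linarith
  set Z := (F₀ + e * F₁ + e ^ 2 * F₂ + e ^ 3 * F₃) + (G₀ + e * G₁ + e ^ 2 * G₂) with hZ
  have he2 : 1 ≤ e ^ 2 := one_le_pow₀ he
  have f1 : F₁ ≤ e * F₁ := le_mul_of_one_le_left hF₁ he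
  have f2 : F₂ ≤ e ^ 2 * F₂ := le_mul_of_one_le_left hF₂ he2
  have f3 : 0 ≤ e ^ 3 * F₃ := by positivity
  have f4 : 0 ≤ e ^ 2 * G₂ := by positivity
  have f5 : G₁ ≤ e * G₁ := le_mul_of_one_le_left hG₁ he
  have hR : F₀ + F₁ + F₂ + G₀ + G₁ ≤ Z := by rw [hZ]; linarith
  have b0 : u₀ ≤ C * (e * Z) := by
    calc u₀ ≤ C * e * Z := h0.trans (by gcongr)
      _ = _ := by ring
  have b1 : e * u₁ ≤ (C ^ 2 + C) * (e * Z) := by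
    calc e * u₁ ≤ e * (C * (ε * u₀ + Z)) := by gcongr; exact h1.trans (by gcongr)
      _ = C * ((e * ε) * u₀ + e * Z) := by ring
      _ ≤ C * (1 * (C * (e * Z)) + e * Z) := by rw [heε]; gcongr
      _ = _ := by ring
  have b2 : e ^ 2 * (F₁ + F₂ + F₃ + G₁ + G₂) ≤ e * Z := by
    have i1 : e ^ 2 * F₂ ≤ e ^ 2 * (e * F₂) := by gcongr; exact le_mul_of_one_le_left hF₂ he
    have i2 : e ^ 2 * F₃ ≤ e ^ 2 * (e ^ 2 * F₃) := by gcongr; exact le_mul_of_one_le_left hF₃ he2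
    have i3 : e ^ 2 * G₂ ≤ e ^ 2 * (e * G₂) := by gcongr; exact le_mul_of_one_le_left hG₂ he
    have i4 : 0 ≤ e * (F₀ + G₀) := by positivity
    rw [hZ]
    linarith
  have b3 : e ^ 2 * u₂ ≤ C * ((1 + B) * (C ^ 2 + C) + 1 + 2 * B * C) * (e * Z) := by
    have j1 : u₁ ≤ e * u₁ := le_mul_of_one_le_left hu₁ he
    have j2 : e ^ 2 * ε ^ 2 = 1 := by rw [← mul_pow, heε, one_pow]
    have j3 : e ^ 2 * ε = e := by rw [pow_two, mul_assoc, heε, mul_one]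
    calc e ^ 2 * u₂ ≤ e ^ 2 * (C * (ε * u₁ + (F₁ + F₂ + F₃ + (G₁ + B * ε ^ 2 * u₀)
            + (G₂ + (B * ε ^ 2 * u₁ + B * ε ^ 2 * u₀))))) := by
          gcongr; exact h2.trans (by gcongr)
      _ = C * ((e ^ 2 * ε) * u₁ + e ^ 2 * (F₁ + F₂ + F₃ + G₁ + G₂)
            + B * (e ^ 2 * ε ^ 2) * (u₁ + 2 * u₀)) := by ring
      _ ≤ C * ((C ^ 2 + C) * (e * Z) + e * Z + B * 1 * ((C ^ 2 + C) * (e * Z) + 2 * (C * (e * Z)))) := by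
          rw [j2, j3]
          gcongr
          exact j1.trans b1
      _ = _ := by ring
  calc u₀ + e * u₁ + e ^ 2 * u₂ ≤ C * (e * Z) + (C ^ 2 + C) * (e * Z)
        + C * ((1 + B) * (C ^ 2 + C) + 1 + 2 * B * C) * (e * Z) := add_le_add (add_le_add b0 b1) b3
    _ = _ := by ring

end RelaxationSystem

end

/-! ### The weighted estimate for the linearized profile equation -/

theorem mainTheorem10 {H : Type*} [NormedAddCommGroup H] [InnerProductSpace ℝ H]
    [CompleteSpace H] (S : RelaxationSystem H) (hred : S.GoodReduced)
    (α : S.𝕌 → ℝ) (r : S.𝕌) (hα : S.GenuinelyNonlinear α r) (κ : ℝ) (hκ : 0 < κ) :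
    ∃ C ε₀ δ₀ ρ : ℝ, 0 < C ∧ 0 < ε₀ ∧ 0 < δ₀ ∧ 0 < ρ ∧
      ∀ (ε : ℝ) (um up : S.𝕌) (ubar : ℝ → S.𝕌),
        ε = ‖up - um‖ → 0 < ε → ε ≤ ε₀ →
        um ∈ Metric.ball S.u₀ ρ → up ∈ Metric.ball S.u₀ ρ →
        ‖ε⁻¹ • (up - um) - r‖ ≤ ρ →
        S.IsNSProfile um up ubar → (∀ x, ubar x ∈ Metric.ball S.u₀ ρ) →
        κ * ε ≤ ‖ubar 0 - um‖ → κ * ε ≤ ‖ubar 0 - up‖ →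
        ∃ ℓ : S.𝕌, ‖ℓ‖ = 1 ∧
          ∀ δ : ℝ, 0 ≤ δ → δ ≤ δ₀ →
          ∀ (f : ℝ → S.𝕌) (g : ℝ → S.𝕍) (U : ℝ → H),
            MemWeightedHs ε δ 3 f → MemWeightedHs ε δ 2 g → MemWeightedHs ε δ 2 U →
            Continuous U →
            S.SolvesLinearized ubar U f g → ⟪ℓ, S.PU (U 0)⟫_ℝ = 0 →
            weightedHsNorm ε δ 2 U ≤
              C * ε⁻¹ * (weightedHsNorm ε δ 3 f + weightedHsNorm ε δ 2 g) := by
  obtain ⟨M, hh, hD, hb, hu, hr, hN⟩ := RelaxationSystem.exists_reducedModel hred hα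
  obtain ⟨K, c₁, k₀, θ₁, hK, hc₁, hk₀, hθ₁, hlayer⟩ := SmallShock.exists_layer M hκ
  obtain ⟨C, c, hC, hc, hnear⟩ := S.exists_nearEquilibrium
  have hK' : 0 ≤ 4 * K + 6 * K ^ 2 + 4 * C * K ^ 2 := by positivity
  set K' := 4 * K + 6 * K ^ 2 + 4 * C * K ^ 2 with hK'def
  obtain ⟨C₀, θ₀, τ₀, ε₀, δ₀, hC₀, hθ₀, hτ₀, hτ₀1, hε₀, hε₀1, hδ₀, hest⟩ :=
    RelaxationSystem.exists_linearized_estimate hD hb hu hN hK hc₁ hk₀ hC hc hK'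
  obtain ⟨ρ₁, hρ₁, hshock⟩ := RelaxationSystem.exists_smallShock hh hb hu (θ := min θ₁ θ₀) (by positivity)
  -- The ball is selected last: `τ₀` was produced by an estimate whose constants depend on `C` and
  -- `c`.
  obtain ⟨ρ₂, hρ₂, hball⟩ := Metric.eventually_nhds_iff_ball.1 (hnear τ₀ hτ₀)
  have hB : 0 ≤ 2 * ‖S.Q‖ * K' := by positivity
  set B := 2 * ‖S.Q‖ * K' with hBdef
  refine ⟨C₀ + (C₀ ^ 2 + C₀) + C₀ * ((1 + B) * (C₀ ^ 2 + C₀) + 1 + 2 * B * C₀), ε₀, δ₀, min ρ₁ ρ₂,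
    by positivity, hε₀, hδ₀, by positivity, ?_⟩
  intro ε um up ubar hε hε0 hεle hum hup hdir hP hmem hκm hκp
  have sub₁ : Metric.ball S.u₀ (min ρ₁ ρ₂) ⊆ Metric.ball S.u₀ ρ₁ := Metric.ball_subset_ball (min_le_left _ _)
  have sub₂ : Metric.ball S.u₀ (min ρ₁ ρ₂) ⊆ Metric.ball S.u₀ ρ₂ := Metric.ball_subset_ball (min_le_right _ _)
  have hs := hshock hε hε0 (sub₁ hum) (sub₁ hup) (by rw [hr]; exact hdir.trans (min_le_left _ _)) hP
    fun x => sub₁ (hmem x)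
  obtain ⟨a, A, m, k, k1, hL⟩ := hlayer hs (min_le_left _ _) hκm hκp
  obtain ⟨m₁, m₂, hp⟩ := hL.exists_equilibriumPath hK.le hC.le hτ₀1 (hεle.trans hε₀1)
    fun x => hball _ (sub₂ (hmem x))
  have hell : M.ell ≠ 0 := fun h0 => by
    have := M.sig_pos
    rw [ReducedModel.sig, h0, inner_zero_left] at this
    exact lt_irrefl _ this
  -- The covector is the normalization of `b_*(u₀) r`, and so does not depend on `ε` or on the
  -- profile.
  refine ⟨‖M.ell‖⁻¹ • M.ell, norm_smul_inv_norm hell, ?_⟩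
  intro δ hδ hδle f g U hf hg hU hUc hsol h0
  rw [real_inner_smul_left, mul_eq_zero, inv_eq_zero, norm_eq_zero, or_iff_right hell] at h0
  obtain ⟨F, pF, aF, mF, nF⟩ := hf.exists_primitives
  obtain ⟨G, pG, aG, mG, nG⟩ := hg.exists_primitives
  obtain ⟨V, pV, aV, mV, nV⟩ := hU.exists_primitives
  -- Continuity of `U` identifies it everywhere with its absolutely continuous representative, so
  -- that the condition at `0` passes to the latter.
  have hV0 : U = V 0 := (hUc.ae_eq_iff_eq volume (pV 0 two_pos).continuous).1 (aV 0 (Nat.zero_le _))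
  have sol : S.LinearizedSolution (weightedMeasure fun x => expWeight ε δ x ^ 2) ubar (V 0) (V 1)
      (F 0) (F 1) (F 2) (G 0) (G 1) :=
    { prim_U := pV 0 (by norm_num)
      prim_f := pF 0 (by norm_num)
      prim_f' := pF 1 (by norm_num)
      prim_g := pG 0 (by norm_num)
      memLp_U := mV 0 (by norm_num)
      memLp_U' := mV 1 (by norm_num)
      memLp_f := mF 0 (by norm_num)
      memLp_f' := mF 1 (by norm_num)
      memLp_f'' := mF 2 (by norm_num)
      memLp_g := mG 0 (by norm_num)
      memLp_g' := mG 1 (by norm_num)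
      macro_eq := by
        have h1 : (fun x => S.PU (S.A (V 0 x))) =ᵐ[volume] F 0 := by
          filter_upwards [hsol.1, aF 0 (by norm_num)] with x hx hfx
          rw [S.PU_A, ← hfx, ← hV0]
          exact hx
        exact congrFun ((((S.PU ∘L S.A).continuous.comp (pV 0 two_pos).continuous).ae_eq_iff_eq volume
          (pF 0 (by norm_num)).continuous).1 h1)
      micro_eq := by
        filter_upwards [hsol.2, aV 1 (by norm_num), aG 0 (by norm_num)] with x hx h1 h2
        rw [S.PV_A, ← h1, ← h2, ← hV0]
        exact hx }
  have sol' := sol.deriv hp (pV 1 (by norm_num)) (pF 2 (by norm_num)) (pG 1 (by norm_num))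
    (mV 2 le_rfl) (mF 3 le_rfl) (mG 2 le_rfl)
  have hη : δ * ε ≤ δ₀ * ε := by gcongr
  have hη0 : 0 ≤ δ * ε := by positivity
  have hw := slowWeight_expWeight hε0.le hδ
  obtain ⟨e1, e0⟩ := hest hL hp (min_le_right _ _) le_rfl hεle hw hη0 hη rfl sol
  -- For `U'` only the bound of the derivative is used: nothing is known about `U' 0`, so the
  -- normalized half of the estimate is not available.
  obtain ⟨e2, -⟩ := hest hL hp (min_le_right _ _) le_rfl hεle hw hη0 hη rfl sol'
  obtain ⟨s1, s2⟩ := hp.l2Norm_source_le hK' (mV 0 (by norm_num)) (mV 1 (by norm_num))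
    (mG 1 (by norm_num)) (mG 2 le_rfl)
  have key := RelaxationSystem.scaled_sum_le hC₀.le hB ((one_le_inv₀ hε0).2 (hεle.trans hε₀1))
    (inv_mul_cancel₀ hε0.ne') (l2Norm_nonneg _) (l2Norm_nonneg _) (l2Norm_nonneg _) (l2Norm_nonneg _)
    (l2Norm_nonneg _) (l2Norm_nonneg _) (l2Norm_nonneg _) (l2Norm_nonneg _) (e0 (by rw [← hV0]; exact h0))
    e1 e2 s1 s2
  have key' := mul_le_mul_of_nonneg_left key (Real.sqrt_nonneg ε)
  rw [nF, nG, nV]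
  simp only [Finset.sum_range_succ, Finset.sum_range_zero, pow_zero, pow_one, one_mul, zero_add]
  linarith
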